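/- **Setting.** Let $n\ge 0$, let $X$ be a smooth $(n+1)$-manifold, let $p:Y\to X$ be a smooth submersion between finite-dimensional manifolds (for example a smooth fibre bundle), with vertical bundle $VY=\ker Tp$. Let $\Sigma$ be a compact oriented $n$-manifold without boundary and $\tau:\Sigma\to X$ a smooth embedding, with image $\Sigma_\tau$. Let $Z\subset\Lambda^{n+1}T^*Y$ be the subbundle of those $z$ with $\mathbf i_v\mathbf i_w z=0$ for all vertical $v,w$, with projection $\pi_{YZ}:Z\to Y$ and canonical $(n+1)$-form $\Theta(z)=\pi_{YZ}^*z$. Sections over $\Sigma_\tau$ are identified with smooth maps defined on $\Sigma$ and covering $\tau$. Let $\mathcal Y_\tau$ and $\mathcal Z_\tau$ be the spaces of smooth sections over $\Sigma_\tau$ of $Y\to X$ and of $Z\to X$. The smooth cotangent bundle $T^*\mathcal Y_\tau$ is the space of pairs $(\varphi,\pi)$ with $\varphi\in\mathcal Y_\tau$ and $\pi$ a smooth map which assigns to $x\in\Sigma$ a linear map $\pi(x):V_{\varphi(x)}Y\to\Lambda^nT_x^*\Sigma$. The tangent space at a section consists of the smooth vertical vector fields along it (for $\mathcal Z_\tau$: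 tangent to $Z$ and vertical over $X$). These infinite-dimensional spaces carry the smooth structure in which a family of sections with parameters in $\mathbb R^k$ is smooth if it is jointly smooth in the parameters and $x\in\Sigma$; smoothness of maps and of forms, tangent maps and exterior derivatives are understood along such families. Define one-forms on $T^*\mathcal Y_\tau$ and on $\mathcal Z_\tau$ by $$\theta_\tau(\varphi,\pi)(V)=\int_{\Sigma}\pi\bigl(T\pi_{\mathcal Y_\tau,T^*\mathcal Y_\tau}\cdot V\bigr),\qquad \Theta_\tau(\sigma)(V)=\int_{\Sigma}\sigma^*(\mathbf i_V\Theta),$$ where $\pi_{\mathcal Y_\tau,T^*\mathcal Y_\tau}:T^*\mathcal Y_\tau\to\mathcal Y_\tau$ is the projection, and two-forms $\omega_\tau=-\mathbf d\theta_\tau$ and $\Omega_\tau=-\mathbf d\Theta_\tau$. Define $R_\tau:\mathcal Z_\tau\to T^*\mathcal Y_\tau$ by $R_\tau(\sigma)=(\varphi,\pi)$, where $\varphi=\pi_{YZ}\circ\sigma$ and $\langle\pi(x),v\rangle=\varphi^*(\mathbf i_v\,\sigma(x))$ for $x\in\Sigma$, $v\in V_{\varphi(x)}Y$. **Statement.**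 $R_\tau$ is well defined and smooth, and has a unique tangent map $TR_\tau$. The one-forms $\theta_\tau$, $\Theta_\tau$ are smooth and the two-forms $\omega_\tau$, $\Omega_\tau$ exist and are unique. The form $\omega_\tau$ is smooth, closed and weakly nondegenerate, and: 1. $R_\tau^*\omega_\tau=\Omega_\tau$. 2. $\ker T_\sigma R_\tau=\ker\Omega_\tau(\sigma)$ for every $\sigma\in\mathcal Z_\tau$. 3. Two elements of $\mathcal Z_\tau$ lie in the same leaf of the distribution $\ker\Omega_\tau$ (that is, they are joined by a finite chain of smooth curves everywhere tangent to $\ker\Omega_\tau$) if and only if they cover the same $\varphi\in\mathcal Y_\tau$ and their difference lies in $\ker R_\tau$; thus $\mathcal Z_\tau/\ker\Omega_\tau=\mathcal Z_\tau/\ker R_\tau$. The map $R_\tau$ induces a bijection $\bar R_\tau:\mathcal Z_\tau/\ker\Omega_\tau\to T^*\mathcal Y_\tau$ which is a symplectic diffeomorphism: for the quotient smooth structure, $\bar R_\tau$ and its inverse are smooth, there is a unique two-form $\bar\Omega_\tau$ on the quotient whose pull-back to $\mathcal Z_\tau$ is $\Omega_\tau$, and $\bar R_\tau^*\omega_\tau=\bar\Omega_\tau$.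 -/

import Mathlib

/-!
Conventions. `S` is the model Cauchy surface, `τ : S → X` its embedding, `p : Y → X` the
configuration bundle. A section over `τ(S)` of a bundle `K → X` is identified with a map `S → K`
covering `τ`. Infinite dimensional spaces of sections are treated through their smooth families with
parameters in `ℝᵏ` (their diffeology).
-/

open Bundle Set Function
open scoped Manifold ContDiff Topology Bundle

set_option linter.unusedSectionVars false

noncomputable section

/-- Spaces of alternating maps are finite dimensional. -/
instance finiteDimensional_continuousAlternatingMap (ι E G : Type*) [Fintype ι]
    [NormedAddCommGroup E] [NormedSpace ℝ E] [FiniteDimensional ℝ E]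
    [NormedAddCommGroup G] [NormedSpace ℝ G] [FiniteDimensional ℝ G] :
    FiniteDimensional ℝ (E [⋀^ι]→L[ℝ] G) := by
  let f : (E [⋀^ι]→L[ℝ] G) →ₗ[ℝ] MultilinearMap ℝ (fun _ : ι => E) G :=
    { toFun := fun A => A.toMultilinearMap
      map_add' := fun _ _ => rfl
      map_smul' := fun _ _ => rfl }
  refine FiniteDimensional.of_injective f ?_
  intro A B h
  ext v
  exact congrArg (fun M : MultilinearMap ℝ (fun _ : ι => E) G => M v) h

/-- Pull-back of alternating maps depends smoothly on the linear map. -/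
theorem contDiff_pullbackAlternating (ι E E' G : Type*) [Fintype ι]
    [NormedAddCommGroup E] [NormedSpace ℝ E] [FiniteDimensional ℝ E]
    [NormedAddCommGroup E'] [NormedSpace ℝ E'] [FiniteDimensional ℝ E']
    [NormedAddCommGroup G] [NormedSpace ℝ G] [FiniteDimensional ℝ G] :
    ContDiff ℝ ∞ (fun L : E →L[ℝ] E' =>
      (ContinuousAlternatingMap.compContinuousLinearMapCLM L :
        (E' [⋀^ι]→L[ℝ] G) →L[ℝ] (E [⋀^ι]→L[ℝ] G))) := by
  rw [contDiff_clm_apply_iff]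
  intro A
  let J : (E [⋀^ι]→L[ℝ] G) →ₗ[ℝ] ContinuousMultilinearMap ℝ (fun _ : ι => E) G :=
    (ContinuousAlternatingMap.toContinuousMultilinearMapCLM ℝ).toLinearMap
  have hfd : FiniteDimensional ℝ (ContinuousMultilinearMap ℝ (fun _ : ι => E) G) := by
    let f : ContinuousMultilinearMap ℝ (fun _ : ι => E) G →ₗ[ℝ]
        MultilinearMap ℝ (fun _ : ι => E) G :=
      { toFun := fun A => A.toMultilinearMap
        map_add' := fun _ _ => rfl
        map_smul' := fun _ _ => rfl }
    refine FiniteDimensional.of_injective f ?_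
    intro A B h
    ext v
    exact congrArg (fun M : MultilinearMap ℝ (fun _ : ι => E) G => M v) h
  obtain ⟨g, hg⟩ := J.exists_leftInverse_of_injective
    (LinearMap.ker_eq_bot.2 ContinuousAlternatingMap.toContinuousMultilinearMap_injective)
  have h1 : ContDiff ℝ ∞ (fun L : E →L[ℝ] E' =>
      ContinuousMultilinearMap.compContinuousLinearMapContinuousMultilinear ℝ
        (fun _ : ι => E) (fun _ : ι => E') G (fun _ => L) A.toContinuousMultilinearMap) := by
    refine ContDiff.clm_apply ?_ contDiff_const
    exact (ContinuousMultilinearMap.contDiff _).comp (contDiff_pi.2 fun _ => contDiff_id)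
  have h2 := (LinearMap.toContinuousLinearMap g).contDiff.comp h1 (n := ∞)
  convert h2 using 1
  funext L
  exact (LinearMap.congr_fun hg (A.compContinuousLinearMap L)).symm

/-! ### The bundle of alternating forms -/

section Alt
variable {E M : Type*} [NormedAddCommGroup E] [NormedSpace ℝ E] [FiniteDimensional ℝ E]
  [TopologicalSpace M] [ChartedSpace E M] [IsManifold 𝓘(ℝ, E) ∞ M]

/-- The fibre `Λᵏ T*ₓM`. -/
abbrev FormAt (E : Type*) {M : Type*} [NormedAddCommGroup E] [NormedSpace ℝ E]
    [TopologicalSpace M] [ChartedSpace E M] (k : ℕ) (x : M) : Type _ :=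
  TangentSpace 𝓘(ℝ, E) x [⋀^Fin k]→L[ℝ] (Bundle.Trivial M ℝ x)

variable (E M) in
/-- The total space of the vector bundle `Λᵏ T*M`. -/
abbrev FormBundle (k : ℕ) : Type _ :=
  TotalSpace (E [⋀^Fin k]→L[ℝ] ℝ) (FormAt E k : M → Type _)

/-- `Λᵏ T*M` is a smooth vector bundle. -/
instance contMDiffVectorBundle_form (k : ℕ) :
    ContMDiffVectorBundle ∞ (E [⋀^Fin k]→L[ℝ] ℝ) (FormAt E k : M → Type _) 𝓘(ℝ, E) := by
  have : (Bundle.ContinuousAlternatingMap.vectorPrebundle ℝ (Fin k) E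
      (TangentSpace 𝓘(ℝ, E) : M → Type _) ℝ (Bundle.Trivial M ℝ)).IsContMDiff 𝓘(ℝ, E) ∞ := by
    constructor
    rintro _ ⟨e₁, e₂, he₁, he₂, rfl⟩ _ ⟨e₁', e₂', he₁', he₂', rfl⟩
    refine ⟨Bundle.Pretrivialization.continuousAlternatingMapCoordChange ℝ (Fin k) e₁ e₁' e₂ e₂', ?_,
      Bundle.Pretrivialization.continuousAlternatingMapCoordChange_apply⟩
    simp +unfoldPartialApp only [Bundle.Pretrivialization.continuousAlternatingMapCoordChange,
      ContinuousLinearEquiv.coe_continuousAlternatingMapCongr, ContinuousLinearEquiv.symm_symm]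
    refine .clm_comp ?_ ?_
    · have h : ContDiff ℝ ∞ (fun L : ℝ →L[ℝ] ℝ =>
          (ContinuousLinearMap.compContinuousAlternatingMapCLM (ι := Fin k) ℝ E ℝ ℝ L)) := by
        rw [contDiff_clm_apply_iff]
        intro A
        let g : (ℝ →L[ℝ] ℝ) →ₗ[ℝ] (E [⋀^Fin k]→L[ℝ] ℝ) :=
          { toFun := fun L => L.compContinuousAlternatingMap A
            map_add' := fun _ _ => rfl
            map_smul' := fun _ _ => rfl }
        exact (LinearMap.toContinuousLinearMap g).contDiff
      exact h.contMDiff.comp_contMDiffOn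
        ((contMDiffOn_coordChangeL e₂ e₂').mono fun b hb => ⟨hb.1.2, hb.2.2⟩)
    · refine (contDiff_pullbackAlternating _ _ _ _).contMDiff.comp_contMDiffOn ?_
      exact (contMDiffOn_coordChangeL e₁' e₁).mono fun b hb => ⟨hb.2.1, hb.1.1⟩
  exact VectorPrebundle.contMDiffVectorBundle _ _

end Alt
/-! ### The vertical tangent bundle of a submersion -/

section Vert
variable {EX EY F X Y : Type*}
  [NormedAddCommGroup EX] [NormedSpace ℝ EX]
  [NormedAddCommGroup EY] [NormedSpace ℝ EY]
  [NormedAddCommGroup F] [NormedSpace ℝ F]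
  [TopologicalSpace X] [ChartedSpace EX X] [IsManifold 𝓘(ℝ, EX) ∞ X]
  [TopologicalSpace Y] [ChartedSpace EY Y] [IsManifold 𝓘(ℝ, EY) ∞ Y]
  {p : Y → X}

/-- The vertical tangent space `V_yY`, the kernel of the derivative of `p : Y → X` at `y`. -/
def VertAt (_hp : Manifold.IsSubmersionOfComplement F 𝓘(ℝ, EY) 𝓘(ℝ, EX) ∞ p) (y : Y) : Type _ :=
  (mfderiv 𝓘(ℝ, EY) 𝓘(ℝ, EX) p y).ker

variable (hp : Manifold.IsSubmersionOfComplement F 𝓘(ℝ, EY) 𝓘(ℝ, EX) ∞ p)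

instance (y : Y) : AddCommGroup (VertAt hp y) :=
  inferInstanceAs (AddCommGroup (mfderiv 𝓘(ℝ, EY) 𝓘(ℝ, EX) p y).ker)
instance (y : Y) : Module ℝ (VertAt hp y) :=
  inferInstanceAs (Module ℝ (mfderiv 𝓘(ℝ, EY) 𝓘(ℝ, EX) p y).ker)
instance (y : Y) : TopologicalSpace (VertAt hp y) :=
  inferInstanceAs (TopologicalSpace (mfderiv 𝓘(ℝ, EY) 𝓘(ℝ, EX) p y).ker)
instance (y : Y) : IsTopologicalAddGroup (VertAt hp y) :=
  inferInstanceAs (IsTopologicalAddGroup (mfderiv 𝓘(ℝ, EY) 𝓘(ℝ, EX) p y).ker)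
instance (y : Y) : ContinuousSMul ℝ (VertAt hp y) :=
  inferInstanceAs (ContinuousSMul ℝ (mfderiv 𝓘(ℝ, EY) 𝓘(ℝ, EX) p y).ker)

/-- The inclusion `V_yY → T_yY`. -/
def VertAt.incl (y : Y) : VertAt hp y →L[ℝ] TangentSpace 𝓘(ℝ, EY) y :=
  (mfderiv 𝓘(ℝ, EY) 𝓘(ℝ, EX) p y).ker.subtypeL

theorem VertAt.mfderiv_incl (y : Y) (v : VertAt hp y) :
    mfderiv 𝓘(ℝ, EY) 𝓘(ℝ, EX) p y (VertAt.incl hp y v) = 0 := v.2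

theorem VertAt.ext {y : Y} {v w : VertAt hp y} (h : VertAt.incl hp y v = VertAt.incl hp y w) :
    v = w := Subtype.ext h

/-- An adapted chart of `Y` around `y₀`. -/
def adChart (y₀ : Y) : OpenPartialHomeomorph Y EY := (hp y₀).domChart
/-- The splitting of the model space in the adapted chart around `y₀`. -/
def adEquiv (y₀ : Y) : EY ≃L[ℝ] EX × F := (hp y₀).equiv

theorem adChart_mdifferentiable (y₀ : Y) :
    (adChart hp y₀).MDifferentiable 𝓘(ℝ, EY) 𝓘(ℝ, EY) :=
  ⟨(contMDiffOn_of_mem_maximalAtlas (hp y₀).domChart_mem_maximalAtlas).mdifferentiableOn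
      (by simp),
    (contMDiffOn_symm_of_mem_maximalAtlas (hp y₀).domChart_mem_maximalAtlas).mdifferentiableOn
      (by simp)⟩

theorem codChart_mdifferentiable (y₀ : Y) :
    ((hp y₀).codChart).MDifferentiable 𝓘(ℝ, EX) 𝓘(ℝ, EX) :=
  ⟨(contMDiffOn_of_mem_maximalAtlas (hp y₀).codChart_mem_maximalAtlas).mdifferentiableOn
      (by simp),
    (contMDiffOn_symm_of_mem_maximalAtlas (hp y₀).codChart_mem_maximalAtlas).mdifferentiableOn
      (by simp)⟩

/-- The derivative of the adapted chart, with values in the model space. -/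
def chartD (y₀ y : Y) : TangentSpace 𝓘(ℝ, EY) y →L[ℝ] EY :=
  mfderiv 𝓘(ℝ, EY) 𝓘(ℝ, EY) (adChart hp y₀) y

/-- The inverse of the derivative of the adapted chart. -/
def chartDInv (y₀ y : Y) (hy : y ∈ (adChart hp y₀).source) :
    EY →L[ℝ] TangentSpace 𝓘(ℝ, EY) y :=
  (((adChart_mdifferentiable hp y₀).mfderiv hy).symm).toContinuousLinearMap

theorem chartDInv_chartD (y₀ y : Y) (hy : y ∈ (adChart hp y₀).source)
    (v : TangentSpace 𝓘(ℝ, EY) y) : chartDInv hp y₀ y hy (chartD hp y₀ y v) = v :=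
  ((adChart_mdifferentiable hp y₀).mfderiv hy).symm_apply_apply v

theorem chartD_chartDInv (y₀ y : Y) (hy : y ∈ (adChart hp y₀).source)
    (w : EY) : chartD hp y₀ y (chartDInv hp y₀ y hy w) = w :=
  ((adChart_mdifferentiable hp y₀).mfderiv hy).apply_symm_apply w

theorem chartD_fst (y₀ y : Y) (hy : y ∈ (adChart hp y₀).source)
    (v : TangentSpace 𝓘(ℝ, EY) y) :
    (adEquiv hp y₀ (chartD hp y₀ y v)).1 =
      mfderiv 𝓘(ℝ, EX) 𝓘(ℝ, EX) (hp y₀).codChart (p y) (mfderiv 𝓘(ℝ, EY) 𝓘(ℝ, EX) p y v) := by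
  have hpd : MDifferentiableAt 𝓘(ℝ, EY) 𝓘(ℝ, EX) p y :=
    ((hp y).contMDiffAt).mdifferentiableAt (by simp)
  have hcy : p y ∈ (hp y₀).codChart.source := (hp y₀).mapsto_domChart_source_codChart_source hy
  have h1 : ((hp y₀).codChart ∘ p) =ᶠ[𝓝 y]
      (fun z : EY => (adEquiv hp y₀ z).1) ∘ adChart hp y₀ := by
    filter_upwards [(adChart hp y₀).open_source.mem_nhds hy] with z hz
    have hz' : adChart hp y₀ z ∈ ((hp y₀).domChart.extend 𝓘(ℝ, EY)).target := by
      have h0 : adChart hp y₀ z ∈ (hp y₀).domChart.target := (adChart hp y₀).map_source hz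
      simpa [OpenPartialHomeomorph.extend_target] using h0
    have := (hp y₀).writtenInCharts hz'
    simp only [OpenPartialHomeomorph.extend, modelWithCornersSelf_partialEquiv,
      PartialEquiv.trans_refl, comp_apply, OpenPartialHomeomorph.toFun_eq_coe,
      OpenPartialHomeomorph.coe_toPartialEquiv_symm] at this
    rw [show (hp y₀).domChart.symm (adChart hp y₀ z) = z from (adChart hp y₀).left_inv hz] at this
    exact this
  have h2 := h1.mfderiv_eq (I := 𝓘(ℝ, EY)) (I' := 𝓘(ℝ, EX))
  rw [mfderiv_comp y ((codChart_mdifferentiable hp y₀).mdifferentiableAt hcy) hpd,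
    mfderiv_comp (I' := 𝓘(ℝ, EY)) y (DifferentiableAt.mdifferentiableAt (by fun_prop))
      ((adChart_mdifferentiable hp y₀).mdifferentiableAt hy), mfderiv_eq_fderiv] at h2
  have h3 : fderiv ℝ (fun z : EY => (adEquiv hp y₀ z).1) (adChart hp y₀ y) =
      (ContinuousLinearMap.fst ℝ EX F).comp (adEquiv hp y₀ : EY →L[ℝ] EX × F) :=
    ((ContinuousLinearMap.fst ℝ EX F).comp (adEquiv hp y₀ : EY →L[ℝ] EX × F)).fderiv
  rw [h3] at h2
  exact (congrArg (fun L => L v) h2).symm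

/-- Coordinates on `V_yY` in an adapted chart. -/
def vertCoord (y₀ y : Y) : VertAt hp y →L[ℝ] F :=
  ((ContinuousLinearMap.snd ℝ EX F).comp (adEquiv hp y₀ : EY →L[ℝ] EX × F)).comp
    ((chartD hp y₀ y).comp (VertAt.incl hp y))

theorem chartDInv_mem_ker (y₀ y : Y) (hy : y ∈ (adChart hp y₀).source) (f : F) :
    mfderiv 𝓘(ℝ, EY) 𝓘(ℝ, EX) p y
      (chartDInv hp y₀ y hy ((adEquiv hp y₀).symm (0, f))) = 0 := by
  have hcy : p y ∈ (hp y₀).codChart.source := (hp y₀).mapsto_domChart_source_codChart_source hy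
  have h := chartD_fst hp y₀ y hy (chartDInv hp y₀ y hy ((adEquiv hp y₀).symm (0, f)))
  rw [chartD_chartDInv, ContinuousLinearEquiv.apply_symm_apply] at h
  apply ((codChart_mdifferentiable hp y₀).mfderiv hcy).injective
  rw [map_zero]
  exact h.symm

/-- The inverse of `vertCoord`. -/
def vertCoordInv (y₀ y : Y) (hy : y ∈ (adChart hp y₀).source) : F →L[ℝ] VertAt hp y :=
  ContinuousLinearMap.codRestrict
    (((chartDInv hp y₀ y hy).comp ((adEquiv hp y₀).symm : EX × F →L[ℝ] EY)).comp
      (ContinuousLinearMap.inr ℝ EX F))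
    (mfderiv 𝓘(ℝ, EY) 𝓘(ℝ, EX) p y).ker (chartDInv_mem_ker hp y₀ y hy)

/-- For `y` in the domain of an adapted chart, `V_yY` is identified with `F`. -/
def vertEquiv (y₀ y : Y) (hy : y ∈ (adChart hp y₀).source) : VertAt hp y ≃L[ℝ] F :=
  ContinuousLinearEquiv.equivOfInverse (vertCoord hp y₀ y) (vertCoordInv hp y₀ y hy)
    (by
      intro v
      apply VertAt.ext
      change chartDInv hp y₀ y hy ((adEquiv hp y₀).symm (0, vertCoord hp y₀ y v)) =
        VertAt.incl hp y v
      have h1 := chartD_fst hp y₀ y hy (VertAt.incl hp y v)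
      rw [VertAt.mfderiv_incl, map_zero] at h1
      have h2 : ((0 : EX), vertCoord hp y₀ y v) =
          adEquiv hp y₀ (chartD hp y₀ y (VertAt.incl hp y v)) := Prod.ext h1.symm rfl
      rw [h2, ContinuousLinearEquiv.symm_apply_apply, chartDInv_chartD])
    (by
      intro f
      change (adEquiv hp y₀ (chartD hp y₀ y
        (chartDInv hp y₀ y hy ((adEquiv hp y₀).symm (0, f))))).2 = f
      rw [chartD_chartDInv, ContinuousLinearEquiv.apply_symm_apply])

theorem vertEquiv_apply (y₀ y : Y) (hy : y ∈ (adChart hp y₀).source) (v : VertAt hp y) :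
    vertEquiv hp y₀ y hy v = vertCoord hp y₀ y v := rfl

open Classical in
/-- The local trivialization of `VY` given by an adapted chart. -/
def vertPretriv (y₀ : Y) : Pretrivialization F (TotalSpace.proj : TotalSpace F (VertAt hp) → Y) where
  toFun z := (z.1, vertCoord hp y₀ z.1 z.2)
  invFun z := ⟨z.1, if h : z.1 ∈ (adChart hp y₀).source then (vertEquiv hp y₀ z.1 h).symm z.2 else 0⟩
  source := TotalSpace.proj ⁻¹' (adChart hp y₀).source
  target := (adChart hp y₀).source ×ˢ univ
  map_source' := fun _ h => ⟨h, mem_univ _⟩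
  map_target' := fun _ h => h.1
  left_inv' := by
    rintro ⟨y, v⟩ h
    replace h : y ∈ (adChart hp y₀).source := h
    simp only [h, dif_pos]
    rw [← vertEquiv_apply hp y₀ y h, ContinuousLinearEquiv.symm_apply_apply]
  right_inv' := by
    rintro ⟨y, f⟩ ⟨h, -⟩
    replace h : y ∈ (adChart hp y₀).source := h
    simp only [h, dif_pos]
    rw [← vertEquiv_apply hp y₀ y h, ContinuousLinearEquiv.apply_symm_apply]
  open_target := (adChart hp y₀).open_source.prod isOpen_univ
  baseSet := (adChart hp y₀).source
  open_baseSet := (adChart hp y₀).open_source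
  source_eq := rfl
  target_eq := rfl
  proj_toFun _ _ := rfl

theorem vertPretriv_symm (y₀ y : Y) (hy : y ∈ (adChart hp y₀).source) (f : F) :
    (vertPretriv hp y₀).symm y f = (vertEquiv hp y₀ y hy).symm f := by
  apply (vertEquiv hp y₀ y hy).injective
  rw [ContinuousLinearEquiv.apply_symm_apply]
  exact congrArg Prod.snd ((vertPretriv hp y₀).apply_mk_symm hy f)

instance vertPretriv_isLinear (y₀ : Y) : (vertPretriv hp y₀).IsLinear ℝ where
  linear y hy := by
    constructor
    · intro v w; exact map_add (vertEquiv hp y₀ y hy) v w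
    · intro c v; exact map_smul (vertEquiv hp y₀ y hy) c v

/-- Coordinate changes of `VY`. -/
def vertCoordChange (y₀ y₁ y : Y) : F →L[ℝ] F :=
  ((ContinuousLinearMap.snd ℝ EX F).comp (adEquiv hp y₁ : EY →L[ℝ] EX × F)).comp
    ((fderiv ℝ (adChart hp y₁ ∘ (adChart hp y₀).symm) (adChart hp y₀ y)).comp
      (((adEquiv hp y₀).symm : EX × F →L[ℝ] EY).comp (ContinuousLinearMap.inr ℝ EX F)))

theorem contMDiffOn_vertCoordChange (y₀ y₁ : Y) :
    ContMDiffOn 𝓘(ℝ, EY) 𝓘(ℝ, F →L[ℝ] F) ∞ (vertCoordChange hp y₀ y₁)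
      ((adChart hp y₀).source ∩ (adChart hp y₁).source) := by
  have ho : IsOpen ((adChart hp y₀).symm.trans (adChart hp y₁)).source :=
    ((adChart hp y₀).symm.trans (adChart hp y₁)).open_source
  have h1 : ContDiffOn ℝ ∞ (adChart hp y₁ ∘ (adChart hp y₀).symm)
      ((adChart hp y₀).symm.trans (adChart hp y₁)).source := by
    rw [← contMDiffOn_iff_contDiffOn]
    refine (contMDiffOn_of_mem_maximalAtlas (hp y₁).domChart_mem_maximalAtlas).comp
      ((contMDiffOn_symm_of_mem_maximalAtlas (hp y₀).domChart_mem_maximalAtlas).mono ?_) ?_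
    · intro z hz; exact hz.1
    · intro z hz; exact hz.2
  have h2 := h1.fderiv_of_isOpen (m := ∞) ho (by simp)
  have h3 : ContMDiffOn 𝓘(ℝ, EY) 𝓘(ℝ, EY →L[ℝ] EY) ∞
      (fun y => fderiv ℝ (adChart hp y₁ ∘ (adChart hp y₀).symm) (adChart hp y₀ y))
      ((adChart hp y₀).source ∩ (adChart hp y₁).source) := by
    refine h2.contMDiffOn.comp
      ((contMDiffOn_of_mem_maximalAtlas (hp y₀).domChart_mem_maximalAtlas).mono ?_) ?_
    · intro z hz; exact hz.1
    · intro z hz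
      refine ⟨(adChart hp y₀).map_source hz.1, ?_⟩
      change (adChart hp y₀).symm (adChart hp y₀ z) ∈ (adChart hp y₁).source
      rw [(adChart hp y₀).left_inv hz.1]; exact hz.2
  exact contMDiffOn_const.clm_comp (h3.clm_comp contMDiffOn_const)

theorem vertCoordChange_apply (y₀ y₁ y : Y)
    (hy : y ∈ (adChart hp y₀).source ∩ (adChart hp y₁).source) (f : F) :
    vertCoordChange hp y₀ y₁ y f =
      (vertPretriv hp y₁ ⟨y, (vertPretriv hp y₀).symm y f⟩).2 := by
  rw [vertPretriv_symm hp y₀ y hy.1]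
  change (adEquiv hp y₁ (fderiv ℝ (adChart hp y₁ ∘ (adChart hp y₀).symm) (adChart hp y₀ y)
    ((adEquiv hp y₀).symm (0, f)))).2 = (adEquiv hp y₁ (chartD hp y₁ y
      (chartDInv hp y₀ y hy.1 ((adEquiv hp y₀).symm (0, f))))).2
  congr 2
  have hl := (adChart hp y₀).left_inv hy.1
  rw [← mfderiv_eq_fderiv, mfderiv_comp (I' := 𝓘(ℝ, EY)) (adChart hp y₀ y)
    (by rw [hl]; exact (adChart_mdifferentiable hp y₁).mdifferentiableAt hy.2)
    ((adChart_mdifferentiable hp y₀).mdifferentiableAt_symm ((adChart hp y₀).map_source hy.1))]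
  rw [hl]
  rfl

/-- The local trivializations given by the adapted charts form a vector bundle. -/
def vertPrebundle : VectorPrebundle ℝ F (VertAt hp) where
  pretrivializationAtlas := Set.range (vertPretriv hp)
  pretrivialization_linear' := by
    rintro _ ⟨y₀, rfl⟩; infer_instance
  pretrivializationAt := vertPretriv hp
  mem_base_pretrivializationAt y := (hp y).mem_domChart_source
  pretrivialization_mem_atlas y := ⟨y, rfl⟩
  exists_coordChange := by
    rintro _ ⟨y₀, rfl⟩ _ ⟨y₁, rfl⟩
    exact ⟨vertCoordChange hp y₀ y₁, (contMDiffOn_vertCoordChange hp y₀ y₁).continuousOn,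
      vertCoordChange_apply hp y₀ y₁⟩
  totalSpaceMk_isInducing y := by
    rw [show (vertPretriv hp y ∘ TotalSpace.mk y) = fun v => (y, vertCoord hp y y v) from rfl,
      Topology.isInducing_const_prod]
    exact (vertEquiv hp y y (hp y).mem_domChart_source).toHomeomorph.isInducing

instance : TopologicalSpace (TotalSpace F (VertAt hp)) := (vertPrebundle hp).totalSpaceTopology
instance : FiberBundle F (VertAt hp) := (vertPrebundle hp).toFiberBundle
instance : VectorBundle ℝ F (VertAt hp) := (vertPrebundle hp).toVectorBundle
instance : ContMDiffVectorBundle ∞ F (VertAt hp) 𝓘(ℝ, EY) := by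
  have : (vertPrebundle hp).IsContMDiff 𝓘(ℝ, EY) ∞ := by
    constructor
    rintro _ ⟨y₀, rfl⟩ _ ⟨y₁, rfl⟩
    exact ⟨vertCoordChange hp y₀ y₁, contMDiffOn_vertCoordChange hp y₀ y₁,
      vertCoordChange_apply hp y₀ y₁⟩
  exact VectorPrebundle.contMDiffVectorBundle _ _
end Vert


/-! ### The bundle of momenta -/

section Mom

/-- The bundle over `S × Y` with fibre `V_yY` at `(x, y)`. -/
def VertOver (S : Type*) {EX EY F X Y : Type*}
    [NormedAddCommGroup EX] [NormedSpace ℝ EX] [NormedAddCommGroup EY] [NormedSpace ℝ EY]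
    [NormedAddCommGroup F] [NormedSpace ℝ F]
    [TopologicalSpace X] [ChartedSpace EX X] [TopologicalSpace Y] [ChartedSpace EY Y] {p : Y → X}
    (hp : Manifold.IsSubmersionOfComplement F 𝓘(ℝ, EY) 𝓘(ℝ, EX) ∞ p) (q : S × Y) : Type _ :=
  VertAt hp q.2

/-- The bundle over `S × Y` with fibre `Λᵏ T*ₓS` at `(x, y)`. -/
def FormOver (ES : Type*) {S : Type*} (Y : Type*) [NormedAddCommGroup ES] [NormedSpace ℝ ES]
    [TopologicalSpace S] [ChartedSpace ES S] (k : ℕ) (q : S × Y) : Type _ :=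
  FormAt ES k q.1

variable {ES EX EY F S X Y : Type*}
  [NormedAddCommGroup ES] [NormedSpace ℝ ES] [FiniteDimensional ℝ ES]
  [NormedAddCommGroup EX] [NormedSpace ℝ EX]
  [NormedAddCommGroup EY] [NormedSpace ℝ EY]
  [NormedAddCommGroup F] [NormedSpace ℝ F]
  [TopologicalSpace S] [ChartedSpace ES S] [IsManifold 𝓘(ℝ, ES) ∞ S]
  [TopologicalSpace X] [ChartedSpace EX X] [IsManifold 𝓘(ℝ, EX) ∞ X]
  [TopologicalSpace Y] [ChartedSpace EY Y] [IsManifold 𝓘(ℝ, EY) ∞ Y]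
  {p : Y → X} (hp : Manifold.IsSubmersionOfComplement F 𝓘(ℝ, EY) 𝓘(ℝ, EX) ∞ p)

instance (q : S × Y) : AddCommGroup (VertOver S hp q) := inferInstanceAs (AddCommGroup (VertAt hp q.2))
instance (q : S × Y) : Module ℝ (VertOver S hp q) := inferInstanceAs (Module ℝ (VertAt hp q.2))
instance (q : S × Y) : TopologicalSpace (VertOver S hp q) :=
  inferInstanceAs (TopologicalSpace (VertAt hp q.2))
instance (q : S × Y) : IsTopologicalAddGroup (VertOver S hp q) :=
  inferInstanceAs (IsTopologicalAddGroup (VertAt hp q.2))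
instance (q : S × Y) : ContinuousSMul ℝ (VertOver S hp q) :=
  inferInstanceAs (ContinuousSMul ℝ (VertAt hp q.2))
instance : TopologicalSpace (TotalSpace F (VertOver S hp)) :=
  inferInstanceAs (TopologicalSpace (TotalSpace F ((ContinuousMap.snd : C(S × Y, Y)) *ᵖ (VertAt hp))))
instance : FiberBundle F (VertOver S hp) :=
  inferInstanceAs (FiberBundle F ((ContinuousMap.snd : C(S × Y, Y)) *ᵖ (VertAt hp)))
instance : VectorBundle ℝ F (VertOver S hp) :=
  inferInstanceAs (VectorBundle ℝ F ((ContinuousMap.snd : C(S × Y, Y)) *ᵖ (VertAt hp)))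
instance : ContMDiffVectorBundle ∞ F (VertOver S hp) (𝓘(ℝ, ES).prod 𝓘(ℝ, EY)) :=
  inferInstanceAs (ContMDiffVectorBundle ∞ F
    ((ContMDiffMap.snd : C^∞⟮𝓘(ℝ, ES).prod 𝓘(ℝ, EY), S × Y; 𝓘(ℝ, EY), Y⟯) *ᵖ (VertAt hp))
    (𝓘(ℝ, ES).prod 𝓘(ℝ, EY)))

instance (k : ℕ) (q : S × Y) : AddCommGroup (FormOver ES Y k q) :=
  inferInstanceAs (AddCommGroup (FormAt ES k q.1))
instance (k : ℕ) (q : S × Y) : Module ℝ (FormOver ES Y k q) :=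
  inferInstanceAs (Module ℝ (FormAt ES k q.1))
instance (k : ℕ) (q : S × Y) : TopologicalSpace (FormOver ES Y k q) :=
  inferInstanceAs (TopologicalSpace (FormAt ES k q.1))
instance (k : ℕ) (q : S × Y) : IsTopologicalAddGroup (FormOver ES Y k q) :=
  inferInstanceAs (IsTopologicalAddGroup (FormAt ES k q.1))
instance (k : ℕ) (q : S × Y) : ContinuousSMul ℝ (FormOver ES Y k q) :=
  inferInstanceAs (ContinuousSMul ℝ (FormAt ES k q.1))
instance (k : ℕ) : TopologicalSpace (TotalSpace (ES [⋀^Fin k]→L[ℝ] ℝ)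
    (FormOver ES Y k : S × Y → Type _)) :=
  inferInstanceAs (TopologicalSpace (TotalSpace (ES [⋀^Fin k]→L[ℝ] ℝ)
    ((ContinuousMap.fst : C(S × Y, S)) *ᵖ (FormAt ES k))))
instance (k : ℕ) : FiberBundle (ES [⋀^Fin k]→L[ℝ] ℝ) (FormOver ES Y k : S × Y → Type _) :=
  inferInstanceAs (FiberBundle (ES [⋀^Fin k]→L[ℝ] ℝ)
    ((ContinuousMap.fst : C(S × Y, S)) *ᵖ (FormAt ES k)))
instance (k : ℕ) : VectorBundle ℝ (ES [⋀^Fin k]→L[ℝ] ℝ) (FormOver ES Y k : S × Y → Type _) :=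
  inferInstanceAs (VectorBundle ℝ (ES [⋀^Fin k]→L[ℝ] ℝ)
    ((ContinuousMap.fst : C(S × Y, S)) *ᵖ (FormAt ES k)))
instance (k : ℕ) : ContMDiffVectorBundle ∞ (ES [⋀^Fin k]→L[ℝ] ℝ)
    (FormOver ES Y k : S × Y → Type _) (𝓘(ℝ, ES).prod 𝓘(ℝ, EY)) :=
  inferInstanceAs (ContMDiffVectorBundle ∞ (ES [⋀^Fin k]→L[ℝ] ℝ)
    ((ContMDiffMap.fst : C^∞⟮𝓘(ℝ, ES).prod 𝓘(ℝ, EY), S × Y; 𝓘(ℝ, ES), S⟯) *ᵖ (FormAt ES k))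
    (𝓘(ℝ, ES).prod 𝓘(ℝ, EY)))

/-- The vector space `L(V_yY, Λᵏ T*ₓS)` at `(x, y)`. -/
abbrev MomentumAt (ES : Type*) {S EX EY F X Y : Type*}
    [NormedAddCommGroup ES] [NormedSpace ℝ ES]
    [NormedAddCommGroup EX] [NormedSpace ℝ EX] [NormedAddCommGroup EY] [NormedSpace ℝ EY]
    [NormedAddCommGroup F] [NormedSpace ℝ F] [TopologicalSpace S] [ChartedSpace ES S]
    [TopologicalSpace X] [ChartedSpace EX X] [TopologicalSpace Y] [ChartedSpace EY Y] {p : Y → X}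
    (hp : Manifold.IsSubmersionOfComplement F 𝓘(ℝ, EY) 𝓘(ℝ, EX) ∞ p) (k : ℕ) (q : S × Y) :
    Type _ :=
  VertOver S hp q →L[ℝ] FormOver ES Y k q

/-- The total space of `L(VY, Λᵏ T*S)`, a smooth vector bundle over `S × Y`. -/
abbrev MomentumBundle (ES S : Type*) {EX EY F X Y : Type*}
    [NormedAddCommGroup ES] [NormedSpace ℝ ES]
    [NormedAddCommGroup EX] [NormedSpace ℝ EX] [NormedAddCommGroup EY] [NormedSpace ℝ EY]
    [NormedAddCommGroup F] [NormedSpace ℝ F] [TopologicalSpace S] [ChartedSpace ES S]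
    [TopologicalSpace X] [ChartedSpace EX X] [TopologicalSpace Y] [ChartedSpace EY Y] {p : Y → X}
    (hp : Manifold.IsSubmersionOfComplement F 𝓘(ℝ, EY) 𝓘(ℝ, EX) ∞ p) (k : ℕ) : Type _ :=
  TotalSpace (F →L[ℝ] (ES [⋀^Fin k]→L[ℝ] ℝ)) (MomentumAt ES hp k : S × Y → Type _)

end Mom

/-! ### Spaces of sections -/

section Sections

/-- The data describing a space of sections over `S`: a smooth map `proj : K → B`, a map
`base : S → B`, and a subset `carrier` of `K`.  The sections are the smooth maps `s : S → K` with
`proj ∘ s = base` and values in `carrier`, that is, the smooth sections of the restriction of the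
bundle `carrier → B` along `base`. -/
structure SectionData {EK HK EB HB : Type*} [NormedAddCommGroup EK] [NormedSpace ℝ EK]
    [TopologicalSpace HK] (IK : ModelWithCorners ℝ EK HK)
    [NormedAddCommGroup EB] [NormedSpace ℝ EB] [TopologicalSpace HB]
    (IB : ModelWithCorners ℝ EB HB) (S K B : Type*)
    [TopologicalSpace K] [ChartedSpace HK K] [TopologicalSpace B] [ChartedSpace HB B] where
  proj : K → B
  base : S → B
  carrier : Set K
  contMDiff_proj : ContMDiff IK IB ∞ proj

variable {ES HS EK HK EB HB S K B : Type*}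
  [NormedAddCommGroup ES] [NormedSpace ℝ ES] [TopologicalSpace HS]
  [NormedAddCommGroup EK] [NormedSpace ℝ EK] [TopologicalSpace HK]
  [NormedAddCommGroup EB] [NormedSpace ℝ EB] [TopologicalSpace HB]
  {IK : ModelWithCorners ℝ EK HK} {IB : ModelWithCorners ℝ EB HB}
  [TopologicalSpace S] [ChartedSpace HS S] [TopologicalSpace K] [ChartedSpace HK K]
  [TopologicalSpace B] [ChartedSpace HB B]

/-- The space of smooth sections. -/
structure Sections (IS : ModelWithCorners ℝ ES HS) (D : SectionData IK IB S K B) where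
  toFun : S → K
  contMDiff : ContMDiff IS IK ∞ toFun
  proj_eq : ∀ x, D.proj (toFun x) = D.base x
  mem_carrier : ∀ x, toFun x ∈ D.carrier

instance (IS : ModelWithCorners ℝ ES HS) (D : SectionData IK IB S K B) :
    CoeFun (Sections IS D) (fun _ => S → K) := ⟨Sections.toFun⟩

variable (IK) in
/-- The tangent space at `k` of a submanifold `C` of `K`: the span of the velocities at `k` of the
smooth curves of `K` that stay in `C`. -/
def tangentSpaceOf [IsManifold IK ∞ K] (C : Set K) (k : K) : Submodule ℝ (TangentSpace IK k) :=
  Submodule.span ℝ {w | ∃ c : ℝ → K, ContMDiff 𝓘(ℝ, ℝ) IK ∞ c ∧ (∀ t, c t ∈ C) ∧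
    (⟨c 0, mfderiv 𝓘(ℝ, ℝ) IK c 0 (1 : ℝ)⟩ : TangentBundle IK K) = ⟨k, w⟩}

variable {IS : ModelWithCorners ℝ ES HS}

variable {D : SectionData IK IB S K B}

section Tangent
variable [IsManifold IK ∞ K]

theorem contMDiff_along_add {s : S → K} (hs : ContMDiff IS IK ∞ s)
    {V W : ∀ x, TangentSpace IK (s x)}
    (hV : ContMDiff IS IK.tangent ∞ (fun x => (⟨s x, V x⟩ : TangentBundle IK K)))
    (hW : ContMDiff IS IK.tangent ∞ (fun x => (⟨s x, W x⟩ : TangentBundle IK K))) :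
    ContMDiff IS IK.tangent ∞ (fun x => (⟨s x, V x + W x⟩ : TangentBundle IK K)) := by
  intro x₀
  have h1 := (contMDiffAt_totalSpace.1 (hV x₀)).2
  have h2 := (contMDiffAt_totalSpace.1 (hW x₀)).2
  refine contMDiffAt_totalSpace.2 ⟨hs x₀, (h1.add h2).congr_of_eventuallyEq ?_⟩
  have hb : ∀ᶠ x in 𝓝 x₀, s x ∈ (trivializationAt EK (TangentSpace IK) (s x₀)).baseSet :=
    (hs.continuous.continuousAt).eventually_mem
      ((trivializationAt EK (TangentSpace IK) (s x₀)).open_baseSet.mem_nhds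
        (FiberBundle.mem_baseSet_trivializationAt' (s x₀)))
  filter_upwards [hb] with x hx
  exact ((trivializationAt EK (TangentSpace IK) (s x₀)).linear ℝ hx).map_add (V x) (W x)

theorem contMDiff_along_smul {s : S → K} (hs : ContMDiff IS IK ∞ s) (a : ℝ)
    {V : ∀ x, TangentSpace IK (s x)}
    (hV : ContMDiff IS IK.tangent ∞ (fun x => (⟨s x, V x⟩ : TangentBundle IK K))) :
    ContMDiff IS IK.tangent ∞ (fun x => (⟨s x, a • V x⟩ : TangentBundle IK K)) := by
  intro x₀
  have h1 := (contMDiffAt_totalSpace.1 (hV x₀)).2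
  have h0 : ContMDiffAt IS 𝓘(ℝ, ℝ) ∞ (fun _ : S => a) x₀ := contMDiffAt_const
  refine contMDiffAt_totalSpace.2 ⟨hs x₀, (h0.smul h1).congr_of_eventuallyEq ?_⟩
  have hb : ∀ᶠ x in 𝓝 x₀, s x ∈ (trivializationAt EK (TangentSpace IK) (s x₀)).baseSet :=
    (hs.continuous.continuousAt).eventually_mem
      ((trivializationAt EK (TangentSpace IK) (s x₀)).open_baseSet.mem_nhds
        (FiberBundle.mem_baseSet_trivializationAt' (s x₀)))
  filter_upwards [hb] with x hx
  exact ((trivializationAt EK (TangentSpace IK) (s x₀)).linear ℝ hx).map_smul a (V x)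

theorem contMDiff_along_zero {s : S → K} (hs : ContMDiff IS IK ∞ s) :
    ContMDiff IS IK.tangent ∞
      (fun x => (⟨s x, (0 : TangentSpace IK (s x))⟩ : TangentBundle IK K)) :=
  (contMDiff_zeroSection ℝ (TangentSpace IK)).comp hs

/-- The tangent space to the space of sections at `s`: the smooth maps `V : S → TK` covering `s`
whose values are tangent to the fibres of `carrier → B`. -/
def SectionTangent (s : Sections IS D) : Submodule ℝ (∀ x, TangentSpace IK (s x)) where
  carrier := {V | ContMDiff IS IK.tangent ∞ (fun x => (⟨s x, V x⟩ : TangentBundle IK K)) ∧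
    ∀ x, mfderiv IK IB D.proj (s x) (V x) = 0 ∧ V x ∈ tangentSpaceOf IK D.carrier (s x)}
  add_mem' := fun hV hW => ⟨contMDiff_along_add s.contMDiff hV.1 hW.1, fun x =>
    ⟨by rw [Pi.add_apply, map_add, (hV.2 x).1, (hW.2 x).1, add_zero],
      add_mem (hV.2 x).2 (hW.2 x).2⟩⟩
  zero_mem' := ⟨contMDiff_along_zero s.contMDiff, fun _ => ⟨map_zero _, zero_mem _⟩⟩
  smul_mem' := fun a V hV => ⟨contMDiff_along_smul s.contMDiff a hV.1, fun x =>
    ⟨by rw [Pi.smul_apply, map_smul, (hV.2 x).1, smul_zero],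
      Submodule.smul_mem _ a (hV.2 x).2⟩⟩

end Tangent

open Diffeology

/-- The diffeology of a space of sections: a map `c` from `ℝᵏ` is smooth if `(t, x) ↦ c t x` is. -/
instance : DiffeologicalSpace (Sections IS D) :=
  DiffeologicalSpace.ofCorePlotsOn
    { isPlotOn := fun {k} {u} _ c =>
        ContMDiffOn (𝓘(ℝ, EuclideanSpace ℝ (Fin k)).prod IS) IK ∞ (fun q : EuclideanSpace ℝ (Fin k) × S => (c q.1).toFun q.2) (u ×ˢ univ)
      isPlotOn_congr := fun {k u} _ {c c'} h =>
        contMDiffOn_congr fun q hq => by rw [h hq.1]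
      isPlot := fun {k} c =>
        ContMDiff (𝓘(ℝ, EuclideanSpace ℝ (Fin k)).prod IS) IK ∞ (fun q : EuclideanSpace ℝ (Fin k) × S => (c q.1).toFun q.2)
      isPlotOn_univ := fun {k c} => by rw [univ_prod_univ, contMDiffOn_univ]
      isPlot_const := fun {k} s => by
        have : ContMDiff (𝓘(ℝ, EuclideanSpace ℝ (Fin k)).prod IS) IK ∞
          (s.toFun ∘ (Prod.snd : EuclideanSpace ℝ (Fin k) × S → S)) :=
          s.contMDiff.comp contMDiff_snd
        exact this
      isPlotOn_reparam := fun {k m u v hu} hv {c f} h hc hf => by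
        refine hc.comp (t := u ×ˢ univ) (f := fun q : EuclideanSpace ℝ (Fin m) × S => (f q.1, q.2)) ?_ (fun q hq => ⟨h hq.1, mem_univ _⟩)
        refine ContMDiffOn.prodMk ?_ contMDiff_snd.contMDiffOn
        exact hf.contMDiffOn.comp contMDiff_fst.contMDiffOn (fun q hq => hq.1)
      locality := fun {k u} hu {c} h => by
        rintro ⟨t, x⟩ ⟨ht, -⟩
        obtain ⟨v, hv, htv, hc⟩ := h t ht
        exact (hc.contMDiffAt ((hv.prod isOpen_univ).mem_nhds ⟨htv, mem_univ _⟩)).contMDiffWithinAt }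

theorem Sections.isPlot_iff {k : ℕ} {c : EuclideanSpace ℝ (Fin k) → Sections IS D} :
    IsPlot c ↔ ContMDiff (𝓘(ℝ, EuclideanSpace ℝ (Fin k)).prod IS) IK ∞
      (fun q : EuclideanSpace ℝ (Fin k) × S => c q.1 q.2) := Iff.rfl


section Velocity

theorem Sections.IsPlot.contMDiff {k : ℕ} {c : EuclideanSpace ℝ (Fin k) → Sections IS D}
    (hc : IsPlot c) : ContMDiff (𝓘(ℝ, EuclideanSpace ℝ (Fin k)).prod IS) IK ∞
      (fun q : EuclideanSpace ℝ (Fin k) × S => c q.1 q.2) := hc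

/-- The velocity of `c` at `t` in the direction `v`, as a family of tangent vectors. -/
def velocityFun {k : ℕ} (c : EuclideanSpace ℝ (Fin k) → Sections IS D)
    (t v : EuclideanSpace ℝ (Fin k)) (x : S) : TangentSpace IK (c t x) :=
  mfderiv 𝓘(ℝ, EuclideanSpace ℝ (Fin k)) IK (fun t' => c t' x) t v

theorem velocityFun_contMDiff_left {k : ℕ} {c : EuclideanSpace ℝ (Fin k) → Sections IS D}
    (hc : IsPlot c) (x : S) :
    ContMDiff 𝓘(ℝ, EuclideanSpace ℝ (Fin k)) IK ∞ (fun t => (c t).toFun x) := by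
  have h : ContMDiff 𝓘(ℝ, EuclideanSpace ℝ (Fin k)) (𝓘(ℝ, EuclideanSpace ℝ (Fin k)).prod IS) ∞
      (fun t : EuclideanSpace ℝ (Fin k) => (t, x)) := contMDiff_id.prodMk contMDiff_const
  exact (Sections.IsPlot.contMDiff hc).comp h

variable [IsManifold IS ∞ S] [IsManifold IK ∞ K]

theorem velocityFun_contMDiff {k : ℕ} {c : EuclideanSpace ℝ (Fin k) → Sections IS D}
    (hc : IsPlot c) (t v : EuclideanSpace ℝ (Fin k)) :
    ContMDiff IS IK.tangent ∞ (fun x => (⟨c t x, velocityFun c t v x⟩ : TangentBundle IK K)) := by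
  have h1 := (Sections.IsPlot.contMDiff hc).contMDiff_tangentMap (m := ∞) (by simp)
  have h2 : ContMDiff IS (𝓘(ℝ, EuclideanSpace ℝ (Fin k)).tangent.prod IS.tangent) ∞
      (fun x : S => ((⟨t, v⟩ : TangentBundle 𝓘(ℝ, EuclideanSpace ℝ (Fin k))
        (EuclideanSpace ℝ (Fin k))), (⟨x, 0⟩ : TangentBundle IS S))) :=
    contMDiff_const.prodMk (contMDiff_zeroSection ℝ (TangentSpace IS))
  have h3 := h1.comp (contMDiff_equivTangentBundleProd_symm.comp h2)
  have key : ∀ x : S, velocityFun c t v x =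
      mfderiv (𝓘(ℝ, EuclideanSpace ℝ (Fin k)).prod IS) IK
        (fun q : EuclideanSpace ℝ (Fin k) × S => (c q.1).toFun q.2) (t, x)
        ((v, 0) : TangentSpace (𝓘(ℝ, EuclideanSpace ℝ (Fin k)).prod IS) (t, x)) := by
    intro x
    have h := mfderiv_prod_eq_add_apply (v := ((v, 0) :
        TangentSpace (𝓘(ℝ, EuclideanSpace ℝ (Fin k)).prod IS) (t, x)))
      ((Sections.IsPlot.contMDiff hc).mdifferentiableAt (x := (t, x)) (by simp))
    refine Eq.trans ?_ h.symm
    refine Eq.trans (add_zero _).symm ?_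
    exact congrArg (fun w => velocityFun c t v x + w) (map_zero _).symm
  refine h3.congr fun x => ?_
  rw [key]
  rfl

theorem velocityFun_mem {k : ℕ} {c : EuclideanSpace ℝ (Fin k) → Sections IS D}
    (hc : IsPlot c) (t v : EuclideanSpace ℝ (Fin k)) :
    velocityFun c t v ∈ SectionTangent (c t) := by
  refine ⟨velocityFun_contMDiff hc t v, fun x => ⟨?_, ?_⟩⟩
  · have h1 := (velocityFun_contMDiff_left hc x).mdifferentiableAt (x := t) (by simp)
    have h2 := mfderiv_comp t (D.contMDiff_proj.mdifferentiableAt (x := c t x) (by simp)) h1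
    have h3 : D.proj ∘ (fun t' => (c t').toFun x) = fun _ => D.base x :=
      funext fun t' => (c t').proj_eq x
    rw [h3, mfderiv_const] at h2
    exact (congrArg (fun L => L v) h2).symm
  · apply Submodule.subset_span
    have h0 : ContMDiff 𝓘(ℝ, ℝ) 𝓘(ℝ, EuclideanSpace ℝ (Fin k)) ∞ (fun r : ℝ => t + r • v) := by
      rw [contMDiff_iff_contDiff]; fun_prop
    refine ⟨fun r => c (t + r • v) x, (velocityFun_contMDiff_left hc x).comp h0,
      fun r => (c _).mem_carrier x, ?_⟩
    have h1 := mfderiv_comp (0 : ℝ)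
      ((velocityFun_contMDiff_left hc x).mdifferentiableAt (x := t + (0 : ℝ) • v) (by simp))
      (h0.mdifferentiableAt (x := (0 : ℝ)) (by simp))
    change mfderiv 𝓘(ℝ, ℝ) IK (fun r : ℝ => (c (t + r • v)).toFun x) 0 = _ at h1
    have h2 : mfderiv 𝓘(ℝ, ℝ) 𝓘(ℝ, EuclideanSpace ℝ (Fin k)) (fun r : ℝ => t + r • v) 0 (1 : ℝ)
        = v := by
      rw [mfderiv_eq_fderiv]
      have h3 : HasDerivAt (fun r : ℝ => t + r • v) v 0 := by
        simpa using ((hasDerivAt_id (0 : ℝ)).smul_const v).const_add t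
      exact (congrArg (fun L => L (1 : ℝ)) h3.hasFDerivAt.fderiv).trans (one_smul ℝ v)
    rw [h1]
    change (⟨c (t + (0 : ℝ) • v) x, mfderiv 𝓘(ℝ, EuclideanSpace ℝ (Fin k)) IK
      (fun t' => (c t').toFun x) (t + (0 : ℝ) • v)
        (mfderiv 𝓘(ℝ, ℝ) 𝓘(ℝ, EuclideanSpace ℝ (Fin k)) (fun r : ℝ => t + r • v) 0 (1 : ℝ))⟩ :
        TangentBundle IK K) = ⟨c t x, mfderiv 𝓘(ℝ, EuclideanSpace ℝ (Fin k)) IK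
      (fun t' => (c t').toFun x) t v⟩
    rw [h2, zero_smul, add_zero]

/-- The velocity at `t` in the direction `v` of a smooth family `c` of sections. -/
def velocity {k : ℕ} (c : EuclideanSpace ℝ (Fin k) → Sections IS D) (hc : IsPlot c)
    (t v : EuclideanSpace ℝ (Fin k)) : SectionTangent (c t) :=
  ⟨velocityFun c t v, velocityFun_mem hc t v⟩
end Velocity
end Sections

/-! ### Differential calculus on spaces of sections -/

section Calculus

open Diffeology

variable {ES HS EK HK EB HB S K B ES' HS' EK' HK' EB' HB' S' K' B' : Type*}
  [NormedAddCommGroup ES] [NormedSpace ℝ ES] [TopologicalSpace HS]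
  [NormedAddCommGroup EK] [NormedSpace ℝ EK] [TopologicalSpace HK]
  [NormedAddCommGroup EB] [NormedSpace ℝ EB] [TopologicalSpace HB]
  {IS : ModelWithCorners ℝ ES HS} {IK : ModelWithCorners ℝ EK HK}
  {IB : ModelWithCorners ℝ EB HB}
  [TopologicalSpace S] [ChartedSpace HS S] [IsManifold IS ∞ S]
  [TopologicalSpace K] [ChartedSpace HK K] [IsManifold IK ∞ K]
  [TopologicalSpace B] [ChartedSpace HB B]
  {D : SectionData IK IB S K B}
  [NormedAddCommGroup EK'] [NormedSpace ℝ EK'] [TopologicalSpace HK']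
  [NormedAddCommGroup EB'] [NormedSpace ℝ EB'] [TopologicalSpace HB']
  {IK' : ModelWithCorners ℝ EK' HK'} {IB' : ModelWithCorners ℝ EB' HB'}
  [TopologicalSpace K'] [ChartedSpace HK' K'] [IsManifold IK' ∞ K']
  [TopologicalSpace B'] [ChartedSpace HB' B']
  {D' : SectionData IK' IB' S K' B'}

/-- A real function on the tangent spaces of a space of sections. It is a smooth one-form if it
satisfies `IsSmoothOneForm`. -/
abbrev TangentFunction (IS : ModelWithCorners ℝ ES HS) (D : SectionData IK IB S K B) : Type _ :=
  ∀ s : Sections IS D, SectionTangent s → ℝ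

/-- A field of alternating bilinear forms on the tangent spaces of a space of sections. -/
abbrev TwoForm (IS : ModelWithCorners ℝ ES HS) (D : SectionData IK IB S K B) : Type _ :=
  ∀ s : Sections IS D, SectionTangent s [⋀^Fin 2]→ₗ[ℝ] ℝ

/-- Smooth one-forms: linear on each tangent space, and smooth along every smooth family. -/
structure IsSmoothOneForm (α : TangentFunction IS D) : Prop where
  isLinearMap : ∀ s, IsLinearMap ℝ (α s)
  contDiff : ∀ {k : ℕ} (c : EuclideanSpace ℝ (Fin k) → Sections IS D) (hc : IsPlot c)
    (v : EuclideanSpace ℝ (Fin k)), ContDiff ℝ ∞ (fun t => α (c t) (velocity c hc t v))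

/-- `β` is the exterior derivative of the smooth one-form `α`: for every smooth family `c` of
sections with parameters in `ℝᵏ`, the two-form `c^*β` is the exterior derivative of `c^*α`, that
is `c^*β (v, w) = ∂_v (c^*α (w)) - ∂_w (c^*α (v))` for constant vectors `v`, `w`. -/
structure IsExtDeriv (α : TangentFunction IS D) (β : TwoForm IS D) : Prop where
  isSmoothOneForm : IsSmoothOneForm α
  eq : ∀ {k : ℕ} (c : EuclideanSpace ℝ (Fin k) → Sections IS D) (hc : IsPlot c)
    (t v w : EuclideanSpace ℝ (Fin k)),
    β (c t) ![velocity c hc t v, velocity c hc t w] =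
      fderiv ℝ (fun t' => α (c t') (velocity c hc t' w)) t v -
        fderiv ℝ (fun t' => α (c t') (velocity c hc t' v)) t w

/-- The kernel of a two-form at `s`. -/
def TwoForm.ker (β : TwoForm IS D) (s : Sections IS D) : Submodule ℝ (SectionTangent s) :=
  LinearMap.ker (AlternatingMap.curryLeft (β s))

theorem TwoForm.mem_ker {β : TwoForm IS D} {s : Sections IS D} {V : SectionTangent s} :
    V ∈ β.ker s ↔ ∀ W, β s ![V, W] = 0 := by
  rw [TwoForm.ker, LinearMap.mem_ker]
  constructor
  · intro h W
    exact congrArg (fun A : SectionTangent s [⋀^Fin 1]→ₗ[ℝ] ℝ => A ![W]) h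
  · intro h
    ext W
    rw [show W = ![W 0] from funext fun i => by rw [Subsingleton.elim i 0]; rfl]
    exact h (W 0)

/-- Smooth, closed and weakly nondegenerate two-forms. -/
structure IsWeaklySymplectic (β : TwoForm IS D) : Prop where
  contDiff : ∀ {k : ℕ} (c : EuclideanSpace ℝ (Fin k) → Sections IS D) (hc : IsPlot c)
    (v w : EuclideanSpace ℝ (Fin k)),
    ContDiff ℝ ∞ (fun t => β (c t) ![velocity c hc t v, velocity c hc t w])
  closed : ∀ {k : ℕ} (c : EuclideanSpace ℝ (Fin k) → Sections IS D) (hc : IsPlot c)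
    (t u v w : EuclideanSpace ℝ (Fin k)),
    fderiv ℝ (fun t' => β (c t') ![velocity c hc t' v, velocity c hc t' w]) t u +
      fderiv ℝ (fun t' => β (c t') ![velocity c hc t' w, velocity c hc t' u]) t v +
      fderiv ℝ (fun t' => β (c t') ![velocity c hc t' u, velocity c hc t' v]) t w = 0
  ker_eq_bot : ∀ s, β.ker s = ⊥

/-- `TR` is the tangent map of the map `R` between spaces of sections: it sends the velocities of a
smooth family `c` to the velocities of `R ∘ c`. -/
def IsTangentMap (R : Sections IS D → Sections IS D')
    (TR : ∀ s, SectionTangent s →ₗ[ℝ] SectionTangent (R s)) : Prop :=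
  ∀ {k : ℕ} (c : EuclideanSpace ℝ (Fin k) → Sections IS D) (hc : IsPlot c)
    (hRc : IsPlot (fun t => R (c t))) (t v : EuclideanSpace ℝ (Fin k)),
    TR (c t) (velocity c hc t v) = velocity (fun t => R (c t)) hRc t v

/-- Two sections are in the same leaf of the characteristic distribution `ker β` if they can be
joined by a chain of smooth curves which are everywhere tangent to `ker β`. -/
def leafSetoid (β : TwoForm IS D) : Setoid (Sections IS D) :=
  Relation.EqvGen.setoid fun a b => ∃ (c : EuclideanSpace ℝ (Fin 1) → Sections IS D)
    (hc : IsPlot c), c 0 = a ∧ c (EuclideanSpace.single 0 1) = b ∧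
      ∀ t v, velocity c hc t v ∈ β.ker (c t)

/-- The quotient of a space of sections by the kernel of a two-form: the space of leaves of the
characteristic distribution. -/
def LeafSpace (β : TwoForm IS D) : Type _ := Quotient (leafSetoid β)

/-- The projection to the space of leaves. -/
def LeafSpace.mk (β : TwoForm IS D) (s : Sections IS D) : LeafSpace β := Quotient.mk (leafSetoid β) s

/-- The quotient diffeology. -/
instance (β : TwoForm IS D) : DiffeologicalSpace (LeafSpace β) :=
  DiffeologicalSpace.generateFrom
    {P | ∃ c : EuclideanSpace ℝ (Fin P.1) → Sections IS D, IsPlot c ∧ P.2 = LeafSpace.mk β ∘ c}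

/-- A smooth two-form on a diffeological space: a smooth two-form on the parameter space of each
plot, compatibly with changes of parameters. -/
structure DiffeologicalTwoForm (Q : Type*) [DiffeologicalSpace Q] where
  toFun : ∀ {k : ℕ} (c : EuclideanSpace ℝ (Fin k) → Q), IsPlot c →
    EuclideanSpace ℝ (Fin k) → EuclideanSpace ℝ (Fin k) [⋀^Fin 2]→L[ℝ] ℝ
  contDiff : ∀ {k : ℕ} (c : EuclideanSpace ℝ (Fin k) → Q) (hc : IsPlot c),
    ContDiff ℝ ∞ (toFun c hc)
  comp : ∀ {k m : ℕ} (c : EuclideanSpace ℝ (Fin k) → Q) (hc : IsPlot c)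
    (f : EuclideanSpace ℝ (Fin m) → EuclideanSpace ℝ (Fin k)) (hf : ContDiff ℝ ∞ f)
    (t : EuclideanSpace ℝ (Fin m)),
    toFun (c ∘ f) (isPlot_reparam hc hf) t =
      (toFun c hc (f t)).compContinuousLinearMap (fderiv ℝ f t)

/-- The pull-back of the form `γ` by the smooth map `q` from a space of sections is `β`. -/
def DiffeologicalTwoForm.PullbackEq {Q : Type*} [DiffeologicalSpace Q]
    (γ : DiffeologicalTwoForm Q) (q : Sections IS D → Q) (β : TwoForm IS D) : Prop :=
  ∀ {k : ℕ} (c : EuclideanSpace ℝ (Fin k) → Sections IS D) (hc : IsPlot c)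
    (hqc : IsPlot (q ∘ c)) (t v w : EuclideanSpace ℝ (Fin k)),
    γ.toFun (q ∘ c) hqc t ![v, w] = β (c t) ![velocity c hc t v, velocity c hc t w]

/-- The pull-back of the two-form `β` by the smooth map `f` to a space of sections is `γ`. -/
def DiffeologicalTwoForm.EqPullback {Q : Type*} [DiffeologicalSpace Q]
    (γ : DiffeologicalTwoForm Q) (f : Q → Sections IS D) (β : TwoForm IS D) : Prop :=
  ∀ {k : ℕ} (c : EuclideanSpace ℝ (Fin k) → Q) (hc : IsPlot c)
    (hfc : IsPlot (f ∘ c)) (t v w : EuclideanSpace ℝ (Fin k)),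
    β (f (c t)) ![velocity (f ∘ c) hfc t v, velocity (f ∘ c) hfc t w] = γ.toFun c hc t ![v, w]

end Calculus

/-! ### Exterior algebra at a point, and integration -/

/-- The interior product of an alternating map on a tangent space with a tangent vector. -/
def interiorAt {E H M : Type*} [NormedAddCommGroup E] [NormedSpace ℝ E] [TopologicalSpace H]
    {I : ModelWithCorners ℝ E H} [TopologicalSpace M] [ChartedSpace H M] {k : ℕ} {x : M}
    (v : TangentSpace I x) (A : TangentSpace I x [⋀^Fin (k + 1)]→L[ℝ] ℝ) :
    TangentSpace I x [⋀^Fin k]→L[ℝ] ℝ :=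
  ContinuousAlternatingMap.curryLeft (E := E) (F := ℝ) A v

theorem interiorAt_apply {E H M : Type*} [NormedAddCommGroup E] [NormedSpace ℝ E]
    [TopologicalSpace H] {I : ModelWithCorners ℝ E H} [TopologicalSpace M] [ChartedSpace H M]
    {k : ℕ} {x : M} (v : TangentSpace I x) (A : TangentSpace I x [⋀^Fin (k + 1)]→L[ℝ] ℝ)
    (u : Fin k → TangentSpace I x) : interiorAt v A u = A (Matrix.vecCons v u) := rfl

section Integral

variable {n : ℕ} {S : Type*} [TopologicalSpace S] [ChartedSpace (EuclideanSpace ℝ (Fin n)) S]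
  [IsManifold 𝓘(ℝ, EuclideanSpace ℝ (Fin n)) ∞ S]

variable (n S) in
/-- A nowhere vanishing smooth `n`-form on the `n`-manifold `S`. It is only used through the
orientation that it defines. -/
structure OrientationForm where
  toFun : ∀ x : S, FormAt (EuclideanSpace ℝ (Fin n)) n x
  contMDiff : ContMDiff 𝓘(ℝ, EuclideanSpace ℝ (Fin n))
    (𝓘(ℝ, EuclideanSpace ℝ (Fin n)).prod 𝓘(ℝ, EuclideanSpace ℝ (Fin n) [⋀^Fin n]→L[ℝ] ℝ)) ∞
    (fun x => (⟨x, toFun x⟩ : FormBundle (EuclideanSpace ℝ (Fin n)) S n))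
  ne_zero : ∀ x, toFun x ≠ 0

/-- The coordinate frame `∂/∂z₁, …, ∂/∂zₙ` of the preferred chart at `i`, at the point with
coordinates `z`. -/
def chartFrame (i : S) (z : EuclideanSpace ℝ (Fin n)) (j : Fin n) :
    TangentSpace 𝓘(ℝ, EuclideanSpace ℝ (Fin n)) ((chartAt (EuclideanSpace ℝ (Fin n)) i).symm z) :=
  mfderiv 𝓘(ℝ, EuclideanSpace ℝ (Fin n)) 𝓘(ℝ, EuclideanSpace ℝ (Fin n))
    (chartAt (EuclideanSpace ℝ (Fin n)) i).symm z (EuclideanSpace.single j (1 : ℝ))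

variable (n S) in
/-- A smooth partition of unity subordinate to the preferred charts. -/
def chartPartition [T2Space S] [SigmaCompactSpace S] :
    SmoothPartitionOfUnity S 𝓘(ℝ, EuclideanSpace ℝ (Fin n)) S univ :=
  (SmoothPartitionOfUnity.exists_isSubordinate_chartAt_source
    𝓘(ℝ, EuclideanSpace ℝ (Fin n)) S).choose

theorem chartPartition_isSubordinate [T2Space S] [SigmaCompactSpace S] :
    (chartPartition n S).IsSubordinate fun i => (chartAt (EuclideanSpace ℝ (Fin n)) i).source :=
  (SmoothPartitionOfUnity.exists_isSubordinate_chartAt_source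
    𝓘(ℝ, EuclideanSpace ℝ (Fin n)) S).choose_spec

/-- The integral of an `n`-form over the compact `n`-manifold `S`, for the orientation given by
`o`: the sum over the preferred charts of the integrals of the form multiplied by the functions of
a partition of unity, with the sign of the chart with respect to the orientation. -/
def integralForm [T2Space S] [SigmaCompactSpace S] (o : OrientationForm n S)
    (α : ∀ x : S, FormAt (EuclideanSpace ℝ (Fin n)) n x) : ℝ :=
  ∑ᶠ i : S, ∫ z in (chartAt (EuclideanSpace ℝ (Fin n)) i).target,
    chartPartition n S i ((chartAt (EuclideanSpace ℝ (Fin n)) i).symm z) *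
      (SignType.sign (α := ℝ) (o.toFun ((chartAt (EuclideanSpace ℝ (Fin n)) i).symm z) (chartFrame i z)) *
        (α ((chartAt (EuclideanSpace ℝ (Fin n)) i).symm z) (chartFrame i z) : ℝ))

end Integral

/-! ### The spaces of fields on a Cauchy surface and their canonical forms -/

section Fields

variable {S X Y EX EY F : Type*}
  [TopologicalSpace S]
  [NormedAddCommGroup EX] [NormedSpace ℝ EX]
  [TopologicalSpace X] [ChartedSpace EX X] [IsManifold 𝓘(ℝ, EX) ∞ X]
  [NormedAddCommGroup EY] [NormedSpace ℝ EY] [FiniteDimensional ℝ EY]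
  [TopologicalSpace Y] [ChartedSpace EY Y] [IsManifold 𝓘(ℝ, EY) ∞ Y]
  [NormedAddCommGroup F] [NormedSpace ℝ F] [FiniteDimensional ℝ F]
  {p : Y → X}

/-- The canonical `k`-form on `Λᵏ T*Y`: its value at `z` is the pull-back of the alternating map
`z` by the tangent map of the projection to `Y`. -/
def canonicalForm {k : ℕ} (z : FormBundle EY Y k) :
    TangentSpace (𝓘(ℝ, EY).prod 𝓘(ℝ, EY [⋀^Fin k]→L[ℝ] ℝ)) z [⋀^Fin k]→L[ℝ] ℝ :=
  ContinuousAlternatingMap.compContinuousLinearMap z.2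
    (mfderiv (𝓘(ℝ, EY).prod 𝓘(ℝ, EY [⋀^Fin k]→L[ℝ] ℝ)) 𝓘(ℝ, EY)
      (TotalSpace.proj : FormBundle EY Y k → Y) z)

/-- The set `Z ⊆ Λᵏ T*Y` of the alternating maps which vanish as soon as two of their arguments are
vertical. -/
def multiphase (EX : Type*) {EY X Y : Type*} [NormedAddCommGroup EX] [NormedSpace ℝ EX]
    [TopologicalSpace X] [ChartedSpace EX X] [NormedAddCommGroup EY] [NormedSpace ℝ EY]
    [TopologicalSpace Y] [ChartedSpace EY Y] (p : Y → X) (k : ℕ) : Set (FormBundle EY Y k) :=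
  {z | ∀ (u : Fin k → TangentSpace 𝓘(ℝ, EY) z.1) (i j : Fin k), i ≠ j →
    mfderiv 𝓘(ℝ, EY) 𝓘(ℝ, EX) p z.1 (u i) = 0 → mfderiv 𝓘(ℝ, EY) 𝓘(ℝ, EX) p z.1 (u j) = 0 →
      z.2 u = 0}

variable (hp : Manifold.IsSubmersionOfComplement F 𝓘(ℝ, EY) 𝓘(ℝ, EX) ∞ p) (τ : S → X) (n : ℕ)

/-- The sections over `τ` of `Z → X`, where `Z ⊆ Λⁿ⁺¹ T*Y`. -/
def multimomentumData : SectionData (𝓘(ℝ, EY).prod 𝓘(ℝ, EY [⋀^Fin (n + 1)]→L[ℝ] ℝ))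
    𝓘(ℝ, EX) S (FormBundle EY Y (n + 1)) X where
  proj z := p z.1
  base := τ
  carrier := multiphase EX p (n + 1)
  contMDiff_proj := by
    have h1 : ContMDiff 𝓘(ℝ, EY) 𝓘(ℝ, EX) ∞ p := fun y => (hp y).contMDiffAt
    have h2 := contMDiff_proj (n := ∞) (IB := 𝓘(ℝ, EY)) (F := EY [⋀^Fin (n + 1)]→L[ℝ] ℝ)
      (FormAt EY (n + 1) : Y → Type _)
    exact h1.comp h2

variable [ChartedSpace (EuclideanSpace ℝ (Fin n)) S]
  [IsManifold 𝓘(ℝ, EuclideanSpace ℝ (Fin n)) ∞ S]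

/-- The sections `(φ, π)` of `L(VY, Λⁿ T*S)`, where `φ` is a section of `Y` over `τ`. -/
def momentumData : SectionData
    ((𝓘(ℝ, EuclideanSpace ℝ (Fin n)).prod 𝓘(ℝ, EY)).prod
      𝓘(ℝ, F →L[ℝ] (EuclideanSpace ℝ (Fin n) [⋀^Fin n]→L[ℝ] ℝ)))
    (𝓘(ℝ, EuclideanSpace ℝ (Fin n)).prod 𝓘(ℝ, EX)) S
    (MomentumBundle (EuclideanSpace ℝ (Fin n)) S hp n) (S × X) where
  proj m := (m.1.1, p m.1.2)
  base x := (x, τ x)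
  carrier := univ
  contMDiff_proj := by
    have h1 : ContMDiff 𝓘(ℝ, EY) 𝓘(ℝ, EX) ∞ p := fun y => (hp y).contMDiffAt
    have h2 := contMDiff_proj (n := ∞) (IB := 𝓘(ℝ, EuclideanSpace ℝ (Fin n)).prod 𝓘(ℝ, EY))
      (F := F →L[ℝ] (EuclideanSpace ℝ (Fin n) [⋀^Fin n]→L[ℝ] ℝ))
      (MomentumAt (EuclideanSpace ℝ (Fin n)) hp n : S × Y → Type _)
    exact (contMDiff_fst.comp h2).prodMk (h1.comp (contMDiff_snd.comp h2))

/-- The space `𝒵_τ`. -/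
abbrev MultimomentumSpace : Type _ :=
  Sections 𝓘(ℝ, EuclideanSpace ℝ (Fin n)) (multimomentumData hp τ n)

/-- The smooth cotangent bundle `T*𝒴_τ`. -/
abbrev PhaseSpace : Type _ :=
  Sections 𝓘(ℝ, EuclideanSpace ℝ (Fin n)) (momentumData hp τ n)

end Fields

section Canonical

variable {S X Y EX EY F : Type*} {n : ℕ}
  [TopologicalSpace S] [ChartedSpace (EuclideanSpace ℝ (Fin n)) S]
  [IsManifold 𝓘(ℝ, EuclideanSpace ℝ (Fin n)) ∞ S]
  [NormedAddCommGroup EX] [NormedSpace ℝ EX]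
  [TopologicalSpace X] [ChartedSpace EX X] [IsManifold 𝓘(ℝ, EX) ∞ X]
  [NormedAddCommGroup EY] [NormedSpace ℝ EY] [FiniteDimensional ℝ EY]
  [TopologicalSpace Y] [ChartedSpace EY Y] [IsManifold 𝓘(ℝ, EY) ∞ Y]
  [NormedAddCommGroup F] [NormedSpace ℝ F] [FiniteDimensional ℝ F]
  {p : Y → X} (hp : Manifold.IsSubmersionOfComplement F 𝓘(ℝ, EY) 𝓘(ℝ, EX) ∞ p) (τ : S → X)

/-- Transport of alternating forms along an equality of base points. -/
def FormAt.cast {ES M : Type*} [NormedAddCommGroup ES] [NormedSpace ℝ ES] [TopologicalSpace M]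
    [ChartedSpace ES M] {k : ℕ} {x x' : M} (h : x = x') (A : FormAt ES k x) : FormAt ES k x' :=
  h ▸ A

/-- The tangent map of the projection `L(VY, Λⁿ T*S) → Y` sends the vectors which are tangent to
the fibres over `S × X` to vertical vectors. -/
theorem mfderiv_momentum_vertical
    (m : MomentumBundle (EuclideanSpace ℝ (Fin n)) S hp n)
    (w : TangentSpace ((𝓘(ℝ, EuclideanSpace ℝ (Fin n)).prod 𝓘(ℝ, EY)).prod
      𝓘(ℝ, F →L[ℝ] (EuclideanSpace ℝ (Fin n) [⋀^Fin n]→L[ℝ] ℝ))) m)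
    (hw : mfderiv ((𝓘(ℝ, EuclideanSpace ℝ (Fin n)).prod 𝓘(ℝ, EY)).prod
      𝓘(ℝ, F →L[ℝ] (EuclideanSpace ℝ (Fin n) [⋀^Fin n]→L[ℝ] ℝ)))
      (𝓘(ℝ, EuclideanSpace ℝ (Fin n)).prod 𝓘(ℝ, EX)) (momentumData hp τ n).proj m w = 0) :
    mfderiv 𝓘(ℝ, EY) 𝓘(ℝ, EX) p m.1.2
      (mfderiv ((𝓘(ℝ, EuclideanSpace ℝ (Fin n)).prod 𝓘(ℝ, EY)).prod
        𝓘(ℝ, F →L[ℝ] (EuclideanSpace ℝ (Fin n) [⋀^Fin n]→L[ℝ] ℝ))) 𝓘(ℝ, EY)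
        (fun m' : MomentumBundle (EuclideanSpace ℝ (Fin n)) S hp n => m'.1.2) m w) = 0 := by
  have h1 : ContMDiff 𝓘(ℝ, EY) 𝓘(ℝ, EX) ∞ p := fun y => (hp y).contMDiffAt
  have h2 : ContMDiff ((𝓘(ℝ, EuclideanSpace ℝ (Fin n)).prod 𝓘(ℝ, EY)).prod
      𝓘(ℝ, F →L[ℝ] (EuclideanSpace ℝ (Fin n) [⋀^Fin n]→L[ℝ] ℝ))) 𝓘(ℝ, EY) ∞
      (fun m' : MomentumBundle (EuclideanSpace ℝ (Fin n)) S hp n => m'.1.2) :=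
    contMDiff_snd.comp (contMDiff_proj (n := ∞)
      (IB := 𝓘(ℝ, EuclideanSpace ℝ (Fin n)).prod 𝓘(ℝ, EY))
      (F := F →L[ℝ] (EuclideanSpace ℝ (Fin n) [⋀^Fin n]→L[ℝ] ℝ))
      (MomentumAt (EuclideanSpace ℝ (Fin n)) hp n : S × Y → Type _))
  have h3 := mfderiv_comp m (h1.mdifferentiableAt (x := m.1.2) (by simp))
    (h2.mdifferentiableAt (x := m) (by simp))
  have h4 := mfderiv_comp m (contMDiff_snd.mdifferentiableAt
      (I := (𝓘(ℝ, EuclideanSpace ℝ (Fin n)).prod 𝓘(ℝ, EX))) (I' := 𝓘(ℝ, EX)) (n := ∞)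
      (x := (momentumData hp τ n).proj m) (by simp))
    ((momentumData hp τ n).contMDiff_proj.mdifferentiableAt (x := m) (by simp))
  have h5 := congrArg (fun L => L w) (h3.symm.trans h4)
  refine h5.trans ?_
  exact (congrArg (mfderiv (𝓘(ℝ, EuclideanSpace ℝ (Fin n)).prod 𝓘(ℝ, EX)) 𝓘(ℝ, EX)
    (Prod.snd : S × X → X) ((momentumData hp τ n).proj m)) hw).trans
    (map_zero (mfderiv (𝓘(ℝ, EuclideanSpace ℝ (Fin n)).prod 𝓘(ℝ, EX)) 𝓘(ℝ, EX)
      (Prod.snd : S × X → X) ((momentumData hp τ n).proj m)))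

/-- The vertical vector field along `φ` which is the image of the tangent vector `V` at `(φ, π)`
by the tangent map of the projection `T*𝒴_τ → 𝒴_τ`. -/
def configVelocity (s : PhaseSpace hp τ n) (V : SectionTangent s) (x : S) :
    VertAt hp (s x).1.2 :=
  ⟨mfderiv ((𝓘(ℝ, EuclideanSpace ℝ (Fin n)).prod 𝓘(ℝ, EY)).prod
      𝓘(ℝ, F →L[ℝ] (EuclideanSpace ℝ (Fin n) [⋀^Fin n]→L[ℝ] ℝ))) 𝓘(ℝ, EY)
      (fun m : MomentumBundle (EuclideanSpace ℝ (Fin n)) S hp n => m.1.2) (s x) (V.1 x),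
    mfderiv_momentum_vertical hp τ (s x) (V.1 x) (V.2.2 x).1⟩

/-- The canonical one-form `θ_τ` of `T*𝒴_τ`: `θ_τ(φ, π)(V) = ∫ π(Tπ · V)`. -/
def phaseOneForm [T2Space S] [SigmaCompactSpace S] (o : OrientationForm n S) :
    TangentFunction 𝓘(ℝ, EuclideanSpace ℝ (Fin n)) (momentumData hp τ n) := fun s V =>
  integralForm o fun x =>
    FormAt.cast (congrArg Prod.fst (s.proj_eq x)) ((s x).2 (configVelocity hp τ s V x))

/-- The canonical one-form `Θ_τ` of `𝒵_τ`: `Θ_τ(σ)(V) = ∫ σ^*(i_V Θ)`. -/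
def multimomentumOneForm [T2Space S] [SigmaCompactSpace S] (o : OrientationForm n S) :
    TangentFunction 𝓘(ℝ, EuclideanSpace ℝ (Fin n)) (multimomentumData hp τ n) := fun σ V =>
  integralForm o fun x =>
    ContinuousAlternatingMap.compContinuousLinearMap
      (interiorAt (V.1 x) (canonicalForm (σ x)))
      (mfderiv 𝓘(ℝ, EuclideanSpace ℝ (Fin n))
        (𝓘(ℝ, EY).prod 𝓘(ℝ, EY [⋀^Fin (n + 1)]→L[ℝ] ℝ)) σ.toFun x)

/-- The value at `x` of the momentum of `σ`: with `φ` the composition of `σ` with the projection to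
`Y`, it is the linear map `v ↦ φ^*(i_v (σ x))` from `V_{φ(x)}Y` to `Λⁿ T*ₓS`. -/
def reductionAt (σ : MultimomentumSpace hp τ n) (x : S) :
    MomentumBundle (EuclideanSpace ℝ (Fin n)) S hp n :=
  ⟨(x, (σ x).1),
    ((ContinuousAlternatingMap.compContinuousLinearMapCLM
      (mfderiv 𝓘(ℝ, EuclideanSpace ℝ (Fin n)) 𝓘(ℝ, EY) (fun x' => (σ x').1) x) :
        (EY [⋀^Fin n]→L[ℝ] ℝ) →L[ℝ] (EuclideanSpace ℝ (Fin n) [⋀^Fin n]→L[ℝ] ℝ)).comp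
        (ContinuousAlternatingMap.curryLeft (E := EY) (F := ℝ) (σ x).2)).comp
          (VertAt.incl hp (σ x).1)⟩

theorem reductionAt_apply (σ : MultimomentumSpace hp τ n) (x : S) (v : VertAt hp (σ x).1) :
    (reductionAt hp τ σ x).2 v = ContinuousAlternatingMap.compContinuousLinearMap
      (interiorAt (VertAt.incl hp (σ x).1 v) (σ x).2)
      (mfderiv 𝓘(ℝ, EuclideanSpace ℝ (Fin n)) 𝓘(ℝ, EY) (fun x' => (σ x').1) x) := rfl

/-- `R` is the reduction map `R_τ : 𝒵_τ → T*𝒴_τ`. -/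
def IsReductionMap (R : MultimomentumSpace hp τ n → PhaseSpace hp τ n) : Prop :=
  ∀ σ x, R σ x = reductionAt hp τ σ x

/-- `σ` and `σ'` cover the same section of `Y`, and `σ' - σ` is in the kernel of `R`. -/
def DifferByKernel (R : MultimomentumSpace hp τ n → PhaseSpace hp τ n)
    (σ σ' : MultimomentumSpace hp τ n) : Prop :=
  ∃ κ : MultimomentumSpace hp τ n, (∀ x, (R κ x).2 = 0) ∧
    ∀ x, ∃ (y : Y) (a b : FormAt EY (n + 1) y), σ x = ⟨y, a⟩ ∧ κ x = ⟨y, b⟩ ∧ σ' x = ⟨y, a + b⟩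

end Canonical

end

/-!
The proof works with families of sections. In charts of the bundles adapted to the submersion, the
sections of `Z` and of `T*𝒴_τ` are maps with values in a linear subspace, so that a compactly
supported field along a section can be realized by pushing in the chart; composing such pushes
for a partition of unity shows that every tangent vector, and every pair of tangent vectors at the
same section, consists of velocities of one smooth family (`exists_plot_velocity_eq`,
`SectionTangent.induction₂`). Hence tangent maps and exterior derivatives are determined by their
values on velocities, which gives their uniqueness (`existsUnique_isTangentMap`,
`IsExtDeriv.unique`) and the fact that an exterior derivative is closed, by symmetry of second
derivatives.

Differentiating under the integral sign, `ω_τ` is the integral over `Σ` of the canonical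
symplectic form of the fibres, `⟨π_W, φ_V⟩ - ⟨π_V, φ_W⟩`, written in adapted coordinates in
`symplecticAt` (`isExtDeriv_phaseOneForm`). Since `R_τ` preserves configurations,
`Θ_τ = R_τ^* θ_τ` holds by the definition of the two one-forms (`multimomentumOneForm_eq`), and
therefore `Ω_τ = R_τ^* ω_τ`.

The reduction map has a right inverse which is smooth on families (`reductionLift`): with a
vertical projection of `TY`, that is, a connection (`exists_verticalProjection`), and a left inverse
of `Tτ` along `τ` (`exists_tangentRetraction`), a momentum `π` is extended to an `(n + 1)`-form on
`Y` by the wedge product of the vertical projection with `π` (`exists_momentumLift`). Images of the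
tangent map of `R_τ` are enough to detect the kernel of `ω_τ`. Moving the multimomentum along an
affine family `σ + r B` changes the momentum alone, by any given one, which shows that a vector in
the kernel has no fibre part (`fibreVelocity_eq_zero`). Any fibre direction at a point is the
velocity of a multimomentum field, and multiplying this velocity by a suitable function makes the
integrand a square, so that the momentum part vanishes as well (`momentumVelocity_eq_zero`). This
yields weak nondegeneracy, and the same test vectors show that `TR_τ` and `Ω_τ` have the same kernel
(`ker_phaseTwoForm`, `ker_tangentMap`).

The leaves of `ker Ω_τ` are the fibres of `R_τ` (`leafSetoid_iff_reduction_eq`): along a curve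
tangent to `ker TR_τ` the reduction is constant, and conversely two fields with the same reduction
cover the same configuration and are joined by a segment, along which the reduction is constant
because `R_τ` is affine over a configuration. Finally the right inverse of `R_τ` makes the
bijection from the quotient to `T*𝒴_τ` a diffeomorphism, and a two-form on the quotient is the
same as one on `T*𝒴_τ` (`exists_leafSpace_equiv`).
-/

set_option linter.unusedSectionVars false

noncomputable section

/-! ### Smoothness of maps into bundles of forms -/

section FiniteDimensional

variable {EM HM M : Type*} [NormedAddCommGroup EM] [NormedSpace ℝ EM] [TopologicalSpace HM]
  {IM : ModelWithCorners ℝ EM HM} [TopologicalSpace M] [ChartedSpace HM M]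

/-- In finite dimension, smoothness can be tested on any family of functionals that separates
points, since such a family spans the dual space. -/
theorem contMDiffAt_of_separating {V ι : Type*} [NormedAddCommGroup V] [NormedSpace ℝ V]
    [FiniteDimensional ℝ V] (l : ι → Module.Dual ℝ V) (hl : ∀ v, (∀ i, l i v = 0) → v = 0)
    {f : M → V} {q₀ : M} (hf : ∀ i, ContMDiffAt IM 𝓘(ℝ, ℝ) ∞ (fun q => l i (f q)) q₀) :
    ContMDiffAt IM 𝓘(ℝ, V) ∞ f q₀ := by
  have hspan : Submodule.span ℝ (range l) = ⊤ := by
    rw [← Subspace.dualCoannihilator_dualAnnihilator_eq (W := Submodule.span ℝ (range l))]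
    have : (Submodule.span ℝ (range l)).dualCoannihilator = ⊥ := by
      rw [eq_bot_iff]
      intro v hv
      rw [Submodule.mem_dualCoannihilator] at hv
      exact hl v fun i => hv _ (Submodule.subset_span ⟨i, rfl⟩)
    rw [this, Submodule.dualAnnihilator_bot]
  have hall : ∀ m : Module.Dual ℝ V, ContMDiffAt IM 𝓘(ℝ, ℝ) ∞ (fun q => m (f q)) q₀ := by
    intro m
    have hm : m ∈ Submodule.span ℝ (range l) := hspan ▸ Submodule.mem_top
    induction hm using Submodule.span_induction with
    | mem x hx => obtain ⟨i, rfl⟩ := hx; exact hf i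
    | zero => exact contMDiffAt_const
    | add x y _ _ hx hy => exact hx.add hy
    | smul a x _ hx => exact (contMDiffAt_const (c := a)).mul hx
  let b := Module.finBasis ℝ V
  have h1 : ContMDiffAt IM 𝓘(ℝ, V) ∞ (fun q => ∑ i, b.coord i (f q) • b i) q₀ :=
    contMDiffAt_finsetSum fun i _ => (hall (b.coord i)).smul contMDiffAt_const
  refine h1.congr_of_eventuallyEq (Filter.Eventually.of_forall fun q => ?_)
  exact (b.sum_repr (f q)).symm

/-- Smoothness of a map into alternating forms on a finite-dimensional space may be tested by
evaluation, since evaluations separate points of a finite-dimensional space. -/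
theorem contMDiffAt_alternating_of_apply {E : Type*} [NormedAddCommGroup E] [NormedSpace ℝ E]
    [FiniteDimensional ℝ E] {k : ℕ} {f : M → E [⋀^Fin k]→L[ℝ] ℝ} {q₀ : M}
    (hf : ∀ u, ContMDiffAt IM 𝓘(ℝ, ℝ) ∞ (fun q => f q u) q₀) :
    ContMDiffAt IM 𝓘(ℝ, E [⋀^Fin k]→L[ℝ] ℝ) ∞ f q₀ :=
  contMDiffAt_of_separating
    (l := fun u : Fin k → E =>
      { toFun := fun A : E [⋀^Fin k]→L[ℝ] ℝ => A u
        map_add' := fun _ _ => rfl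
        map_smul' := fun _ _ => rfl })
    (fun _ hA => ContinuousAlternatingMap.ext hA) hf

theorem contMDiffAt_clm_of_apply {F G : Type*} [NormedAddCommGroup F] [NormedSpace ℝ F]
    [FiniteDimensional ℝ F] [NormedAddCommGroup G] [NormedSpace ℝ G] [FiniteDimensional ℝ G]
    {f : M → F →L[ℝ] G} {q₀ : M}
    (hf : ∀ v, ContMDiffAt IM 𝓘(ℝ, G) ∞ (fun q => f q v) q₀) :
    ContMDiffAt IM 𝓘(ℝ, F →L[ℝ] G) ∞ f q₀ := by
  refine contMDiffAt_of_separating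
    (l := fun u : F × Module.Dual ℝ G =>
      { toFun := fun A : F →L[ℝ] G => u.2 (A u.1)
        map_add' := fun _ _ => map_add u.2 _ _
        map_smul' := fun _ _ => map_smul u.2 _ _ })
    (fun _ hA => ContinuousLinearMap.ext fun v => ?_) fun u => ?_
  · exact (Module.forall_dual_apply_eq_zero_iff ℝ _).1 fun m => hA (v, m)
  · exact (LinearMap.toContinuousLinearMap u.2).contMDiff.contMDiffAt.comp q₀ (hf u.1)

/-- Evaluation of alternating maps is smooth in all variables. It is the pull-back of the
alternating map by the linear map which sends the standard basis to the given vectors. -/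
theorem ContMDiffAt.alternating_apply {E : Type*} [NormedAddCommGroup E] [NormedSpace ℝ E]
    [FiniteDimensional ℝ E] {k : ℕ} {f : M → E [⋀^Fin k]→L[ℝ] ℝ} {u : Fin k → M → E} {q₀ : M}
    (hf : ContMDiffAt IM 𝓘(ℝ, E [⋀^Fin k]→L[ℝ] ℝ) ∞ f q₀)
    (hu : ∀ i, ContMDiffAt IM 𝓘(ℝ, E) ∞ (u i) q₀) :
    ContMDiffAt IM 𝓘(ℝ, ℝ) ∞ (fun q => f q (fun i => u i q)) q₀ := by
  let L : M → (Fin k → ℝ) →L[ℝ] E := fun q =>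
    ∑ i, (ContinuousLinearMap.proj i : (Fin k → ℝ) →L[ℝ] ℝ).smulRight (u i q)
  have hL : ContMDiffAt IM 𝓘(ℝ, (Fin k → ℝ) →L[ℝ] E) ∞ L q₀ := by
    refine contMDiffAt_clm_of_apply fun v => ?_
    have : (fun q => L q v) = fun q => ∑ i, v i • u i q := by
      funext q; simp [L]
    rw [this]
    have h : ∀ i, ContMDiffAt IM 𝓘(ℝ, E) ∞ (fun q => v i • u i q) q₀ := fun i =>
      (v i • ContinuousLinearMap.id ℝ E).contMDiff.contMDiffAt.comp q₀ (hu i)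
    exact contMDiffAt_finsetSum fun i _ => h i
  have h1 := ((contDiff_pullbackAlternating (Fin k) (Fin k → ℝ) E ℝ).contMDiff.contMDiffAt.comp q₀
    hL).clm_apply hf
  let ev : ((Fin k → ℝ) [⋀^Fin k]→L[ℝ] ℝ) →ₗ[ℝ] ℝ :=
    { toFun := fun A => A (fun i => Pi.single i 1)
      map_add' := fun _ _ => rfl
      map_smul' := fun _ _ => rfl }
  have h2 := (LinearMap.toContinuousLinearMap ev).contMDiff.contMDiffAt.comp q₀ h1
  refine h2.congr_of_eventuallyEq (Filter.Eventually.of_forall fun q => ?_)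
  change f q (fun i => u i q) = f q (fun i => L q (Pi.single i 1))
  congr 1
  funext i
  simp [L, Pi.single_apply]

end FiniteDimensional

section TangentMaps

variable {EM HM M : Type*} [NormedAddCommGroup EM] [NormedSpace ℝ EM] [TopologicalSpace HM]
  {IM : ModelWithCorners ℝ EM HM} [TopologicalSpace M] [ChartedSpace HM M]
  {EN HN N EP HP P : Type*} [NormedAddCommGroup EN] [NormedSpace ℝ EN] [TopologicalSpace HN]
  {IN : ModelWithCorners ℝ EN HN} [TopologicalSpace N] [ChartedSpace HN N] [IsManifold IN ∞ N]
  [NormedAddCommGroup EP] [NormedSpace ℝ EP] [TopologicalSpace HP]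
  {IP : ModelWithCorners ℝ EP HP} [TopologicalSpace P] [ChartedSpace HP P] [IsManifold IP ∞ P]

theorem ContMDiffOn.mfderiv_along {f : N → P} {U : Set N} (hU : IsOpen U)
    (hf : ContMDiffOn IN IP ∞ f U) {b : M → N} {w : ∀ q, TangentSpace IN (b q)} {q₀ : M}
    (hb : b q₀ ∈ U)
    (hw : ContMDiffAt IM IN.tangent ∞ (fun q => (⟨b q, w q⟩ : TangentBundle IN N)) q₀) :
    ContMDiffAt IM IP.tangent ∞
      (fun q => (⟨f (b q), mfderiv IN IP f (b q) (w q)⟩ : TangentBundle IP P)) q₀ := by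
  have h1 := hf.contMDiffOn_tangentMapWithin (m := ∞) (by simp) hU.uniqueMDiffOn
  have hV : IsOpen (TotalSpace.proj ⁻¹' U : Set (TangentBundle IN N)) :=
    hU.preimage (FiberBundle.continuous_proj EN (TangentSpace IN))
  have h2 := (h1.contMDiffAt (hV.mem_nhds (x := (⟨b q₀, w q₀⟩ : TangentBundle IN N)) hb)).comp q₀ hw
  have hbc : ContinuousAt b q₀ :=
    (FiberBundle.continuous_proj EN (TangentSpace IN)).continuousAt.comp hw.continuousAt
  refine h2.congr_of_eventuallyEq ?_
  filter_upwards [hbc.eventually (hU.mem_nhds hb)] with q hq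
  change _ = (⟨f (b q), mfderivWithin IN IP f U (b q) (w q)⟩ : TangentBundle IP P)
  rw [mfderivWithin_of_isOpen hU hq]

theorem ContMDiff.mfderiv_along {f : N → P}
    (hf : ContMDiff IN IP ∞ f) {b : M → N} {w : ∀ q, TangentSpace IN (b q)} {q₀ : M}
    (hw : ContMDiffAt IM IN.tangent ∞ (fun q => (⟨b q, w q⟩ : TangentBundle IN N)) q₀) :
    ContMDiffAt IM IP.tangent ∞
      (fun q => (⟨f (b q), mfderiv IN IP f (b q) (w q)⟩ : TangentBundle IP P)) q₀ :=
  (hf.contMDiffOn (s := univ)).mfderiv_along isOpen_univ (mem_univ _) hw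

theorem contMDiffAt_tangent_vectorSpace {V : Type*} [NormedAddCommGroup V] [NormedSpace ℝ V]
    {b : M → V} {w : M → V} {q₀ : M} :
    ContMDiffAt IM 𝓘(ℝ, V).tangent ∞ (fun q => (⟨b q, w q⟩ : TangentBundle 𝓘(ℝ, V) V)) q₀ ↔
      ContMDiffAt IM 𝓘(ℝ, V) ∞ b q₀ ∧ ContMDiffAt IM 𝓘(ℝ, V) ∞ w q₀ := by
  refine contMDiffAt_totalSpace.trans (and_congr Iff.rfl ?_)
  refine Filter.EventuallyEq.contMDiffAt_iff (Filter.Eventually.of_forall fun q => ?_)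
  simp

end TangentMaps

section Forms

variable {EM HM M : Type*} [NormedAddCommGroup EM] [NormedSpace ℝ EM] [TopologicalSpace HM]
  {IM : ModelWithCorners ℝ EM HM} [TopologicalSpace M] [ChartedSpace HM M]
  {E N : Type*} [NormedAddCommGroup E] [NormedSpace ℝ E] [FiniteDimensional ℝ E]
  [TopologicalSpace N] [ChartedSpace E N] [IsManifold 𝓘(ℝ, E) ∞ N] {k : ℕ}

/-- The coordinate of a form in the bundle of forms is its pull-back by the inverse of the
tangent trivialization. -/
theorem trivializationAt_form_apply (y₀ : N) (z : FormBundle E N k) :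
    (trivializationAt (E [⋀^Fin k]→L[ℝ] ℝ) (FormAt E k : N → Type _) y₀ z).2 =
      ContinuousAlternatingMap.compContinuousLinearMap z.2
        ((trivializationAt E (TangentSpace 𝓘(ℝ, E)) y₀).symmL ℝ z.1) := by
  rw [FiberBundle.trivializationAt_continuousAlternatingMap_apply]
  ext v
  simp [ContinuousAlternatingMap.inCoordinates]

/-- A smooth form along a map, evaluated on smooth vector fields along the same map, is smooth. -/
theorem ContMDiffAt.form_apply {b : M → N} {A : ∀ q, FormAt E k (b q)}
    {u : Fin k → ∀ q, TangentSpace 𝓘(ℝ, E) (b q)} {q₀ : M}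
    (hA : ContMDiffAt IM (𝓘(ℝ, E).prod 𝓘(ℝ, E [⋀^Fin k]→L[ℝ] ℝ)) ∞
      (fun q => (⟨b q, A q⟩ : FormBundle E N k)) q₀)
    (hu : ∀ i, ContMDiffAt IM 𝓘(ℝ, E).tangent ∞
      (fun q => (⟨b q, u i q⟩ : TangentBundle 𝓘(ℝ, E) N)) q₀) :
    ContMDiffAt IM 𝓘(ℝ, ℝ) ∞ (fun q => A q (fun i => u i q)) q₀ := by
  obtain ⟨hb, hA⟩ := contMDiffAt_totalSpace.1 hA
  have h1 := hA.alternating_apply fun i => (contMDiffAt_totalSpace.1 (hu i)).2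
  refine h1.congr_of_eventuallyEq ?_
  have hb' : ∀ᶠ q in 𝓝 q₀, b q ∈ (trivializationAt E (TangentSpace 𝓘(ℝ, E)) (b q₀)).baseSet :=
    hb.continuousAt.eventually_mem
      ((trivializationAt E (TangentSpace 𝓘(ℝ, E)) (b q₀)).open_baseSet.mem_nhds
        (FiberBundle.mem_baseSet_trivializationAt' (b q₀)))
  filter_upwards [hb'] with q hq
  rw [trivializationAt_form_apply]
  change A q _ = A q _
  congr 1
  funext i
  change u i q = (trivializationAt E (TangentSpace 𝓘(ℝ, E)) (b q₀)).symmL ℝ (b q)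
    ((trivializationAt E (TangentSpace 𝓘(ℝ, E)) (b q₀)) ⟨b q, u i q⟩).2
  have := (trivializationAt E (TangentSpace 𝓘(ℝ, E)) (b q₀)).symmL_continuousLinearMapAt
    (R := ℝ) hq (u i q)
  rw [Trivialization.continuousLinearMapAt_apply,
    Trivialization.coe_linearMapAt_of_mem _ hq] at this
  exact this.symm

theorem contMDiffAt_trivialization_symmL (y₀ : N) (e : E) :
    ContMDiffAt 𝓘(ℝ, E) 𝓘(ℝ, E).tangent ∞ (fun y => (⟨y, (trivializationAt E
      (TangentSpace 𝓘(ℝ, E)) y₀).symmL ℝ y e⟩ : TangentBundle 𝓘(ℝ, E) N)) y₀ := by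
  have hy := FiberBundle.mem_baseSet_trivializationAt' (F := E) (E := TangentSpace 𝓘(ℝ, E)) y₀
  refine contMDiffAt_totalSpace.2 ⟨contMDiffAt_id, ?_⟩
  refine (contMDiffAt_const (c := e)).congr_of_eventuallyEq ?_
  filter_upwards [(trivializationAt E (TangentSpace 𝓘(ℝ, E)) y₀).open_baseSet.mem_nhds hy] with y h
  have := (trivializationAt E (TangentSpace 𝓘(ℝ, E)) y₀).continuousLinearMapAt_symmL (R := ℝ) h e
  rw [Trivialization.continuousLinearMapAt_apply, Trivialization.coe_linearMapAt_of_mem _ h] at this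
  exact this

/-- A family of forms is smooth as soon as its values on smooth vector fields are. -/
theorem contMDiffAt_form_of_apply {b : M → N} {A : ∀ q, FormAt E k (b q)} {q₀ : M}
    (hb : ContMDiffAt IM 𝓘(ℝ, E) ∞ b q₀)
    (hA : ∀ u : Fin k → ∀ y : N, TangentSpace 𝓘(ℝ, E) y,
      (∀ i, ContMDiffAt 𝓘(ℝ, E) 𝓘(ℝ, E).tangent ∞
        (fun y => (⟨y, u i y⟩ : TangentBundle 𝓘(ℝ, E) N)) (b q₀)) →
      ContMDiffAt IM 𝓘(ℝ, ℝ) ∞ (fun q => A q (fun i => u i (b q))) q₀) :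
    ContMDiffAt IM (𝓘(ℝ, E).prod 𝓘(ℝ, E [⋀^Fin k]→L[ℝ] ℝ)) ∞
      (fun q => (⟨b q, A q⟩ : FormBundle E N k)) q₀ := by
  refine contMDiffAt_totalSpace.2 ⟨hb, contMDiffAt_alternating_of_apply fun e => ?_⟩
  have h := hA (fun i y => (trivializationAt E (TangentSpace 𝓘(ℝ, E)) (b q₀)).symmL ℝ y (e i))
    fun i => contMDiffAt_trivialization_symmL (b q₀) (e i)
  refine h.congr_of_eventuallyEq (Filter.Eventually.of_forall fun q => ?_)
  change (trivializationAt (E [⋀^Fin k]→L[ℝ] ℝ) (FormAt E k : N → Type _) (b q₀) ⟨b q, A q⟩).2 e = _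
  rw [trivializationAt_form_apply]
  rfl

end Forms

/-! ### Smoothness of maps into the vertical bundle and into the bundle of momenta -/

section Vertical

variable {EX EY F X Y : Type*}
  [NormedAddCommGroup EX] [NormedSpace ℝ EX]
  [NormedAddCommGroup EY] [NormedSpace ℝ EY]
  [NormedAddCommGroup F] [NormedSpace ℝ F]
  [TopologicalSpace X] [ChartedSpace EX X] [IsManifold 𝓘(ℝ, EX) ∞ X]
  [TopologicalSpace Y] [ChartedSpace EY Y] [IsManifold 𝓘(ℝ, EY) ∞ Y]
  {p : Y → X} (hp : Manifold.IsSubmersionOfComplement F 𝓘(ℝ, EY) 𝓘(ℝ, EX) ∞ p)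
  {EM HM M : Type*} [NormedAddCommGroup EM] [NormedSpace ℝ EM] [TopologicalSpace HM]
  {IM : ModelWithCorners ℝ EM HM} [TopologicalSpace M] [ChartedSpace HM M]

theorem contMDiffOn_adChart (y₀ : Y) :
    ContMDiffOn 𝓘(ℝ, EY) 𝓘(ℝ, EY) ∞ (adChart hp y₀) (adChart hp y₀).source :=
  contMDiffOn_of_mem_maximalAtlas (hp y₀).domChart_mem_maximalAtlas

theorem contMDiffOn_adChart_symm (y₀ : Y) :
    ContMDiffOn 𝓘(ℝ, EY) 𝓘(ℝ, EY) ∞ (adChart hp y₀).symm (adChart hp y₀).target :=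
  contMDiffOn_symm_of_mem_maximalAtlas (hp y₀).domChart_mem_maximalAtlas

theorem mem_adChart_source (y₀ : Y) : y₀ ∈ (adChart hp y₀).source := (hp y₀).mem_domChart_source

/-- A vector field along a map is smooth if and only if its coordinates in an adapted chart are. -/
theorem contMDiffAt_tangent_iff_chartD (y₀ : Y) {b : M → Y} {w : ∀ q, TangentSpace 𝓘(ℝ, EY) (b q)}
    {q₀ : M} (h : b q₀ ∈ (adChart hp y₀).source) :
    ContMDiffAt IM 𝓘(ℝ, EY).tangent ∞
      (fun q => (⟨b q, w q⟩ : TangentBundle 𝓘(ℝ, EY) Y)) q₀ ↔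
    ContMDiffAt IM 𝓘(ℝ, EY) ∞ b q₀ ∧
      ContMDiffAt IM 𝓘(ℝ, EY) ∞ (fun q => chartD hp y₀ (b q) (w q)) q₀ := by
  constructor
  · intro hw
    exact ⟨(contMDiffAt_totalSpace.1 hw).1, (contMDiffAt_tangent_vectorSpace.1
      ((contMDiffOn_adChart hp y₀).mfderiv_along (adChart hp y₀).open_source h hw)).2⟩
  · rintro ⟨hb, hw⟩
    have h1 := ((contMDiffOn_adChart hp y₀).contMDiffAt
      ((adChart hp y₀).open_source.mem_nhds h)).comp q₀ hb
    have h2 := (contMDiffOn_adChart_symm hp y₀).mfderiv_along (adChart hp y₀).open_target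
      (b := fun q => adChart hp y₀ (b q)) ((adChart hp y₀).map_source h)
      (contMDiffAt_tangent_vectorSpace.2 ⟨h1, hw⟩)
    refine h2.congr_of_eventuallyEq ?_
    filter_upwards [hb.continuousAt.eventually_mem ((adChart hp y₀).open_source.mem_nhds h)]
      with q hq
    have h3 := chartDInv_chartD hp y₀ (b q) hq (w q)
    have h4 := (adChart hp y₀).left_inv hq
    refine TotalSpace.ext h4.symm ?_
    exact heq_of_eq h3.symm

theorem adEquiv_chartD_incl (y₀ y : Y) (hy : y ∈ (adChart hp y₀).source) (v : VertAt hp y) :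
    adEquiv hp y₀ (chartD hp y₀ y (VertAt.incl hp y v)) = (0, vertCoord hp y₀ y v) := by
  have h1 := chartD_fst hp y₀ y hy (VertAt.incl hp y v)
  rw [VertAt.mfderiv_incl, map_zero] at h1
  exact Prod.ext h1 rfl

/-- A family of vertical vectors is smooth in `VY` if and only if it is smooth in `TY`: the model
fibre of `VY` is the second factor of the adapted chart. -/
theorem contMDiffAt_vert_iff {b : M → Y} {v : ∀ q, VertAt hp (b q)} {q₀ : M} :
    ContMDiffAt IM (𝓘(ℝ, EY).prod 𝓘(ℝ, F)) ∞
      (fun q => (⟨b q, v q⟩ : TotalSpace F (VertAt hp))) q₀ ↔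
    ContMDiffAt IM 𝓘(ℝ, EY).tangent ∞
      (fun q => (⟨b q, VertAt.incl hp (b q) (v q)⟩ : TangentBundle 𝓘(ℝ, EY) Y)) q₀ := by
  rw [contMDiffAt_tangent_iff_chartD hp (b q₀) (mem_adChart_source hp (b q₀))]
  refine contMDiffAt_totalSpace.trans ?_
  change ContMDiffAt IM 𝓘(ℝ, EY) ∞ b q₀ ∧
    ContMDiffAt IM 𝓘(ℝ, F) ∞ (fun q => vertCoord hp (b q₀) (b q) (v q)) q₀ ↔ _
  constructor
  · rintro ⟨hb, hv⟩
    refine ⟨hb, ?_⟩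
    have h1 : ContMDiffAt IM 𝓘(ℝ, EY) ∞ (fun q => (adEquiv hp (b q₀)).symm
        (0, vertCoord hp (b q₀) (b q) (v q))) q₀ :=
      (((adEquiv hp (b q₀)).symm : EX × F →L[ℝ] EY).comp
        (ContinuousLinearMap.inr ℝ EX F)).contMDiff.contMDiffAt.comp q₀ hv
    refine h1.congr_of_eventuallyEq ?_
    filter_upwards [hb.continuousAt.eventually_mem
      ((adChart hp (b q₀)).open_source.mem_nhds (mem_adChart_source hp (b q₀)))] with q hq
    rw [← adEquiv_chartD_incl hp _ _ hq, ContinuousLinearEquiv.symm_apply_apply]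
  · rintro ⟨hb, hv⟩
    exact ⟨hb, ((ContinuousLinearMap.snd ℝ EX F).comp
      (adEquiv hp (b q₀) : EY →L[ℝ] EX × F)).contMDiff.contMDiffAt.comp q₀ hv⟩

theorem contMDiffAt_vert_symmL (y₀ : Y) (f : F) :
    ContMDiffAt 𝓘(ℝ, EY) (𝓘(ℝ, EY).prod 𝓘(ℝ, F)) ∞ (fun y => (⟨y, (trivializationAt F
      (VertAt hp) y₀).symmL ℝ y f⟩ : TotalSpace F (VertAt hp))) y₀ := by
  have hy := FiberBundle.mem_baseSet_trivializationAt' (F := F) (E := VertAt hp) y₀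
  refine contMDiffAt_totalSpace.2 ⟨contMDiffAt_id, ?_⟩
  refine (contMDiffAt_const (c := f)).congr_of_eventuallyEq ?_
  filter_upwards [(trivializationAt F (VertAt hp) y₀).open_baseSet.mem_nhds hy] with y h
  have := (trivializationAt F (VertAt hp) y₀).continuousLinearMapAt_symmL (R := ℝ) h f
  rw [Trivialization.continuousLinearMapAt_apply, Trivialization.coe_linearMapAt_of_mem _ h] at this
  exact this

end Vertical

section Momentum

variable {ES EX EY F S X Y : Type*}
  [NormedAddCommGroup ES] [NormedSpace ℝ ES] [FiniteDimensional ℝ ES]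
  [NormedAddCommGroup EX] [NormedSpace ℝ EX]
  [NormedAddCommGroup EY] [NormedSpace ℝ EY]
  [NormedAddCommGroup F] [NormedSpace ℝ F] [FiniteDimensional ℝ F]
  [TopologicalSpace S] [ChartedSpace ES S] [IsManifold 𝓘(ℝ, ES) ∞ S]
  [TopologicalSpace X] [ChartedSpace EX X] [IsManifold 𝓘(ℝ, EX) ∞ X]
  [TopologicalSpace Y] [ChartedSpace EY Y] [IsManifold 𝓘(ℝ, EY) ∞ Y]
  {p : Y → X} (hp : Manifold.IsSubmersionOfComplement F 𝓘(ℝ, EY) 𝓘(ℝ, EX) ∞ p) {k : ℕ}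
  {EM HM M : Type*} [NormedAddCommGroup EM] [NormedSpace ℝ EM] [TopologicalSpace HM]
  {IM : ModelWithCorners ℝ EM HM} [TopologicalSpace M] [ChartedSpace HM M]

theorem vertOver_symmL (q₀ q : S × Y)
    (h : q.2 ∈ (trivializationAt F (VertAt hp) q₀.2).baseSet) (f : F) :
    (trivializationAt F (VertOver S hp) q₀).symmL ℝ q f =
      (trivializationAt F (VertAt hp) q₀.2).symmL ℝ q.2 f := by
  have h' : q ∈ (trivializationAt F (VertOver S hp) q₀).baseSet := h
  apply (Trivialization.continuousLinearEquivAt ℝ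
    (trivializationAt F (VertAt hp) q₀.2) q.2 h).injective
  have h1 := (trivializationAt F (VertAt hp) q₀.2).continuousLinearMapAt_symmL (R := ℝ) h f
  have h2 := (trivializationAt F (VertOver S hp) q₀).continuousLinearMapAt_symmL (R := ℝ) h' f
  rw [Trivialization.continuousLinearMapAt_apply, Trivialization.coe_linearMapAt_of_mem _ h]
    at h1
  rw [Trivialization.continuousLinearMapAt_apply, Trivialization.coe_linearMapAt_of_mem _ h']
    at h2
  exact h2.trans h1.symm

/-- The coordinate of a momentum is the linear map read in the trivializations of `VY` and of
the bundle of forms. -/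
theorem trivializationAt_momentum_apply (q₀ : S × Y) (m : MomentumBundle ES S hp k)
    (h₁ : m.1.1 ∈ (trivializationAt (ES [⋀^Fin k]→L[ℝ] ℝ) (FormAt ES k : S → Type _) q₀.1).baseSet)
    (h₂ : m.1.2 ∈ (trivializationAt F (VertAt hp) q₀.2).baseSet) (f : F) :
    (trivializationAt (F →L[ℝ] (ES [⋀^Fin k]→L[ℝ] ℝ)) (MomentumAt ES hp k : S × Y → Type _) q₀ m).2
        f = (trivializationAt (ES [⋀^Fin k]→L[ℝ] ℝ) (FormAt ES k : S → Type _) q₀.1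
          ⟨m.1.1, m.2 ((trivializationAt F (VertAt hp) q₀.2).symmL ℝ m.1.2 f)⟩).2 := by
  have h₁' : m.1 ∈ (trivializationAt (ES [⋀^Fin k]→L[ℝ] ℝ)
    (FormOver ES Y k : S × Y → Type _) q₀).baseSet := h₁
  rw [hom_trivializationAt_apply]
  change (trivializationAt (ES [⋀^Fin k]→L[ℝ] ℝ)
    (FormOver ES Y k : S × Y → Type _) q₀).continuousLinearMapAt ℝ m.1 (m.2
      ((trivializationAt F (VertOver S hp) q₀).symmL ℝ m.1 f)) = _
  rw [vertOver_symmL hp q₀ m.1 h₂, Trivialization.continuousLinearMapAt_apply,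
    Trivialization.coe_linearMapAt_of_mem _ h₁']
  rfl

/-- A smooth family of momenta, evaluated on a smooth family of vertical vectors, is a smooth
family of forms. -/
theorem ContMDiffAt.momentum_apply {a : M → S} {b : M → Y} {μ : ∀ q, MomentumAt ES hp k (a q, b q)}
    {v : ∀ q, VertAt hp (b q)} {q₀ : M}
    (hμ : ContMDiffAt IM ((𝓘(ℝ, ES).prod 𝓘(ℝ, EY)).prod 𝓘(ℝ, F →L[ℝ] (ES [⋀^Fin k]→L[ℝ] ℝ))) ∞
      (fun q => (⟨(a q, b q), μ q⟩ : MomentumBundle ES S hp k)) q₀)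
    (hv : ContMDiffAt IM (𝓘(ℝ, EY).prod 𝓘(ℝ, F)) ∞
      (fun q => (⟨b q, v q⟩ : TotalSpace F (VertAt hp))) q₀) :
    ContMDiffAt IM (𝓘(ℝ, ES).prod 𝓘(ℝ, ES [⋀^Fin k]→L[ℝ] ℝ)) ∞
      (fun q => (⟨a q, μ q (v q)⟩ : FormBundle ES S k)) q₀ := by
  have hb := (contMDiffAt_totalSpace.1 hμ).1
  have hv' : ContMDiffAt IM ((𝓘(ℝ, ES).prod 𝓘(ℝ, EY)).prod 𝓘(ℝ, F)) ∞
      (fun q => (⟨(a q, b q), v q⟩ : TotalSpace F (VertOver S hp))) q₀ :=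
    contMDiffAt_totalSpace.2 ⟨hb, (contMDiffAt_totalSpace.1 hv).2⟩
  have h := ContMDiffAt.clm_bundle_apply hμ hv'
  exact contMDiffAt_totalSpace.2 ⟨contMDiffAt_fst.comp q₀ hb, (contMDiffAt_totalSpace.1 h).2⟩

/-- A family of momenta is smooth as soon as its values on smooth vertical vector fields are. -/
theorem contMDiffAt_momentum_of_apply {a : M → S} {b : M → Y}
    {μ : ∀ q, MomentumAt ES hp k (a q, b q)} {q₀ : M}
    (ha : ContMDiffAt IM 𝓘(ℝ, ES) ∞ a q₀) (hb : ContMDiffAt IM 𝓘(ℝ, EY) ∞ b q₀)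
    (hμ : ∀ v : ∀ y : Y, VertAt hp y,
      ContMDiffAt 𝓘(ℝ, EY) (𝓘(ℝ, EY).prod 𝓘(ℝ, F)) ∞
        (fun y => (⟨y, v y⟩ : TotalSpace F (VertAt hp))) (b q₀) →
      ContMDiffAt IM (𝓘(ℝ, ES).prod 𝓘(ℝ, ES [⋀^Fin k]→L[ℝ] ℝ)) ∞
        (fun q => (⟨a q, μ q (v (b q))⟩ : FormBundle ES S k)) q₀) :
    ContMDiffAt IM ((𝓘(ℝ, ES).prod 𝓘(ℝ, EY)).prod 𝓘(ℝ, F →L[ℝ] (ES [⋀^Fin k]→L[ℝ] ℝ))) ∞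
      (fun q => (⟨(a q, b q), μ q⟩ : MomentumBundle ES S hp k)) q₀ := by
  refine contMDiffAt_totalSpace.2 ⟨ha.prodMk hb, contMDiffAt_clm_of_apply fun f => ?_⟩
  have h := hμ (fun y => (trivializationAt F (VertAt hp) (b q₀)).symmL ℝ y f)
    (contMDiffAt_vert_symmL hp (b q₀) f)
  refine (contMDiffAt_totalSpace.1 h).2.congr_of_eventuallyEq ?_
  filter_upwards [ha.continuousAt.eventually_mem ((trivializationAt (ES [⋀^Fin k]→L[ℝ] ℝ)
      (FormAt ES k : S → Type _) (a q₀)).open_baseSet.mem_nhds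
        (FiberBundle.mem_baseSet_trivializationAt' (a q₀))),
    hb.continuousAt.eventually_mem ((trivializationAt F (VertAt hp) (b q₀)).open_baseSet.mem_nhds
        (FiberBundle.mem_baseSet_trivializationAt' (b q₀)))] with q h₁ h₂
  exact trivializationAt_momentum_apply hp (a q₀, b q₀) ⟨(a q, b q), μ q⟩ h₁ h₂ f

end Momentum

/-! ### Deformations of sections -/

section Deformation

open Diffeology

variable {ES EK HK EB HB S K B : Type*}
  [NormedAddCommGroup ES] [NormedSpace ℝ ES] [FiniteDimensional ℝ ES]
  [NormedAddCommGroup EK] [NormedSpace ℝ EK] [TopologicalSpace HK]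
  [NormedAddCommGroup EB] [NormedSpace ℝ EB] [TopologicalSpace HB]
  {IK : ModelWithCorners ℝ EK HK} {IB : ModelWithCorners ℝ EB HB}
  [TopologicalSpace S] [ChartedSpace ES S] [IsManifold 𝓘(ℝ, ES) ∞ S]
  [TopologicalSpace K] [ChartedSpace HK K] [IsManifold IK ∞ K]
  [TopologicalSpace B] [ChartedSpace HB B]
  {D : SectionData IK IB S K B}

theorem Sections.ext_apply {s s' : Sections 𝓘(ℝ, ES) D} (h : ∀ x, s x = s' x) : s = s' := by
  cases s; cases s'; congr 1; exact funext h

/-- A chart `Psi` of `K` near `k₀`, with inverse `Phi`, in which moving in the directions of the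
subspace `H` stays in the fibres of `D.proj` and in `D.carrier`, and in which `H` contains all the
directions tangent to these fibres. The bump function `f` cuts off such motions. -/
structure AdaptedChart (D : SectionData IK IB S K B) (k₀ : K) where
  Psi : K → EK
  Phi : EK → K
  H : Submodule ℝ EK
  f : K → ℝ
  N : Set K
  C : Set K
  O : Set EK
  ε : ℝ
  isOpen_N : IsOpen N
  isClosed_C : IsClosed C
  isOpen_O : IsOpen O
  C_subset : C ⊆ N
  contMDiff_f : ContMDiff IK 𝓘(ℝ, ℝ) ∞ f
  abs_f_le : ∀ k, |f k| ≤ 1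
  f_eq_zero : ∀ k, k ∉ C → f k = 0
  f_eq_one : ∀ᶠ k in 𝓝 k₀, f k = 1
  contMDiffOn_Psi : ContMDiffOn IK 𝓘(ℝ, EK) ∞ Psi N
  contMDiffOn_Phi : ContMDiffOn 𝓘(ℝ, EK) IK ∞ Phi O
  Psi_mem : ∀ k ∈ N, Psi k ∈ O
  left_inv : ∀ k ∈ N, Phi (Psi k) = k
  right_inv : ∀ z ∈ O, Psi (Phi z) = z
  ε_pos : 0 < ε
  add_mem : ∀ k ∈ C, ∀ h ∈ H, ‖h‖ < ε → Psi k + h ∈ O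
  proj_add : ∀ k ∈ N, ∀ h ∈ H, Psi k + h ∈ O → D.proj (Phi (Psi k + h)) = D.proj k
  carrier_add : ∀ k ∈ N, k ∈ D.carrier → ∀ h ∈ H, Psi k + h ∈ O → Phi (Psi k + h) ∈ D.carrier
  mfderiv_mem : ∀ k ∈ N, k ∈ D.carrier → ∀ w : TangentSpace IK k, mfderiv IK IB D.proj k w = 0 →
    w ∈ tangentSpaceOf IK D.carrier k → mfderiv IK 𝓘(ℝ, EK) Psi k w ∈ H

namespace AdaptedChart

variable {k₀ : K} (a : AdaptedChart D k₀)

theorem mem_N_of_f {k : K} (h : a.f k = 1) : k ∈ a.N := by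
  by_contra hk
  have := a.f_eq_zero k fun hC => hk (a.C_subset hC)
  rw [h] at this
  exact one_ne_zero this

theorem mdifferentiableAt_Psi {k : K} (hk : k ∈ a.N) : MDifferentiableAt IK 𝓘(ℝ, EK) a.Psi k :=
  (a.contMDiffOn_Psi.contMDiffAt (a.isOpen_N.mem_nhds hk)).mdifferentiableAt (by simp)

theorem mfderiv_Psi_injective {k : K} (hk : k ∈ a.N) :
    Injective (mfderiv IK 𝓘(ℝ, EK) a.Psi k) := by
  have h1 : MDifferentiableAt 𝓘(ℝ, EK) IK a.Phi (a.Psi k) :=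
    (a.contMDiffOn_Phi.contMDiffAt (a.isOpen_O.mem_nhds (a.Psi_mem k hk))).mdifferentiableAt
      (by simp)
  have h2 := mfderiv_comp k h1 (a.mdifferentiableAt_Psi hk)
  have h3 : a.Phi ∘ a.Psi =ᶠ[𝓝 k] id := by
    filter_upwards [a.isOpen_N.mem_nhds hk] with k' hk' using a.left_inv k' hk'
  rw [h3.mfderiv_eq, mfderiv_id] at h2
  intro v w h
  have h4 := congrArg (fun L => L v) h2
  have h5 := congrArg (fun L => L w) h2
  refine h4.trans (Eq.trans ?_ h5.symm)
  exact congrArg (mfderiv 𝓘(ℝ, EK) IK a.Phi (a.Psi k)) h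

open Classical in
/-- The motion in the direction of the field `h`, cut off by the bump function and with parameter
`r` replaced by the bounded function `δ sin (r / δ)`, which has derivative `1` at `0`. -/
def push (h : S → EK) (δ : ℝ) (q : ℝ × S × K) : K :=
  if q.2.2 ∈ a.N then a.Phi (a.Psi q.2.2 + (a.f q.2.2 * (δ * Real.sin (q.1 / δ))) • h q.2.1)
  else q.2.2

variable {h : S → EK} {δ : ℝ}

/-- Since `|δ sin (t / δ)| ≤ δ`, the pushed point stays in the chart domain for all times. -/
theorem push_mem (hH : ∀ x, h x ∈ a.H) (hδ : 0 < δ) (hh : ∀ x, δ * ‖h x‖ < a.ε)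
    {q : ℝ × S × K} (hq : q.2.2 ∈ a.N) :
    a.Psi q.2.2 + (a.f q.2.2 * (δ * Real.sin (q.1 / δ))) • h q.2.1 ∈ a.O := by
  by_cases hC : q.2.2 ∈ a.C
  · refine a.add_mem _ hC _ (a.H.smul_mem _ (hH _)) ?_
    rw [norm_smul, Real.norm_eq_abs, abs_mul, abs_mul, abs_of_pos hδ]
    refine lt_of_le_of_lt ?_ (hh q.2.1)
    refine mul_le_mul_of_nonneg_right ?_ (norm_nonneg _)
    calc |a.f q.2.2| * (δ * |Real.sin (q.1 / δ)|) ≤ 1 * (δ * 1) := by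
          gcongr
          · exact a.abs_f_le _
          · exact Real.abs_sin_le_one _
      _ = δ := by ring
  · rw [a.f_eq_zero _ hC, zero_mul, zero_smul, add_zero]
    exact a.Psi_mem _ hq

theorem push_of_mem {q : ℝ × S × K} (hq : q.2.2 ∈ a.N) : a.push h δ q =
    a.Phi (a.Psi q.2.2 + (a.f q.2.2 * (δ * Real.sin (q.1 / δ))) • h q.2.1) := if_pos hq

theorem push_of_notMem {q : ℝ × S × K} (hq : q.2.2 ∉ a.C) : a.push h δ q = q.2.2 := by
  by_cases hN : q.2.2 ∈ a.N
  · rw [a.push_of_mem hN, a.f_eq_zero _ hq, zero_mul, zero_smul, add_zero, a.left_inv _ hN]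
  · exact if_neg hN

theorem push_zero (x : S) (k : K) : a.push h δ (0, x, k) = k := by
  by_cases hN : k ∈ a.N
  · rw [a.push_of_mem hN]
    simp [a.left_inv k hN]
  · exact if_neg hN

theorem contMDiff_push (hs : ContMDiff 𝓘(ℝ, ES) 𝓘(ℝ, EK) ∞ h) (hH : ∀ x, h x ∈ a.H) (hδ : 0 < δ)
    (hh : ∀ x, δ * ‖h x‖ < a.ε) :
    ContMDiff (𝓘(ℝ, ℝ).prod (𝓘(ℝ, ES).prod IK)) IK ∞ (a.push h δ) := by
  intro q
  have h22 : ContMDiff (𝓘(ℝ, ℝ).prod (𝓘(ℝ, ES).prod IK)) IK ∞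
      (fun q : ℝ × S × K => q.2.2) := contMDiff_snd.comp contMDiff_snd
  by_cases hq : q.2.2 ∈ a.C
  · have hN := a.C_subset hq
    have h1 : ContMDiffAt (𝓘(ℝ, ℝ).prod (𝓘(ℝ, ES).prod IK)) 𝓘(ℝ, EK) ∞
        (fun q : ℝ × S × K => a.Psi q.2.2) q :=
      (a.contMDiffOn_Psi.contMDiffAt (a.isOpen_N.mem_nhds hN)).comp q h22.contMDiffAt
    have h2 : ContMDiffAt (𝓘(ℝ, ℝ).prod (𝓘(ℝ, ES).prod IK)) 𝓘(ℝ, ℝ) ∞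
        (fun q : ℝ × S × K => a.f q.2.2) q := (a.contMDiff_f.comp h22).contMDiffAt
    have h3 : ContMDiffAt (𝓘(ℝ, ℝ).prod (𝓘(ℝ, ES).prod IK)) 𝓘(ℝ, ℝ) ∞
        (fun q : ℝ × S × K => δ * Real.sin (q.1 / δ)) q := by
      have h0 : ContDiff ℝ ∞ (fun r : ℝ => δ * Real.sin (r / δ)) := by fun_prop
      exact (h0.contMDiff.comp contMDiff_fst).contMDiffAt
    have h4 : ContMDiffAt (𝓘(ℝ, ℝ).prod (𝓘(ℝ, ES).prod IK)) 𝓘(ℝ, EK) ∞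
        (fun q : ℝ × S × K => h q.2.1) q :=
      (hs.comp (contMDiff_fst.comp contMDiff_snd)).contMDiffAt
    have h5 := (a.contMDiffOn_Phi.contMDiffAt (a.isOpen_O.mem_nhds
      (a.push_mem hH hδ hh hN))).comp q (h1.add ((h2.mul h3).smul h4))
    refine h5.congr_of_eventuallyEq ?_
    filter_upwards [h22.continuous.continuousAt.eventually_mem (a.isOpen_N.mem_nhds hN)]
      with q' hq' using a.push_of_mem hq'
  · refine h22.contMDiffAt.congr_of_eventuallyEq ?_
    filter_upwards [h22.continuous.continuousAt.eventually_mem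
      (a.isClosed_C.isOpen_compl.mem_nhds hq)] with q' hq' using a.push_of_notMem hq'

theorem proj_push (hH : ∀ x, h x ∈ a.H) (hδ : 0 < δ) (hh : ∀ x, δ * ‖h x‖ < a.ε)
    (q : ℝ × S × K) : D.proj (a.push h δ q) = D.proj q.2.2 := by
  by_cases hN : q.2.2 ∈ a.N
  · rw [a.push_of_mem hN]
    exact a.proj_add _ hN _ (a.H.smul_mem _ (hH _)) (a.push_mem hH hδ hh hN)
  · exact congrArg D.proj (if_neg hN)

theorem push_mem_carrier (hH : ∀ x, h x ∈ a.H) (hδ : 0 < δ) (hh : ∀ x, δ * ‖h x‖ < a.ε)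
    (q : ℝ × S × K) (hq : q.2.2 ∈ D.carrier) : a.push h δ q ∈ D.carrier := by
  by_cases hN : q.2.2 ∈ a.N
  · rw [a.push_of_mem hN]
    exact a.carrier_add _ hN hq _ (a.H.smul_mem _ (hH _)) (a.push_mem hH hδ hh hN)
  · rw [show a.push h δ q = q.2.2 from if_neg hN]
    exact hq

theorem mfderiv_push (hs : ContMDiff 𝓘(ℝ, ES) 𝓘(ℝ, EK) ∞ h) (hH : ∀ x, h x ∈ a.H) (hδ : 0 < δ)
    (hh : ∀ x, δ * ‖h x‖ < a.ε) (x : S) {k : K} (hk : k ∈ a.N) :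
    mfderiv IK 𝓘(ℝ, EK) a.Psi k (mfderiv 𝓘(ℝ, ℝ) IK (fun r : ℝ => a.push h δ (r, x, k)) 0 (1 : ℝ) :
      EK) =
      a.f k • h x := by
  have h0 : ContMDiff 𝓘(ℝ, ℝ) IK ∞ (fun r : ℝ => a.push h δ (r, x, k)) :=
    (a.contMDiff_push hs hH hδ hh).comp (contMDiff_id.prodMk contMDiff_const)
  have h1 := mfderiv_comp (0 : ℝ) (g := a.Psi) (I' := IK) (f := fun r : ℝ => a.push h δ (r, x, k))
    (by rw [a.push_zero]; exact a.mdifferentiableAt_Psi hk)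
    (h0.mdifferentiableAt (by simp))
  have h2 : a.Psi ∘ (fun r : ℝ => a.push h δ (r, x, k)) =
      fun r : ℝ => a.Psi k + (a.f k * (δ * Real.sin (r / δ))) • h x := by
    funext r
    change a.Psi (a.push h δ (r, x, k)) = _
    rw [a.push_of_mem (q := (r, x, k)) hk]
    exact a.right_inv _ (a.push_mem hH hδ hh (q := (r, x, k)) hk)
  have h3 : HasDerivAt (fun r : ℝ => a.Psi k + (a.f k * (δ * Real.sin (r / δ))) • h x)
      (a.f k • h x) 0 := by
    have h4 : HasDerivAt (fun r : ℝ => a.f k * (δ * Real.sin (r / δ))) (a.f k) 0 := by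
      have h5 := (((hasDerivAt_id (0 : ℝ)).div_const δ).sin.const_mul δ).const_mul (a.f k)
      refine h5.congr_deriv ?_
      have h6 : Real.cos (id (0 : ℝ) / δ) = 1 := by simp
      rw [h6]
      field_simp
    exact (h4.smul_const (h x)).const_add _
  rw [h2, mfderiv_eq_fderiv] at h1
  have h6 := congrArg (fun L => L (1 : ℝ)) h1
  rw [show a.push h δ (0, x, k) = k from a.push_zero x k] at h6
  refine Eq.trans h6.symm ?_
  exact (congrArg (fun L => L (1 : ℝ)) h3.hasFDerivAt.fderiv).trans (one_smul ℝ _)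

end AdaptedChart

theorem mfderiv_comp_curve {G : ℝ × K → K} {c : ℝ → K} (hG : ContMDiff (𝓘(ℝ, ℝ).prod IK) IK ∞ G)
    (hc : ContMDiff 𝓘(ℝ, ℝ) IK ∞ c) :
    (mfderiv 𝓘(ℝ, ℝ) IK (fun r => G (r, c r)) 0 (1 : ℝ) : EK) =
      (mfderiv 𝓘(ℝ, ℝ) IK (fun r => G (r, c 0)) 0 (1 : ℝ) : EK) +
        mfderiv IK IK (fun k => G (0, k)) (c 0) (mfderiv 𝓘(ℝ, ℝ) IK c 0 (1 : ℝ)) := by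
  have h1 := mfderiv_comp (I' := 𝓘(ℝ, ℝ).prod IK) (0 : ℝ) (g := G) (f := fun r : ℝ => (r, c r))
    (hG.mdifferentiableAt (by simp))
    ((contMDiff_id.prodMk hc).mdifferentiableAt (n := ∞) (by simp))
  have h2 := mfderiv_prodMk (I := 𝓘(ℝ, ℝ)) (I' := 𝓘(ℝ, ℝ)) (I'' := IK) (x := (0 : ℝ))
    (f := fun r : ℝ => r) (g := c) mdifferentiableAt_id (hc.mdifferentiableAt (by simp))
  have h3 := congrArg (fun L => L (1 : ℝ)) h1
  refine h3.trans ?_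
  change mfderiv (𝓘(ℝ, ℝ).prod IK) IK G (0, c 0)
    (mfderiv 𝓘(ℝ, ℝ) (𝓘(ℝ, ℝ).prod IK) (fun r => (r, c r)) 0 (1 : ℝ)) = _
  rw [h2, mfderiv_prod_eq_add_apply (hG.mdifferentiableAt (by simp))]
  congr 2
  rw [show mfderiv 𝓘(ℝ, ℝ) 𝓘(ℝ, ℝ) (fun r : ℝ => r) 0 = ContinuousLinearMap.id ℝ ℝ from mfderiv_id]
  rfl

/-- A smooth family `A (r, x, ·)` of transformations of `K`, starting with the identity, which
preserves the fibres of `D.proj` and `D.carrier`, and moves `s` with initial velocity `V`. -/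
structure IsDeformation (s : Sections 𝓘(ℝ, ES) D) (V : ∀ x, TangentSpace IK (s x))
    (A : ℝ × S × K → K) : Prop where
  contMDiff : ContMDiff (𝓘(ℝ, ℝ).prod (𝓘(ℝ, ES).prod IK)) IK ∞ A
  zero : ∀ x k, A (0, x, k) = k
  proj : ∀ q, D.proj (A q) = D.proj q.2.2
  mem_carrier : ∀ q : ℝ × S × K, q.2.2 ∈ D.carrier → A q ∈ D.carrier
  mfderiv : ∀ x, (mfderiv 𝓘(ℝ, ℝ) IK (fun r : ℝ => A (r, x, s x)) 0 (1 : ℝ) : EK) = V x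

namespace IsDeformation

variable {s : Sections 𝓘(ℝ, ES) D} {V W : ∀ x, TangentSpace IK (s x)} {A A' : ℝ × S × K → K}

theorem id_zero (s : Sections 𝓘(ℝ, ES) D) : IsDeformation s 0 (fun q => q.2.2) where
  contMDiff := contMDiff_snd.comp contMDiff_snd
  zero _ _ := rfl
  proj _ := rfl
  mem_carrier _ h := h
  mfderiv x := by
    rw [mfderiv_const]
    rfl

/-- The velocity of a composite of two deformations of the same section is the sum of the
velocities, as both fix the section at time zero. -/
theorem comp (hA : IsDeformation s V A) (hA' : IsDeformation s W A') :
    IsDeformation s (V + W) (fun q => A (q.1, q.2.1, A' q)) where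
  contMDiff := hA.contMDiff.comp
    (contMDiff_fst.prodMk ((contMDiff_fst.comp contMDiff_snd).prodMk hA'.contMDiff))
  zero x k := by rw [hA'.zero, hA.zero]
  proj q := by rw [hA.proj, hA'.proj]
  mem_carrier q hq := hA.mem_carrier _ (hA'.mem_carrier q hq)
  mfderiv x := by
    let G : ℝ × K → K := fun z => A (z.1, x, z.2)
    have hG : ContMDiff (𝓘(ℝ, ℝ).prod IK) IK ∞ G :=
      hA.contMDiff.comp (contMDiff_fst.prodMk (contMDiff_const.prodMk contMDiff_snd))
    have hc : ContMDiff 𝓘(ℝ, ℝ) IK ∞ (fun r : ℝ => A' (r, x, s x)) :=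
      hA'.contMDiff.comp (contMDiff_id.prodMk contMDiff_const)
    have hc0 : A' (0, x, s x) = s x := hA'.zero x (s x)
    have h := mfderiv_comp_curve hG hc
    have h1 : (fun k => G (0, k)) = id := funext fun k => hA.zero x k
    rw [h1, mfderiv_id] at h
    refine h.trans ?_
    rw [show A' (0, x, s x) = s x from hc0]
    exact congrArg₂ (fun v w : EK => v + w) (hA.mfderiv x) (hA'.mfderiv x)

theorem finset_sum {ι : Type*} (t : Finset ι) {V : ι → ∀ x, TangentSpace IK (s x)}
    (h : ∀ i, ∃ A, IsDeformation s (V i) A) : ∃ A, IsDeformation s (∑ i ∈ t, V i) A := by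
  classical
  induction t using Finset.induction_on with
  | empty => exact ⟨_, by simpa using id_zero s⟩
  | insert i t hi ih =>
    obtain ⟨A, hA⟩ := h i
    obtain ⟨A', hA'⟩ := ih
    rw [Finset.sum_insert hi]
    exact ⟨_, hA.comp hA'⟩

end IsDeformation

/-- A field along a section supported where the bump function of an adapted chart is one, with
smooth coordinate expression, is the velocity of a push. -/
theorem AdaptedChart.exists_isDeformation [CompactSpace S] {k₀ : K} (a : AdaptedChart D k₀)
    {s : Sections 𝓘(ℝ, ES) D} {V : ∀ x, TangentSpace IK (s x)} {h : S → EK}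
    (hs : ContMDiff 𝓘(ℝ, ES) 𝓘(ℝ, EK) ∞ h) (hH : ∀ x, h x ∈ a.H)
    (hV : ∀ x, a.f (s x) = 1 ∧ mfderiv IK 𝓘(ℝ, EK) a.Psi (s x) (V x) = h x ∨ V x = 0 ∧ h x = 0) :
    ∃ A, IsDeformation s V A := by
  obtain ⟨M, hM⟩ := isCompact_univ.exists_bound_of_continuousOn hs.continuous.continuousOn
  have hM' : ∀ x, ‖h x‖ ≤ |M| := fun x => (hM x (mem_univ x)).trans (le_abs_self M)
  have hM1 : 0 < |M| + 1 := by positivity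
  have hδ : 0 < a.ε / (|M| + 1) := div_pos a.ε_pos hM1
  have hh : ∀ x, a.ε / (|M| + 1) * ‖h x‖ < a.ε := by
    intro x
    rw [div_mul_eq_mul_div, div_lt_iff₀ hM1]
    exact mul_lt_mul_of_pos_left ((hM' x).trans_lt (lt_add_one _)) a.ε_pos
  refine ⟨a.push h (a.ε / (|M| + 1)), a.contMDiff_push hs hH hδ hh, a.push_zero,
    a.proj_push hH hδ hh, fun q hq => a.push_mem_carrier hH hδ hh q hq, fun x => ?_⟩
  rcases hV x with ⟨h1, h2⟩ | ⟨h1, h2⟩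
  · have hN := a.mem_N_of_f h1
    apply a.mfderiv_Psi_injective hN
    refine (a.mfderiv_push hs hH hδ hh x hN).trans ?_
    rw [h1, one_smul]
    exact h2.symm
  · have h3 : (fun r : ℝ => a.push h (a.ε / (|M| + 1)) (r, x, s x)) = fun _ => s x := by
      funext r
      by_cases hN : s x ∈ a.N
      · rw [a.push_of_mem (q := (r, x, s x)) hN, h2, smul_zero, add_zero, a.left_inv _ hN]
      · exact if_neg hN
    rw [h3, mfderiv_const, h1]
    rfl

/-- Every tangent vector to the space of sections is the initial velocity of a deformation: it is a
sum of tangent vectors supported in the domains of adapted charts. -/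
theorem exists_isDeformation [CompactSpace S] [T2Space S]
    (hD : ∀ k ∈ D.carrier, Nonempty (AdaptedChart D k)) {s : Sections 𝓘(ℝ, ES) D}
    (V : SectionTangent s) : ∃ A, IsDeformation s V.1 A := by
  let a : ∀ x, AdaptedChart D (s x) := fun x => (hD (s x) (s.mem_carrier x)).some
  have hU : ∀ x, ∃ U : Set S, IsOpen U ∧ x ∈ U ∧ ∀ x' ∈ U, (a x).f (s x') = 1 := by
    intro x
    obtain ⟨U, hU, hUo, hxU⟩ := eventually_nhds_iff.1
      (s.contMDiff.continuous.continuousAt.eventually (a x).f_eq_one)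
    exact ⟨U, hUo, hxU, hU⟩
  choose U hUo hxU hU using hU
  obtain ⟨t, ht⟩ := isCompact_univ.elim_finite_subcover U hUo
    (fun x _ => mem_iUnion.2 ⟨x, hxU x⟩)
  obtain ⟨χ, hχ⟩ := SmoothPartitionOfUnity.exists_isSubordinate 𝓘(ℝ, ES) isClosed_univ
    (fun i : t => U i) (fun i => hUo i) (by rwa [iUnion_subtype])
  have hsum : V.1 = ∑ i : t, fun x => χ i x • V.1 x := by
    funext x
    rw [Finset.sum_apply, ← Finset.sum_smul]
    have := χ.sum_eq_one (mem_univ x)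
    rw [finsum_eq_sum_of_fintype] at this
    rw [this, one_smul]
  rw [hsum]
  refine IsDeformation.finset_sum Finset.univ fun i => ?_
  have hmem : ∀ x ∈ tsupport (χ i), (a i).f (s x) = 1 := fun x hx => hU i x (hχ i hx)
  refine (a i).exists_isDeformation
    (h := fun x => χ i x • (mfderiv IK 𝓘(ℝ, EK) (a i).Psi (s x) (V.1 x) : EK)) ?_ ?_ ?_
  · refine χ.contMDiff_smul fun x hx => ?_
    exact (contMDiffAt_tangent_vectorSpace.1 ((a i).contMDiffOn_Psi.mfderiv_along (a i).isOpen_N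
      ((a i).mem_N_of_f (hmem x hx)) (V.2.1 x))).2
  · intro x
    by_cases hx : x ∈ tsupport (χ i)
    · exact (a i).H.smul_mem _ ((a i).mfderiv_mem _ ((a i).mem_N_of_f (hmem x hx))
        (s.mem_carrier x) _ (V.2.2 x).1 (V.2.2 x).2)
    · rw [image_eq_zero_of_notMem_tsupport hx, zero_smul]
      exact zero_mem _
  · intro x
    by_cases hx : x ∈ tsupport (χ i)
    · exact Or.inl ⟨hmem x hx, map_smul _ _ _⟩
    · refine Or.inr ⟨?_, ?_⟩
      · rw [image_eq_zero_of_notMem_tsupport hx, zero_smul]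
      · exact (congrArg (fun r : ℝ => r • (mfderiv IK 𝓘(ℝ, EK) (a i).Psi (s x) (V.1 x) : EK))
          (image_eq_zero_of_notMem_tsupport hx)).trans (zero_smul ℝ _)

/-- Velocities of a family are those of its restrictions to lines in the parameter space. -/
theorem velocityFun_eq_curve {k : ℕ} {c : EuclideanSpace ℝ (Fin k) → Sections 𝓘(ℝ, ES) D}
    (hc : IsPlot c) (t v : EuclideanSpace ℝ (Fin k)) (x : S) :
    (velocityFun c t v x : EK) =
      mfderiv 𝓘(ℝ, ℝ) IK (fun r : ℝ => (c (t + r • v)).toFun x) 0 (1 : ℝ) := by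
  have h0 : ContMDiff 𝓘(ℝ, ℝ) 𝓘(ℝ, EuclideanSpace ℝ (Fin k)) ∞ (fun r : ℝ => t + r • v) := by
    rw [contMDiff_iff_contDiff]; fun_prop
  have h1 := mfderiv_comp (0 : ℝ)
    ((velocityFun_contMDiff_left hc x).mdifferentiableAt (x := t + (0 : ℝ) • v) (by simp))
    (h0.mdifferentiableAt (x := (0 : ℝ)) (by simp))
  have h2 : mfderiv 𝓘(ℝ, ℝ) 𝓘(ℝ, EuclideanSpace ℝ (Fin k)) (fun r : ℝ => t + r • v) 0 (1 : ℝ)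
      = v := by
    rw [mfderiv_eq_fderiv]
    have h3 : HasDerivAt (fun r : ℝ => t + r • v) v 0 := by
      simpa using ((hasDerivAt_id (0 : ℝ)).smul_const v).const_add t
    exact (congrArg (fun L => L (1 : ℝ)) h3.hasFDerivAt.fderiv).trans (one_smul ℝ v)
  have h3 := congrArg (fun L => L (1 : ℝ)) h1
  refine Eq.trans ?_ h3.symm
  change _ = mfderiv 𝓘(ℝ, EuclideanSpace ℝ (Fin k)) IK
      (fun t' => (c t').toFun x) (t + (0 : ℝ) • v)
        (mfderiv 𝓘(ℝ, ℝ) 𝓘(ℝ, EuclideanSpace ℝ (Fin k)) (fun r : ℝ => t + r • v) 0 (1 : ℝ))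
  rw [h2, zero_smul, add_zero]
  rfl

/-- Every pair of tangent vectors at a section is the pair of partial velocities of a smooth family
with two parameters. -/
theorem exists_plot_velocity_eq [CompactSpace S] [T2Space S]
    (hD : ∀ k ∈ D.carrier, Nonempty (AdaptedChart D k)) {s : Sections 𝓘(ℝ, ES) D}
    (V W : SectionTangent s) :
    ∃ (c : EuclideanSpace ℝ (Fin 2) → Sections 𝓘(ℝ, ES) D) (_ : IsPlot c), c 0 = s ∧
      (∀ x, (velocityFun c 0 (EuclideanSpace.single 0 1) x : EK) = V.1 x) ∧
      (∀ x, (velocityFun c 0 (EuclideanSpace.single 1 1) x : EK) = W.1 x) := by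
  obtain ⟨A, hA⟩ := exists_isDeformation hD V
  obtain ⟨A', hA'⟩ := exists_isDeformation hD W
  let F : EuclideanSpace ℝ (Fin 2) × S → K := fun q => A (q.1 0, q.2, A' (q.1 1, q.2, s q.2))
  have hcoord : ∀ i : Fin 2, ContMDiff (𝓘(ℝ, EuclideanSpace ℝ (Fin 2)).prod 𝓘(ℝ, ES)) 𝓘(ℝ, ℝ) ∞
      (fun q : EuclideanSpace ℝ (Fin 2) × S => q.1 i) := fun i =>
    (EuclideanSpace.proj i : EuclideanSpace ℝ (Fin 2) →L[ℝ] ℝ).contMDiff.comp contMDiff_fst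
  have hF : ContMDiff (𝓘(ℝ, EuclideanSpace ℝ (Fin 2)).prod 𝓘(ℝ, ES)) IK ∞ F :=
    hA.contMDiff.comp ((hcoord 0).prodMk (contMDiff_snd.prodMk (hA'.contMDiff.comp
      ((hcoord 1).prodMk (contMDiff_snd.prodMk (s.contMDiff.comp contMDiff_snd))))))
  let c : EuclideanSpace ℝ (Fin 2) → Sections 𝓘(ℝ, ES) D := fun t =>
    { toFun := fun x => F (t, x)
      contMDiff := hF.comp (contMDiff_const.prodMk contMDiff_id)
      proj_eq := fun x => by
        rw [hA.proj, hA'.proj]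
        exact s.proj_eq x
      mem_carrier := fun x => hA.mem_carrier _ (hA'.mem_carrier _ (s.mem_carrier x)) }
  have hc : IsPlot c := hF
  refine ⟨c, hc, Sections.ext_apply fun x => ?_, fun x => ?_, fun x => ?_⟩
  · change A (0, x, A' (0, x, s x)) = s x
    rw [hA'.zero, hA.zero]
  · rw [velocityFun_eq_curve hc]
    rw [← hA.mfderiv x]
    have : (fun r : ℝ => (c (0 + r • EuclideanSpace.single 0 1)).toFun x) =
        fun r : ℝ => A (r, x, s x) := by
      funext r
      change A ((0 + r • EuclideanSpace.single (0 : Fin 2) (1 : ℝ)) 0, x,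
        A' ((0 + r • EuclideanSpace.single (0 : Fin 2) (1 : ℝ)) 1, x, s x)) = _
      simp [hA'.zero]
    rw [this]
    rfl
  · rw [velocityFun_eq_curve hc]
    rw [← hA'.mfderiv x]
    have : (fun r : ℝ => (c (0 + r • EuclideanSpace.single 1 1)).toFun x) =
        fun r : ℝ => A' (r, x, s x) := by
      funext r
      change A ((0 + r • EuclideanSpace.single (1 : Fin 2) (1 : ℝ)) 0, x,
        A' ((0 + r • EuclideanSpace.single (1 : Fin 2) (1 : ℝ)) 1, x, s x)) = _
      simp [hA.zero]
    rw [this]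
    rfl

/-- To prove a property of two tangent vectors at a section, one may assume that they are
velocities of a smooth family. -/
theorem SectionTangent.induction₂ [CompactSpace S] [T2Space S]
    (hD : ∀ k ∈ D.carrier, Nonempty (AdaptedChart D k))
    {P : ∀ s : Sections 𝓘(ℝ, ES) D, SectionTangent s → SectionTangent s → Prop}
    (h : ∀ (c : EuclideanSpace ℝ (Fin 2) → Sections 𝓘(ℝ, ES) D) (hc : IsPlot c)
      (t v w : EuclideanSpace ℝ (Fin 2)), P (c t) (velocity c hc t v) (velocity c hc t w))
    {s : Sections 𝓘(ℝ, ES) D} (V W : SectionTangent s) : P s V W := by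
  obtain ⟨c, hc, rfl, hV, hW⟩ := exists_plot_velocity_eq hD V W
  rw [show V = velocity c hc 0 (EuclideanSpace.single 0 1) from
    Subtype.ext (funext fun x => (hV x).symm),
    show W = velocity c hc 0 (EuclideanSpace.single 1 1) from
    Subtype.ext (funext fun x => (hW x).symm)]
  exact h c hc _ _ _

end Deformation

/-! ### Adapted charts of the bundles of multimomenta and of momenta -/

section Bump

theorem exists_bump_tsupport_subset {E M : Type*} [NormedAddCommGroup E] [NormedSpace ℝ E]
    [FiniteDimensional ℝ E] [TopologicalSpace M] [ChartedSpace E M] [IsManifold 𝓘(ℝ, E) ∞ M]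
    [T2Space M] {x : M} {U : Set M} (hU : U ∈ 𝓝 x) :
    ∃ f : M → ℝ, ContMDiff 𝓘(ℝ, E) 𝓘(ℝ, ℝ) ∞ f ∧ (∀ y, |f y| ≤ 1) ∧ tsupport f ⊆ U ∧
      ∀ᶠ y in 𝓝 x, f y = 1 := by
  obtain ⟨f, -, hf⟩ := (SmoothBumpFunction.nhds_basis_tsupport (I := 𝓘(ℝ, E)) x).mem_iff.1 hU
  refine ⟨f, f.contMDiff, fun y => ?_, hf, f.eventuallyEq_one⟩
  rw [abs_of_nonneg f.nonneg]
  exact f.le_one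

/-- Tangent vectors of a subset annihilate the differential of a function vanishing on it. -/
theorem mfderiv_eq_zero_of_mem_tangentSpaceOf {EK HK K : Type*}
    [NormedAddCommGroup EK] [NormedSpace ℝ EK] [TopologicalSpace HK]
    {IK : ModelWithCorners ℝ EK HK} [TopologicalSpace K] [ChartedSpace HK K] [IsManifold IK ∞ K]
    {C : Set K} {k : K} {g : K → ℝ} (hg : MDifferentiableAt IK 𝓘(ℝ, ℝ) g k)
    (h0 : ∀ᶠ k' in 𝓝 k, k' ∈ C → g k' = 0) {w : TangentSpace IK k}
    (hw : w ∈ tangentSpaceOf IK C k) : (mfderiv IK 𝓘(ℝ, ℝ) g k w : ℝ) = 0 := by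
  have : tangentSpaceOf IK C k ≤ (mfderiv IK 𝓘(ℝ, ℝ) g k).ker := by
    refine Submodule.span_le.2 ?_
    rintro w ⟨c, hc, hcC, h⟩
    obtain rfl : c 0 = k := congrArg TotalSpace.proj h
    obtain rfl : (mfderiv 𝓘(ℝ, ℝ) IK c 0 (1 : ℝ)) = w := eq_of_heq (TotalSpace.mk.inj h).2
    have h1 := mfderiv_comp (0 : ℝ) hg (hc.mdifferentiableAt (by simp))
    have h2 : g ∘ c =ᶠ[𝓝 0] fun _ => 0 := by
      filter_upwards [hc.continuous.continuousAt.eventually h0] with t ht using ht (hcC t)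
    rw [h2.mfderiv_eq, mfderiv_const] at h1
    exact (congrArg (fun L => L (1 : ℝ)) h1).symm
  exact this hw

variable {EM HM M A B : Type*} [NormedAddCommGroup EM] [NormedSpace ℝ EM] [TopologicalSpace HM]
  {IM : ModelWithCorners ℝ EM HM} [TopologicalSpace M] [ChartedSpace HM M]
  [NormedAddCommGroup A] [NormedSpace ℝ A] [NormedAddCommGroup B] [NormedSpace ℝ B]
  {f : M → A × B} {m : M}

theorem mdifferentiableAt_fst_space (hf : MDifferentiableAt IM 𝓘(ℝ, A × B) f m) :
    MDifferentiableAt IM 𝓘(ℝ, A) (fun m => (f m).1) m :=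
  ((ContinuousLinearMap.fst ℝ A B).contMDiff.mdifferentiableAt (n := ∞) (by simp)).comp m hf

theorem mfderiv_fst_apply (hf : MDifferentiableAt IM 𝓘(ℝ, A × B) f m) (w : TangentSpace IM m) :
    (mfderiv IM 𝓘(ℝ, A × B) f m w : A × B).1 =
      (mfderiv IM 𝓘(ℝ, A) (fun m => (f m).1) m w : A) := by
  have h1 := mfderiv_comp m (g := ContinuousLinearMap.fst ℝ A B) (I'' := 𝓘(ℝ, A)) (f := f)
    ((ContinuousLinearMap.contMDiff _).mdifferentiableAt (n := ∞) (by simp)) hf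
  rw [mfderiv_eq_fderiv, ContinuousLinearMap.fderiv] at h1
  exact (congrArg (fun L => L w) h1).symm

theorem mfderiv_snd_apply (hf : MDifferentiableAt IM 𝓘(ℝ, A × B) f m) (w : TangentSpace IM m) :
    (mfderiv IM 𝓘(ℝ, A × B) f m w : A × B).2 =
      (mfderiv IM 𝓘(ℝ, B) (fun m => (f m).2) m w : B) := by
  have h1 := mfderiv_comp m (g := ContinuousLinearMap.snd ℝ A B) (I'' := 𝓘(ℝ, B)) (f := f)
    ((ContinuousLinearMap.contMDiff _).mdifferentiableAt (n := ∞) (by simp)) hf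
  rw [mfderiv_eq_fderiv, ContinuousLinearMap.fderiv] at h1
  exact (congrArg (fun L => L w) h1).symm

end Bump

section AdaptedChart

variable {EX EY F X Y : Type*}
  [NormedAddCommGroup EX] [NormedSpace ℝ EX]
  [NormedAddCommGroup EY] [NormedSpace ℝ EY]
  [NormedAddCommGroup F] [NormedSpace ℝ F]
  [TopologicalSpace X] [ChartedSpace EX X] [IsManifold 𝓘(ℝ, EX) ∞ X]
  [TopologicalSpace Y] [ChartedSpace EY Y] [IsManifold 𝓘(ℝ, EY) ∞ Y]
  {p : Y → X} (hp : Manifold.IsSubmersionOfComplement F 𝓘(ℝ, EY) 𝓘(ℝ, EX) ∞ p)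

/-- In adapted charts the submersion is the projection to the first factor. -/
theorem codChart_proj (y₀ y : Y) (hy : y ∈ (adChart hp y₀).source) :
    (hp y₀).codChart (p y) = (adEquiv hp y₀ (adChart hp y₀ y)).1 := by
  have hz' : adChart hp y₀ y ∈ ((hp y₀).domChart.extend 𝓘(ℝ, EY)).target := by
    have h0 : adChart hp y₀ y ∈ (hp y₀).domChart.target := (adChart hp y₀).map_source hy
    simpa [OpenPartialHomeomorph.extend_target] using h0
  have := (hp y₀).writtenInCharts hz'
  simp only [OpenPartialHomeomorph.extend, modelWithCornersSelf_partialEquiv,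
    PartialEquiv.trans_refl, comp_apply, OpenPartialHomeomorph.toFun_eq_coe,
    OpenPartialHomeomorph.coe_toPartialEquiv_symm] at this
  rw [show (hp y₀).domChart.symm (adChart hp y₀ y) = y from (adChart hp y₀).left_inv hy] at this
  exact this

/-- In an adapted chart, the points which differ by a vertical vector are in the same fibre. -/
theorem proj_adChart_symm_add (y₀ y : Y) (hy : y ∈ (adChart hp y₀).source) {e : EY}
    (he : (adEquiv hp y₀ e).1 = 0) (hm : adChart hp y₀ y + e ∈ (adChart hp y₀).target) :
    p ((adChart hp y₀).symm (adChart hp y₀ y + e)) = p y := by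
  have hs := (adChart hp y₀).map_target hm
  refine (hp y₀).codChart.injOn ((hp y₀).mapsto_domChart_source_codChart_source hs)
    ((hp y₀).mapsto_domChart_source_codChart_source hy) ?_
  rw [codChart_proj hp y₀ _ hs, codChart_proj hp y₀ _ hy, (adChart hp y₀).right_inv hm, map_add,
    Prod.fst_add, he, add_zero]

theorem chartD_fst_eq_zero_iff (y₀ y : Y) (hy : y ∈ (adChart hp y₀).source)
    (v : TangentSpace 𝓘(ℝ, EY) y) :
    (adEquiv hp y₀ (chartD hp y₀ y v)).1 = 0 ↔ mfderiv 𝓘(ℝ, EY) 𝓘(ℝ, EX) p y v = 0 := by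
  have hcy : p y ∈ (hp y₀).codChart.source := (hp y₀).mapsto_domChart_source_codChart_source hy
  rw [chartD_fst hp y₀ y hy]
  exact map_eq_zero_iff _ ((codChart_mdifferentiable hp y₀).mfderiv hcy).injective

theorem exists_bump_adChart [FiniteDimensional ℝ EY] [T2Space Y] (y₀ : Y) :
    ∃ (f : Y → ℝ) (ε : ℝ), ContMDiff 𝓘(ℝ, EY) 𝓘(ℝ, ℝ) ∞ f ∧ (∀ y, |f y| ≤ 1) ∧
      tsupport f ⊆ (adChart hp y₀).source ∧ (∀ᶠ y in 𝓝 y₀, f y = 1) ∧ 0 < ε ∧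
      ∀ y ∈ tsupport f, ∀ e : EY, ‖e‖ < ε → adChart hp y₀ y + e ∈ (adChart hp y₀).target := by
  have h0 := mem_adChart_source hp y₀
  obtain ⟨R, hR, hRt⟩ := Metric.isOpen_iff.1 (adChart hp y₀).open_target _
    ((adChart hp y₀).map_source h0)
  have hU : (adChart hp y₀).source ∩ adChart hp y₀ ⁻¹' Metric.ball (adChart hp y₀ y₀) (R / 2) ∈
      𝓝 y₀ := Filter.inter_mem ((adChart hp y₀).open_source.mem_nhds h0)
    (((adChart hp y₀).continuousAt h0).preimage_mem_nhds (Metric.ball_mem_nhds _ (half_pos hR)))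
  obtain ⟨f, hf1, hf2, hf3, hf4⟩ := exists_bump_tsupport_subset (E := EY) hU
  refine ⟨f, R / 2, hf1, hf2, fun y hy => (hf3 hy).1, hf4, half_pos hR, fun y hy e he => hRt ?_⟩
  have h1 : dist (adChart hp y₀ y) (adChart hp y₀ y₀) < R / 2 := (hf3 hy).2
  rw [Metric.mem_ball, dist_eq_norm] at *
  calc ‖adChart hp y₀ y + e - adChart hp y₀ y₀‖ = ‖(adChart hp y₀ y - adChart hp y₀ y₀) + e‖ := by
        congr 1; abel
    _ ≤ ‖adChart hp y₀ y - adChart hp y₀ y₀‖ + ‖e‖ := norm_add_le _ _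
    _ < R := by linarith

/-! #### Multimomenta -/

section Multimomentum

variable {k : ℕ}

/-- The bundle chart of `Λᵏ T*Y` given by an adapted chart of `Y`. -/
def formPsi (y₀ : Y) (z : FormBundle EY Y k) : EY × (EY [⋀^Fin k]→L[ℝ] ℝ) :=
  (adChart hp y₀ z.1, ContinuousAlternatingMap.compContinuousLinearMap
    (M := EY) (M' := EY) (N := ℝ) z.2
    (mfderiv 𝓘(ℝ, EY) 𝓘(ℝ, EY) (adChart hp y₀).symm (adChart hp y₀ z.1)))

/-- The inverse of `formPsi`. -/
def formPhi (y₀ : Y) (q : EY × (EY [⋀^Fin k]→L[ℝ] ℝ)) : FormBundle EY Y k :=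
  ⟨(adChart hp y₀).symm q.1, ContinuousAlternatingMap.compContinuousLinearMap q.2
    (chartD hp y₀ ((adChart hp y₀).symm q.1))⟩

theorem formPsi_snd_apply (y₀ : Y) (z : FormBundle EY Y k) (hz : z.1 ∈ (adChart hp y₀).source)
    (u : Fin k → EY) : (formPsi hp y₀ z).2 u = z.2 fun i => chartDInv hp y₀ z.1 hz (u i) := rfl

theorem contMDiffOn_formPhi [FiniteDimensional ℝ EY] (y₀ : Y) :
    ContMDiffOn 𝓘(ℝ, EY × (EY [⋀^Fin k]→L[ℝ] ℝ)) (𝓘(ℝ, EY).prod 𝓘(ℝ, EY [⋀^Fin k]→L[ℝ] ℝ)) ∞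
      (formPhi (k := k) hp y₀) ((adChart hp y₀).target ×ˢ univ) := by
  rintro ⟨w, A⟩ ⟨hw, -⟩
  apply ContMDiffAt.contMDiffWithinAt
  have hb : ContMDiffAt 𝓘(ℝ, EY × (EY [⋀^Fin k]→L[ℝ] ℝ)) 𝓘(ℝ, EY) ∞
      (fun q : EY × (EY [⋀^Fin k]→L[ℝ] ℝ) => (adChart hp y₀).symm q.1) (w, A) :=
    ((contMDiffOn_adChart_symm hp y₀).contMDiffAt ((adChart hp y₀).open_target.mem_nhds hw)).comp
      (w, A) contDiff_fst.contMDiff.contMDiffAt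
  refine contMDiffAt_form_of_apply hb fun u hu => ?_
  refine ContMDiffAt.alternating_apply (f := fun q : EY × (EY [⋀^Fin k]→L[ℝ] ℝ) => q.2)
    (u := fun i q => chartD hp y₀ _ (u i ((adChart hp y₀).symm q.1)))
    contDiff_snd.contMDiff.contMDiffAt fun i => ?_
  have h1 := ((contMDiffAt_tangent_iff_chartD hp y₀ (b := fun y : Y => y)
    ((adChart hp y₀).map_target hw)).1 (hu i)).2
  exact ContMDiffAt.comp (w, A) h1 hb

theorem contMDiffOn_formPsi [FiniteDimensional ℝ EY] (y₀ : Y) :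
    ContMDiffOn (𝓘(ℝ, EY).prod 𝓘(ℝ, EY [⋀^Fin k]→L[ℝ] ℝ)) 𝓘(ℝ, EY × (EY [⋀^Fin k]→L[ℝ] ℝ)) ∞
      (formPsi (k := k) hp y₀) (TotalSpace.proj ⁻¹' (adChart hp y₀).source) := by
  intro z hz
  apply ContMDiffAt.contMDiffWithinAt
  have hb : ContMDiffAt (𝓘(ℝ, EY).prod 𝓘(ℝ, EY [⋀^Fin k]→L[ℝ] ℝ)) 𝓘(ℝ, EY) ∞
      (fun z : FormBundle EY Y k => z.1) z := (contMDiff_proj (FormAt EY k)).contMDiffAt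
  have h1 := ((contMDiffOn_adChart hp y₀).contMDiffAt
    ((adChart hp y₀).open_source.mem_nhds hz)).comp z hb
  refine h1.prodMk_space (contMDiffAt_alternating_of_apply fun u => ?_)
  refine ContMDiffAt.form_apply (b := fun z : FormBundle EY Y k => z.1) (A := fun z => z.2)
    (u := fun i z => mfderiv 𝓘(ℝ, EY) 𝓘(ℝ, EY) (adChart hp y₀).symm (adChart hp y₀ z.1) (u i))
    contMDiffAt_id fun i => ?_
  have h2 := (contMDiffOn_adChart_symm hp y₀).mfderiv_along (adChart hp y₀).open_target
      (b := fun z : FormBundle EY Y k => adChart hp y₀ z.1) (w := fun _ => u i)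
      ((adChart hp y₀).map_source hz)
      (contMDiffAt_tangent_vectorSpace.2 ⟨h1, contMDiffAt_const⟩)
  refine h2.congr_of_eventuallyEq ?_
  filter_upwards [hb.continuousAt.eventually_mem ((adChart hp y₀).open_source.mem_nhds hz)]
    with q hq
  exact TotalSpace.ext ((adChart hp y₀).left_inv hq).symm HEq.rfl

theorem formPhi_formPsi (y₀ : Y) (z : FormBundle EY Y k) (hz : z.1 ∈ (adChart hp y₀).source) :
    formPhi hp y₀ (formPsi hp y₀ z) = z := by
  have h1 := (adChart hp y₀).left_inv hz
  refine TotalSpace.ext h1 (heq_of_eq ?_)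
  refine ContinuousAlternatingMap.ext fun u => ?_
  change z.2 (fun i => chartDInv hp y₀ z.1 hz
    (chartD hp y₀ ((adChart hp y₀).symm (adChart hp y₀ z.1)) (u i))) = z.2 u
  congr 1
  funext i
  have h2 : (chartD hp y₀ ((adChart hp y₀).symm (adChart hp y₀ z.1)) : EY →L[ℝ] EY) =
    chartD hp y₀ z.1 := by rw [h1]
  exact (congrArg (fun L : EY →L[ℝ] EY => chartDInv hp y₀ z.1 hz (L (u i))) h2).trans
    (chartDInv_chartD hp y₀ z.1 hz (u i))

theorem formPsi_formPhi (y₀ : Y) (q : EY × (EY [⋀^Fin k]→L[ℝ] ℝ))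
    (hq : q.1 ∈ (adChart hp y₀).target) : formPsi hp y₀ (formPhi hp y₀ q) = q := by
  refine Prod.ext ((adChart hp y₀).right_inv hq) (ContinuousAlternatingMap.ext fun u => ?_)
  rw [formPsi_snd_apply hp y₀ _ ((adChart hp y₀).map_target hq)]
  change q.2 (fun i => chartD hp y₀ ((adChart hp y₀).symm q.1) (chartDInv hp y₀
    ((adChart hp y₀).symm q.1) _ (u i))) = q.2 u
  simp only [chartD_chartDInv]

/-- The alternating maps on the model space which vanish if two arguments are vertical. -/
def multiphaseModel (y₀ : Y) (k : ℕ) : Submodule ℝ (EY [⋀^Fin k]→L[ℝ] ℝ) where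
  carrier := {A | ∀ (u : Fin k → EY) (i j : Fin k), i ≠ j → (adEquiv hp y₀ (u i)).1 = 0 →
    (adEquiv hp y₀ (u j)).1 = 0 → A u = 0}
  add_mem' := fun hA hB u i j hij hi hj => by
    rw [ContinuousAlternatingMap.add_apply, hA u i j hij hi hj, hB u i j hij hi hj, add_zero]
  zero_mem' := fun _ _ _ _ _ _ => rfl
  smul_mem' := fun a A hA u i j hij hi hj => by
    rw [ContinuousAlternatingMap.smul_apply, hA u i j hij hi hj, smul_zero]

/-- In an adapted chart the condition defining the bundle of multimomenta is a fixed linear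
condition on the coefficient. -/
theorem mem_multiphase_iff (y₀ : Y) (z : FormBundle EY Y k) (hz : z.1 ∈ (adChart hp y₀).source) :
    z ∈ multiphase EX p k ↔ (formPsi hp y₀ z).2 ∈ multiphaseModel hp y₀ k := by
  constructor
  · intro h u i j hij hi hj
    rw [formPsi_snd_apply hp y₀ z hz]
    refine h _ i j hij ?_ ?_
    · rw [← chartD_fst_eq_zero_iff hp y₀ _ hz, chartD_chartDInv, hi]
    · rw [← chartD_fst_eq_zero_iff hp y₀ _ hz, chartD_chartDInv, hj]
  · intro h u i j hij hi hj
    have := h (fun i => chartD hp y₀ z.1 (u i)) i j hij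
      ((chartD_fst_eq_zero_iff hp y₀ _ hz _).2 hi) ((chartD_fst_eq_zero_iff hp y₀ _ hz _).2 hj)
    rw [formPsi_snd_apply hp y₀ z hz] at this
    simpa only [chartDInv_chartD] using this

theorem mfderiv_formPsi_fst [FiniteDimensional ℝ EY] (y₀ : Y) (z : FormBundle EY Y k)
    (hz : z.1 ∈ (adChart hp y₀).source)
    (w : TangentSpace (𝓘(ℝ, EY).prod 𝓘(ℝ, EY [⋀^Fin k]→L[ℝ] ℝ)) z) :
    (mfderiv (𝓘(ℝ, EY).prod 𝓘(ℝ, EY [⋀^Fin k]→L[ℝ] ℝ)) 𝓘(ℝ, EY × (EY [⋀^Fin k]→L[ℝ] ℝ))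
      (formPsi hp y₀) z w : EY × (EY [⋀^Fin k]→L[ℝ] ℝ)).1 =
      chartD hp y₀ z.1 (mfderiv (𝓘(ℝ, EY).prod 𝓘(ℝ, EY [⋀^Fin k]→L[ℝ] ℝ)) 𝓘(ℝ, EY)
        (TotalSpace.proj : FormBundle EY Y k → Y) z w) := by
  have hproj : ContMDiff (𝓘(ℝ, EY).prod 𝓘(ℝ, EY [⋀^Fin k]→L[ℝ] ℝ)) 𝓘(ℝ, EY) ∞
      (TotalSpace.proj : FormBundle EY Y k → Y) := contMDiff_proj (FormAt EY k)
  have hN : TotalSpace.proj ⁻¹' (adChart hp y₀).source ∈ 𝓝 z :=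
    ((adChart hp y₀).open_source.preimage hproj.continuous).mem_nhds hz
  have hPsi' := ((contMDiffOn_formPsi (k := k) hp y₀).contMDiffAt hN).mdifferentiableAt (by simp)
  have h1 := mfderiv_comp z (g := Prod.fst) (I' := 𝓘(ℝ, EY × (EY [⋀^Fin k]→L[ℝ] ℝ)))
    (I'' := 𝓘(ℝ, EY)) (f := formPsi hp y₀)
    (contDiff_fst.contMDiff.mdifferentiableAt (n := ∞) (by simp)) hPsi'
  have h2 := mfderiv_comp z (g := adChart hp y₀) (I' := 𝓘(ℝ, EY)) (I'' := 𝓘(ℝ, EY))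
    (f := (TotalSpace.proj : FormBundle EY Y k → Y))
    ((adChart_mdifferentiable hp y₀).mdifferentiableAt hz)
    (hproj.mdifferentiableAt (by simp))
  rw [mfderiv_eq_fderiv, fderiv_fst] at h1
  exact congrArg (fun L => L w) (h1.symm.trans h2)

/-- Adapted chart of the bundle of multimomenta: the admissible directions are those with
vertical base component and coefficient in the model subspace. -/
theorem exists_adaptedChart_multimomentum [FiniteDimensional ℝ EY] [FiniteDimensional ℝ F]
    [T2Space Y] {S : Type*} [TopologicalSpace S]
    (τ : S → X) (n : ℕ) (z₀ : FormBundle EY Y (n + 1)) :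
    ∃ a : AdaptedChart (multimomentumData hp τ n) z₀, a.Psi = formPsi hp z₀.1 ∧
      a.H = (LinearMap.ker ((LinearMap.fst ℝ EX F).comp (adEquiv hp z₀.1).toLinearMap)).prod
        (multiphaseModel hp z₀.1 (n + 1)) := by
  obtain ⟨f, ε, hf1, hf2, hf3, hf4, hε, hf5⟩ := exists_bump_adChart hp z₀.1
  have hproj : ContMDiff (𝓘(ℝ, EY).prod 𝓘(ℝ, EY [⋀^Fin (n + 1)]→L[ℝ] ℝ)) 𝓘(ℝ, EY) ∞
      (TotalSpace.proj : FormBundle EY Y (n + 1) → Y) := contMDiff_proj (FormAt EY (n + 1))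
  have hpd : ContMDiff 𝓘(ℝ, EY) 𝓘(ℝ, EX) ∞ p := fun y => (hp y).contMDiffAt
  refine ⟨
    { Psi := formPsi hp z₀.1
      Phi := formPhi hp z₀.1
      H := (LinearMap.ker ((LinearMap.fst ℝ EX F).comp (adEquiv hp z₀.1).toLinearMap)).prod
        (multiphaseModel hp z₀.1 (n + 1))
      f := fun z => f z.1
      N := TotalSpace.proj ⁻¹' (adChart hp z₀.1).source
      C := TotalSpace.proj ⁻¹' tsupport f
      O := (adChart hp z₀.1).target ×ˢ univ
      ε := ε
      isOpen_N := (adChart hp z₀.1).open_source.preimage hproj.continuous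
      isClosed_C := (isClosed_tsupport f).preimage hproj.continuous
      isOpen_O := (adChart hp z₀.1).open_target.prod isOpen_univ
      C_subset := preimage_mono hf3
      contMDiff_f := hf1.comp hproj
      abs_f_le := fun z => hf2 z.1
      f_eq_zero := fun z hz => image_eq_zero_of_notMem_tsupport hz
      f_eq_one := hproj.continuous.continuousAt.eventually hf4
      contMDiffOn_Psi := contMDiffOn_formPsi hp z₀.1
      contMDiffOn_Phi := contMDiffOn_formPhi hp z₀.1
      Psi_mem := fun z hz => ⟨(adChart hp z₀.1).map_source hz, mem_univ _⟩
      left_inv := fun z hz => formPhi_formPsi hp z₀.1 z hz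
      right_inv := fun q hq => formPsi_formPhi hp z₀.1 q hq.1
      ε_pos := hε
      add_mem := fun z hz h _ hh =>
        ⟨hf5 _ hz _ ((norm_fst_le h).trans_lt hh), mem_univ _⟩
      proj_add := fun z hz h hh hO => proj_adChart_symm_add hp z₀.1 z.1 hz hh.1 hO.1
      carrier_add := ?_
      mfderiv_mem := ?_ }, rfl, rfl⟩
  · intro z hz hzC h hh hO
    refine (mem_multiphase_iff hp z₀.1 _ ((adChart hp z₀.1).map_target hO.1)).2 ?_
    rw [formPsi_formPhi hp z₀.1 _ hO.1]
    exact add_mem ((mem_multiphase_iff hp z₀.1 z hz).1 hzC) hh.2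
  · intro z hz hzC w hw0 hwC
    have hN : TotalSpace.proj ⁻¹' (adChart hp z₀.1).source ∈ 𝓝 z :=
      ((adChart hp z₀.1).open_source.preimage hproj.continuous).mem_nhds hz
    have hPsi := (contMDiffOn_formPsi (k := n + 1) hp z₀.1).contMDiffAt hN
    have hPsi' := hPsi.mdifferentiableAt (by simp)
    constructor
    · have h3 := mfderiv_comp z (hpd.mdifferentiableAt (x := z.1) (by simp))
        (hproj.mdifferentiableAt (x := z) (by simp))
      have h4 := mfderiv_formPsi_fst hp z₀.1 z hz w
      have h5 : mfderiv 𝓘(ℝ, EY) 𝓘(ℝ, EX) p z.1 (mfderiv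
          (𝓘(ℝ, EY).prod 𝓘(ℝ, EY [⋀^Fin (n + 1)]→L[ℝ] ℝ)) 𝓘(ℝ, EY) TotalSpace.proj z w) = 0 :=
        (congrArg (fun L => L w) h3).symm.trans hw0
      change (adEquiv hp z₀.1 _).1 = 0
      exact (congrArg (fun e : EY => (adEquiv hp z₀.1 e).1) h4).trans
        ((chartD_fst_eq_zero_iff hp z₀.1 _ hz _).2 h5)
    · intro u i j hij hi hj
      let ev : (EY [⋀^Fin (n + 1)]→L[ℝ] ℝ) →ₗ[ℝ] ℝ :=
        { toFun := fun A => A u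
          map_add' := fun _ _ => rfl
          map_smul' := fun _ _ => rfl }
      let l : EY × (EY [⋀^Fin (n + 1)]→L[ℝ] ℝ) →L[ℝ] ℝ :=
        (LinearMap.toContinuousLinearMap ev).comp (ContinuousLinearMap.snd ℝ _ _)
      have h1 := mfderiv_comp z (g := l) (I'' := 𝓘(ℝ, ℝ)) (f := formPsi hp z₀.1)
        (l.contMDiff.mdifferentiableAt (n := ∞) (by simp)) hPsi'
      have h2 := mfderiv_eq_zero_of_mem_tangentSpaceOf (g := l ∘ formPsi hp z₀.1)
        ((l.contMDiff.mdifferentiableAt (n := ∞) (by simp)).comp z hPsi') (by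
          filter_upwards [hN] with z' hz' hzC'
          exact (mem_multiphase_iff hp z₀.1 z' hz').1 hzC' u i j hij hi hj) hwC
      rw [h1, mfderiv_eq_fderiv, ContinuousLinearMap.fderiv] at h2
      exact h2

theorem nonempty_adaptedChart_multimomentum [FiniteDimensional ℝ EY] [FiniteDimensional ℝ F]
    [T2Space Y] {S : Type*} [TopologicalSpace S]
    (τ : S → X) (n : ℕ) (z₀ : FormBundle EY Y (n + 1)) :
    Nonempty (AdaptedChart (multimomentumData hp τ n) z₀) :=
  ⟨(exists_adaptedChart_multimomentum hp τ n z₀).choose⟩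

end Multimomentum

/-! #### Momenta -/

section Momentum

variable {ES S : Type*} [NormedAddCommGroup ES] [NormedSpace ℝ ES] [FiniteDimensional ℝ ES]
  [TopologicalSpace S] [ChartedSpace ES S] [IsManifold 𝓘(ℝ, ES) ∞ S] {k : ℕ}

theorem mem_trivializationAt_momentum_baseSet (q₀ q : S × Y)
    (h₁ : q.1 ∈ (chartAt ES q₀.1).source) (h₂ : q.2 ∈ (adChart hp q₀.2).source) :
    q ∈ (trivializationAt (F →L[ℝ] (ES [⋀^Fin k]→L[ℝ] ℝ))
      (MomentumAt ES hp k : S × Y → Type _) q₀).baseSet := by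
  rw [hom_trivializationAt_baseSet]
  refine ⟨h₂, ?_⟩
  change q.1 ∈ (trivializationAt (ES [⋀^Fin k]→L[ℝ] ℝ) (FormAt ES k : S → Type _) q₀.1).baseSet
  rw [FiberBundle.trivializationAt_continuousAlternatingMap_baseSet]
  exact ⟨h₁, mem_univ _⟩

/-- The bundle chart of `L(VY, Λᵏ T*S)` given by the preferred chart of `S`, an adapted chart of
`Y`, and the corresponding trivialization. -/
def momPsi (q₀ : S × Y) (m : MomentumBundle ES S hp k) :
    (ES × EY) × (F →L[ℝ] (ES [⋀^Fin k]→L[ℝ] ℝ)) :=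
  ((chartAt ES q₀.1 m.1.1, adChart hp q₀.2 m.1.2),
    (trivializationAt (F →L[ℝ] (ES [⋀^Fin k]→L[ℝ] ℝ))
      (MomentumAt ES hp k : S × Y → Type _) q₀ m).2)

/-- The inverse of `momPsi`. -/
def momPhi (q₀ : S × Y) (z : (ES × EY) × (F →L[ℝ] (ES [⋀^Fin k]→L[ℝ] ℝ))) :
    MomentumBundle ES S hp k :=
  (trivializationAt (F →L[ℝ] (ES [⋀^Fin k]→L[ℝ] ℝ))
      (MomentumAt ES hp k : S × Y → Type _) q₀).toOpenPartialHomeomorph.symm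
    (((chartAt ES q₀.1).symm z.1.1, (adChart hp q₀.2).symm z.1.2), z.2)

variable (ES k) in
/-- The domain of `momPsi`. -/
def momSource (q₀ : S × Y) : Set (MomentumBundle ES S hp k) :=
  TotalSpace.proj ⁻¹' ((chartAt ES q₀.1).source ×ˢ (adChart hp q₀.2).source)

theorem isOpen_momSource (q₀ : S × Y) : IsOpen (momSource hp ES k q₀) :=
  ((chartAt ES q₀.1).open_source.prod (adChart hp q₀.2).open_source).preimage
    (FiberBundle.continuous_proj _ _)

theorem contMDiffOn_momPsi (q₀ : S × Y) :
    ContMDiffOn ((𝓘(ℝ, ES).prod 𝓘(ℝ, EY)).prod 𝓘(ℝ, F →L[ℝ] (ES [⋀^Fin k]→L[ℝ] ℝ)))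
      𝓘(ℝ, (ES × EY) × (F →L[ℝ] (ES [⋀^Fin k]→L[ℝ] ℝ))) ∞ (momPsi hp q₀)
      (momSource hp ES k q₀) := by
  have hproj : ContMDiff ((𝓘(ℝ, ES).prod 𝓘(ℝ, EY)).prod 𝓘(ℝ, F →L[ℝ] (ES [⋀^Fin k]→L[ℝ] ℝ)))
      (𝓘(ℝ, ES).prod 𝓘(ℝ, EY)) ∞ (TotalSpace.proj : MomentumBundle ES S hp k → S × Y) :=
    contMDiff_proj (MomentumAt ES hp k : S × Y → Type _)
  have h1 : ContMDiffOn ((𝓘(ℝ, ES).prod 𝓘(ℝ, EY)).prod 𝓘(ℝ, F →L[ℝ] (ES [⋀^Fin k]→L[ℝ] ℝ)))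
      𝓘(ℝ, ES) ∞ (fun m : MomentumBundle ES S hp k => chartAt ES q₀.1 m.1.1)
        (momSource hp ES k q₀) :=
    (contMDiffOn_chart (I := 𝓘(ℝ, ES))).comp (contMDiff_fst.comp hproj).contMDiffOn
      fun m hm => hm.1
  have h2 : ContMDiffOn ((𝓘(ℝ, ES).prod 𝓘(ℝ, EY)).prod 𝓘(ℝ, F →L[ℝ] (ES [⋀^Fin k]→L[ℝ] ℝ)))
      𝓘(ℝ, EY) ∞ (fun m : MomentumBundle ES S hp k => adChart hp q₀.2 m.1.2)
        (momSource hp ES k q₀) :=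
    (contMDiffOn_adChart hp q₀.2).comp (contMDiff_snd.comp hproj).contMDiffOn fun m hm => hm.2
  have h3 := (contMDiff_snd.comp_contMDiffOn (Trivialization.contMDiffOn
      (F := F →L[ℝ] (ES [⋀^Fin k]→L[ℝ] ℝ))
    (E := (MomentumAt ES hp k : S × Y → Type _)) (IB := 𝓘(ℝ, ES).prod 𝓘(ℝ, EY)) (n := ∞)
    (trivializationAt (F →L[ℝ] (ES [⋀^Fin k]→L[ℝ] ℝ))
      (MomentumAt ES hp k : S × Y → Type _) q₀))).mono (t := momSource hp ES k q₀) fun m hm => by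
        rw [Trivialization.mem_source]
        exact mem_trivializationAt_momentum_baseSet hp q₀ m.1 hm.1 hm.2
  exact (h1.prodMk_space h2).prodMk_space h3

theorem contMDiffOn_momPhi (q₀ : S × Y) :
    ContMDiffOn 𝓘(ℝ, (ES × EY) × (F →L[ℝ] (ES [⋀^Fin k]→L[ℝ] ℝ)))
      ((𝓘(ℝ, ES).prod 𝓘(ℝ, EY)).prod 𝓘(ℝ, F →L[ℝ] (ES [⋀^Fin k]→L[ℝ] ℝ))) ∞
      (momPhi (ES := ES) (k := k) hp q₀) (((chartAt ES q₀.1).target ×ˢ (adChart hp q₀.2).target) ×ˢ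
        univ) := by
  have h1 : ContMDiffOn 𝓘(ℝ, (ES × EY) × (F →L[ℝ] (ES [⋀^Fin k]→L[ℝ] ℝ))) 𝓘(ℝ, ES) ∞
      (fun z : (ES × EY) × (F →L[ℝ] (ES [⋀^Fin k]→L[ℝ] ℝ)) => (chartAt ES q₀.1).symm z.1.1)
      (((chartAt ES q₀.1).target ×ˢ (adChart hp q₀.2).target) ×ˢ univ) :=
    (contMDiffOn_chart_symm (I := 𝓘(ℝ, ES))).comp
      (contDiff_fst.comp contDiff_fst).contMDiff.contMDiffOn fun z hz => hz.1.1
  have h2 : ContMDiffOn 𝓘(ℝ, (ES × EY) × (F →L[ℝ] (ES [⋀^Fin k]→L[ℝ] ℝ))) 𝓘(ℝ, EY) ∞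
      (fun z : (ES × EY) × (F →L[ℝ] (ES [⋀^Fin k]→L[ℝ] ℝ)) => (adChart hp q₀.2).symm z.1.2)
      (((chartAt ES q₀.1).target ×ˢ (adChart hp q₀.2).target) ×ˢ univ) :=
    (contMDiffOn_adChart_symm hp q₀.2).comp
      (contDiff_snd.comp contDiff_fst).contMDiff.contMDiffOn fun z hz => hz.1.2
  have h3 := (h1.prodMk h2).prodMk (contDiff_snd.contMDiff.contMDiffOn :
    ContMDiffOn 𝓘(ℝ, (ES × EY) × (F →L[ℝ] (ES [⋀^Fin k]→L[ℝ] ℝ)))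
      𝓘(ℝ, F →L[ℝ] (ES [⋀^Fin k]→L[ℝ] ℝ)) ∞ Prod.snd
      (((chartAt ES q₀.1).target ×ˢ (adChart hp q₀.2).target) ×ˢ univ))
  have h4 := Trivialization.contMDiffOn_symm (F := F →L[ℝ] (ES [⋀^Fin k]→L[ℝ] ℝ))
    (E := (MomentumAt ES hp k : S × Y → Type _)) (IB := 𝓘(ℝ, ES).prod 𝓘(ℝ, EY)) (n := ∞)
    (trivializationAt (F →L[ℝ] (ES [⋀^Fin k]→L[ℝ] ℝ)) (MomentumAt ES hp k : S × Y → Type _) q₀)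
  refine ContMDiffOn.comp h4 h3 fun z hz => ?_
  rw [mem_preimage, Trivialization.mem_target]
  exact mem_trivializationAt_momentum_baseSet hp q₀ _ ((chartAt ES q₀.1).map_target hz.1.1)
    ((adChart hp q₀.2).map_target hz.1.2)

theorem momPhi_proj (q₀ : S × Y) {z : (ES × EY) × (F →L[ℝ] (ES [⋀^Fin k]→L[ℝ] ℝ))}
    (h₁ : z.1.1 ∈ (chartAt ES q₀.1).target) (h₂ : z.1.2 ∈ (adChart hp q₀.2).target) :
    (momPhi hp q₀ z).1 = ((chartAt ES q₀.1).symm z.1.1, (adChart hp q₀.2).symm z.1.2) := by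
  refine Trivialization.proj_symm_apply _ ?_
  rw [Trivialization.mem_target]
  exact mem_trivializationAt_momentum_baseSet hp q₀ _ ((chartAt ES q₀.1).map_target h₁)
    ((adChart hp q₀.2).map_target h₂)

theorem momPhi_momPsi (q₀ : S × Y) (m : MomentumBundle ES S hp k) (hm : m ∈ momSource hp ES k q₀) :
    momPhi hp q₀ (momPsi hp q₀ m) = m := by
  have hb := mem_trivializationAt_momentum_baseSet (k := k) hp q₀ m.1 hm.1 hm.2
  rw [momPhi, momPsi]
  simp only [(chartAt ES q₀.1).left_inv hm.1, (adChart hp q₀.2).left_inv hm.2]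
  have h1 := (trivializationAt (F →L[ℝ] (ES [⋀^Fin k]→L[ℝ] ℝ))
      (MomentumAt ES hp k : S × Y → Type _) q₀).symm_apply_mk_proj
        ((Trivialization.mem_source _).2 hb)
  exact h1

theorem momPsi_momPhi (q₀ : S × Y) {z : (ES × EY) × (F →L[ℝ] (ES [⋀^Fin k]→L[ℝ] ℝ))}
    (h₁ : z.1.1 ∈ (chartAt ES q₀.1).target) (h₂ : z.1.2 ∈ (adChart hp q₀.2).target) :
    momPsi hp q₀ (momPhi hp q₀ z) = z := by
  have h := momPhi_proj hp q₀ h₁ h₂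
  rw [momPsi, h]
  have h3 : (trivializationAt (F →L[ℝ] (ES [⋀^Fin k]→L[ℝ] ℝ))
      (MomentumAt ES hp k : S × Y → Type _) q₀) (momPhi hp q₀ z) =
      (((chartAt ES q₀.1).symm z.1.1, (adChart hp q₀.2).symm z.1.2), z.2) := by
    refine Trivialization.apply_symm_apply _ ?_
    rw [Trivialization.mem_target]
    exact mem_trivializationAt_momentum_baseSet hp q₀ _ ((chartAt ES q₀.1).map_target h₁)
      ((adChart hp q₀.2).map_target h₂)
  rw [h3]
  simp only [(chartAt ES q₀.1).right_inv h₁, (adChart hp q₀.2).right_inv h₂]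

variable (ES k) in
/-- The directions in which the image of `momPsi` may be moved along the fibres over `S × X`. -/
def momH (q₀ : S × Y) : Submodule ℝ ((ES × EY) × (F →L[ℝ] (ES [⋀^Fin k]→L[ℝ] ℝ))) where
  carrier := {h | h.1.1 = 0 ∧ (adEquiv hp q₀.2 h.1.2).1 = 0}
  add_mem' := fun {a b} ha hb => by
    refine ⟨?_, ?_⟩
    · rw [Prod.fst_add, Prod.fst_add, ha.1, hb.1, add_zero]
    · rw [Prod.fst_add, Prod.snd_add, map_add, Prod.fst_add, ha.2, hb.2, add_zero]
  zero_mem' := by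
    refine ⟨rfl, ?_⟩
    rw [Prod.fst_zero, Prod.snd_zero, map_zero, Prod.fst_zero]
  smul_mem' := fun c {a} ha => by
    refine ⟨?_, ?_⟩
    · rw [Prod.smul_fst, Prod.smul_fst, ha.1, smul_zero]
    · rw [Prod.smul_fst, Prod.smul_snd, map_smul, Prod.smul_fst, ha.2, smul_zero]

theorem mdifferentiableAt_momPsi (q₀ : S × Y) {m : MomentumBundle ES S hp k}
    (hm : m ∈ momSource hp ES k q₀) :
    MDifferentiableAt ((𝓘(ℝ, ES).prod 𝓘(ℝ, EY)).prod 𝓘(ℝ, F →L[ℝ] (ES [⋀^Fin k]→L[ℝ] ℝ)))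
      𝓘(ℝ, (ES × EY) × (F →L[ℝ] (ES [⋀^Fin k]→L[ℝ] ℝ))) (momPsi hp q₀) m :=
  ((contMDiffOn_momPsi hp q₀).contMDiffAt
    ((isOpen_momSource hp q₀).mem_nhds hm)).mdifferentiableAt (by simp)

theorem contMDiff_momentum_proj :
    ContMDiff ((𝓘(ℝ, ES).prod 𝓘(ℝ, EY)).prod 𝓘(ℝ, F →L[ℝ] (ES [⋀^Fin k]→L[ℝ] ℝ)))
      (𝓘(ℝ, ES).prod 𝓘(ℝ, EY)) ∞ (TotalSpace.proj : MomentumBundle ES S hp k → S × Y) :=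
  contMDiff_proj (MomentumAt ES hp k : S × Y → Type _)

theorem mfderiv_momPsi_fst_fst (q₀ : S × Y) {m : MomentumBundle ES S hp k}
    (hm : m ∈ momSource hp ES k q₀) (w : TangentSpace
      ((𝓘(ℝ, ES).prod 𝓘(ℝ, EY)).prod 𝓘(ℝ, F →L[ℝ] (ES [⋀^Fin k]→L[ℝ] ℝ))) m) :
    (mfderiv ((𝓘(ℝ, ES).prod 𝓘(ℝ, EY)).prod 𝓘(ℝ, F →L[ℝ] (ES [⋀^Fin k]→L[ℝ] ℝ)))
      𝓘(ℝ, (ES × EY) × (F →L[ℝ] (ES [⋀^Fin k]→L[ℝ] ℝ))) (momPsi hp q₀) m w :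
      (ES × EY) × (F →L[ℝ] (ES [⋀^Fin k]→L[ℝ] ℝ))).1.1 =
    mfderiv 𝓘(ℝ, ES) 𝓘(ℝ, ES) (chartAt ES q₀.1) m.1.1
      (mfderiv ((𝓘(ℝ, ES).prod 𝓘(ℝ, EY)).prod 𝓘(ℝ, F →L[ℝ] (ES [⋀^Fin k]→L[ℝ] ℝ))) 𝓘(ℝ, ES)
        (fun m : MomentumBundle ES S hp k => m.1.1) m w) := by
  have h2 := mfderiv_comp m (g := chartAt ES q₀.1) (I' := 𝓘(ℝ, ES)) (I'' := 𝓘(ℝ, ES))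
    (f := fun m : MomentumBundle ES S hp k => m.1.1)
    (((contMDiffOn_chart (I := 𝓘(ℝ, ES)) (n := ∞)).contMDiffAt
      ((chartAt ES q₀.1).open_source.mem_nhds hm.1)).mdifferentiableAt (by simp))
    ((contMDiff_fst.comp (contMDiff_momentum_proj (ES := ES) (S := S) (k := k)
      hp)).mdifferentiableAt (n := ∞) (by simp))
  have hPsi := mdifferentiableAt_momPsi hp q₀ hm
  have hfst := mdifferentiableAt_fst_space hPsi
  rw [mfderiv_fst_apply hPsi, mfderiv_fst_apply hfst]
  exact congrArg (fun L => L w) h2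

theorem mfderiv_momPsi_fst_snd (q₀ : S × Y) {m : MomentumBundle ES S hp k}
    (hm : m ∈ momSource hp ES k q₀) (w : TangentSpace
      ((𝓘(ℝ, ES).prod 𝓘(ℝ, EY)).prod 𝓘(ℝ, F →L[ℝ] (ES [⋀^Fin k]→L[ℝ] ℝ))) m) :
    (mfderiv ((𝓘(ℝ, ES).prod 𝓘(ℝ, EY)).prod 𝓘(ℝ, F →L[ℝ] (ES [⋀^Fin k]→L[ℝ] ℝ)))
      𝓘(ℝ, (ES × EY) × (F →L[ℝ] (ES [⋀^Fin k]→L[ℝ] ℝ))) (momPsi hp q₀) m w :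
      (ES × EY) × (F →L[ℝ] (ES [⋀^Fin k]→L[ℝ] ℝ))).1.2 =
    chartD hp q₀.2 m.1.2
      (mfderiv ((𝓘(ℝ, ES).prod 𝓘(ℝ, EY)).prod 𝓘(ℝ, F →L[ℝ] (ES [⋀^Fin k]→L[ℝ] ℝ))) 𝓘(ℝ, EY)
        (fun m : MomentumBundle ES S hp k => m.1.2) m w) := by
  have h2 := mfderiv_comp m (g := adChart hp q₀.2) (I' := 𝓘(ℝ, EY)) (I'' := 𝓘(ℝ, EY))
    (f := fun m : MomentumBundle ES S hp k => m.1.2)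
    ((adChart_mdifferentiable hp q₀.2).mdifferentiableAt hm.2)
    ((contMDiff_snd.comp (contMDiff_momentum_proj (ES := ES) (S := S) (k := k)
      hp)).mdifferentiableAt (n := ∞) (by simp))
  have hPsi := mdifferentiableAt_momPsi hp q₀ hm
  have hfst := mdifferentiableAt_fst_space hPsi
  rw [mfderiv_fst_apply hPsi, mfderiv_snd_apply hfst]
  exact congrArg (fun L => L w) h2

end Momentum

/-- Tangent vectors of the bundle of momenta that are vertical over `X` and over `Σ` have
admissible coordinates. -/
theorem mfderiv_momPsi_mem_momH {n : ℕ} {S : Type*}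
    [TopologicalSpace S] [ChartedSpace (EuclideanSpace ℝ (Fin n)) S]
    [IsManifold 𝓘(ℝ, EuclideanSpace ℝ (Fin n)) ∞ S]
    [FiniteDimensional ℝ EY] [FiniteDimensional ℝ F] (τ : S → X) (q₀ : S × Y)
    {m : MomentumBundle (EuclideanSpace ℝ (Fin n)) S hp n}
    (hm : m ∈ momSource hp (EuclideanSpace ℝ (Fin n)) n q₀)
    (w : TangentSpace ((𝓘(ℝ, EuclideanSpace ℝ (Fin n)).prod 𝓘(ℝ, EY)).prod
      𝓘(ℝ, F →L[ℝ] (EuclideanSpace ℝ (Fin n) [⋀^Fin n]→L[ℝ] ℝ))) m)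
    (hw : mfderiv ((𝓘(ℝ, EuclideanSpace ℝ (Fin n)).prod 𝓘(ℝ, EY)).prod
      𝓘(ℝ, F →L[ℝ] (EuclideanSpace ℝ (Fin n) [⋀^Fin n]→L[ℝ] ℝ)))
      (𝓘(ℝ, EuclideanSpace ℝ (Fin n)).prod 𝓘(ℝ, EX)) (momentumData hp τ n).proj m w = 0) :
    mfderiv ((𝓘(ℝ, EuclideanSpace ℝ (Fin n)).prod 𝓘(ℝ, EY)).prod
      𝓘(ℝ, F →L[ℝ] (EuclideanSpace ℝ (Fin n) [⋀^Fin n]→L[ℝ] ℝ)))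
      𝓘(ℝ, ((EuclideanSpace ℝ (Fin n)) × EY) ×
        (F →L[ℝ] (EuclideanSpace ℝ (Fin n) [⋀^Fin n]→L[ℝ] ℝ))) (momPsi hp q₀) m w ∈
      momH hp (EuclideanSpace ℝ (Fin n)) n q₀ := by
  refine ⟨(mfderiv_momPsi_fst_fst hp q₀ hm w).trans ?_, ?_⟩
  · have h1 := mfderiv_comp m (contMDiff_fst.mdifferentiableAt
        (I := (𝓘(ℝ, EuclideanSpace ℝ (Fin n)).prod 𝓘(ℝ, EX)))
        (I' := 𝓘(ℝ, EuclideanSpace ℝ (Fin n))) (n := ∞)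
        (x := (momentumData hp τ n).proj m) (by simp))
      ((momentumData hp τ n).contMDiff_proj.mdifferentiableAt (x := m) (by simp))
    have h2 : mfderiv ((𝓘(ℝ, EuclideanSpace ℝ (Fin n)).prod 𝓘(ℝ, EY)).prod
        𝓘(ℝ, F →L[ℝ] (EuclideanSpace ℝ (Fin n) [⋀^Fin n]→L[ℝ] ℝ))) 𝓘(ℝ, EuclideanSpace ℝ (Fin n))
        (fun m : MomentumBundle (EuclideanSpace ℝ (Fin n)) S hp n => m.1.1) m w = 0 := by
      refine (congrArg (fun L => L w) h1).trans ?_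
      exact (congrArg (mfderiv (𝓘(ℝ, EuclideanSpace ℝ (Fin n)).prod 𝓘(ℝ, EX))
        𝓘(ℝ, EuclideanSpace ℝ (Fin n)) (Prod.fst : S × X → S) ((momentumData hp τ n).proj m))
        hw).trans (map_zero _)
    rw [h2]
    exact map_zero _
  · refine (congrArg (fun e : EY => (adEquiv hp q₀.2 e).1)
      (mfderiv_momPsi_fst_snd hp q₀ hm w)).trans ?_
    exact (chartD_fst_eq_zero_iff hp q₀.2 m.1.2 hm.2 _).2 (mfderiv_momentum_vertical hp τ m w hw)

/-- The adapted chart of the bundle of momenta around a point. -/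
theorem exists_adaptedChart_momentum {n : ℕ} {S : Type*}
    [TopologicalSpace S] [ChartedSpace (EuclideanSpace ℝ (Fin n)) S]
    [IsManifold 𝓘(ℝ, EuclideanSpace ℝ (Fin n)) ∞ S] [T2Space S]
    [FiniteDimensional ℝ EY] [FiniteDimensional ℝ F] [T2Space Y]
    (τ : S → X) (m₀ : MomentumBundle (EuclideanSpace ℝ (Fin n)) S hp n) :
    ∃ a : AdaptedChart (momentumData hp τ n) m₀, a.Psi = momPsi hp m₀.1 ∧
      a.H = momH hp (EuclideanSpace ℝ (Fin n)) n m₀.1 ∧ a.N = momSource hp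
        (EuclideanSpace ℝ (Fin n)) n m₀.1 := by
  obtain ⟨f, ε, hf1, hf2, hf3, hf4, hε, hf5⟩ := exists_bump_adChart hp m₀.1.2
  obtain ⟨g, hg1, hg2, hg3, hg4⟩ := exists_bump_tsupport_subset (E := EuclideanSpace ℝ (Fin n))
    (chart_source_mem_nhds (EuclideanSpace ℝ (Fin n)) m₀.1.1)
  let IK := (𝓘(ℝ, EuclideanSpace ℝ (Fin n)).prod 𝓘(ℝ, EY)).prod
    𝓘(ℝ, F →L[ℝ] (EuclideanSpace ℝ (Fin n) [⋀^Fin n]→L[ℝ] ℝ))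
  have hproj : ContMDiff IK (𝓘(ℝ, EuclideanSpace ℝ (Fin n)).prod 𝓘(ℝ, EY)) ∞
      (TotalSpace.proj : MomentumBundle (EuclideanSpace ℝ (Fin n)) S hp n → S × Y) :=
    contMDiff_proj (MomentumAt (EuclideanSpace ℝ (Fin n)) hp n : S × Y → Type _)
  have hproj1 := contMDiff_fst.comp hproj
  have hproj2 := contMDiff_snd.comp hproj
  have hpd : ContMDiff 𝓘(ℝ, EY) 𝓘(ℝ, EX) ∞ p := fun y => (hp y).contMDiffAt
  refine ⟨
    { Psi := momPsi hp m₀.1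
      Phi := momPhi hp m₀.1
      H := momH hp (EuclideanSpace ℝ (Fin n)) n m₀.1
      f := fun m => g m.1.1 * f m.1.2
      N := momSource hp (EuclideanSpace ℝ (Fin n)) n m₀.1
      C := TotalSpace.proj ⁻¹' (tsupport g ×ˢ tsupport f)
      O := ((chartAt (EuclideanSpace ℝ (Fin n)) m₀.1.1).target ×ˢ
        (adChart hp m₀.1.2).target) ×ˢ univ
      ε := ε
      isOpen_N := isOpen_momSource hp m₀.1
      isClosed_C := ((isClosed_tsupport g).prod (isClosed_tsupport f)).preimage hproj.continuous
      isOpen_O := ((chartAt (EuclideanSpace ℝ (Fin n)) m₀.1.1).open_target.prod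
        (adChart hp m₀.1.2).open_target).prod isOpen_univ
      C_subset := fun m hm => ⟨hg3 hm.1, hf3 hm.2⟩
      contMDiff_f := (hg1.comp hproj1).mul (hf1.comp hproj2)
      abs_f_le := fun m => by
        rw [abs_mul]
        exact mul_le_one₀ (hg2 _) (abs_nonneg _) (hf2 _)
      f_eq_zero := fun m hm => by
        by_cases h : m.1.1 ∈ tsupport g
        · rw [image_eq_zero_of_notMem_tsupport (f := f) fun h' => hm ⟨h, h'⟩, mul_zero]
        · rw [image_eq_zero_of_notMem_tsupport h, zero_mul]
      f_eq_one := by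
        filter_upwards [hproj1.continuous.continuousAt.eventually hg4,
          hproj2.continuous.continuousAt.eventually hf4] with m h1 h2
        change g m.1.1 = 1 at h1
        change f m.1.2 = 1 at h2
        rw [h1, h2, one_mul]
      contMDiffOn_Psi := contMDiffOn_momPsi hp m₀.1
      contMDiffOn_Phi := contMDiffOn_momPhi hp m₀.1
      Psi_mem := fun m hm => ⟨⟨(chartAt _ m₀.1.1).map_source hm.1,
        (adChart hp m₀.1.2).map_source hm.2⟩, mem_univ _⟩
      left_inv := fun m hm => momPhi_momPsi hp m₀.1 m hm
      right_inv := fun z hz => momPsi_momPhi hp m₀.1 hz.1.1 hz.1.2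
      ε_pos := hε
      add_mem := ?_
      proj_add := ?_
      carrier_add := fun _ _ _ _ _ _ => mem_univ _
      mfderiv_mem := fun m hm _ w hw _ => mfderiv_momPsi_mem_momH hp τ m₀.1 hm w hw }, rfl, rfl,
        rfl⟩
  · intro m hm h hh hlt
    have h0 : h.1.1 = 0 := hh.1
    refine ⟨⟨?_, hf5 _ hm.2 _ (((norm_snd_le h.1).trans (norm_fst_le h)).trans_lt hlt)⟩, mem_univ _⟩
    change chartAt _ m₀.1.1 m.1.1 + h.1.1 ∈ _
    rw [h0, add_zero]
    exact (chartAt _ m₀.1.1).map_source (hg3 hm.1)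
  · intro m hm h hh hO
    have h0 : h.1.1 = 0 := hh.1
    have h1 : (adEquiv hp m₀.1.2 h.1.2).1 = 0 := hh.2
    change ((momPhi hp m₀.1 _).1.1, p (momPhi hp m₀.1 _).1.2) = (m.1.1, p m.1.2)
    rw [momPhi_proj hp m₀.1 hO.1.1 hO.1.2]
    refine Prod.ext ?_ (proj_adChart_symm_add hp m₀.1.2 m.1.2 hm.2 h1 hO.1.2)
    change (chartAt _ m₀.1.1).symm (chartAt _ m₀.1.1 m.1.1 + h.1.1) = m.1.1
    rw [h0, add_zero, (chartAt _ m₀.1.1).left_inv hm.1]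

end AdaptedChart

/-! ### Partial derivatives of maps depending on parameters -/

section Partial

variable {EM HM M ET HT T ES HS S EN HN N : Type*}
  [NormedAddCommGroup EM] [NormedSpace ℝ EM] [TopologicalSpace HM]
  {IM : ModelWithCorners ℝ EM HM} [TopologicalSpace M] [ChartedSpace HM M]
  [NormedAddCommGroup ET] [NormedSpace ℝ ET] [TopologicalSpace HT]
  {IT : ModelWithCorners ℝ ET HT} [TopologicalSpace T] [ChartedSpace HT T] [IsManifold IT ∞ T]
  [NormedAddCommGroup ES] [NormedSpace ℝ ES] [TopologicalSpace HS]
  {IS : ModelWithCorners ℝ ES HS} [TopologicalSpace S] [ChartedSpace HS S] [IsManifold IS ∞ S]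
  [NormedAddCommGroup EN] [NormedSpace ℝ EN] [TopologicalSpace HN]
  {IN : ModelWithCorners ℝ EN HN} [TopologicalSpace N] [ChartedSpace HN N] [IsManifold IN ∞ N]

theorem ContMDiff.mfderiv_partial_right {g : T × S → N} (hg : ContMDiff (IT.prod IS) IN ∞ g)
    {a : M → T} {b : M → S} {w : ∀ q, TangentSpace IS (b q)} {q₀ : M}
    (ha : ContMDiffAt IM IT ∞ a q₀)
    (hw : ContMDiffAt IM IS.tangent ∞ (fun q => (⟨b q, w q⟩ : TangentBundle IS S)) q₀) :
    ContMDiffAt IM IN.tangent ∞ (fun q => (⟨g (a q, b q),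
      mfderiv IS IN (fun x => g (a q, x)) (b q) (w q)⟩ : TangentBundle IN N)) q₀ := by
  have h1 : ContMDiffAt IM IT.tangent ∞ (fun q => (⟨a q, 0⟩ : TangentBundle IT T)) q₀ :=
    (contMDiff_zeroSection ℝ (TangentSpace IT)).contMDiffAt.comp q₀ ha
  have h2 := (contMDiff_equivTangentBundleProd_symm (I := IT) (M := T) (I' := IS) (M' := S)
    (n := ∞)).contMDiffAt.comp q₀ (h1.prodMk hw)
  refine (hg.mfderiv_along (b := fun q => (a q, b q))
    (w := fun q => ((0, w q) : TangentSpace (IT.prod IS) (a q, b q))) h2).congr_of_eventuallyEq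
    (Filter.Eventually.of_forall fun q => ?_)
  refine TotalSpace.ext rfl (heq_of_eq ?_)
  have h := mfderiv_prod_eq_add_apply (v := ((0, w q) : TangentSpace (IT.prod IS) (a q, b q)))
      (hg.mdifferentiableAt (x := (a q, b q)) (by simp))
  refine Eq.trans ?_ h.symm
  refine Eq.trans (zero_add _).symm ?_
  exact congrArg (fun w' => w' + mfderiv IS IN (fun x => g (a q, x)) (b q) (w q))
    (map_zero _).symm

theorem ContMDiff.mfderiv_partial_left {g : T × S → N} (hg : ContMDiff (IT.prod IS) IN ∞ g)
    {a : M → T} {b : M → S} {w : ∀ q, TangentSpace IT (a q)} {q₀ : M}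
    (hb : ContMDiffAt IM IS ∞ b q₀)
    (hw : ContMDiffAt IM IT.tangent ∞ (fun q => (⟨a q, w q⟩ : TangentBundle IT T)) q₀) :
    ContMDiffAt IM IN.tangent ∞ (fun q => (⟨g (a q, b q),
      mfderiv IT IN (fun t => g (t, b q)) (a q) (w q)⟩ : TangentBundle IN N)) q₀ := by
  have h1 : ContMDiffAt IM IS.tangent ∞ (fun q => (⟨b q, 0⟩ : TangentBundle IS S)) q₀ :=
    (contMDiff_zeroSection ℝ (TangentSpace IS)).contMDiffAt.comp q₀ hb
  have h2 := (contMDiff_equivTangentBundleProd_symm (I := IT) (M := T) (I' := IS) (M' := S)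
    (n := ∞)).contMDiffAt.comp q₀ (hw.prodMk h1)
  refine (hg.mfderiv_along (b := fun q => (a q, b q))
    (w := fun q => ((w q, 0) : TangentSpace (IT.prod IS) (a q, b q))) h2).congr_of_eventuallyEq
    (Filter.Eventually.of_forall fun q => ?_)
  refine TotalSpace.ext rfl (heq_of_eq ?_)
  have h := mfderiv_prod_eq_add_apply (v := ((w q, 0) : TangentSpace (IT.prod IS) (a q, b q)))
      (hg.mdifferentiableAt (x := (a q, b q)) (by simp))
  refine Eq.trans ?_ h.symm
  refine Eq.trans (add_zero _).symm ?_
  exact congrArg (fun w' => mfderiv IT IN (fun t => g (t, b q)) (a q) (w q) + w')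
    (map_zero _).symm

end Partial

section ModelValued

variable {EM HM M EN HN N EP HP P : Type*}
  [NormedAddCommGroup EM] [NormedSpace ℝ EM] [TopologicalSpace HM]
  {IM : ModelWithCorners ℝ EM HM} [TopologicalSpace M] [ChartedSpace HM M]
  [NormedAddCommGroup EN] [NormedSpace ℝ EN] [TopologicalSpace HN]
  {IN : ModelWithCorners ℝ EN HN} [TopologicalSpace N] [ChartedSpace HN N]
  [NormedAddCommGroup EP] [NormedSpace ℝ EP] [TopologicalSpace HP]
  {IP : ModelWithCorners ℝ EP HP} [TopologicalSpace P] [ChartedSpace HP P]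

/-- Equality of the values of derivatives, as vectors of the model space. -/
theorem mfderiv_apply_congr {f g : M → N} {x : M} (h : f =ᶠ[𝓝 x] g) (w : EM) :
    @Eq EN (mfderiv IM IN f x w) (mfderiv IM IN g x w) := by
  have h1 := h.mfderiv_eq (I := IM) (I' := IN)
  exact congrArg (fun L : EM →L[ℝ] EN => L w) h1

theorem mfderiv_comp_model {f : M → N} {g : N → P} (x : M) (hg : MDifferentiableAt IN IP g (f x))
    (hf : MDifferentiableAt IM IN f x) (w : EM) :
    @Eq EP (mfderiv IM IP (fun x => g (f x)) x w) (mfderiv IN IP g (f x) (mfderiv IM IN f x w)) :=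
  congrArg (fun L : EM →L[ℝ] EP => L w) (mfderiv_comp x hg hf)

theorem mfderiv_prodMk_model {f : M → N} {g : M → P} {x : M} (hf : MDifferentiableAt IM IN f x)
    (hg : MDifferentiableAt IM IP g x) (w : EM) :
    (mfderiv IM (IN.prod IP) (fun x => (f x, g x)) x w : EN × EP) =
      ((mfderiv IM IN f x w : EN), (mfderiv IM IP g x w : EP)) :=
  congrArg (fun L : EM →L[ℝ] EN × EP => L w) (mfderiv_prodMk hf hg)

end ModelValued

section Symmetry

/-- Symmetry of second derivatives for the mixed partial derivatives of a map on a product. -/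
theorem fderiv_fderiv_comm {A B V : Type*} [NormedAddCommGroup A] [NormedSpace ℝ A]
    [NormedAddCommGroup B] [NormedSpace ℝ B] [NormedAddCommGroup V] [NormedSpace ℝ V]
    {g : A × B → V} {a : A} {b : B} (hg : ContDiffAt ℝ ∞ g (a, b)) (v : A) (w : B) :
    fderiv ℝ (fun t => fderiv ℝ (fun z => g (t, z)) b w) a v =
      fderiv ℝ (fun z => fderiv ℝ (fun t => g (t, z)) a v) b w := by
  have hev : ∀ᶠ q in 𝓝 (a, b), ContDiffAt ℝ 2 g q :=
    (hg.of_le (m := 2) (by decide)).eventually (by decide)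
  have h1 : (fun t => fderiv ℝ (fun z => g (t, z)) b w) =ᶠ[𝓝 a]
      fun t => fderiv ℝ g (t, b) (0, w) := by
    filter_upwards [(Continuous.prodMk_left b).continuousAt.eventually hev] with t ht
    have h := (ht.differentiableAt (by simp)).hasFDerivAt.comp b (hasFDerivAt_prodMk_right t b)
    exact congrArg (fun L => L w) h.fderiv
  have h2 : (fun z => fderiv ℝ (fun t => g (t, z)) a v) =ᶠ[𝓝 b]
      fun z => fderiv ℝ g (a, z) (v, 0) := by
    filter_upwards [(Continuous.prodMk_right a).continuousAt.eventually hev] with z hz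
    have h := (hz.differentiableAt (by simp)).hasFDerivAt.comp (f := fun t => (t, z)) a
        (hasFDerivAt_prodMk_left a z)
    exact congrArg (fun L => L v) h.fderiv
  have hd : DifferentiableAt ℝ (fderiv ℝ g) (a, b) :=
    (hg.fderiv_right (m := 1) (by decide)).differentiableAt (by simp)
  have hl := hd.hasFDerivAt.comp (f := fun t => (t, b)) a (hasFDerivAt_prodMk_left a b)
  have hr := hd.hasFDerivAt.comp b (hasFDerivAt_prodMk_right a b)
  rw [h1.fderiv_eq, h2.fderiv_eq]
  have hl' := (hl.clm_apply (hasFDerivAt_const ((0 : A), w) a)).fderiv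
  have hr' := (hr.clm_apply (hasFDerivAt_const (v, (0 : B)) b)).fderiv
  have e1 := congrArg (fun L => L v) hl'
  have e2 := congrArg (fun L => L w) hr'
  simp only [comp_apply] at e1 e2
  rw [e1, e2]
  have hs := (hg.of_le (m := 2) (by decide)).isSymmSndFDerivAt
    (by simp)
  simpa using hs (v, 0) (0, w)

variable {ES S A V : Type*} [NormedAddCommGroup ES] [NormedSpace ℝ ES]
  [TopologicalSpace S] [ChartedSpace ES S] [IsManifold 𝓘(ℝ, ES) ∞ S]
  [NormedAddCommGroup A] [NormedSpace ℝ A] [NormedAddCommGroup V] [NormedSpace ℝ V]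

theorem mfderiv_eq_fderiv_chartAt {f : S → V} {x : S}
    (hf : MDifferentiableAt 𝓘(ℝ, ES) 𝓘(ℝ, V) f x) :
    mfderiv 𝓘(ℝ, ES) 𝓘(ℝ, V) f x =
      fderiv ℝ (f ∘ (chartAt ES x).symm) (chartAt ES x x) := by
  refine hf.mfderiv.trans ?_
  simp only [writtenInExtChartAt, extChartAt, mfld_simps, fderivWithin_univ]
  rfl

/-- Partial derivatives of a map on the product of a vector space and a manifold commute. -/
theorem fderiv_mfderiv_comm {G : A × S → V} {t₀ : A} {x₀ : S}
    (hG : ContMDiffAt (𝓘(ℝ, A).prod 𝓘(ℝ, ES)) 𝓘(ℝ, V) ∞ G (t₀, x₀)) (v : A)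
    (e : TangentSpace 𝓘(ℝ, ES) x₀) :
    fderiv ℝ (fun t => (mfderiv 𝓘(ℝ, ES) 𝓘(ℝ, V) (fun x => G (t, x)) x₀ e : V)) t₀ v =
      (mfderiv 𝓘(ℝ, ES) 𝓘(ℝ, V) (fun x => fderiv ℝ (fun t => G (t, x)) t₀ v) x₀ e : V) := by
  have hψ : ContMDiffAt 𝓘(ℝ, ES) 𝓘(ℝ, ES) ∞ (chartAt ES x₀).symm (chartAt ES x₀ x₀) :=
    (contMDiffOn_chart_symm (I := 𝓘(ℝ, ES))).contMDiffAt
      ((chartAt ES x₀).open_target.mem_nhds (mem_chart_target ES x₀))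
  have hx := (chartAt ES x₀).left_inv (mem_chart_source ES x₀)
  let g : A × ES → V := fun q => G (q.1, (chartAt ES x₀).symm q.2)
  have hg : ContDiffAt ℝ ∞ g (t₀, chartAt ES x₀ x₀) := by
    rw [← contMDiffAt_iff_contDiffAt]
    refine ContMDiffAt.comp (I' := 𝓘(ℝ, A).prod 𝓘(ℝ, ES)) (t₀, chartAt ES x₀ x₀) (g := G)
      (f := fun q : A × ES => (q.1, (chartAt ES x₀).symm q.2)) ?_
      (contDiffAt_fst.contMDiffAt.prodMk
        (ContMDiffAt.comp (t₀, chartAt ES x₀ x₀) hψ contDiffAt_snd.contMDiffAt))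
    simpa only [hx] using hG
  have hev : ∀ᶠ q in 𝓝 (t₀, x₀), ContMDiffAt (𝓘(ℝ, A).prod 𝓘(ℝ, ES)) 𝓘(ℝ, V) 1 G q :=
    (contMDiffAt_iff_contMDiffAt_nhds (by decide)).1 (hG.of_le (m := 1) (by decide))
  have h1 : (fun t => (mfderiv 𝓘(ℝ, ES) 𝓘(ℝ, V) (fun x => G (t, x)) x₀ e : V)) =ᶠ[𝓝 t₀]
      fun t => fderiv ℝ (fun z => g (t, z)) (chartAt ES x₀ x₀) e := by
    filter_upwards [(Continuous.prodMk_left x₀).continuousAt.eventually hev] with t ht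
    have : MDifferentiableAt 𝓘(ℝ, ES) 𝓘(ℝ, V) (fun x => G (t, x)) x₀ :=
      (ContMDiffAt.comp (g := G) x₀ ht (contMDiffAt_const.prodMk contMDiffAt_id)).mdifferentiableAt
        (by simp)
    rw [mfderiv_eq_fderiv_chartAt this]
    rfl
  have h2 : MDifferentiableAt 𝓘(ℝ, ES) 𝓘(ℝ, V) (fun x => fderiv ℝ (fun t => G (t, x)) t₀ v) x₀ := by
    have h3 : ContMDiffAt 𝓘(ℝ, ES) 𝓘(ℝ, V) 1
        (fun x => fderiv ℝ (fun t => g (t, chartAt ES x₀ x)) t₀ v) x₀ := by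
      have h4 : ContDiffAt ℝ 1 (fun z => fderiv ℝ (fun t => g (t, z)) t₀ v) (chartAt ES x₀ x₀) := by
        have h5 : ContDiffAt ℝ ∞ (uncurry fun (z : ES) (t : A) => g (t, z))
            (chartAt ES x₀ x₀, t₀) :=
          ContDiffAt.comp (chartAt ES x₀ x₀, t₀) (g := g) (f := fun q : ES × A => (q.2, q.1)) hg
            (contDiffAt_snd.prodMk contDiffAt_fst)
        exact (h5.fderiv (m := 1) contDiffAt_const (by decide)).clm_apply contDiffAt_const
      exact ContMDiffAt.comp x₀ h4.contMDiffAt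
        ((contMDiffOn_chart (I := 𝓘(ℝ, ES))).contMDiffAt (chart_source_mem_nhds ES x₀))
    refine (h3.mdifferentiableAt (by simp)).congr_of_eventuallyEq ?_
    filter_upwards [chart_source_mem_nhds ES x₀] with x hx'
    simp only [g, (chartAt ES x₀).left_inv hx']
  rw [h1.fderiv_eq, mfderiv_eq_fderiv_chartAt h2]
  exact fderiv_fderiv_comm hg v e

end Symmetry

/-! ### The reduction map and its tangent map -/

section Reduction

open Diffeology

variable {S X Y EX EY F : Type*} {n : ℕ}
  [TopologicalSpace S] [ChartedSpace (EuclideanSpace ℝ (Fin n)) S]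
  [IsManifold 𝓘(ℝ, EuclideanSpace ℝ (Fin n)) ∞ S]
  [NormedAddCommGroup EX] [NormedSpace ℝ EX]
  [TopologicalSpace X] [ChartedSpace EX X] [IsManifold 𝓘(ℝ, EX) ∞ X]
  [NormedAddCommGroup EY] [NormedSpace ℝ EY] [FiniteDimensional ℝ EY]
  [TopologicalSpace Y] [ChartedSpace EY Y] [IsManifold 𝓘(ℝ, EY) ∞ Y]
  [NormedAddCommGroup F] [NormedSpace ℝ F] [FiniteDimensional ℝ F]
  {p : Y → X} (hp : Manifold.IsSubmersionOfComplement F 𝓘(ℝ, EY) 𝓘(ℝ, EX) ∞ p) (τ : S → X)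

local notation "ℰ" => EuclideanSpace ℝ (Fin n)
local notation "𝓘Z" => ModelWithCorners.prod (modelWithCornersSelf ℝ EY)
  (modelWithCornersSelf ℝ (ContinuousAlternatingMap ℝ EY ℝ (Fin (n + 1))))
local notation "𝓘M" => ModelWithCorners.prod
  (ModelWithCorners.prod (modelWithCornersSelf ℝ (EuclideanSpace ℝ (Fin n)))
    (modelWithCornersSelf ℝ EY))
  (modelWithCornersSelf ℝ (ContinuousLinearMap (RingHom.id ℝ) F
    (ContinuousAlternatingMap ℝ (EuclideanSpace ℝ (Fin n)) ℝ (Fin n))))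

/-- The reduction of a smooth family of multimomentum fields is jointly smooth in the parameters
and the point; smoothness is tested by evaluation on vertical vectors and on tangent frames. -/
theorem contMDiff_reductionAt {k : ℕ} {c : EuclideanSpace ℝ (Fin k) → MultimomentumSpace hp τ n}
    (hc : IsPlot c) : ContMDiff (𝓘(ℝ, EuclideanSpace ℝ (Fin k)).prod 𝓘(ℝ, ℰ)) 𝓘M ∞
      (fun q : EuclideanSpace ℝ (Fin k) × S => reductionAt hp τ (c q.1) q.2) := by
  intro q₀
  have hc' := Sections.IsPlot.contMDiff hc
  have hy : ContMDiff (𝓘(ℝ, EuclideanSpace ℝ (Fin k)).prod 𝓘(ℝ, ℰ)) 𝓘(ℝ, EY) ∞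
      (fun q : EuclideanSpace ℝ (Fin k) × S => (c q.1 q.2).1) :=
    (contMDiff_proj (FormAt EY (n + 1) : Y → Type _)).comp hc'
  refine contMDiffAt_momentum_of_apply hp (a := fun q : EuclideanSpace ℝ (Fin k) × S => q.2)
    (b := fun q => (c q.1 q.2).1) (μ := fun q => (reductionAt hp τ (c q.1) q.2).2)
    contMDiffAt_snd hy.contMDiffAt fun v hv => ?_
  refine contMDiffAt_form_of_apply (b := fun q : EuclideanSpace ℝ (Fin k) × S => q.2)
    contMDiffAt_snd fun u hu => ?_
  have h := ContMDiffAt.form_apply (b := fun q : EuclideanSpace ℝ (Fin k) × S => (c q.1 q.2).1)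
    (A := fun q => (c q.1 q.2).2)
    (u := fun i q => (Matrix.vecCons (VertAt.incl hp (c q.1 q.2).1 (v (c q.1 q.2).1))
      (fun j => mfderiv 𝓘(ℝ, ℰ) 𝓘(ℝ, EY) (fun x' => (c q.1 x').1) q.2 (u j q.2)) :
        Fin (n + 1) → TangentSpace 𝓘(ℝ, EY) (c q.1 q.2).1) i) (q₀ := q₀) hc'.contMDiffAt ?_
  · exact h
  · intro i
    refine Fin.cases ?_ (fun j => ?_) i
    · exact ((contMDiffAt_vert_iff hp (b := fun y : Y => y)).1 hv).comp q₀ hy.contMDiffAt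
    · exact ContMDiff.mfderiv_partial_right hy contMDiffAt_fst
        ((hu j).comp q₀ contMDiffAt_snd)

theorem contMDiff_reductionAt_right (σ : MultimomentumSpace hp τ n) :
    ContMDiff 𝓘(ℝ, ℰ) 𝓘M ∞ (fun x => reductionAt hp τ σ x) :=
  (contMDiff_reductionAt hp τ (k := 0) (c := fun _ => σ) (isPlot_const)).comp
    ((contMDiff_const (c := (0 : EuclideanSpace ℝ (Fin 0)))).prodMk contMDiff_id)

/-- The reduction map. -/
def reduction (σ : MultimomentumSpace hp τ n) : PhaseSpace hp τ n where
  toFun := reductionAt hp τ σ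
  contMDiff := contMDiff_reductionAt_right hp τ σ
  proj_eq x := Prod.ext rfl (σ.proj_eq x)
  mem_carrier _ := mem_univ _

theorem isReductionMap_reduction : IsReductionMap hp τ (reduction hp τ (n := n)) := fun _ _ => rfl

theorem IsReductionMap.eq_reduction {R : MultimomentumSpace hp τ n → PhaseSpace hp τ n}
    (hR : IsReductionMap hp τ R) : R = reduction hp τ :=
  funext fun σ => Sections.ext_apply (hR σ)

theorem isPlot_reduction {k : ℕ} {c : EuclideanSpace ℝ (Fin k) → MultimomentumSpace hp τ n}
    (hc : IsPlot c) : IsPlot (fun t => reduction hp τ (c t)) := contMDiff_reductionAt hp τ hc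

theorem dsmooth_reduction : DSmooth (reduction hp τ (n := n)) := fun _ _ hc =>
  isPlot_reduction hp τ hc

/-- The momentum at `x₀` as a function of the value `z` of the multimomentum field and of the
coordinates `B` of the derivative at `x₀` of the configuration field. -/
def reductionModel (y₀ : Y) (x₀ : S) (q : FormBundle EY Y (n + 1) × (ℰ →L[ℝ] EY)) :
    MomentumBundle ℰ S hp n :=
  ⟨(x₀, q.1.1), ((ContinuousAlternatingMap.compContinuousLinearMapCLM
    ((mfderiv 𝓘(ℝ, EY) 𝓘(ℝ, EY) (adChart hp y₀).symm (adChart hp y₀ q.1.1) : EY →L[ℝ] EY).comp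
      q.2) :
      (EY [⋀^Fin n]→L[ℝ] ℝ) →L[ℝ] (ℰ [⋀^Fin n]→L[ℝ] ℝ)).comp
        (ContinuousAlternatingMap.curryLeft (E := EY) (F := ℝ) q.1.2)).comp
          (VertAt.incl hp q.1.1)⟩

theorem contMDiffAt_reductionModel (y₀ : Y) (x₀ : S) (q₀ : FormBundle EY Y (n + 1) × (ℰ →L[ℝ] EY))
    (hq : q₀.1.1 ∈ (adChart hp y₀).source) :
    ContMDiffAt (ModelWithCorners.prod 𝓘Z 𝓘(ℝ, ℰ →L[ℝ] EY)) 𝓘M ∞ (reductionModel hp y₀ x₀) q₀ := by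
  have hz : ContMDiff (ModelWithCorners.prod 𝓘Z 𝓘(ℝ, ℰ →L[ℝ] EY)) 𝓘(ℝ, EY) ∞
      (fun q : FormBundle EY Y (n + 1) × (ℰ →L[ℝ] EY) => q.1.1) :=
    (contMDiff_proj (FormAt EY (n + 1) : Y → Type _)).comp contMDiff_fst
  have hz' := ((contMDiffOn_adChart hp y₀).contMDiffAt
    ((adChart hp y₀).open_source.mem_nhds hq)).comp q₀ hz.contMDiffAt
  refine contMDiffAt_momentum_of_apply hp (a := fun _ => x₀)
    (b := fun q : FormBundle EY Y (n + 1) × (ℰ →L[ℝ] EY) => q.1.1)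
    (μ := fun q => (reductionModel hp y₀ x₀ q).2)
    contMDiffAt_const hz.contMDiffAt fun v hv => ?_
  refine contMDiffAt_form_of_apply contMDiffAt_const fun u _ => ?_
  have h := ContMDiffAt.form_apply
    (b := fun q : FormBundle EY Y (n + 1) × (ℰ →L[ℝ] EY) => q.1.1) (A := fun q => q.1.2)
    (u := fun i q => (Matrix.vecCons (VertAt.incl hp q.1.1 (v q.1.1))
      (fun j => mfderiv 𝓘(ℝ, EY) 𝓘(ℝ, EY) (adChart hp y₀).symm (adChart hp y₀ q.1.1)
        (q.2 (u j x₀))) :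
        Fin (n + 1) → EY) i) (q₀ := q₀)
    (contMDiffAt_fst (I := 𝓘Z) (J := 𝓘(ℝ, ℰ →L[ℝ] EY)) (n := ∞)
      (M := FormBundle EY Y (n + 1)) (N := ℰ →L[ℝ] EY)) ?_
  · exact h
  · intro i
    refine Fin.cases ?_ (fun j => ?_) i
    · exact ((contMDiffAt_vert_iff hp (b := fun y : Y => y)).1 hv).comp q₀ hz.contMDiffAt
    · have h0 : ContMDiff 𝓘(ℝ, ℰ →L[ℝ] EY) 𝓘(ℝ, EY) ∞
          (fun B : ℰ →L[ℝ] EY => B (show ℰ from u j x₀)) :=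
        (ContinuousLinearMap.apply ℝ EY (show ℰ from u j x₀)).contDiff.contMDiff
      have h1 : ContMDiffAt (ModelWithCorners.prod 𝓘Z 𝓘(ℝ, ℰ →L[ℝ] EY)) 𝓘(ℝ, EY) ∞
          (fun q : FormBundle EY Y (n + 1) × (ℰ →L[ℝ] EY) => q.2 (show ℰ from u j x₀)) q₀ :=
        (h0.comp (contMDiff_snd (I := 𝓘Z) (J := 𝓘(ℝ, ℰ →L[ℝ] EY)) (n := ∞)
          (M := FormBundle EY Y (n + 1)) (N := ℰ →L[ℝ] EY))).contMDiffAt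
      have h2 := (contMDiffOn_adChart_symm hp y₀).mfderiv_along (adChart hp y₀).open_target
        (b := fun q : FormBundle EY Y (n + 1) × (ℰ →L[ℝ] EY) => adChart hp y₀ q.1.1)
        ((adChart hp y₀).map_source hq) (contMDiffAt_tangent_vectorSpace.2 ⟨hz', h1⟩)
      refine h2.congr_of_eventuallyEq ?_
      filter_upwards [hz.continuous.continuousAt.eventually_mem
        ((adChart hp y₀).open_source.mem_nhds hq)] with q hq'
      exact TotalSpace.ext ((adChart hp y₀).left_inv hq').symm HEq.rfl

/-- The coordinates of the derivative at `x` of the configuration field. -/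
def configDeriv (y₀ : Y) (σ : MultimomentumSpace hp τ n) (x : S) : ℰ →L[ℝ] EY :=
  (chartD hp y₀ (σ x).1 : EY →L[ℝ] EY).comp
    (mfderiv 𝓘(ℝ, ℰ) 𝓘(ℝ, EY) (fun x' => (σ x').1) x : ℰ →L[ℝ] EY)

/-- In an adapted chart the reduction of `σ` at `x` depends only on the value of `σ` and on the
first derivative of its configuration at `x`. -/
theorem reduction_eq_reductionModel (y₀ : Y) (σ : MultimomentumSpace hp τ n) (x : S)
    (hy : (σ x).1 ∈ (adChart hp y₀).source) :
    reduction hp τ σ x = reductionModel hp y₀ x (σ x, configDeriv hp τ y₀ σ x) := by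
  refine TotalSpace.ext rfl (heq_of_eq ?_)
  refine ContinuousLinearMap.ext fun v => ContinuousAlternatingMap.ext fun u => ?_
  change (σ x).2 _ = (σ x).2 _
  congr 1
  funext i
  refine Fin.cases rfl (fun j => ?_) i
  exact (chartDInv_chartD hp y₀ (σ x).1 hy _).symm

theorem contMDiff_config {k : ℕ} {c : EuclideanSpace ℝ (Fin k) → MultimomentumSpace hp τ n}
    (hc : IsPlot c) : ContMDiff (𝓘(ℝ, EuclideanSpace ℝ (Fin k)).prod 𝓘(ℝ, ℰ)) 𝓘(ℝ, EY) ∞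
      (fun q : EuclideanSpace ℝ (Fin k) × S => (c q.1 q.2).1) :=
  (contMDiff_proj (FormAt EY (n + 1) : Y → Type _)).comp (Sections.IsPlot.contMDiff hc)

theorem contDiffAt_configDeriv {k : ℕ} {c : EuclideanSpace ℝ (Fin k) → MultimomentumSpace hp τ n}
    (hc : IsPlot c) (t₀ : EuclideanSpace ℝ (Fin k)) (x₀ : S) (y₀ : Y)
    (hy : (c t₀ x₀).1 ∈ (adChart hp y₀).source) :
    ContDiffAt ℝ ∞ (fun t => configDeriv hp τ y₀ (c t) x₀) t₀ := by
  rw [← contMDiffAt_iff_contDiffAt]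
  refine contMDiffAt_clm_of_apply fun e => ?_
  have h := ContMDiff.mfderiv_partial_right (contMDiff_config hp τ hc)
      (IM := 𝓘(ℝ, EuclideanSpace ℝ (Fin k)))
    (a := fun t => t) (b := fun _ => x₀) (w := fun _ => e) (q₀ := t₀) contMDiffAt_id
      contMDiffAt_const
  exact ((contMDiffAt_tangent_iff_chartD hp y₀ (b := fun t => (c t x₀).1) hy).1 h).2

theorem mdifferentiableAt_section_config (σ : MultimomentumSpace hp τ n) (x : S) :
    MDifferentiableAt 𝓘(ℝ, ℰ) 𝓘(ℝ, EY) (fun x' => (σ x').1) x :=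
  ((contMDiff_proj (n := ∞) (IB := 𝓘(ℝ, EY)) (FormAt EY (n + 1) : Y → Type _)).comp
    σ.contMDiff).mdifferentiableAt (by simp)

theorem configDeriv_apply (y₀ : Y) (σ : MultimomentumSpace hp τ n) (x : S)
    (hy : (σ x).1 ∈ (adChart hp y₀).source) (e : TangentSpace 𝓘(ℝ, ℰ) x) :
    configDeriv hp τ y₀ σ x e =
      mfderiv 𝓘(ℝ, ℰ) 𝓘(ℝ, EY) (fun x' => adChart hp y₀ (σ x').1) x e := by
  have h := mfderiv_comp x (g := adChart hp y₀) (I' := 𝓘(ℝ, EY))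
    ((adChart_mdifferentiable hp y₀).mdifferentiableAt hy)
    (mdifferentiableAt_section_config hp τ σ x)
  exact (congrArg (fun L => L e) h).symm

/-- The vertical vector field along the configuration field of `σ` which is the projection of the
tangent vector `V` at `σ`. -/
def multimomentumConfigVelocity (σ : MultimomentumSpace hp τ n) (V : SectionTangent σ) (x : S) :
    TangentSpace 𝓘(ℝ, EY) (σ x).1 :=
  mfderiv 𝓘Z 𝓘(ℝ, EY) (TotalSpace.proj : FormBundle EY Y (n + 1) → Y) (σ x) (V.1 x)

theorem mfderiv_plot_config {k : ℕ} {c : EuclideanSpace ℝ (Fin k) → MultimomentumSpace hp τ n}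
    (hc : IsPlot c) (t v : EuclideanSpace ℝ (Fin k)) (x : S) :
    mfderiv 𝓘(ℝ, EuclideanSpace ℝ (Fin k)) 𝓘(ℝ, EY) (fun t => (c t x).1) t v =
      multimomentumConfigVelocity hp τ (c t) (velocity c hc t v) x := by
  have h := mfderiv_comp t (g := (TotalSpace.proj : FormBundle EY Y (n + 1) → Y)) (I' := 𝓘Z)
    (I'' := 𝓘(ℝ, EY))
    ((contMDiff_proj (n := ∞) (FormAt EY (n + 1) : Y → Type _)).mdifferentiableAt (by simp))
    ((velocityFun_contMDiff_left hc x).mdifferentiableAt (x := t) (by simp))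
  exact congrArg (fun L => L v) h

/-- The derivative of the coordinates of the derivative of the configuration field, along a family
of sections, only depends on the velocity of the family: derivatives commute. -/
theorem fderiv_configDeriv {k : ℕ} {c : EuclideanSpace ℝ (Fin k) → MultimomentumSpace hp τ n}
    (hc : IsPlot c) (t v : EuclideanSpace ℝ (Fin k)) (x₀ : S) (y₀ : Y)
    (hy : (c t x₀).1 ∈ (adChart hp y₀).source) (e : TangentSpace 𝓘(ℝ, ℰ) x₀) :
    fderiv ℝ (fun t => configDeriv hp τ y₀ (c t) x₀) t v e =
      mfderiv 𝓘(ℝ, ℰ) 𝓘(ℝ, EY) (fun x => chartD hp y₀ (c t x).1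
        (multimomentumConfigVelocity hp τ (c t) (velocity c hc t v) x)) x₀ e := by
  have hG : ContMDiffAt (𝓘(ℝ, EuclideanSpace ℝ (Fin k)).prod 𝓘(ℝ, ℰ)) 𝓘(ℝ, EY) ∞
      (fun q : EuclideanSpace ℝ (Fin k) × S => adChart hp y₀ (c q.1 q.2).1) (t, x₀) :=
    ContMDiffAt.comp (t, x₀) ((contMDiffOn_adChart hp y₀).contMDiffAt
      ((adChart hp y₀).open_source.mem_nhds hy)) (contMDiff_config hp τ hc).contMDiffAt
  have h1 := fderiv_mfderiv_comm hG v e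
  have hcont := (contMDiff_config hp τ hc).continuous
  have h2 : (fun t' => configDeriv hp τ y₀ (c t') x₀ e) =ᶠ[𝓝 t] fun t' =>
      mfderiv 𝓘(ℝ, ℰ) 𝓘(ℝ, EY) (fun x' => adChart hp y₀ (c t' x').1) x₀ e := by
    filter_upwards [(hcont.comp (Continuous.prodMk_left x₀)).continuousAt.eventually_mem
      ((adChart hp y₀).open_source.mem_nhds hy)] with t' ht'
    exact configDeriv_apply hp τ y₀ (c t') x₀ ht' e
  have h3 : (fun x => fderiv ℝ (fun t' => adChart hp y₀ (c t' x).1) t v) =ᶠ[𝓝 x₀] fun x =>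
      chartD hp y₀ (c t x).1
        (multimomentumConfigVelocity hp τ (c t) (velocity c hc t v) x) := by
    filter_upwards [(hcont.comp (Continuous.prodMk_right t)).continuousAt.eventually_mem
      ((adChart hp y₀).open_source.mem_nhds hy)] with x hx
    have h := mfderiv_comp t (g := adChart hp y₀) (I' := 𝓘(ℝ, EY))
      (f := fun t' => (c t' x).1)
      ((adChart_mdifferentiable hp y₀).mdifferentiableAt hx)
      (((contMDiff_config hp τ hc).comp (contMDiff_id.prodMk contMDiff_const)).mdifferentiableAt
        (by simp))
    rw [← mfderiv_eq_fderiv, ← mfderiv_plot_config]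
    exact congrArg (fun L => L v) h
  have h4 : fderiv ℝ (fun t => configDeriv hp τ y₀ (c t) x₀) t v e =
      fderiv ℝ (fun t => configDeriv hp τ y₀ (c t) x₀ e) t v := by
    have h := ((contDiffAt_configDeriv hp τ hc t x₀ y₀ hy).differentiableAt (by simp)).hasFDerivAt
    have h' := ((ContinuousLinearMap.apply ℝ EY (show ℰ from e)).hasFDerivAt.comp t h).fderiv
    exact (congrArg (fun L => L v) h').symm
  rw [h4, h2.fderiv_eq, ← h3.mfderiv_eq]
  exact h1

/-- The derivative of `reductionModel` at the point given by `σ`. -/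
def reductionModelDeriv (σ : MultimomentumSpace hp τ n) (x : S)
    (w : EY × (EY [⋀^Fin (n + 1)]→L[ℝ] ℝ)) (B : ℰ →L[ℝ] EY) :
    (ℰ × EY) × (F →L[ℝ] (ℰ [⋀^Fin n]→L[ℝ] ℝ)) :=
  mfderiv (ModelWithCorners.prod 𝓘Z 𝓘(ℝ, ℰ →L[ℝ] EY)) 𝓘M (reductionModel hp (σ x).1 x)
    (σ x, configDeriv hp τ (σ x).1 σ x) (w, B)

/-- The velocity of the reduced family at `x` is determined by the velocity of the family at `x`
and the derivative, along the parameters, of the first derivative of the configuration. -/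
theorem velocityFun_reduction {k : ℕ} {c : EuclideanSpace ℝ (Fin k) → MultimomentumSpace hp τ n}
    (hc : IsPlot c) (t v : EuclideanSpace ℝ (Fin k)) (x : S) :
    (velocityFun (fun t => reduction hp τ (c t)) t v x :
      (ℰ × EY) × (F →L[ℝ] (ℰ [⋀^Fin n]→L[ℝ] ℝ))) =
      reductionModelDeriv hp τ (c t) x (velocityFun c t v x)
        (fderiv ℝ (fun t' => configDeriv hp τ (c t x).1 (c t') x) t v) := by
  have hy := mem_adChart_source hp (c t x).1
  have h1 : (fun t' => reduction hp τ (c t') x) =ᶠ[𝓝 t] fun t' =>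
      reductionModel hp (c t x).1 x (c t' x, configDeriv hp τ (c t x).1 (c t') x) := by
    filter_upwards [((contMDiff_config hp τ hc).continuous.comp
      (Continuous.prodMk_left x)).continuousAt.eventually_mem
      ((adChart hp (c t x).1).open_source.mem_nhds hy)] with t' ht'
    exact reduction_eq_reductionModel hp τ _ _ _ ht'
  have hd1 : MDifferentiableAt 𝓘(ℝ, EuclideanSpace ℝ (Fin k)) 𝓘Z (fun t' => c t' x) t :=
    (velocityFun_contMDiff_left hc x).mdifferentiableAt (by simp)
  have hd2 : MDifferentiableAt 𝓘(ℝ, EuclideanSpace ℝ (Fin k)) 𝓘(ℝ, ℰ →L[ℝ] EY)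
      (fun t' => configDeriv hp τ (c t x).1 (c t') x) t :=
    ((contDiffAt_configDeriv hp τ hc t x _ hy).contMDiffAt).mdifferentiableAt (by simp)
  have hd3 := (contMDiffAt_reductionModel hp (c t x).1 x
      (c t x, configDeriv hp τ (c t x).1 (c t) x) hy).mdifferentiableAt (by simp)
  have h2 := mfderiv_comp_model t (g := reductionModel hp (c t x).1 x)
    (f := fun t' => (c t' x, configDeriv hp τ (c t x).1 (c t') x)) hd3 (hd1.prodMk hd2) v
  have h3 := mfderiv_prodMk_model hd1 hd2 v
  have h5 : (mfderiv 𝓘(ℝ, EuclideanSpace ℝ (Fin k)) 𝓘(ℝ, ℰ →L[ℝ] EY)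
      (fun t' => configDeriv hp τ (c t x).1 (c t') x) t v : ℰ →L[ℝ] EY) =
      fderiv ℝ (fun t' => configDeriv hp τ (c t x).1 (c t') x) t v :=
    congrArg (fun L : EuclideanSpace ℝ (Fin k) →L[ℝ] (ℰ →L[ℝ] EY) => L v) mfderiv_eq_fderiv
  have h4 := mfderiv_apply_congr (IM := 𝓘(ℝ, EuclideanSpace ℝ (Fin k))) (IN := 𝓘M) h1 v
  -- The equalities are stated in the model space, as the tangent spaces at the two base points
  -- are different types.
  refine Eq.trans (α := (ℰ × EY) × (F →L[ℝ] (ℰ [⋀^Fin n]→L[ℝ] ℝ))) h4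
    (Eq.trans (α := (ℰ × EY) × (F →L[ℝ] (ℰ [⋀^Fin n]→L[ℝ] ℝ))) h2 ?_)
  refine (congrArg (fun w : (EY × (EY [⋀^Fin (n + 1)]→L[ℝ] ℝ)) × (ℰ →L[ℝ] EY) =>
    reductionModelDeriv hp τ (c t) x w.1 w.2) h3).trans ?_
  exact congrArg (reductionModelDeriv hp τ (c t) x (velocityFun c t v x)) h5

/-- The velocity of the image of a smooth family by the reduction map only depends on the velocity
of the family. -/
theorem velocity_reduction_congr {k k' : ℕ}
    {c : EuclideanSpace ℝ (Fin k) → MultimomentumSpace hp τ n} (hc : IsPlot c)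
    {c' : EuclideanSpace ℝ (Fin k') → MultimomentumSpace hp τ n} (hc' : IsPlot c')
    (t v : EuclideanSpace ℝ (Fin k)) (t' v' : EuclideanSpace ℝ (Fin k')) (h0 : c t = c' t')
    (h : ∀ x, (velocityFun c t v x : EY × (EY [⋀^Fin (n + 1)]→L[ℝ] ℝ)) = velocityFun c' t' v' x)
    (x : S) :
    (velocityFun (fun t => reduction hp τ (c t)) t v x :
      (ℰ × EY) × (F →L[ℝ] (ℰ [⋀^Fin n]→L[ℝ] ℝ))) =
      velocityFun (fun t => reduction hp τ (c' t)) t' v' x := by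
  refine (velocityFun_reduction hp τ hc t v x).trans
    (Eq.trans ?_ (velocityFun_reduction hp τ hc' t' v' x).symm)
  have hV : ∀ {σ σ' : MultimomentumSpace hp τ n} (V : SectionTangent σ) (V' : SectionTangent σ'),
      σ = σ' → (∀ x, (V.1 x : EY × (EY [⋀^Fin (n + 1)]→L[ℝ] ℝ)) = V'.1 x) → ∀ e : ℰ,
      (mfderiv 𝓘(ℝ, ℰ) 𝓘(ℝ, EY) (fun x' => chartD hp (σ x).1 (σ x').1
        (multimomentumConfigVelocity hp τ σ V x')) x e : EY) =
      mfderiv 𝓘(ℝ, ℰ) 𝓘(ℝ, EY) (fun x' => chartD hp (σ' x).1 (σ' x').1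
        (multimomentumConfigVelocity hp τ σ' V' x')) x e := by
    rintro σ _ V V' rfl h e
    obtain rfl : V = V' := Subtype.ext (funext h)
    rfl
  have h4 : fderiv ℝ (fun t' => configDeriv hp τ (c t x).1 (c t') x) t v =
      fderiv ℝ (fun s => configDeriv hp τ (c' t' x).1 (c' s) x) t' v' := by
    refine ContinuousLinearMap.ext fun e => ?_
    exact (fderiv_configDeriv hp τ hc t v x _ (mem_adChart_source hp _) e).trans
      ((hV (velocity c hc t v) (velocity c' hc' t' v') h0 h e).trans
        (fderiv_configDeriv hp τ hc' t' v' x _ (mem_adChart_source hp _) e).symm)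
  exact congr (congr (congrArg (fun σ => reductionModelDeriv hp τ σ x) h0) (h x)) h4

end Reduction

/-! ### Tangent maps and two-forms determined by families -/

section TangentMap

open Diffeology

variable {ES EK HK EB HB S K B EK' HK' EB' HB' K' B' : Type*}
  [NormedAddCommGroup ES] [NormedSpace ℝ ES] [FiniteDimensional ℝ ES]
  [NormedAddCommGroup EK] [NormedSpace ℝ EK] [TopologicalSpace HK]
  [NormedAddCommGroup EB] [NormedSpace ℝ EB] [TopologicalSpace HB]
  {IK : ModelWithCorners ℝ EK HK} {IB : ModelWithCorners ℝ EB HB}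
  [TopologicalSpace S] [ChartedSpace ES S] [IsManifold 𝓘(ℝ, ES) ∞ S] [CompactSpace S] [T2Space S]
  [TopologicalSpace K] [ChartedSpace HK K] [IsManifold IK ∞ K]
  [TopologicalSpace B] [ChartedSpace HB B]
  {D : SectionData IK IB S K B}
  [NormedAddCommGroup EK'] [NormedSpace ℝ EK'] [TopologicalSpace HK']
  [NormedAddCommGroup EB'] [NormedSpace ℝ EB'] [TopologicalSpace HB']
  {IK' : ModelWithCorners ℝ EK' HK'} {IB' : ModelWithCorners ℝ EB' HB'}
  [TopologicalSpace K'] [ChartedSpace HK' K'] [IsManifold IK' ∞ K']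
  [TopologicalSpace B'] [ChartedSpace HB' B']
  {D' : SectionData IK' IB' S K' B'}

theorem velocity_add {k : ℕ} {c : EuclideanSpace ℝ (Fin k) → Sections 𝓘(ℝ, ES) D} (hc : IsPlot c)
    (t v w : EuclideanSpace ℝ (Fin k)) :
    velocity c hc t (v + w) = velocity c hc t v + velocity c hc t w :=
  Subtype.ext (funext fun _ => map_add _ _ _)

theorem velocity_smul {k : ℕ} {c : EuclideanSpace ℝ (Fin k) → Sections 𝓘(ℝ, ES) D} (hc : IsPlot c)
    (t v : EuclideanSpace ℝ (Fin k)) (r : ℝ) :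
    velocity c hc t (r • v) = r • velocity c hc t v :=
  Subtype.ext (funext fun _ => map_smul _ _ _)

/-- A smooth map between spaces of sections has a unique tangent map as soon as the velocity of the
image of a smooth family only depends on the velocity of the family. -/
theorem existsUnique_isTangentMap (hD : ∀ k ∈ D.carrier, Nonempty (AdaptedChart D k))
    {R : Sections 𝓘(ℝ, ES) D → Sections 𝓘(ℝ, ES) D'} (hR : DSmooth R)
    (hcongr : ∀ {k k' : ℕ}
      {c : EuclideanSpace ℝ (Fin k) → Sections 𝓘(ℝ, ES) D} (_ : IsPlot c)
      {c' : EuclideanSpace ℝ (Fin k') → Sections 𝓘(ℝ, ES) D} (_ : IsPlot c')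
      (t v : EuclideanSpace ℝ (Fin k)) (t' v' : EuclideanSpace ℝ (Fin k')) (_ : c t = c' t')
      (_ : ∀ x, (velocityFun c t v x : EK) = velocityFun c' t' v' x) (x : S),
      (velocityFun (fun t => R (c t)) t v x : EK') = velocityFun (fun t => R (c' t)) t' v' x) :
    ∃! TR : ∀ s, SectionTangent s →ₗ[ℝ] SectionTangent (R s), IsTangentMap R TR := by
  have hU : ∀ (s : Sections 𝓘(ℝ, ES) D) (V : SectionTangent s), ∃ U : SectionTangent (R s),
      ∀ {k : ℕ} (c : EuclideanSpace ℝ (Fin k) → Sections 𝓘(ℝ, ES) D) (_ : IsPlot c)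
        (t v : EuclideanSpace ℝ (Fin k)), c t = s →
        (∀ x, (velocityFun c t v x : EK) = V.1 x) →
        ∀ x, (velocityFun (fun t => R (c t)) t v x : EK') = U.1 x := by
    intro s V
    obtain ⟨c, hc, rfl, hV, -⟩ := exists_plot_velocity_eq hD V V
    refine ⟨velocity (fun t => R (c t)) (hR _ _ hc) 0 (EuclideanSpace.single 0 1), ?_⟩
    intro k c' hc' t v h0 h x
    exact hcongr hc' hc t v 0 _ h0 (fun x => (h x).trans (hV x).symm) x
  choose T hT using hU
  have hadd : ∀ s (V W : SectionTangent s), T s (V + W) = T s V + T s W := by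
    intro s V W
    obtain ⟨c, hc, rfl, hV, hW⟩ := exists_plot_velocity_eq hD V W
    have hV' : velocity c hc 0 (EuclideanSpace.single 0 1) = V := Subtype.ext (funext hV)
    have hW' : velocity c hc 0 (EuclideanSpace.single 1 1) = W := Subtype.ext (funext hW)
    have hRc : IsPlot (fun t => R (c t)) := hR _ _ hc
    have e : ∀ (v) (V : SectionTangent (c 0)), velocity c hc 0 v = V →
        velocity (fun t => R (c t)) hRc 0 v = T (c 0) V := by
      rintro v _ rfl
      exact Subtype.ext (funext fun x => hT _ _ c hc 0 v rfl (fun _ => rfl) x)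
    rw [← e _ _ hV', ← e _ _ hW', ← velocity_add]
    exact (e _ _ (by rw [velocity_add, hV', hW'])).symm
  have hsmul : ∀ s (r : ℝ) (V : SectionTangent s), T s (r • V) = r • T s V := by
    intro s r V
    obtain ⟨c, hc, rfl, hV, -⟩ := exists_plot_velocity_eq hD V V
    have hV' : velocity c hc 0 (EuclideanSpace.single 0 1) = V := Subtype.ext (funext hV)
    have hRc : IsPlot (fun t => R (c t)) := hR _ _ hc
    have e : ∀ (v) (V : SectionTangent (c 0)), velocity c hc 0 v = V →
        velocity (fun t => R (c t)) hRc 0 v = T (c 0) V := by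
      rintro v _ rfl
      exact Subtype.ext (funext fun x => hT _ _ c hc 0 v rfl (fun _ => rfl) x)
    rw [← e _ _ hV', ← velocity_smul]
    exact (e _ _ (by rw [velocity_smul, hV'])).symm
  refine ⟨fun s => { toFun := T s, map_add' := hadd s, map_smul' := hsmul s }, ?_, ?_⟩
  · intro k c hc hRc t v
    exact Subtype.ext (funext fun x => (hT _ _ c hc t v rfl (fun _ => rfl) x).symm)
  · intro TR hTR
    funext s
    refine LinearMap.ext fun V => ?_
    refine SectionTangent.induction₂ hD (P := fun s V _ => TR s V = T s V) ?_ V V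
    intro c hc t v _
    rw [hTR c hc (hR _ _ hc) t v]
    exact Subtype.ext (funext fun x => hT _ _ c hc t v rfl (fun _ => rfl) x)

/-- A two-form is determined by its values on the velocities of smooth families. -/
theorem TwoForm.ext_velocity (hD : ∀ k ∈ D.carrier, Nonempty (AdaptedChart D k))
    {β β' : TwoForm 𝓘(ℝ, ES) D}
    (h : ∀ (c : EuclideanSpace ℝ (Fin 2) → Sections 𝓘(ℝ, ES) D) (hc : IsPlot c)
      (t v w : EuclideanSpace ℝ (Fin 2)),
      β (c t) ![velocity c hc t v, velocity c hc t w] =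
        β' (c t) ![velocity c hc t v, velocity c hc t w]) : β = β' := by
  funext s
  refine AlternatingMap.ext fun U => ?_
  have h' := SectionTangent.induction₂ hD (P := fun s V W => β s ![V, W] = β' s ![V, W])
    (fun c hc t v w => h c hc t v w) (U 0) (U 1)
  have hU : U = ![U 0, U 1] := by
    funext i
    fin_cases i <;> rfl
  rw [hU]
  exact h'

theorem IsExtDeriv.unique (hD : ∀ k ∈ D.carrier, Nonempty (AdaptedChart D k))
    {α : TangentFunction 𝓘(ℝ, ES) D} {β β' : TwoForm 𝓘(ℝ, ES) D} (h : IsExtDeriv α β)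
    (h' : IsExtDeriv α β') : β = β' :=
  TwoForm.ext_velocity hD fun c hc t v w => (h.eq c hc t v w).trans (h'.eq c hc t v w).symm

/-- Exterior derivatives are smooth. -/
theorem IsExtDeriv.contDiff {α : TangentFunction 𝓘(ℝ, ES) D} {β : TwoForm 𝓘(ℝ, ES) D}
    (h : IsExtDeriv α β) {k : ℕ} (c : EuclideanSpace ℝ (Fin k) → Sections 𝓘(ℝ, ES) D)
    (hc : IsPlot c) (v w : EuclideanSpace ℝ (Fin k)) :
    ContDiff ℝ ∞ (fun t => β (c t) ![velocity c hc t v, velocity c hc t w]) := by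
  simp_rw [h.eq]
  exact (((h.isSmoothOneForm.contDiff c hc w).fderiv_right (m := ∞) (by simp)).clm_apply
    contDiff_const).sub (((h.isSmoothOneForm.contDiff c hc v).fderiv_right (m := ∞)
      (by simp)).clm_apply contDiff_const)

/-- Exterior derivatives are closed: second derivatives commute. -/
theorem IsExtDeriv.closed {α : TangentFunction 𝓘(ℝ, ES) D} {β : TwoForm 𝓘(ℝ, ES) D}
    (h : IsExtDeriv α β) {k : ℕ} (c : EuclideanSpace ℝ (Fin k) → Sections 𝓘(ℝ, ES) D)
    (hc : IsPlot c) (t u v w : EuclideanSpace ℝ (Fin k)) :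
    fderiv ℝ (fun t' => β (c t') ![velocity c hc t' v, velocity c hc t' w]) t u +
      fderiv ℝ (fun t' => β (c t') ![velocity c hc t' w, velocity c hc t' u]) t v +
      fderiv ℝ (fun t' => β (c t') ![velocity c hc t' u, velocity c hc t' v]) t w = 0 := by
  have hs : ∀ v, ContDiff ℝ ∞ (fun t => α (c t) (velocity c hc t v)) :=
    h.isSmoothOneForm.contDiff c hc
  have hd : ∀ v w, DifferentiableAt ℝ
      (fun t' => fderiv ℝ (fun t => α (c t) (velocity c hc t v)) t' w) t := fun v w =>
    (((hs v).fderiv_right (m := ∞) (by simp)).clm_apply contDiff_const).differentiable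
      (by simp) t
  have hsub : ∀ u v w, fderiv ℝ (fun t' => β (c t') ![velocity c hc t' v, velocity c hc t' w]) t u =
      fderiv ℝ (fun t' => fderiv ℝ (fun t => α (c t) (velocity c hc t w)) t' v) t u -
      fderiv ℝ (fun t' => fderiv ℝ (fun t => α (c t) (velocity c hc t v)) t' w) t u := by
    intro u v w
    simp_rw [h.eq]
    exact congrArg (fun L => L u) (fderiv_sub (hd w v) (hd v w))
  have hcomm : ∀ w u v,
      fderiv ℝ (fun t' => fderiv ℝ (fun t => α (c t) (velocity c hc t w)) t' v) t u =
      fderiv ℝ (fun t' => fderiv ℝ (fun t => α (c t) (velocity c hc t w)) t' u) t v := by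
    intro w u v
    have h2 := (hs w).contDiffAt.isSymmSndFDerivAt (x := t) (by simp; decide)
    have e : ∀ v u, fderiv ℝ (fun t' => fderiv ℝ (fun t => α (c t) (velocity c hc t w)) t' v) t u =
        fderiv ℝ (fderiv ℝ (fun t => α (c t) (velocity c hc t w))) t u v := by
      intro v u
      have h3 := (((hs w).fderiv_right (m := ∞) (by simp)).differentiable (by simp) t).hasFDerivAt
      exact congrArg (fun L => L u)
        ((ContinuousLinearMap.apply ℝ ℝ v).hasFDerivAt.comp t h3).fderiv
    rw [e, e]
    exact h2 u v
  rw [hsub, hsub, hsub, hcomm w u v, hcomm u v w, hcomm v u w]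
  ring

end TangentMap

/-! ### Integrals of forms depending on parameters -/

section ParametricIntegral

open MeasureTheory

variable {P G : Type*} [NormedAddCommGroup P] [NormedSpace ℝ P]
  [NormedAddCommGroup G] [NormedSpace ℝ G] [MeasurableSpace G] [BorelSpace G]
  {μ : Measure G} {g : P × G → ℝ} {C : Set G}

/-- An integral with parameters is the value at `0` of a convolution with the constant `1`;
this makes the differentiability of convolutions with parameters available. -/
theorem integral_convolution_const (g : P × G → ℝ) [μ.IsAddHaarMeasure] [FiniteDimensional ℝ G]
    (t : P) :
    (MeasureTheory.convolution (fun _ : G => (1 : ℝ)) (fun z => g (t, z))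
      (ContinuousLinearMap.mul ℝ ℝ) μ) 0 = ∫ z, g (t, z) ∂μ := by
  rw [convolution_def]
  simp only [ContinuousLinearMap.mul_apply', one_mul]
  exact integral_sub_left_eq_self (fun z => g (t, z)) μ 0

theorem contDiff_integral_of_compact [μ.IsAddHaarMeasure] [FiniteDimensional ℝ G]
    (hg : ContDiff ℝ ∞ g) (hC : IsCompact C) (h0 : ∀ t z, z ∉ C → g (t, z) = 0) :
    ContDiff ℝ ∞ (fun t => ∫ z, g (t, z) ∂μ) := by
  rw [← contDiffOn_univ]
  have h := contDiffOn_convolution_right_with_param_comp (n := ⊤) (𝕜 := ℝ) (μ := μ)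
    (ContinuousLinearMap.mul ℝ ℝ) (s := univ) (v := fun _ : P => (0 : G)) contDiffOn_const
    (f := fun _ => (1 : ℝ)) (g := fun t z => g (t, z)) isOpen_univ hC (fun t z _ hz => h0 t z hz)
    (locallyIntegrable_const _) hg.contDiffOn
  refine h.congr fun t _ => ?_
  exact (integral_convolution_const g t).symm

/-- Differentiation under the integral sign for integrands with support in a fixed compact set. -/
theorem fderiv_integral_of_compact [μ.IsAddHaarMeasure] [FiniteDimensional ℝ G]
    (hg : ContDiff ℝ ∞ g) (hC : IsCompact C) (h0 : ∀ t z, z ∉ C → g (t, z) = 0) (t v : P) :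
    fderiv ℝ (fun t => ∫ z, g (t, z) ∂μ) t v = ∫ z, fderiv ℝ (fun t => g (t, z)) t v ∂μ := by
  have hpart : ∀ z, HasFDerivAt (fun t => g (t, z))
      ((fderiv ℝ g (t, z)).comp (ContinuousLinearMap.inl ℝ P G)) t := fun z =>
    (hg.differentiable (by simp) (t, z)).hasFDerivAt.comp t (hasFDerivAt_prodMk_left t z)
  have h := hasFDerivAt_convolution_right_with_param (𝕜 := ℝ) (μ := μ)
    (ContinuousLinearMap.mul ℝ ℝ) (s := univ)
    (f := fun _ => (1 : ℝ)) (g := fun t z => g (t, z)) isOpen_univ hC (fun t z _ hz => h0 t z hz)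
    (locallyIntegrable_const _) (hg.of_le (by simp)).contDiffOn (t, 0) (mem_univ _)
  have h' := (HasFDerivAt.comp (𝕜 := ℝ) (f := fun t : P => (t, (0 : G))) t h
    (hasFDerivAt_prodMk_left t (0 : G))).fderiv
  have e : (fun q : P × G => (MeasureTheory.convolution (fun _ : G => (1 : ℝ))
      (fun z => g (q.1, z)) (ContinuousLinearMap.mul ℝ ℝ) μ) q.2) ∘ (fun t : P => (t, (0 : G))) =
      fun t => ∫ z, g (t, z) ∂μ := funext fun t => integral_convolution_const g t
  rw [e] at h'
  rw [h', convolution_def]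
  have hcont : Continuous (fun z : G => fderiv ℝ g (t, z)) :=
    (hg.continuous_fderiv (by simp)).comp (Continuous.prodMk_right t)
  have hsupp : HasCompactSupport (fun z : G => fderiv ℝ g (t, z)) := by
    refine HasCompactSupport.intro hC fun z hz => ?_
    have : g =ᶠ[𝓝 (t, z)] fun _ => 0 := by
      filter_upwards [(hC.isClosed.isOpen_compl.preimage continuous_snd).mem_nhds
        (show (t, z) ∈ Prod.snd ⁻¹' Cᶜ from hz)] with q hq using h0 q.1 q.2 hq
    rw [this.fderiv_eq]
    simp
  have hint : Integrable (fun z : G => fderiv ℝ g (t, z)) μ :=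
    hcont.integrable_of_hasCompactSupport hsupp
  have h1 : (∫ z, ((ContinuousLinearMap.mul ℝ ℝ).precompR (P × G)) 1 (fderiv ℝ g (t, 0 - z)) ∂μ) =
      ∫ z, fderiv ℝ g (t, z) ∂μ := by
    rw [← integral_sub_left_eq_self (fun z => fderiv ℝ g (t, z)) μ 0]
    congr 1
    funext z
    refine ContinuousLinearMap.ext fun q => ?_
    simp [ContinuousLinearMap.precompR_apply]
  have h2 : (∫ z, fderiv ℝ g (t, z) ∂μ) (v, 0) = ∫ z, fderiv ℝ g (t, z) (v, 0) ∂μ :=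
    ContinuousLinearMap.integral_apply hint _
  refine (congrArg (fun L : P × G →L[ℝ] ℝ => L (v, 0)) h1).trans (h2.trans ?_)
  congr 1
  funext z
  rw [(hpart z).fderiv]
  rfl

end ParametricIntegral

section IntegralForm

open MeasureTheory

variable {n : ℕ} {S : Type*} [TopologicalSpace S] [ChartedSpace (EuclideanSpace ℝ (Fin n)) S]
  [IsManifold 𝓘(ℝ, EuclideanSpace ℝ (Fin n)) ∞ S]

local notation "ℰ" => EuclideanSpace ℝ (Fin n)

theorem contMDiffAt_chartFrame (i : S) {z : ℰ} (hz : z ∈ (chartAt ℰ i).target) (j : Fin n) :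
    ContMDiffAt 𝓘(ℝ, ℰ) 𝓘(ℝ, ℰ).tangent ∞ (fun z => (⟨(chartAt ℰ i).symm z, chartFrame i z j⟩ :
      TangentBundle 𝓘(ℝ, ℰ) S)) z :=
  (contMDiffOn_chart_symm (I := 𝓘(ℝ, ℰ)) (n := ∞) (x := i)).mfderiv_along
    (chartAt ℰ i).open_target (b := fun z : ℰ => z)
    (w := fun _ : ℰ => EuclideanSpace.single j (1 : ℝ)) hz
    (contMDiffAt_tangent_vectorSpace.2 ⟨contMDiffAt_id, contMDiffAt_const⟩)

/-- The coordinate frame is a basis, so that a nonzero form of maximal degree does not vanish on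
it. -/
theorem form_chartFrame_ne_zero (i : S) {z : ℰ} (hz : z ∈ (chartAt ℰ i).target)
    {A : FormAt ℰ n ((chartAt ℰ i).symm z)} (hA : A ≠ 0) : (A (chartFrame i z) : ℝ) ≠ 0 := by
  have hd : (chartAt ℰ i).MDifferentiable 𝓘(ℝ, ℰ) 𝓘(ℝ, ℰ) := mdifferentiable_chart i
  let L : ℰ ≃L[ℝ] TangentSpace 𝓘(ℝ, ℰ) ((chartAt ℰ i).symm z) := hd.symm.mfderiv hz
  let b : Module.Basis (Fin n) ℝ (TangentSpace 𝓘(ℝ, ℰ) ((chartAt ℰ i).symm z)) :=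
    (EuclideanSpace.basisFun (Fin n) ℝ).toBasis.map L.toLinearEquiv
  have hb : (b : Fin n → TangentSpace 𝓘(ℝ, ℰ) ((chartAt ℰ i).symm z)) = chartFrame i z := by
    funext j
    simp only [b, Module.Basis.map_apply, OrthonormalBasis.coe_toBasis,
      EuclideanSpace.basisFun_apply]
    rfl
  intro h
  apply hA
  have h1 := (AlternatingMap.map_basis_eq_zero_iff b
    (ContinuousAlternatingMap.toAlternatingMap A)).1 (by rw [hb]; exact h)
  ext u
  exact congrArg (fun B => B u) h1

variable [T2Space S] [CompactSpace S]

/-- The density in the preferred chart at `i` whose integral contributes to the integral of a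
form. -/
def integralDensity (o : OrientationForm n S) (i : S) (α : ∀ x : S, FormAt ℰ n x) : ℰ → ℝ :=
  (chartAt ℰ i).target.indicator fun z =>
    chartPartition n S i ((chartAt ℰ i).symm z) *
      (SignType.sign (α := ℝ) (o.toFun ((chartAt ℰ i).symm z) (chartFrame i z)) *
        (α ((chartAt ℰ i).symm z) (chartFrame i z) : ℝ))

variable (n S) in
/-- The finite set of the charts which contribute to integrals. -/
def integralSupport : Set S := {i | (support (chartPartition n S i)).Nonempty}

variable (n S) in
theorem finite_integralSupport : (integralSupport n S).Finite :=
  (chartPartition n S).locallyFinite.finite_nonempty_of_compact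

/-- Only finitely many charts of the partition of unity contribute to the integral of a form. -/
theorem integralForm_eq (o : OrientationForm n S) (α : ∀ x : S, FormAt ℰ n x) :
    integralForm o α = ∑ i ∈ (finite_integralSupport n S).toFinset,
      ∫ z, integralDensity o i α z := by
  have h : ∀ i, ∫ z, integralDensity o i α z = ∫ z in (chartAt ℰ i).target,
    chartPartition n S i ((chartAt ℰ i).symm z) *
      (SignType.sign (α := ℝ) (o.toFun ((chartAt ℰ i).symm z) (chartFrame i z)) *
        (α ((chartAt ℰ i).symm z) (chartFrame i z) : ℝ)) := fun i =>
    integral_indicator (chartAt ℰ i).open_target.measurableSet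
  unfold integralForm
  simp_rw [← h]
  refine finsum_eq_sum_of_support_subset _ fun i hi => ?_
  rw [Finite.coe_toFinset]
  by_contra hne
  apply hi
  have h0 : integralDensity o i α = 0 := by
    funext z
    by_cases hz : z ∈ (chartAt ℰ i).target
    · rw [integralDensity, indicator_of_mem hz]
      have : chartPartition n S i ((chartAt ℰ i).symm z) = 0 := by
        by_contra h'
        exact hne ⟨_, h'⟩
      rw [this, zero_mul]
      rfl
    · exact indicator_of_notMem hz _
  simp [h0]

/-- A compact subset of the target of the chart, outside of which the densities vanish. -/
def integralCompact (i : S) : Set ℰ := chartAt ℰ i '' tsupport (chartPartition n S i)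

theorem tsupport_chartPartition_subset (i : S) :
    tsupport (chartPartition n S i) ⊆ (chartAt ℰ i).source := chartPartition_isSubordinate i

theorem isCompact_integralCompact (i : S) : IsCompact (integralCompact (n := n) i) :=
  (isClosed_tsupport _).isCompact.image_of_continuousOn
    ((chartAt ℰ i).continuousOn.mono (tsupport_chartPartition_subset i))

theorem integralCompact_subset (i : S) : integralCompact (n := n) i ⊆ (chartAt ℰ i).target := by
  rintro _ ⟨x, hx, rfl⟩
  exact (chartAt ℰ i).map_source (tsupport_chartPartition_subset i hx)

theorem integralDensity_of_notMem (o : OrientationForm n S) (i : S) (α : ∀ x : S, FormAt ℰ n x)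
    {z : ℰ} (hz : z ∉ integralCompact (n := n) i) : integralDensity o i α z = 0 := by
  by_cases hzt : z ∈ (chartAt ℰ i).target
  · rw [integralDensity, indicator_of_mem hzt]
    have : chartPartition n S i ((chartAt ℰ i).symm z) = 0 := by
      refine image_eq_zero_of_notMem_tsupport fun h => hz ⟨_, h, (chartAt ℰ i).right_inv hzt⟩
    rw [this, zero_mul]
  · exact indicator_of_notMem hzt _

theorem contDiff_integralDensity (o : OrientationForm n S) (i : S) {P : Type*}
    [NormedAddCommGroup P] [NormedSpace ℝ P] {α : P → ∀ x : S, FormAt ℰ n x}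
    (hα : ContMDiff (𝓘(ℝ, P).prod 𝓘(ℝ, ℰ)) (𝓘(ℝ, ℰ).prod 𝓘(ℝ, ℰ [⋀^Fin n]→L[ℝ] ℝ)) ∞
      (fun q : P × S => (⟨q.2, α q.1 q.2⟩ : FormBundle ℰ S n))) :
    ContDiff ℝ ∞ (fun q : P × ℰ => integralDensity o i (α q.1) q.2) := by
  rw [contDiff_iff_contDiffAt]
  intro q₀
  by_cases hq : q₀.2 ∈ integralCompact (n := n) i
  · have ht := integralCompact_subset i hq
    have hsymm : ContMDiffAt 𝓘(ℝ, ℰ) 𝓘(ℝ, ℰ) ∞ (chartAt ℰ i).symm q₀.2 :=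
      (contMDiffOn_chart_symm (I := 𝓘(ℝ, ℰ)) (n := ∞) (x := i)).contMDiffAt
        ((chartAt ℰ i).open_target.mem_nhds ht)
    have ho : ContMDiffAt 𝓘(ℝ, ℰ) 𝓘(ℝ, ℝ) ∞
        (fun z => (o.toFun ((chartAt ℰ i).symm z) (chartFrame i z) : ℝ)) q₀.2 :=
      ContMDiffAt.form_apply (b := (chartAt ℰ i).symm)
        (A := fun z => o.toFun ((chartAt ℰ i).symm z))
        (u := fun j z => chartFrame i z j) (o.contMDiff.contMDiffAt.comp _ hsymm)
        (fun j => contMDiffAt_chartFrame i ht j)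
    have h2 : ContMDiffAt 𝓘(ℝ, P × ℰ) 𝓘(ℝ, ℰ) ∞ (fun q : P × ℰ => q.2) q₀ :=
      contDiffAt_snd.contMDiffAt
    have h1 : ContMDiffAt 𝓘(ℝ, P × ℰ) 𝓘(ℝ, P) ∞ (fun q : P × ℰ => q.1) q₀ :=
      contDiffAt_fst.contMDiffAt
    have hα' : ContMDiffAt 𝓘(ℝ, P × ℰ) 𝓘(ℝ, ℝ) ∞ (fun q : P × ℰ =>
        (α q.1 ((chartAt ℰ i).symm q.2) (chartFrame i q.2) : ℝ)) q₀ :=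
      ContMDiffAt.form_apply (b := fun q : P × ℰ => (chartAt ℰ i).symm q.2)
        (A := fun q => α q.1 ((chartAt ℰ i).symm q.2))
        (u := fun j q => chartFrame i q.2 j)
        (hα.contMDiffAt.comp q₀ (h1.prodMk (hsymm.comp q₀ h2)))
        (fun j => (contMDiffAt_chartFrame i ht j).comp q₀ h2)
    have hρ : ContMDiffAt 𝓘(ℝ, P × ℰ) 𝓘(ℝ, ℝ) ∞ (fun q : P × ℰ =>
        chartPartition n S i ((chartAt ℰ i).symm q.2)) q₀ :=
      ((chartPartition n S i).contMDiff.contMDiffAt.comp _ hsymm).comp q₀ h2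
    have hmain : ContMDiffAt 𝓘(ℝ, P × ℰ) 𝓘(ℝ, ℝ) ∞ (fun q : P × ℰ =>
        chartPartition n S i ((chartAt ℰ i).symm q.2) *
        (SignType.sign (α := ℝ) (o.toFun ((chartAt ℰ i).symm q₀.2) (chartFrame i q₀.2)) *
        (α q.1 ((chartAt ℰ i).symm q.2) (chartFrame i q.2) : ℝ))) q₀ :=
      hρ.mul (contMDiffAt_const.mul hα')
    refine (contMDiffAt_iff_contDiffAt.1 hmain).congr_of_eventuallyEq ?_
    have hne := form_chartFrame_ne_zero i ht (o.ne_zero ((chartAt ℰ i).symm q₀.2))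
    have hsign : ∀ᶠ z in 𝓝 q₀.2,
        SignType.sign (α := ℝ) (o.toFun ((chartAt ℰ i).symm z) (chartFrame i z)) =
          SignType.sign (α := ℝ) (o.toFun ((chartAt ℰ i).symm q₀.2) (chartFrame i q₀.2)) :=
      ((continuousAt_sign_of_ne_zero hne).comp_of_eq ho.continuousAt rfl).eventually_mem
        ((isOpen_discrete {_}).mem_nhds rfl)
    filter_upwards [continuous_snd.continuousAt.eventually hsign,
      continuous_snd.continuousAt.eventually ((chartAt ℰ i).open_target.mem_nhds ht)] with q hs hqt
    rw [integralDensity, indicator_of_mem hqt]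
    exact congrArg (fun s : SignType => chartPartition n S i ((chartAt ℰ i).symm q.2) *
      ((s : ℝ) * (α q.1 ((chartAt ℰ i).symm q.2) (chartFrame i q.2) : ℝ))) hs
  · refine contDiffAt_const (c := (0 : ℝ)) |>.congr_of_eventuallyEq ?_
    filter_upwards [continuous_snd.continuousAt.eventually
      ((isCompact_integralCompact i).isClosed.isOpen_compl.mem_nhds hq)] with q hq'
    exact integralDensity_of_notMem o i _ hq'

theorem continuous_integralDensity (o : OrientationForm n S) (i : S) {α : ∀ x : S, FormAt ℰ n x}
    (hα : ContMDiff 𝓘(ℝ, ℰ) (𝓘(ℝ, ℰ).prod 𝓘(ℝ, ℰ [⋀^Fin n]→L[ℝ] ℝ)) ∞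
      (fun x => (⟨x, α x⟩ : FormBundle ℰ S n))) : Continuous (integralDensity o i α) :=
  (contDiff_integralDensity o i (P := ℝ) (α := fun _ => α) (hα.comp contMDiff_snd)).continuous.comp
    (Continuous.prodMk_right (0 : ℝ))

theorem hasCompactSupport_integralDensity (o : OrientationForm n S) (i : S)
    (α : ∀ x : S, FormAt ℰ n x) : HasCompactSupport (integralDensity o i α) :=
  HasCompactSupport.intro (isCompact_integralCompact i)
    fun _ hz => integralDensity_of_notMem o i α hz

theorem integrable_integralDensity (o : OrientationForm n S) (i : S) {α : ∀ x : S, FormAt ℰ n x}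
    (hα : ContMDiff 𝓘(ℝ, ℰ) (𝓘(ℝ, ℰ).prod 𝓘(ℝ, ℰ [⋀^Fin n]→L[ℝ] ℝ)) ∞
      (fun x => (⟨x, α x⟩ : FormBundle ℰ S n))) : Integrable (integralDensity o i α) :=
  (continuous_integralDensity o i hα).integrable_of_hasCompactSupport
    (hasCompactSupport_integralDensity o i α)

theorem integralForm_add (o : OrientationForm n S) {α β : ∀ x : S, FormAt ℰ n x}
    (hα : ContMDiff 𝓘(ℝ, ℰ) (𝓘(ℝ, ℰ).prod 𝓘(ℝ, ℰ [⋀^Fin n]→L[ℝ] ℝ)) ∞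
      (fun x => (⟨x, α x⟩ : FormBundle ℰ S n)))
    (hβ : ContMDiff 𝓘(ℝ, ℰ) (𝓘(ℝ, ℰ).prod 𝓘(ℝ, ℰ [⋀^Fin n]→L[ℝ] ℝ)) ∞
      (fun x => (⟨x, β x⟩ : FormBundle ℰ S n))) :
    integralForm o (fun x => α x + β x) = integralForm o α + integralForm o β := by
  rw [integralForm_eq, integralForm_eq, integralForm_eq, ← Finset.sum_add_distrib]
  refine Finset.sum_congr rfl fun i _ => ?_
  rw [← integral_add (integrable_integralDensity o i hα) (integrable_integralDensity o i hβ)]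
  congr 1
  funext z
  by_cases hz : z ∈ (chartAt ℰ i).target
  · simp only [integralDensity, indicator_of_mem hz]
    exact (congrArg (fun r : ℝ => _ * (_ * r)) (ContinuousAlternatingMap.add_apply _ _ _)).trans
      (by ring)
  · simp only [integralDensity, indicator_of_notMem hz, add_zero]

theorem integralForm_smul (o : OrientationForm n S) (r : ℝ) (α : ∀ x : S, FormAt ℰ n x) :
    integralForm o (fun x => r • α x) = r * integralForm o α := by
  rw [integralForm_eq, integralForm_eq, Finset.mul_sum]
  refine Finset.sum_congr rfl fun i _ => ?_
  rw [← integral_const_mul]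
  congr 1
  funext z
  by_cases hz : z ∈ (chartAt ℰ i).target
  · simp only [integralDensity, indicator_of_mem hz]
    exact (congrArg (fun r : ℝ => _ * (_ * r)) (ContinuousAlternatingMap.smul_apply _ _ _)).trans
      (by rw [smul_eq_mul]; ring)
  · simp only [integralDensity, indicator_of_notMem hz, mul_zero]

variable {P : Type*} [NormedAddCommGroup P] [NormedSpace ℝ P]

theorem contDiff_integralForm (o : OrientationForm n S) {α : P → ∀ x : S, FormAt ℰ n x}
    (hα : ContMDiff (𝓘(ℝ, P).prod 𝓘(ℝ, ℰ)) (𝓘(ℝ, ℰ).prod 𝓘(ℝ, ℰ [⋀^Fin n]→L[ℝ] ℝ)) ∞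
      (fun q : P × S => (⟨q.2, α q.1 q.2⟩ : FormBundle ℰ S n))) :
    ContDiff ℝ ∞ (fun t => integralForm o (α t)) := by
  simp_rw [integralForm_eq]
  exact ContDiff.sum fun i _ => contDiff_integral_of_compact (contDiff_integralDensity o i hα)
    (isCompact_integralCompact i) fun t z hz => integralDensity_of_notMem o i _ hz

/-- Differentiation under the integral sign. -/
theorem fderiv_integralForm (o : OrientationForm n S) {α : P → ∀ x : S, FormAt ℰ n x}
    (hα : ContMDiff (𝓘(ℝ, P).prod 𝓘(ℝ, ℰ)) (𝓘(ℝ, ℰ).prod 𝓘(ℝ, ℰ [⋀^Fin n]→L[ℝ] ℝ)) ∞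
      (fun q : P × S => (⟨q.2, α q.1 q.2⟩ : FormBundle ℰ S n))) (t v : P)
    {β : ∀ x : S, FormAt ℰ n x}
    (hβ : ∀ x (u : Fin n → TangentSpace 𝓘(ℝ, ℰ) x),
      fderiv ℝ (fun t => (α t x u : ℝ)) t v = (β x u : ℝ)) :
    fderiv ℝ (fun t => integralForm o (α t)) t v = integralForm o β := by
  have hd : ∀ x (u : Fin n → TangentSpace 𝓘(ℝ, ℰ) x),
      DifferentiableAt ℝ (fun t => (α t x u : ℝ)) t := by
    intro x u
    have h := hα.comp (contMDiff_id.prodMk (contMDiff_const (c := x)) :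
      ContMDiff 𝓘(ℝ, P) (𝓘(ℝ, P).prod 𝓘(ℝ, ℰ)) ∞ (fun t : P => (t, x)))
    have h1 : ContMDiffAt 𝓘(ℝ, P) 𝓘(ℝ, ℝ) ∞ (fun t => (α t x u : ℝ)) t :=
      ContMDiffAt.form_apply (b := fun _ : P => x) (A := fun t => α t x)
        (u := fun j _ => u j) h.contMDiffAt (fun j => contMDiffAt_const)
    exact (contMDiffAt_iff_contDiffAt.1 h1).differentiableAt (by simp)
  simp_rw [integralForm_eq]
  rw [fderiv_fun_sum fun i _ => (contDiff_integral_of_compact (contDiff_integralDensity o i hα)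
    (isCompact_integralCompact i) fun t z hz =>
      integralDensity_of_notMem o i _ hz).differentiable (by simp) t]
  rw [sum_apply]
  refine Finset.sum_congr rfl fun i _ => ?_
  rw [fderiv_integral_of_compact (contDiff_integralDensity o i hα)
    (isCompact_integralCompact i) fun t z hz => integralDensity_of_notMem o i _ hz]
  congr 1
  funext z
  by_cases hz : z ∈ (chartAt ℰ i).target
  · simp only [integralDensity, indicator_of_mem hz]
    rw [← hβ]
    exact congrArg (fun L => L v) ((((hd _ (chartFrame i z)).hasFDerivAt.const_mul _).const_mul
      _).fderiv)
  · simp only [integralDensity, indicator_of_notMem hz]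
    simp

/-- The integral of a nonnegative multiple of the orientation form is positive, unless the multiple
vanishes. -/
theorem integralForm_pos (o : OrientationForm n S) {g : S → ℝ}
    (h0 : ∀ x, 0 ≤ g x) {x₀ : S} (hx₀ : g x₀ ≠ 0)
    {α : ∀ x : S, FormAt ℰ n x} (hα : ∀ x, α x = g x • o.toFun x)
    (hs : ContMDiff 𝓘(ℝ, ℰ) (𝓘(ℝ, ℰ).prod 𝓘(ℝ, ℰ [⋀^Fin n]→L[ℝ] ℝ)) ∞
      (fun x => (⟨x, α x⟩ : FormBundle ℰ S n))) : 0 < integralForm o α := by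
  have hval : ∀ i, ∀ z ∈ (chartAt ℰ i).target, integralDensity o i α z =
      chartPartition n S i ((chartAt ℰ i).symm z) * (g ((chartAt ℰ i).symm z) *
        |(o.toFun ((chartAt ℰ i).symm z) (chartFrame i z) : ℝ)|) := by
    intro i z hz
    rw [integralDensity, indicator_of_mem hz, hα]
    have := sign_mul_self (show ℝ from o.toFun ((chartAt ℰ i).symm z) (chartFrame i z))
    rw [← this]
    exact (congrArg (fun r : ℝ => _ * (_ * r)) (ContinuousAlternatingMap.smul_apply _ _ _)).trans
      (by rw [smul_eq_mul]; ring)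
  have hnn : ∀ i, 0 ≤ integralDensity o i α := by
    intro i z
    by_cases hz : z ∈ (chartAt ℰ i).target
    · rw [hval i z hz]
      exact mul_nonneg ((chartPartition n S).nonneg i _) (mul_nonneg (h0 _) (abs_nonneg _))
    · rw [integralDensity, indicator_of_notMem hz]
      rfl
  obtain ⟨i, hi⟩ := (chartPartition n S).exists_pos_of_mem (mem_univ x₀)
  have hsrc : x₀ ∈ (chartAt ℰ i).source :=
    tsupport_chartPartition_subset i (subset_tsupport _ hi.ne')
  rw [integralForm_eq]
  refine Finset.sum_pos' (fun j _ => integral_nonneg (hnn j)) ⟨i, ?_, ?_⟩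
  · rw [Finite.mem_toFinset]
    exact ⟨x₀, hi.ne'⟩
  · refine (continuous_integralDensity o i hs).integral_pos_of_hasCompactSupport_nonneg_nonzero
      (hasCompactSupport_integralDensity o i α) (hnn i) (x := chartAt ℰ i x₀) ?_
    have hz := (chartAt ℰ i).map_source hsrc
    have hl := (chartAt ℰ i).left_inv hsrc
    rw [hval i _ hz, hl]
    refine mul_ne_zero hi.ne' (mul_ne_zero hx₀ (abs_ne_zero.2 ?_))
    have h := form_chartFrame_ne_zero i hz (o.ne_zero _)
    rwa [hl] at h

end IntegralForm

/-! ### The pointwise symplectic form -/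

section FormDerivative

variable {n : ℕ} {S : Type*} [TopologicalSpace S] [ChartedSpace (EuclideanSpace ℝ (Fin n)) S]
  [IsManifold 𝓘(ℝ, EuclideanSpace ℝ (Fin n)) ∞ S]
  {P : Type*} [NormedAddCommGroup P] [NormedSpace ℝ P]

local notation "ℰ" => EuclideanSpace ℝ (Fin n)

/-- The parameter derivative of a smooth family of forms is a smooth form. -/
theorem exists_form_fderiv {α : P → ∀ x : S, FormAt ℰ n x}
    (hα : ContMDiff (𝓘(ℝ, P).prod 𝓘(ℝ, ℰ)) (𝓘(ℝ, ℰ).prod 𝓘(ℝ, ℰ [⋀^Fin n]→L[ℝ] ℝ)) ∞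
      (fun q : P × S => (⟨q.2, α q.1 q.2⟩ : FormBundle ℰ S n))) (t v : P) :
    ∃ β : ∀ x : S, FormAt ℰ n x, (∀ x (u : Fin n → TangentSpace 𝓘(ℝ, ℰ) x),
      fderiv ℝ (fun t => (α t x u : ℝ)) t v = (β x u : ℝ)) ∧
      ContMDiff 𝓘(ℝ, ℰ) (𝓘(ℝ, ℰ).prod 𝓘(ℝ, ℰ [⋀^Fin n]→L[ℝ] ℝ)) ∞
        (fun x => (⟨x, β x⟩ : FormBundle ℰ S n)) := by
  have hval : ∀ x, ∃ B : ℰ [⋀^Fin n]→L[ℝ] ℝ, ∀ u : Fin n → ℰ,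
      fderiv ℝ (fun t => (α t x u : ℝ)) t v = B u := by
    intro x
    let a : P → ℰ [⋀^Fin n]→L[ℝ] ℝ := fun t => α t x
    have ha : DifferentiableAt ℝ a t := by
      refine (contMDiffAt_iff_contDiffAt.1 (contMDiffAt_alternating_of_apply
        (IM := 𝓘(ℝ, P)) (f := a) (q₀ := t) fun u => ?_)).differentiableAt (by simp)
      have h := hα.comp (contMDiff_id.prodMk (contMDiff_const (c := x)) :
        ContMDiff 𝓘(ℝ, P) (𝓘(ℝ, P).prod 𝓘(ℝ, ℰ)) ∞ (fun t : P => (t, x)))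
      exact ContMDiffAt.form_apply (b := fun _ : P => x) (A := fun t => α t x)
        (u := fun j _ => u j) h.contMDiffAt (fun j => contMDiffAt_const)
    refine ⟨fderiv ℝ a t v, fun u => ?_⟩
    let ev : (ℰ [⋀^Fin n]→L[ℝ] ℝ) →ₗ[ℝ] ℝ :=
      { toFun := fun A => A u
        map_add' := fun A B => rfl
        map_smul' := fun r A => rfl }
    exact congrArg (fun L => L v)
      ((LinearMap.toContinuousLinearMap ev).hasFDerivAt.comp t ha.hasFDerivAt).fderiv
  choose β hβ using hval
  refine ⟨β, hβ, fun x₀ => ?_⟩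
  refine contMDiffAt_form_of_apply (b := fun x : S => x) contMDiffAt_id fun u hu => ?_
  have hG : ContMDiffAt (𝓘(ℝ, P).prod 𝓘(ℝ, ℰ)) 𝓘(ℝ, ℝ) ∞
      (fun q : P × S => (α q.1 q.2 (fun i => u i q.2) : ℝ)) (t, x₀) :=
    ContMDiffAt.form_apply (b := fun q : P × S => q.2) (A := fun q => α q.1 q.2)
      (u := fun j q => u j q.2) hα.contMDiffAt
      (fun j => (hu j).comp (t, x₀) contMDiffAt_snd)
  have hG' : ContMDiffAt (𝓘(ℝ, ℰ).prod 𝓘(ℝ, P)) 𝓘(ℝ, ℝ) ∞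
      (Function.uncurry fun (x : S) (t : P) => (α t x (fun i => u i x) : ℝ)) (x₀, t) :=
    hG.comp (x₀, t) (contMDiffAt_snd.prodMk contMDiffAt_fst)
  have h := ContMDiffAt.mfderiv (m := ∞) (J := 𝓘(ℝ, ℰ)) (I := 𝓘(ℝ, P)) (I' := 𝓘(ℝ, ℝ))
    (x₀ := x₀) (fun (x : S) (t : P) => (α t x (fun i => u i x) : ℝ)) (fun _ => t) hG'
    contMDiffAt_const (by simp)
  have h1 : ContMDiffAt 𝓘(ℝ, ℰ) 𝓘(ℝ, P →L[ℝ] ℝ) ∞ (fun x : S => (mfderiv 𝓘(ℝ, P) 𝓘(ℝ, ℝ)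
      (fun t : P => (α t x (fun i => u i x) : ℝ)) t : P →L[ℝ] ℝ)) x₀ :=
    Eq.mp (congrArg (fun f => ContMDiffAt 𝓘(ℝ, ℰ) 𝓘(ℝ, P →L[ℝ] ℝ) ∞ f x₀)
      (inTangentCoordinates_model_space (I := 𝓘(ℝ, P)) (I' := 𝓘(ℝ, ℝ)) (fun _ : S => t)
      (fun x => (α t x (fun i => u i x) : ℝ)) (fun x => mfderiv 𝓘(ℝ, P) 𝓘(ℝ, ℝ)
        (fun t : P => (α t x (fun i => u i x) : ℝ)) t) x₀)) h
  have h2 := ((ContinuousLinearMap.apply ℝ ℝ v).contDiff (n := ∞)).contMDiff.contMDiffAt.comp x₀ h1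
  refine h2.congr_of_eventuallyEq (Filter.Eventually.of_forall fun x => ?_)
  refine (hβ x (fun i => u i x)).symm.trans ?_
  exact congrArg (fun L : P →L[ℝ] ℝ => L v) mfderiv_eq_fderiv.symm

/-- The second derivatives cancel in the exterior derivative of the pairing of a map with the
derivative of another map. -/
theorem fderiv_pairing_sub {F G : Type*} [NormedAddCommGroup F] [NormedSpace ℝ F]
    [NormedAddCommGroup G] [NormedSpace ℝ G] {A : P → F →L[ℝ] G} {y : P → F} {t : P}
    (hA : ContDiffAt ℝ ∞ A t) (hy : ContDiffAt ℝ ∞ y t) (ev : G →L[ℝ] ℝ) (v w : P) :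
    fderiv ℝ (fun t => ev (A t (fderiv ℝ y t w))) t v -
      fderiv ℝ (fun t => ev (A t (fderiv ℝ y t v))) t w =
    ev (fderiv ℝ A t v (fderiv ℝ y t w)) - ev (fderiv ℝ A t w (fderiv ℝ y t v)) := by
  have hA' := (hA.differentiableAt (by simp)).hasFDerivAt
  have hy' := ((hy.fderiv_right (m := ∞) (by simp)).differentiableAt (by simp)).hasFDerivAt
  have h : ∀ v w, fderiv ℝ (fun t => ev (A t (fderiv ℝ y t w))) t v =
      ev (fderiv ℝ A t v (fderiv ℝ y t w)) + ev (A t (fderiv ℝ (fderiv ℝ y) t v w)) := by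
    intro v w
    have h1 := (ContinuousLinearMap.apply ℝ F w).hasFDerivAt.comp t hy'
    have h2 := ev.hasFDerivAt.comp t (hA'.clm_apply h1)
    refine (congrArg (fun L => L v) h2.fderiv).trans ?_
    change ev (A t _ + _) = _
    rw [map_add, add_comm]
    rfl
  rw [h, h, hy.isSymmSndFDerivAt (by simp; decide) v w]
  ring

end FormDerivative

section SymplecticAt

open Diffeology

variable {S X Y EX EY F : Type*} {n : ℕ}
  [TopologicalSpace S] [ChartedSpace (EuclideanSpace ℝ (Fin n)) S]
  [IsManifold 𝓘(ℝ, EuclideanSpace ℝ (Fin n)) ∞ S]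
  [NormedAddCommGroup EX] [NormedSpace ℝ EX]
  [TopologicalSpace X] [ChartedSpace EX X] [IsManifold 𝓘(ℝ, EX) ∞ X]
  [NormedAddCommGroup EY] [NormedSpace ℝ EY] [FiniteDimensional ℝ EY]
  [TopologicalSpace Y] [ChartedSpace EY Y] [IsManifold 𝓘(ℝ, EY) ∞ Y]
  [NormedAddCommGroup F] [NormedSpace ℝ F] [FiniteDimensional ℝ F]
  {p : Y → X} (hp : Manifold.IsSubmersionOfComplement F 𝓘(ℝ, EY) 𝓘(ℝ, EX) ∞ p) (τ : S → X)

local notation "ℰ" => EuclideanSpace ℝ (Fin n)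
local notation "𝓘M" => ModelWithCorners.prod
  (ModelWithCorners.prod (modelWithCornersSelf ℝ (EuclideanSpace ℝ (Fin n)))
    (modelWithCornersSelf ℝ EY))
  (modelWithCornersSelf ℝ (ContinuousLinearMap (RingHom.id ℝ) F
    (ContinuousAlternatingMap ℝ (EuclideanSpace ℝ (Fin n)) ℝ (Fin n))))

theorem FormAt.cast_eq {ES M : Type*} [NormedAddCommGroup ES] [NormedSpace ℝ ES]
    [TopologicalSpace M] [ChartedSpace ES M] {k : ℕ} {x x' : M} (h : x = x') (A : FormAt ES k x) :
    (FormAt.cast h A : ES [⋀^Fin k]→L[ℝ] ℝ) = A := by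
  subst h
  rfl

theorem FormAt.mk_cast {ES M : Type*} [NormedAddCommGroup ES] [NormedSpace ℝ ES]
    [TopologicalSpace M] [ChartedSpace ES M] {k : ℕ} {x x' : M} (h : x = x') (A : FormAt ES k x) :
    (⟨x', FormAt.cast h A⟩ : FormBundle ES M k) = ⟨x, A⟩ := by
  subst h
  rfl

theorem trivializationAt_tangent_symmL_self {ES M : Type*} [NormedAddCommGroup ES]
    [NormedSpace ℝ ES] [TopologicalSpace M] [ChartedSpace ES M] [IsManifold 𝓘(ℝ, ES) ∞ M]
    {x x' : M} (h : x = x') (e : ES) :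
    ((trivializationAt ES (TangentSpace 𝓘(ℝ, ES)) x).symmL ℝ x' e : ES) = e := by
  subst h
  rw [TangentBundle.symmL_trivializationAt_eq_core (mem_chart_source ES x)]
  exact (tangentBundleCore 𝓘(ℝ, ES) M).coordChange_self (achart ES x) x (mem_chart_source ES x) e

/-- The coordinate of a point of `Y` along the fibres of `p`. -/
def fibreCoord (y₀ y : Y) : F := (adEquiv hp y₀ (adChart hp y₀ y)).2

/-- The coordinates of the momentum, in the bundle chart around `q₀`. -/
def momentumCoord (q₀ : S × Y) (m : MomentumBundle ℰ S hp n) : F →L[ℝ] (ℰ [⋀^Fin n]→L[ℝ] ℝ) :=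
  (momPsi hp q₀ m).2

theorem contMDiffAt_momentumCoord (q₀ : S × Y) {m : MomentumBundle ℰ S hp n}
    (hm : m ∈ momSource hp ℰ n q₀) :
    ContMDiffAt 𝓘M 𝓘(ℝ, F →L[ℝ] (ℰ [⋀^Fin n]→L[ℝ] ℝ)) ∞ (momentumCoord hp q₀) m := by
  have h := (contMDiffOn_momPsi hp q₀).contMDiffAt ((isOpen_momSource hp q₀).mem_nhds hm)
  have h2 : ContMDiff 𝓘(ℝ, (ℰ × EY) × (F →L[ℝ] (ℰ [⋀^Fin n]→L[ℝ] ℝ)))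
      𝓘(ℝ, F →L[ℝ] (ℰ [⋀^Fin n]→L[ℝ] ℝ)) ∞
      (Prod.snd : (ℰ × EY) × (F →L[ℝ] (ℰ [⋀^Fin n]→L[ℝ] ℝ)) → _) := contDiff_snd.contMDiff
  exact h2.contMDiffAt.comp m h

theorem contMDiff_momentum_config :
    ContMDiff 𝓘M 𝓘(ℝ, EY) ∞ (fun m : MomentumBundle ℰ S hp n => m.1.2) :=
  contMDiff_snd.comp (contMDiff_momentum_proj (ES := ℰ) (S := S) (k := n) hp)

theorem contMDiffAt_fibreCoord (y₀ : Y) {y : Y} (hy : y ∈ (adChart hp y₀).source) :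
    ContMDiffAt 𝓘(ℝ, EY) 𝓘(ℝ, F) ∞ (fibreCoord hp y₀) y := by
  have h2 : ContMDiff 𝓘(ℝ, EY) 𝓘(ℝ, F) ∞ (fun e : EY => (adEquiv hp y₀ e).2) :=
    ((ContinuousLinearMap.snd ℝ EX F).comp (adEquiv hp y₀ : EY →L[ℝ] EX × F)).contDiff.contMDiff
  exact h2.contMDiffAt.comp y ((contMDiffOn_adChart hp y₀).contMDiffAt
    ((adChart hp y₀).open_source.mem_nhds hy))

theorem mem_momSource_self (m : MomentumBundle ℰ S hp n) : m ∈ momSource hp ℰ n m.1 :=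
  ⟨mem_chart_source ℰ m.1.1, mem_adChart_source hp m.1.2⟩

/-- The coordinates of the vertical part of a tangent vector to `L(VY, Λⁿ T*S)`. -/
def fibreVelocity (m : MomentumBundle ℰ S hp n) :
    ((ℰ × EY) × (F →L[ℝ] (ℰ [⋀^Fin n]→L[ℝ] ℝ))) →L[ℝ] F :=
  mfderiv 𝓘M 𝓘(ℝ, F) (fun m' : MomentumBundle ℰ S hp n => fibreCoord hp m.1.2 m'.1.2) m

/-- The coordinates of the variation of the momentum along a tangent vector to
`L(VY, Λⁿ T*S)`. -/
def momentumVelocity (m : MomentumBundle ℰ S hp n) :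
    ((ℰ × EY) × (F →L[ℝ] (ℰ [⋀^Fin n]→L[ℝ] ℝ))) →L[ℝ] (F →L[ℝ] (ℰ [⋀^Fin n]→L[ℝ] ℝ)) :=
  mfderiv 𝓘M 𝓘(ℝ, F →L[ℝ] (ℰ [⋀^Fin n]→L[ℝ] ℝ)) (momentumCoord hp m.1) m

/-- The canonical symplectic form of `L(VY, Λⁿ T*S)` along the fibres over `S × X`, with values in
`Λⁿ T*S`. -/
def symplecticAt (m : MomentumBundle ℰ S hp n)
    (v w : (ℰ × EY) × (F →L[ℝ] (ℰ [⋀^Fin n]→L[ℝ] ℝ))) : ℰ [⋀^Fin n]→L[ℝ] ℝ :=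
  momentumVelocity hp m w (fibreVelocity hp m v) - momentumVelocity hp m v (fibreVelocity hp m w)

variable {τ}

theorem PhaseSpace.base_eq (s : PhaseSpace hp τ n) (x : S) : (s x).1.1 = x :=
  congrArg Prod.fst (s.proj_eq x)

/-- The momentum of `s` at `x`, as an alternating map on the model space. -/
def PhaseSpace.momentum (s : PhaseSpace hp τ n) (x : S) (v : VertAt hp (s x).1.2) :
    ℰ [⋀^Fin n]→L[ℝ] ℝ := (s x).2 v

/-- The momentum in coordinates: the vertical vector is read in an adapted chart. -/
theorem momentum_eq_momentumCoord (s : PhaseSpace hp τ n) (x : S) (q₀ : S × Y) (hq : q₀.1 = x)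
    (hy : (s x).1.2 ∈ (adChart hp q₀.2).source) (v : VertAt hp (s x).1.2) :
    PhaseSpace.momentum hp s x v =
      momentumCoord hp q₀ (s x) (vertCoord hp q₀.2 (s x).1.2 v) := by
  have hx : (s x).1.1 = q₀.1 := (PhaseSpace.base_eq hp s x).trans hq.symm
  have h₁ : (s x).1.1 ∈ (trivializationAt (ℰ [⋀^Fin n]→L[ℝ] ℝ)
      (FormAt ℰ n : S → Type _) q₀.1).baseSet := by
    rw [hx]
    exact FiberBundle.mem_baseSet_trivializationAt' _
  have h₂ : (s x).1.2 ∈ (trivializationAt F (VertAt hp) q₀.2).baseSet := hy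
  have h3 := trivializationAt_momentum_apply hp q₀ (s x) h₁ h₂ (vertCoord hp q₀.2 (s x).1.2 v)
  have h4 : (trivializationAt F (VertAt hp) q₀.2).symmL ℝ (s x).1.2
      (vertCoord hp q₀.2 (s x).1.2 v) = v := by
    have h := (trivializationAt F (VertAt hp) q₀.2).symmL_continuousLinearMapAt (R := ℝ) h₂ v
    rwa [Trivialization.continuousLinearMapAt_apply,
      Trivialization.coe_linearMapAt_of_mem _ h₂] at h
  rw [h4, trivializationAt_form_apply] at h3
  refine Eq.trans ?_ h3.symm
  refine ContinuousAlternatingMap.ext fun u => ?_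
  exact congrArg (fun u : Fin n → ℰ => PhaseSpace.momentum hp s x v u)
    (funext fun i => (trivializationAt_tangent_symmL_self hx.symm (u i)).symm)

theorem mfderiv_fibreCoord (y₀ : Y) (m : MomentumBundle ℰ S hp n)
    (hy : m.1.2 ∈ (adChart hp y₀).source) (w : TangentSpace 𝓘M m) :
    (mfderiv 𝓘M 𝓘(ℝ, F) (fun m' : MomentumBundle ℰ S hp n => fibreCoord hp y₀ m'.1.2) m w : F) =
      (adEquiv hp y₀ (chartD hp y₀ m.1.2 (mfderiv 𝓘M 𝓘(ℝ, EY)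
        (fun m' : MomentumBundle ℰ S hp n => m'.1.2) m w))).2 := by
  have h1 := mfderiv_comp_model m (IP := 𝓘(ℝ, F)) (g := fibreCoord hp y₀)
    (f := fun m' : MomentumBundle ℰ S hp n => m'.1.2)
    ((contMDiffAt_fibreCoord hp y₀ hy).mdifferentiableAt (by simp))
    ((contMDiff_momentum_config hp).mdifferentiableAt (x := m) (by simp)) w
  refine h1.trans ?_
  let L : EY →L[ℝ] F := (ContinuousLinearMap.snd ℝ EX F).comp (adEquiv hp y₀ : EY →L[ℝ] EX × F)
  have h2 := mfderiv_comp_model m.1.2 (IN := 𝓘(ℝ, EY)) (IP := 𝓘(ℝ, F)) (g := L)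
    (f := adChart hp y₀) L.differentiableAt.mdifferentiableAt
    ((adChart_mdifferentiable hp y₀).mdifferentiableAt hy)
    (mfderiv 𝓘M 𝓘(ℝ, EY) (fun m' : MomentumBundle ℰ S hp n => m'.1.2) m w)
  refine h2.trans ?_
  have h3 : mfderiv 𝓘(ℝ, EY) 𝓘(ℝ, F) L (adChart hp y₀ m.1.2) = L := by
    rw [mfderiv_eq_fderiv]
    exact L.fderiv
  exact congrArg (fun L : EY →L[ℝ] F => L (mfderiv 𝓘(ℝ, EY) 𝓘(ℝ, EY) (adChart hp y₀) m.1.2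
    (mfderiv 𝓘M 𝓘(ℝ, EY) (fun m' : MomentumBundle ℰ S hp n => m'.1.2) m w))) h3

section Family

variable {k : ℕ} {c : EuclideanSpace ℝ (Fin k) → PhaseSpace hp τ n}

theorem contMDiff_phase_left (hc : IsPlot c) (x : S) :
    ContMDiff 𝓘(ℝ, EuclideanSpace ℝ (Fin k)) 𝓘M ∞ (fun t => c t x) :=
  velocityFun_contMDiff_left hc x

theorem contMDiff_phase_config_left (hc : IsPlot c) (x : S) :
    ContMDiff 𝓘(ℝ, EuclideanSpace ℝ (Fin k)) 𝓘(ℝ, EY) ∞ (fun t => (c t x).1.2) :=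
  (contMDiff_momentum_config hp).comp (contMDiff_phase_left hp hc x)

/-- The integrand of the canonical one-form along a family, in coordinates. -/
theorem momentum_configVelocity_eq (hc : IsPlot c) (t w : EuclideanSpace ℝ (Fin k)) (x : S)
    (q₀ : S × Y) (hq : q₀.1 = x) (hy : (c t x).1.2 ∈ (adChart hp q₀.2).source) :
    PhaseSpace.momentum hp (c t) x (configVelocity hp τ (c t) (velocity c hc t w) x) =
      momentumCoord hp q₀ (c t x)
        (fderiv ℝ (fun t => fibreCoord hp q₀.2 (c t x).1.2) t w) := by
  rw [momentum_eq_momentumCoord hp (c t) x q₀ hq hy]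
  congr 1
  have h1 := mfderiv_comp_model t (IM := 𝓘(ℝ, EuclideanSpace ℝ (Fin k))) (IN := 𝓘M)
    (IP := 𝓘(ℝ, F))
    (g := fun m' : MomentumBundle ℰ S hp n => fibreCoord hp q₀.2 m'.1.2)
    (f := fun t => c t x)
    (((contMDiffAt_fibreCoord hp q₀.2 hy).comp (c t x)
      (contMDiff_momentum_config hp).contMDiffAt).mdifferentiableAt (by simp))
    ((contMDiff_phase_left hp hc x).mdifferentiableAt (by simp)) w
  rw [mfderiv_fibreCoord hp q₀.2 (c t x) hy] at h1
  rw [← mfderiv_eq_fderiv]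
  exact h1.symm

/-- The derivative of the fibre coordinates along a family is the fibre part of its velocity. -/
theorem fderiv_fibreCoord (hc : IsPlot c) (t w : EuclideanSpace ℝ (Fin k)) (x : S) :
    fderiv ℝ (fun t' => fibreCoord hp (c t x).1.2 (c t' x).1.2) t w =
      fibreVelocity hp (c t x) (velocityFun c t w x) := by
  have h1 := mfderiv_comp_model t (IM := 𝓘(ℝ, EuclideanSpace ℝ (Fin k))) (IN := 𝓘M)
    (IP := 𝓘(ℝ, F))
    (g := fun m' : MomentumBundle ℰ S hp n => fibreCoord hp (c t x).1.2 m'.1.2)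
    (f := fun t => c t x)
    (((contMDiffAt_fibreCoord hp (c t x).1.2 (mem_adChart_source hp _)).comp (c t x)
      (contMDiff_momentum_config hp).contMDiffAt).mdifferentiableAt (by simp))
    ((contMDiff_phase_left hp hc x).mdifferentiableAt (by simp)) w
  exact (congrArg (fun L : EuclideanSpace ℝ (Fin k) →L[ℝ] F => L w) mfderiv_eq_fderiv).symm.trans h1

/-- The derivative of the momentum coordinates along a family is the momentum part of its
velocity. -/
theorem fderiv_momentumCoord (hc : IsPlot c) (t w : EuclideanSpace ℝ (Fin k)) (x : S) :
    fderiv ℝ (fun t' => momentumCoord hp (c t x).1 (c t' x)) t w =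
      momentumVelocity hp (c t x) (velocityFun c t w x) := by
  have h1 := mfderiv_comp_model t (IM := 𝓘(ℝ, EuclideanSpace ℝ (Fin k))) (IN := 𝓘M)
    (IP := 𝓘(ℝ, F →L[ℝ] (ℰ [⋀^Fin n]→L[ℝ] ℝ)))
    (g := momentumCoord hp (c t x).1) (f := fun t => c t x)
    ((contMDiffAt_momentumCoord hp _ (mem_momSource_self hp _)).mdifferentiableAt (by simp))
    ((contMDiff_phase_left hp hc x).mdifferentiableAt (by simp)) w
  exact (congrArg (fun L : EuclideanSpace ℝ (Fin k) →L[ℝ] (F →L[ℝ] (ℰ [⋀^Fin n]→L[ℝ] ℝ)) => L w)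
    mfderiv_eq_fderiv).symm.trans h1

/-- The symplectic form at a point is minus the exterior derivative of the integrand of the
canonical one-form. -/
theorem fderiv_momentum_configVelocity_sub (hc : IsPlot c) (t v w : EuclideanSpace ℝ (Fin k))
    (x : S) (u : Fin n → ℰ) :
    fderiv ℝ (fun t => PhaseSpace.momentum hp (c t) x
      (configVelocity hp τ (c t) (velocity c hc t w) x) u) t v -
    fderiv ℝ (fun t => PhaseSpace.momentum hp (c t) x
      (configVelocity hp τ (c t) (velocity c hc t v) x) u) t w =
    - symplecticAt hp (c t x) (velocityFun c t v x) (velocityFun c t w x) u := by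
  let ev : (ℰ [⋀^Fin n]→L[ℝ] ℝ) →L[ℝ] ℝ := LinearMap.toContinuousLinearMap
    { toFun := fun A => A u
      map_add' := fun A B => rfl
      map_smul' := fun r A => rfl }
  have heq : ∀ w, (fun t => PhaseSpace.momentum hp (c t) x
      (configVelocity hp τ (c t) (velocity c hc t w) x) u) =ᶠ[𝓝 t] fun t' => ev
        (momentumCoord hp (c t x).1 (c t' x)
        (fderiv ℝ (fun t' => fibreCoord hp (c t x).1.2 (c t' x).1.2) t' w)) := by
    intro w
    filter_upwards [(contMDiff_phase_config_left hp hc x).continuous.continuousAt.eventually_mem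
      ((adChart hp (c t x).1.2).open_source.mem_nhds (mem_adChart_source hp (c t x).1.2))]
      with t' ht'
    exact congrArg (fun A : ℰ [⋀^Fin n]→L[ℝ] ℝ => A u) (momentum_configVelocity_eq hp hc t' w x
      (c t x).1 (PhaseSpace.base_eq hp (c t) x) ht')
  have hA : ContMDiffAt 𝓘(ℝ, EuclideanSpace ℝ (Fin k)) 𝓘(ℝ, F →L[ℝ] (ℰ [⋀^Fin n]→L[ℝ] ℝ)) ∞
      (fun t' => momentumCoord hp (c t x).1 (c t' x)) t :=
    ContMDiffAt.comp t (I' := 𝓘M) (g := momentumCoord hp (c t x).1) (f := fun t' => c t' x)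
      (contMDiffAt_momentumCoord hp _ (mem_momSource_self hp _))
      (contMDiff_phase_left hp hc x).contMDiffAt
  have hy : ContMDiffAt 𝓘(ℝ, EuclideanSpace ℝ (Fin k)) 𝓘(ℝ, F) ∞
      (fun t' => fibreCoord hp (c t x).1.2 (c t' x).1.2) t :=
    ContMDiffAt.comp t (I' := 𝓘(ℝ, EY)) (g := fibreCoord hp (c t x).1.2)
      (f := fun t' => (c t' x).1.2)
      (contMDiffAt_fibreCoord hp _ (mem_adChart_source hp _))
      (contMDiff_phase_config_left hp hc x).contMDiffAt
  have h := fderiv_pairing_sub (contMDiffAt_iff_contDiffAt.1 hA) (contMDiffAt_iff_contDiffAt.1 hy)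
    ev v w
  rw [fderiv_fibreCoord hp hc, fderiv_fibreCoord hp hc, fderiv_momentumCoord hp hc,
    fderiv_momentumCoord hp hc] at h
  rw [(heq v).fderiv_eq, (heq w).fderiv_eq, h]
  exact (neg_sub _ _).symm

end Family

end SymplecticAt

/-! ### The canonical forms of the phase space -/

section TwoForms

open Diffeology

variable {ES EK HK EB HB S K B EK' HK' EB' HB' K' B' : Type*}
  [NormedAddCommGroup ES] [NormedSpace ℝ ES] [FiniteDimensional ℝ ES]
  [NormedAddCommGroup EK] [NormedSpace ℝ EK] [TopologicalSpace HK]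
  [NormedAddCommGroup EB] [NormedSpace ℝ EB] [TopologicalSpace HB]
  {IK : ModelWithCorners ℝ EK HK} {IB : ModelWithCorners ℝ EB HB}
  [TopologicalSpace S] [ChartedSpace ES S] [IsManifold 𝓘(ℝ, ES) ∞ S] [CompactSpace S] [T2Space S]
  [TopologicalSpace K] [ChartedSpace HK K] [IsManifold IK ∞ K]
  [TopologicalSpace B] [ChartedSpace HB B]
  {D : SectionData IK IB S K B}
  [NormedAddCommGroup EK'] [NormedSpace ℝ EK'] [TopologicalSpace HK']
  [NormedAddCommGroup EB'] [NormedSpace ℝ EB'] [TopologicalSpace HB']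
  {IK' : ModelWithCorners ℝ EK' HK'} {IB' : ModelWithCorners ℝ EB' HB'}
  [TopologicalSpace K'] [ChartedSpace HK' K'] [IsManifold IK' ∞ K']
  [TopologicalSpace B'] [ChartedSpace HB' B']
  {D' : SectionData IK' IB' S K' B'}

/-- The pull-back of a two-form by a family of linear maps. -/
def TwoForm.pullback {R : Sections 𝓘(ℝ, ES) D → Sections 𝓘(ℝ, ES) D'} (β : TwoForm 𝓘(ℝ, ES) D')
    (TR : ∀ s, SectionTangent s →ₗ[ℝ] SectionTangent (R s)) : TwoForm 𝓘(ℝ, ES) D :=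
  fun s => (β (R s)).compLinearMap (TR s)

theorem TwoForm.pullback_apply {R : Sections 𝓘(ℝ, ES) D → Sections 𝓘(ℝ, ES) D'}
    (β : TwoForm 𝓘(ℝ, ES) D') (TR : ∀ s, SectionTangent s →ₗ[ℝ] SectionTangent (R s))
    (s : Sections 𝓘(ℝ, ES) D) (V W : SectionTangent s) :
    β.pullback TR s ![V, W] = β (R s) ![TR s V, TR s W] := by
  refine congrArg (β (R s)) (funext fun i => ?_)
  fin_cases i <;> rfl

/-- Exterior derivatives commute with pull-backs. -/
theorem IsExtDeriv.pullback {R : Sections 𝓘(ℝ, ES) D → Sections 𝓘(ℝ, ES) D'} (hR : DSmooth R)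
    {TR : ∀ s, SectionTangent s →ₗ[ℝ] SectionTangent (R s)} (hTR : IsTangentMap R TR)
    {α : TangentFunction 𝓘(ℝ, ES) D'} {β : TwoForm 𝓘(ℝ, ES) D'} (h : IsExtDeriv α β) :
    IsExtDeriv (fun s V => α (R s) (TR s V)) (β.pullback TR) where
  isSmoothOneForm :=
    { isLinearMap := fun s =>
        { map_add := fun V W => by rw [map_add, (h.isSmoothOneForm.isLinearMap _).map_add]
          map_smul := fun r V => by rw [map_smul, (h.isSmoothOneForm.isLinearMap _).map_smul] }
      contDiff := fun c hc v => by
        simp_rw [hTR c hc (hR _ _ hc)]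
        exact h.isSmoothOneForm.contDiff _ (hR _ _ hc) v }
  eq := fun c hc t v w => by
    rw [TwoForm.pullback_apply]
    simp_rw [hTR c hc (hR _ _ hc)]
    exact h.eq _ (hR _ _ hc) t v w

/-- The two-form on a space of sections given by an alternating function of two tangent vectors. -/
def TwoForm.mk₂ (f : ∀ s : Sections 𝓘(ℝ, ES) D, SectionTangent s → SectionTangent s → ℝ)
    (hadd : ∀ s U V W, f s (U + V) W = f s U W + f s V W)
    (hsmul : ∀ s (r : ℝ) V W, f s (r • V) W = r * f s V W)
    (hanti : ∀ s V W, f s V W = - f s W V) : TwoForm 𝓘(ℝ, ES) D := fun s =>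
  { toFun := fun U => f s (U 0) (U 1)
    map_update_add' := by
      intro _ m i x y
      fin_cases i
      · simp [Function.update, hadd]
      · simp only [Fin.mk_one]
        simp [Function.update]
        rw [hanti, hadd, hanti _ x, hanti _ y]; ring
    map_update_smul' := by
      intro _ m i r x
      fin_cases i
      · simp [Function.update, hsmul]
      · simp [Function.update]
        rw [hanti, hsmul, hanti _ x]; ring
    map_eq_zero_of_eq' := by
      intro U i j h hij
      have : U 0 = U 1 := by
        fin_cases i <;> fin_cases j
        · exact absurd rfl hij
        · exact h
        · exact h.symm
        · exact absurd rfl hij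
      change f s (U 0) (U 1) = 0
      rw [this]
      linarith [hanti s (U 1) (U 1)] }

end TwoForms

section PhaseForms

open Diffeology

variable {S X Y EX EY F : Type*} {n : ℕ}
  [TopologicalSpace S] [ChartedSpace (EuclideanSpace ℝ (Fin n)) S]
  [IsManifold 𝓘(ℝ, EuclideanSpace ℝ (Fin n)) ∞ S] [CompactSpace S] [T2Space S]
  [NormedAddCommGroup EX] [NormedSpace ℝ EX]
  [TopologicalSpace X] [ChartedSpace EX X] [IsManifold 𝓘(ℝ, EX) ∞ X]
  [NormedAddCommGroup EY] [NormedSpace ℝ EY] [FiniteDimensional ℝ EY]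
  [TopologicalSpace Y] [ChartedSpace EY Y] [IsManifold 𝓘(ℝ, EY) ∞ Y] [T2Space Y]
  [NormedAddCommGroup F] [NormedSpace ℝ F] [FiniteDimensional ℝ F]
  {p : Y → X} (hp : Manifold.IsSubmersionOfComplement F 𝓘(ℝ, EY) 𝓘(ℝ, EX) ∞ p) {τ : S → X}

local notation "ℰ" => EuclideanSpace ℝ (Fin n)
local notation "𝓘M" => ModelWithCorners.prod
  (ModelWithCorners.prod (modelWithCornersSelf ℝ (EuclideanSpace ℝ (Fin n)))
    (modelWithCornersSelf ℝ EY))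
  (modelWithCornersSelf ℝ (ContinuousLinearMap (RingHom.id ℝ) F
    (ContinuousAlternatingMap ℝ (EuclideanSpace ℝ (Fin n)) ℝ (Fin n))))

theorem nonempty_adaptedChart_momentum (m : MomentumBundle ℰ S hp n) :
    Nonempty (AdaptedChart (momentumData hp τ n) m) :=
  ⟨(exists_adaptedChart_momentum hp τ m).choose⟩

/-- The integrand of the canonical one-form of the phase space. -/
def phaseIntegrand (s : PhaseSpace hp τ n) (V : SectionTangent s) (x : S) : FormAt ℰ n x :=
  FormAt.cast (congrArg Prod.fst (s.proj_eq x)) ((s x).2 (configVelocity hp τ s V x))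

theorem phaseIntegrand_apply (s : PhaseSpace hp τ n) (V : SectionTangent s) (x : S)
    (u : Fin n → ℰ) : (phaseIntegrand hp s V x u : ℝ) =
      PhaseSpace.momentum hp s x (configVelocity hp τ s V x) u :=
  congrArg (fun A : ℰ [⋀^Fin n]→L[ℝ] ℝ => A u) (FormAt.cast_eq _ _)

theorem contMDiff_phaseIntegrand {k : ℕ} {c : EuclideanSpace ℝ (Fin k) → PhaseSpace hp τ n}
    (hc : IsPlot c) (w : EuclideanSpace ℝ (Fin k)) :
    ContMDiff (𝓘(ℝ, EuclideanSpace ℝ (Fin k)).prod 𝓘(ℝ, ℰ))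
      (𝓘(ℝ, ℰ).prod 𝓘(ℝ, ℰ [⋀^Fin n]→L[ℝ] ℝ)) ∞
      (fun q : EuclideanSpace ℝ (Fin k) × S =>
        (⟨q.2, phaseIntegrand hp (c q.1) (velocity c hc q.1 w) q.2⟩ : FormBundle ℰ S n)) := by
  intro q₀
  have h1 := ContMDiff.mfderiv_partial_left (Sections.IsPlot.contMDiff hc)
    (IM := 𝓘(ℝ, EuclideanSpace ℝ (Fin k)).prod 𝓘(ℝ, ℰ))
    (a := fun q : EuclideanSpace ℝ (Fin k) × S => q.1) (b := fun q => q.2) (w := fun _ => w)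
    (q₀ := q₀) contMDiffAt_snd (contMDiffAt_tangent_vectorSpace.2
      ⟨contMDiffAt_fst, contMDiffAt_const⟩)
  have h2 := (contMDiff_momentum_config hp (n := n) (S := S)).mfderiv_along h1
  have h3 := (contMDiffAt_vert_iff hp
    (b := fun q : EuclideanSpace ℝ (Fin k) × S => (c q.1 q.2).1.2)
    (v := fun q => configVelocity hp τ (c q.1) (velocity c hc q.1 w) q.2)).2 h2
  have h4 := ContMDiffAt.momentum_apply hp
    (a := fun q : EuclideanSpace ℝ (Fin k) × S => (c q.1 q.2).1.1)
    (b := fun q => (c q.1 q.2).1.2) (μ := fun q => (c q.1 q.2).2)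
    (Sections.IsPlot.contMDiff hc).contMDiffAt h3
  refine h4.congr_of_eventuallyEq (Filter.Eventually.of_forall fun q => ?_)
  exact FormAt.mk_cast _ _

theorem contMDiff_phaseIntegrand_right (s : PhaseSpace hp τ n) (V : SectionTangent s) :
    ContMDiff 𝓘(ℝ, ℰ) (𝓘(ℝ, ℰ).prod 𝓘(ℝ, ℰ [⋀^Fin n]→L[ℝ] ℝ)) ∞
      (fun x => (⟨x, phaseIntegrand hp s V x⟩ : FormBundle ℰ S n)) := by
  refine SectionTangent.induction₂ (fun m _ => nonempty_adaptedChart_momentum hp m)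
    (P := fun s V _ => ContMDiff 𝓘(ℝ, ℰ) (𝓘(ℝ, ℰ).prod 𝓘(ℝ, ℰ [⋀^Fin n]→L[ℝ] ℝ)) ∞
      (fun x => (⟨x, phaseIntegrand hp s V x⟩ : FormBundle ℰ S n))) ?_ V V
  intro c hc t v _
  exact (contMDiff_phaseIntegrand hp hc v).comp (contMDiff_const.prodMk contMDiff_id)

theorem phaseIntegrand_add (s : PhaseSpace hp τ n) (V W : SectionTangent s) (x : S) :
    phaseIntegrand hp s (V + W) x = phaseIntegrand hp s V x + phaseIntegrand hp s W x := by
  have h : configVelocity hp τ s (V + W) x =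
      configVelocity hp τ s V x + configVelocity hp τ s W x :=
    Subtype.ext (map_add (mfderiv 𝓘M 𝓘(ℝ, EY)
      (fun m : MomentumBundle ℰ S hp n => m.1.2) (s x)) (V.1 x) (W.1 x))
  have h2 : PhaseSpace.momentum hp s x (configVelocity hp τ s (V + W) x) =
      PhaseSpace.momentum hp s x (configVelocity hp τ s V x) +
      PhaseSpace.momentum hp s x (configVelocity hp τ s W x) := by
    rw [h]
    exact map_add (s x).2 _ _
  refine ContinuousAlternatingMap.ext fun u => ?_
  exact (phaseIntegrand_apply hp s (V + W) x u).trans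
    ((congrArg (fun A : ℰ [⋀^Fin n]→L[ℝ] ℝ => A u) h2).trans (congrArg₂ (· + ·)
      (phaseIntegrand_apply hp s V x u) (phaseIntegrand_apply hp s W x u)).symm)

theorem phaseIntegrand_smul (s : PhaseSpace hp τ n) (r : ℝ) (V V' : SectionTangent s)
    (hV' : ∀ x, V'.1 x = r • V.1 x) (x : S) :
    phaseIntegrand hp s V' x = r • phaseIntegrand hp s V x := by
  have h : configVelocity hp τ s V' x = r • configVelocity hp τ s V x :=
    Subtype.ext ((congrArg (mfderiv 𝓘M 𝓘(ℝ, EY)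
      (fun m : MomentumBundle ℰ S hp n => m.1.2) (s x)) (hV' x)).trans
        (map_smul (mfderiv 𝓘M 𝓘(ℝ, EY)
      (fun m : MomentumBundle ℰ S hp n => m.1.2) (s x)) r (V.1 x)))
  have h2 : PhaseSpace.momentum hp s x (configVelocity hp τ s V' x) =
      r • PhaseSpace.momentum hp s x (configVelocity hp τ s V x) := by
    rw [h]
    exact map_smul (s x).2 r _
  refine ContinuousAlternatingMap.ext fun u => ?_
  exact (phaseIntegrand_apply hp s V' x u).trans
    ((congrArg (fun A : ℰ [⋀^Fin n]→L[ℝ] ℝ => A u) h2).trans (congrArg (r * ·)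
      (phaseIntegrand_apply hp s V x u)).symm)

theorem isSmoothOneForm_phaseOneForm (o : OrientationForm n S) :
    IsSmoothOneForm (phaseOneForm hp τ o) where
  isLinearMap s :=
    { map_add := fun V W => (congrArg (integralForm o)
        (funext fun x => phaseIntegrand_add hp s V W x)).trans
          (integralForm_add o (contMDiff_phaseIntegrand_right hp s V)
            (contMDiff_phaseIntegrand_right hp s W))
      map_smul := fun r V => (congrArg (integralForm o)
        (funext fun x => phaseIntegrand_smul hp s r V _ (fun _ => rfl) x)).trans
          (integralForm_smul o r (phaseIntegrand hp s V)) }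
  contDiff c hc v := contDiff_integralForm o
    (α := fun t => phaseIntegrand hp (c t) (velocity c hc t v)) (contMDiff_phaseIntegrand hp hc v)

/-- The pointwise symplectic form evaluated on two tangent vectors of the phase space. -/
def symplecticIntegrand (s : PhaseSpace hp τ n) (V W : SectionTangent s) (x : S) :
    FormAt ℰ n x := symplecticAt hp (s x) (V.1 x) (W.1 x)

/-- The exterior derivative of the integrand of the canonical one-form. -/
theorem exists_fderiv_phaseIntegrand {k : ℕ} {c : EuclideanSpace ℝ (Fin k) → PhaseSpace hp τ n}
    (hc : IsPlot c) (t v w : EuclideanSpace ℝ (Fin k)) :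
    ∃ β β' : ∀ x : S, FormAt ℰ n x,
      (∀ x (u : Fin n → TangentSpace 𝓘(ℝ, ℰ) x), fderiv ℝ (fun t =>
        (phaseIntegrand hp (c t) (velocity c hc t w) x u : ℝ)) t v = (β x u : ℝ)) ∧
      (∀ x (u : Fin n → TangentSpace 𝓘(ℝ, ℰ) x), fderiv ℝ (fun t =>
        (phaseIntegrand hp (c t) (velocity c hc t v) x u : ℝ)) t w = (β' x u : ℝ)) ∧
      ContMDiff 𝓘(ℝ, ℰ) (𝓘(ℝ, ℰ).prod 𝓘(ℝ, ℰ [⋀^Fin n]→L[ℝ] ℝ)) ∞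
        (fun x => (⟨x, β x⟩ : FormBundle ℰ S n)) ∧
      ContMDiff 𝓘(ℝ, ℰ) (𝓘(ℝ, ℰ).prod 𝓘(ℝ, ℰ [⋀^Fin n]→L[ℝ] ℝ)) ∞
        (fun x => (⟨x, β' x⟩ : FormBundle ℰ S n)) ∧
      ∀ x (u : Fin n → ℰ), (symplecticIntegrand hp (c t) (velocity c hc t v) (velocity c hc t w) x
        u : ℝ)
        = (β' x u : ℝ) - (β x u : ℝ) := by
  obtain ⟨β, hβ, hβs⟩ := exists_form_fderiv
    (α := fun t => phaseIntegrand hp (c t) (velocity c hc t w)) (contMDiff_phaseIntegrand hp hc w)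
      t v
  obtain ⟨β', hβ', hβs'⟩ := exists_form_fderiv
    (α := fun t => phaseIntegrand hp (c t) (velocity c hc t v)) (contMDiff_phaseIntegrand hp hc v)
      t w
  refine ⟨β, β', hβ, hβ', hβs, hβs', fun x u => ?_⟩
  have h := fderiv_momentum_configVelocity_sub hp hc t v w x u
  have e : ∀ v, (fun t => PhaseSpace.momentum hp (c t) x
      (configVelocity hp τ (c t) (velocity c hc t v) x) u) =
      fun t => (phaseIntegrand hp (c t) (velocity c hc t v) x u : ℝ) := fun v =>
    funext fun t => (phaseIntegrand_apply hp (c t) (velocity c hc t v) x u).symm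
  rw [e, e] at h
  have h1 := hβ x u
  have h2 := hβ' x u
  have h3 : symplecticAt hp (c t x) (velocityFun c t v x) (velocityFun c t w x) u =
    (fderiv ℝ (fun t => (phaseIntegrand hp (c t) (velocity c hc t v) x u : ℝ)) t w) -
    (fderiv ℝ (fun t => (phaseIntegrand hp (c t) (velocity c hc t w) x u : ℝ)) t v) := by
    linarith
  exact h3.trans (congrArg₂ (· - ·) h2 h1)

/-- The integrand of the two-form is smooth: any two tangent vectors are velocities of one
smooth family, along which the integrand is a difference of derivatives of smooth families. -/
theorem contMDiff_symplecticIntegrand (s : PhaseSpace hp τ n) (V W : SectionTangent s) :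
    ContMDiff 𝓘(ℝ, ℰ) (𝓘(ℝ, ℰ).prod 𝓘(ℝ, ℰ [⋀^Fin n]→L[ℝ] ℝ)) ∞
      (fun x => (⟨x, symplecticIntegrand hp s V W x⟩ : FormBundle ℰ S n)) := by
  refine SectionTangent.induction₂ (fun m _ => nonempty_adaptedChart_momentum hp m)
    (P := fun s V W => ContMDiff 𝓘(ℝ, ℰ) (𝓘(ℝ, ℰ).prod 𝓘(ℝ, ℰ [⋀^Fin n]→L[ℝ] ℝ)) ∞
      (fun x => (⟨x, symplecticIntegrand hp s V W x⟩ : FormBundle ℰ S n))) ?_ V W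
  intro c hc t v w x₀
  obtain ⟨β, β', -, -, hβ, hβ', h⟩ := exists_fderiv_phaseIntegrand hp hc t v w
  refine contMDiffAt_form_of_apply (b := fun x : S => x) contMDiffAt_id fun u hu => ?_
  have h1 := ContMDiffAt.form_apply (b := fun x : S => x) (A := β) (u := u) hβ.contMDiffAt hu
  have h2 := ContMDiffAt.form_apply (b := fun x : S => x) (A := β') (u := u) hβ'.contMDiffAt hu
  exact (h2.sub h1).congr_of_eventuallyEq (Filter.Eventually.of_forall fun x => h x fun i => u i x)

theorem symplecticAt_add_left (m : MomentumBundle ℰ S hp n)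
    (u v w : (ℰ × EY) × (F →L[ℝ] (ℰ [⋀^Fin n]→L[ℝ] ℝ))) :
    symplecticAt hp m (u + v) w = symplecticAt hp m u w + symplecticAt hp m v w := by
  unfold symplecticAt
  rw [map_add, map_add, map_add, add_apply]
  abel

theorem symplecticAt_smul_left (m : MomentumBundle ℰ S hp n) (r : ℝ)
    (v w : (ℰ × EY) × (F →L[ℝ] (ℰ [⋀^Fin n]→L[ℝ] ℝ))) :
    symplecticAt hp m (r • v) w = r • symplecticAt hp m v w := by
  unfold symplecticAt
  rw [map_smul, map_smul, map_smul, smul_apply, smul_sub]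

theorem symplecticAt_swap (m : MomentumBundle ℰ S hp n)
    (v w : (ℰ × EY) × (F →L[ℝ] (ℰ [⋀^Fin n]→L[ℝ] ℝ))) :
    symplecticAt hp m v w = (-1 : ℝ) • symplecticAt hp m w v := by
  unfold symplecticAt
  exact (neg_sub _ _).symm.trans (neg_one_smul ℝ _).symm

/-- The canonical two-form of the phase space. -/
def phaseTwoForm (τ : S → X) (o : OrientationForm n S) : TwoForm 𝓘(ℝ, ℰ) (momentumData hp τ n) :=
  TwoForm.mk₂ (fun s V W => integralForm o (symplecticIntegrand hp s V W))
    (fun s U V W => by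
      refine Eq.trans ?_ (integralForm_add o (contMDiff_symplecticIntegrand hp s U W)
        (contMDiff_symplecticIntegrand hp s V W))
      exact congrArg (integralForm o) (funext fun x => symplecticAt_add_left hp (s x) _ _ _))
    (fun s r V W => by
      refine Eq.trans ?_ (integralForm_smul o r (symplecticIntegrand hp s V W))
      exact congrArg (integralForm o) (funext fun x => symplecticAt_smul_left hp (s x) _ _ _))
    (fun s V W => by
      refine Eq.trans ?_ ((integralForm_smul o (-1) (symplecticIntegrand hp s W V)).trans
        (neg_one_mul _))
      exact congrArg (integralForm o) (funext fun x => symplecticAt_swap hp (s x) _ _))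

theorem phaseOneForm_eq (o : OrientationForm n S) (s : PhaseSpace hp τ n) (V : SectionTangent s) :
    phaseOneForm hp τ o s V = integralForm o (phaseIntegrand hp s V) := rfl

/-- Minus the two-form on two velocities of a family is the exterior derivative of the
one-form, by differentiation under the integral sign. -/
theorem integralForm_symplecticIntegrand (o : OrientationForm n S) {k : ℕ}
    {c : EuclideanSpace ℝ (Fin k) → PhaseSpace hp τ n} (hc : IsPlot c)
    (t v w : EuclideanSpace ℝ (Fin k)) :
    -integralForm o (symplecticIntegrand hp (c t) (velocity c hc t v) (velocity c hc t w)) =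
      fderiv ℝ (fun t' => integralForm o (phaseIntegrand hp (c t') (velocity c hc t' w))) t v -
      fderiv ℝ (fun t' => integralForm o (phaseIntegrand hp (c t') (velocity c hc t' v))) t w := by
  obtain ⟨β, β', h1, h2, hβ, hβ', h⟩ := exists_fderiv_phaseIntegrand hp hc t v w
  have e1 := fderiv_integralForm o (α := fun t => phaseIntegrand hp (c t) (velocity c hc t w))
    (contMDiff_phaseIntegrand hp hc w) t v h1
  have e2 := fderiv_integralForm o (α := fun t => phaseIntegrand hp (c t) (velocity c hc t v))
    (contMDiff_phaseIntegrand hp hc v) t w h2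
  have h4 : (fun x => β x + symplecticIntegrand hp (c t) (velocity c hc t v)
      (velocity c hc t w) x) = β' := by
    funext x
    refine ContinuousAlternatingMap.ext fun u => ?_
    exact (congrArg (fun r => (β x u : ℝ) + r) (h x u)).trans (add_sub_cancel _ _)
  have h3 := integralForm_add o hβ
    (contMDiff_symplecticIntegrand hp (c t) (velocity c hc t v) (velocity c hc t w))
  have h5 := (congrArg (integralForm o) h4).symm.trans h3
  refine Eq.trans ?_ (congrArg₂ (· - ·) e1 e2).symm
  linarith

/-- The canonical two-form `ω_τ = -dθ_τ` is the integral of the pointwise symplectic form. -/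
theorem isExtDeriv_phaseOneForm (o : OrientationForm n S) :
    IsExtDeriv (phaseOneForm hp τ o) (-phaseTwoForm hp τ o) where
  isSmoothOneForm := isSmoothOneForm_phaseOneForm hp o
  eq _ hc t v w := integralForm_symplecticIntegrand hp o hc t v w

end PhaseForms

/-! ### The canonical one-form of the multimomentum fields is a pull-back -/

section PullbackForm

open Diffeology

variable {S X Y EX EY F : Type*} {n : ℕ}
  [TopologicalSpace S] [ChartedSpace (EuclideanSpace ℝ (Fin n)) S]
  [IsManifold 𝓘(ℝ, EuclideanSpace ℝ (Fin n)) ∞ S] [CompactSpace S] [T2Space S]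
  [NormedAddCommGroup EX] [NormedSpace ℝ EX]
  [TopologicalSpace X] [ChartedSpace EX X] [IsManifold 𝓘(ℝ, EX) ∞ X]
  [NormedAddCommGroup EY] [NormedSpace ℝ EY] [FiniteDimensional ℝ EY]
  [TopologicalSpace Y] [ChartedSpace EY Y] [IsManifold 𝓘(ℝ, EY) ∞ Y] [T2Space Y]
  [NormedAddCommGroup F] [NormedSpace ℝ F] [FiniteDimensional ℝ F]
  {p : Y → X} (hp : Manifold.IsSubmersionOfComplement F 𝓘(ℝ, EY) 𝓘(ℝ, EX) ∞ p) {τ : S → X}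

local notation "ℰ" => EuclideanSpace ℝ (Fin n)
local notation "𝓘Z" => ModelWithCorners.prod (modelWithCornersSelf ℝ EY)
  (modelWithCornersSelf ℝ (ContinuousAlternatingMap ℝ EY ℝ (Fin (n + 1))))
local notation "𝓘M" => ModelWithCorners.prod
  (ModelWithCorners.prod (modelWithCornersSelf ℝ (EuclideanSpace ℝ (Fin n)))
    (modelWithCornersSelf ℝ EY))
  (modelWithCornersSelf ℝ (ContinuousLinearMap (RingHom.id ℝ) F
    (ContinuousAlternatingMap ℝ (EuclideanSpace ℝ (Fin n)) ℝ (Fin n))))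

theorem incl_configVelocity_velocity {k : ℕ} {c : EuclideanSpace ℝ (Fin k) → PhaseSpace hp τ n}
    (hc : IsPlot c) (t v : EuclideanSpace ℝ (Fin k)) (x : S) :
    (VertAt.incl hp _ (configVelocity hp τ (c t) (velocity c hc t v) x) : EY) =
      mfderiv 𝓘(ℝ, EuclideanSpace ℝ (Fin k)) 𝓘(ℝ, EY) (fun t => (c t x).1.2) t v :=
  (mfderiv_comp_model t (IM := 𝓘(ℝ, EuclideanSpace ℝ (Fin k))) (IN := 𝓘M) (IP := 𝓘(ℝ, EY))
    (g := fun m : MomentumBundle ℰ S hp n => m.1.2) (f := fun t => c t x)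
    ((contMDiff_momentum_config hp).mdifferentiableAt (by simp))
    ((contMDiff_phase_left hp hc x).mdifferentiableAt (by simp)) v).symm

/-- The reduction map covers the identity of the configuration fields. -/
theorem incl_configVelocity_tangentMap
    {TR : ∀ σ : MultimomentumSpace hp τ n, SectionTangent σ →ₗ[ℝ] SectionTangent (reduction hp τ σ)}
    (hTR : IsTangentMap (reduction hp τ) TR) (σ : MultimomentumSpace hp τ n)
    (V : SectionTangent σ) (x : S) :
    (VertAt.incl hp (σ x).1 (configVelocity hp τ (reduction hp τ σ) (TR σ V) x) : EY) =
      multimomentumConfigVelocity hp τ σ V x := by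
  refine SectionTangent.induction₂
    (fun z _ => nonempty_adaptedChart_multimomentum hp τ n z)
    (P := fun σ V _ => (VertAt.incl hp (σ x).1
      (configVelocity hp τ (reduction hp τ σ) (TR σ V) x) : EY) =
        multimomentumConfigVelocity hp τ σ V x) ?_ V V
  intro c hc t v _
  rw [hTR c hc (isPlot_reduction hp τ hc) t v]
  refine (incl_configVelocity_velocity hp (isPlot_reduction hp τ hc) t v x).trans ?_
  exact mfderiv_plot_config hp τ hc t v x

/-- The canonical one-form of the multimomentum fields is the pull-back of the canonical one-form
of the phase space. -/
theorem multimomentumOneForm_eq (o : OrientationForm n S)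
    {TR : ∀ σ : MultimomentumSpace hp τ n, SectionTangent σ →ₗ[ℝ] SectionTangent (reduction hp τ σ)}
    (hTR : IsTangentMap (reduction hp τ) TR) :
    multimomentumOneForm hp τ o = fun σ V => phaseOneForm hp τ o (reduction hp τ σ) (TR σ V) := by
  funext σ V
  rw [phaseOneForm_eq]
  refine congrArg (integralForm o) (funext fun x => ContinuousAlternatingMap.ext fun u => ?_)
  refine Eq.trans ?_ (phaseIntegrand_apply hp (reduction hp τ σ) (TR σ V) x u).symm
  change ((σ x).2 _ : ℝ) = (σ x).2 _
  refine congrArg (fun w : Fin (n + 1) → EY => ((σ x).2 w : ℝ)) (funext fun i => ?_)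
  refine Fin.cases ?_ (fun j => ?_) i
  · exact (incl_configVelocity_tangentMap hp hTR σ V x).symm
  · exact (mfderiv_comp_model x (IM := 𝓘(ℝ, ℰ)) (IN := 𝓘Z) (IP := 𝓘(ℝ, EY))
      (g := (TotalSpace.proj : FormBundle EY Y (n + 1) → Y)) (f := σ.toFun)
      ((contMDiff_proj (n := ∞) (FormAt EY (n + 1) : Y → Type _)).mdifferentiableAt (by simp))
      (σ.contMDiff.mdifferentiableAt (by simp)) (u j)).symm

theorem existsUnique_isTangentMap_reduction :
    ∃! TR : ∀ σ : MultimomentumSpace hp τ n,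
      SectionTangent σ →ₗ[ℝ] SectionTangent (reduction hp τ σ),
      IsTangentMap (reduction hp τ) TR :=
  existsUnique_isTangentMap (fun z _ => nonempty_adaptedChart_multimomentum hp τ n z)
    (dsmooth_reduction hp τ)
    fun hc _ hc' t v t' v' h0 h x => velocity_reduction_congr hp τ hc hc' t v t' v' h0 h x

theorem isExtDeriv_multimomentumOneForm (o : OrientationForm n S)
    {TR : ∀ σ : MultimomentumSpace hp τ n, SectionTangent σ →ₗ[ℝ] SectionTangent (reduction hp τ σ)}
    (hTR : IsTangentMap (reduction hp τ) TR) :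
    IsExtDeriv (multimomentumOneForm hp τ o) (-(phaseTwoForm hp τ o).pullback TR) := by
  rw [multimomentumOneForm_eq hp o hTR]
  exact (isExtDeriv_phaseOneForm hp o).pullback (dsmooth_reduction hp τ) hTR

end PullbackForm

/-! ### A right inverse of the reduction map -/

section Gluing

variable {EM HM M EN HN N V ι : Type*}
  [NormedAddCommGroup EM] [NormedSpace ℝ EM] [TopologicalSpace HM] {IM : ModelWithCorners ℝ EM HM}
  [TopologicalSpace M] [ChartedSpace HM M]
  [NormedAddCommGroup EN] [NormedSpace ℝ EN] [TopologicalSpace HN] {IN : ModelWithCorners ℝ EN HN}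
  [TopologicalSpace N] [ChartedSpace HN N]
  [NormedAddCommGroup V] [NormedSpace ℝ V] {B : N → Type*} [TopologicalSpace (TotalSpace V B)]
  [∀ y, AddCommGroup (B y)] [∀ y, Module ℝ (B y)] [∀ y, TopologicalSpace (B y)]
  [FiberBundle V B] [VectorBundle ℝ V B]

/-- Sections along a map which are smooth on the members of a covering are glued by a partition of
unity. -/
theorem SmoothPartitionOfUnity.contMDiffAt_sum_along {s : Set N}
    (ρ : SmoothPartitionOfUnity ι IN N s) {b : M → N} {v : ι → ∀ q, B (b q)} {q₀ : M}
    (hb : ContMDiffAt IM IN ∞ b q₀)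
    (hv : ∀ i, b q₀ ∈ tsupport (ρ i) → ContMDiffAt IM (IN.prod 𝓘(ℝ, V)) ∞
      (fun q => (⟨b q, v i q⟩ : TotalSpace V B)) q₀) :
    ContMDiffAt IM (IN.prod 𝓘(ℝ, V)) ∞ (fun q =>
      (⟨b q, ∑ i ∈ ρ.finsupport (b q), ρ i (b q) • v i q⟩ : TotalSpace V B)) q₀ := by
  refine contMDiffAt_totalSpace.2 ⟨hb, ?_⟩
  let e := trivializationAt V B (b q₀)
  have h1 : ContMDiffAt IM 𝓘(ℝ, V) ∞ (fun q => ∑ i ∈ ρ.fintsupport (b q₀),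
      ρ i (b q) • (e ⟨b q, v i q⟩).2) q₀ := by
    refine ContMDiffAt.sum fun i hi => ?_
    exact ((ρ i).contMDiff.contMDiffAt.comp q₀ hb).smul
      (contMDiffAt_totalSpace.1 (hv i ((ρ.mem_fintsupport_iff _ i).1 hi))).2
  refine h1.congr_of_eventuallyEq ?_
  filter_upwards [hb.continuousAt.eventually (ρ.eventually_finsupport_subset (b q₀)),
    hb.continuousAt.eventually_mem (e.open_baseSet.mem_nhds
      (FiberBundle.mem_baseSet_trivializationAt' (b q₀)))] with q hq hq'
  have h2 : ∀ w : B (b q), (e ⟨b q, w⟩).2 = e.linearMapAt ℝ (b q) w := fun w => by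
    rw [Trivialization.coe_linearMapAt_of_mem _ hq']
  change (e ⟨b q, _⟩).2 = _
  rw [h2, map_sum]
  simp_rw [map_smul, ← h2]
  refine Finset.sum_subset hq fun i _ hi => ?_
  have : ρ i (b q) = 0 := by
    by_contra h
    exact hi ((ρ.mem_finsupport _).2 h)
  rw [this, zero_smul]

end Gluing

section VerticalProjection

variable {S X Y EX EY F : Type*}
  [NormedAddCommGroup EX] [NormedSpace ℝ EX]
  [TopologicalSpace X] [ChartedSpace EX X] [IsManifold 𝓘(ℝ, EX) ∞ X]
  [NormedAddCommGroup EY] [NormedSpace ℝ EY] [FiniteDimensional ℝ EY]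
  [TopologicalSpace Y] [ChartedSpace EY Y] [IsManifold 𝓘(ℝ, EY) ∞ Y]
  [NormedAddCommGroup F] [NormedSpace ℝ F]
  {p : Y → X} (hp : Manifold.IsSubmersionOfComplement F 𝓘(ℝ, EY) 𝓘(ℝ, EX) ∞ p)
  {EM HM M : Type*} [NormedAddCommGroup EM] [NormedSpace ℝ EM] [TopologicalSpace HM]
  {IM : ModelWithCorners ℝ EM HM} [TopologicalSpace M] [ChartedSpace HM M]

/-- The vertical projection given by an adapted chart. -/
def chartVerticalProjection (y₀ y : Y) : EY →L[ℝ] VertAt hp y :=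
  ((trivializationAt F (VertAt hp) y₀).symmL ℝ y).comp
    (((ContinuousLinearMap.snd ℝ EX F).comp (adEquiv hp y₀ : EY →L[ℝ] EX × F)).comp
      (chartD hp y₀ y : EY →L[ℝ] EY))

theorem trivializationAt_vert_symmL_vertCoord (y₀ y : Y) (hy : y ∈ (adChart hp y₀).source)
    (v : VertAt hp y) :
    (trivializationAt F (VertAt hp) y₀).symmL ℝ y (vertCoord hp y₀ y v) = v := by
  have hy' : y ∈ (trivializationAt F (VertAt hp) y₀).baseSet := hy
  have h := (trivializationAt F (VertAt hp) y₀).symmL_continuousLinearMapAt (R := ℝ) hy' v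
  rwa [Trivialization.continuousLinearMapAt_apply, Trivialization.coe_linearMapAt_of_mem _ hy'] at h

theorem vertCoord_trivializationAt_vert_symmL (y₀ y : Y) (hy : y ∈ (adChart hp y₀).source)
    (f : F) : vertCoord hp y₀ y ((trivializationAt F (VertAt hp) y₀).symmL ℝ y f) = f := by
  have hy' : y ∈ (trivializationAt F (VertAt hp) y₀).baseSet := hy
  have h := (trivializationAt F (VertAt hp) y₀).continuousLinearMapAt_symmL (R := ℝ) hy' f
  rwa [Trivialization.continuousLinearMapAt_apply, Trivialization.coe_linearMapAt_of_mem _ hy'] at h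

theorem chartVerticalProjection_incl (y₀ y : Y) (hy : y ∈ (adChart hp y₀).source)
    (v : VertAt hp y) : chartVerticalProjection hp y₀ y (VertAt.incl hp y v) = v :=
  trivializationAt_vert_symmL_vertCoord hp y₀ y hy v

theorem contMDiffAt_chartVerticalProjection (y₀ : Y) {b : M → Y}
    {w : ∀ q, TangentSpace 𝓘(ℝ, EY) (b q)} {q₀ : M} (h : b q₀ ∈ (adChart hp y₀).source)
    (hw : ContMDiffAt IM 𝓘(ℝ, EY).tangent ∞
      (fun q => (⟨b q, w q⟩ : TangentBundle 𝓘(ℝ, EY) Y)) q₀) :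
    ContMDiffAt IM (𝓘(ℝ, EY).prod 𝓘(ℝ, F)) ∞
      (fun q => (⟨b q, chartVerticalProjection hp y₀ (b q) (w q)⟩ : TotalSpace F (VertAt hp)))
        q₀ := by
  obtain ⟨hb, hw'⟩ := (contMDiffAt_tangent_iff_chartD hp y₀ h).1 hw
  refine (contMDiffAt_vert_iff hp).2 ((contMDiffAt_tangent_iff_chartD hp y₀ h).2 ⟨hb, ?_⟩)
  let L : EY →L[ℝ] EY := ((adEquiv hp y₀).symm : EX × F →L[ℝ] EY).comp
    ((ContinuousLinearMap.inr ℝ EX F).comp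
      ((ContinuousLinearMap.snd ℝ EX F).comp (adEquiv hp y₀ : EY →L[ℝ] EX × F)))
  have h1 : ContMDiffAt IM 𝓘(ℝ, EY) ∞ (fun q => L (chartD hp y₀ (b q) (w q))) q₀ :=
    (L.contDiff (n := ∞)).contMDiff.contMDiffAt.comp q₀ hw'
  refine h1.congr_of_eventuallyEq ?_
  filter_upwards [hb.continuousAt.eventually_mem ((adChart hp y₀).open_source.mem_nhds h)] with q hq
  have h2 := adEquiv_chartD_incl hp y₀ (b q) hq (chartVerticalProjection hp y₀ (b q) (w q))
  rw [show vertCoord hp y₀ (b q) (chartVerticalProjection hp y₀ (b q) (w q)) =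
    (adEquiv hp y₀ (chartD hp y₀ (b q) (w q))).2 from
    vertCoord_trivializationAt_vert_symmL hp y₀ (b q) hq _] at h2
  exact ((adEquiv hp y₀).eq_symm_apply.2 h2)

/-- There is a smooth field of projections of the tangent spaces of `Y` onto the vertical tangent
spaces, that is, an Ehresmann connection. -/
theorem exists_verticalProjection [T2Space Y] [SigmaCompactSpace Y] (IS : ModelWithCorners ℝ EM HM)
    (S : Type*) [TopologicalSpace S] [ChartedSpace HM S] :
    ∃ P : ∀ y : Y, EY →L[ℝ] VertAt hp y,
      (∀ y (v : VertAt hp y), P y (VertAt.incl hp y v) = v) ∧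
      ∀ {k : ℕ} (b : EuclideanSpace ℝ (Fin k) × S → Y) (w : ∀ q, TangentSpace 𝓘(ℝ, EY) (b q))
        (q₀ : EuclideanSpace ℝ (Fin k) × S),
        ContMDiffAt (𝓘(ℝ, EuclideanSpace ℝ (Fin k)).prod IS) 𝓘(ℝ, EY).tangent ∞
          (fun q => (⟨b q, w q⟩ : TangentBundle 𝓘(ℝ, EY) Y)) q₀ →
        ContMDiffAt (𝓘(ℝ, EuclideanSpace ℝ (Fin k)).prod IS) (𝓘(ℝ, EY).prod 𝓘(ℝ, F)) ∞
          (fun q => (⟨b q, P (b q) (w q)⟩ : TotalSpace F (VertAt hp))) q₀ := by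
  obtain ⟨ρ, hρ⟩ := SmoothPartitionOfUnity.exists_isSubordinate 𝓘(ℝ, EY) isClosed_univ
    (fun y₀ : Y => (adChart hp y₀).source) (fun y₀ => (adChart hp y₀).open_source)
    (fun y _ => mem_iUnion.2 ⟨y, mem_adChart_source hp y⟩)
  have hP : ∀ y (u : EY), (∑ i ∈ ρ.finsupport y, ρ i y • chartVerticalProjection hp i y) u =
      ∑ i ∈ ρ.finsupport y, ρ i y • chartVerticalProjection hp i y u := fun y u => by
    rw [sum_apply]
    rfl
  refine ⟨fun y => ∑ i ∈ ρ.finsupport y, ρ i y • chartVerticalProjection hp i y,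
    fun y v => ?_, fun {k} b w q₀ hw => ?_⟩
  · refine (hP y _).trans ?_
    have h1 : ∀ i ∈ ρ.finsupport y, ρ i y • chartVerticalProjection hp i y (VertAt.incl hp y v) =
        ρ i y • v := fun i hi => by
      rw [chartVerticalProjection_incl hp i y
        (hρ i (subset_tsupport _ ((ρ.mem_finsupport y).1 hi))) v]
    rw [Finset.sum_congr rfl h1, ← Finset.sum_smul, ρ.sum_finsupport y (mem_univ y), one_smul]
  · have hb : ContMDiffAt (𝓘(ℝ, EuclideanSpace ℝ (Fin k)).prod IS) 𝓘(ℝ, EY) ∞ b q₀ :=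
      (contMDiffAt_totalSpace.1 hw).1
    have h := ρ.contMDiffAt_sum_along (V := F) (B := VertAt hp) hb
      (v := fun i q => chartVerticalProjection hp i (b q) (w q)) (q₀ := q₀)
      fun i hi => contMDiffAt_chartVerticalProjection hp i (hρ i hi) hw
    refine h.congr_of_eventuallyEq (Filter.Eventually.of_forall fun q => ?_)
    exact congrArg (TotalSpace.mk (b q)) (hP (b q) (w q))

end VerticalProjection

section TangentRetraction

variable {S X ES EX : Type*}
  [NormedAddCommGroup ES] [NormedSpace ℝ ES] [FiniteDimensional ℝ ES]
  [TopologicalSpace S] [ChartedSpace ES S] [IsManifold 𝓘(ℝ, ES) ∞ S]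
  [NormedAddCommGroup EX] [NormedSpace ℝ EX]
  [TopologicalSpace X] [ChartedSpace EX X] [IsManifold 𝓘(ℝ, EX) ∞ X]
  {τ : S → X}

/-- Immersions have local retractions. -/
theorem exists_local_retraction (hτ : Manifold.IsImmersion 𝓘(ℝ, ES) 𝓘(ℝ, EX) ∞ τ) (x₀ : S) :
    ∃ (r : X → S) (U : Set X) (W : Set S), IsOpen U ∧ IsOpen W ∧ x₀ ∈ W ∧ MapsTo τ W U ∧
      ContMDiffOn 𝓘(ℝ, EX) 𝓘(ℝ, ES) ∞ r U ∧ ∀ x ∈ W, r (τ x) = x := by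
  obtain ⟨F, _, _, hF⟩ := hτ
  have h := hF x₀
  let L : EX →L[ℝ] ES := (ContinuousLinearMap.fst ℝ ES F).comp (h.equiv.symm : EX →L[ℝ] ES × F)
  have hc : ∀ x ∈ h.domChart.source, L (h.codChart (τ x)) = h.domChart x := by
    intro x hx
    have hx' : h.domChart x ∈ (h.domChart.extend 𝓘(ℝ, ES)).target := by
      simpa [OpenPartialHomeomorph.extend_target] using h.domChart.map_source hx
    have h1 := h.writtenInCharts hx'
    simp only [OpenPartialHomeomorph.extend, modelWithCornersSelf_partialEquiv,
      PartialEquiv.trans_refl, comp_apply, OpenPartialHomeomorph.toFun_eq_coe,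
      OpenPartialHomeomorph.coe_toPartialEquiv_symm] at h1
    rw [h.domChart.left_inv hx] at h1
    change (h.equiv.symm (h.codChart (τ x))).1 = _
    rw [h1, ContinuousLinearEquiv.symm_apply_apply]
  have hcod := contMDiffOn_of_mem_maximalAtlas h.codChart_mem_maximalAtlas
  have hL : ContMDiffOn 𝓘(ℝ, EX) 𝓘(ℝ, ES) ∞ (fun y => L (h.codChart y)) h.codChart.source :=
    (L.contDiff (n := ∞)).contMDiff.comp_contMDiffOn hcod
  refine ⟨fun y => h.domChart.symm (L (h.codChart y)),
    h.codChart.source ∩ (fun y => L (h.codChart y)) ⁻¹' h.domChart.target, h.domChart.source,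
    hL.continuousOn.isOpen_inter_preimage h.codChart.open_source h.domChart.open_target,
    h.domChart.open_source, h.mem_domChart_source, fun x hx => ⟨?_, ?_⟩, ?_, fun x hx => ?_⟩
  · exact h.mapsto_domChart_source_codChart_source hx
  · rw [mem_preimage, hc x hx]
    exact h.domChart.map_source hx
  · exact (contMDiffOn_symm_of_mem_maximalAtlas h.domChart_mem_maximalAtlas).comp
      (hL.mono inter_subset_left) inter_subset_right
  · change h.domChart.symm (L (h.codChart (τ x))) = x
    rw [hc x hx]
    exact h.domChart.left_inv hx

/-- The tangent map of an immersion has a smooth left inverse. -/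
theorem exists_tangentRetraction [T2Space S] [SigmaCompactSpace S]
    (hτ : Manifold.IsImmersion 𝓘(ℝ, ES) 𝓘(ℝ, EX) ∞ τ) :
    ∃ Q : S → EX →L[ℝ] ES,
      (∀ (x : S) (e : ES), Q x (mfderiv 𝓘(ℝ, ES) 𝓘(ℝ, EX) τ x e) = e) ∧
      ∀ {k : ℕ} (b : EuclideanSpace ℝ (Fin k) × S → S) (a : EuclideanSpace ℝ (Fin k) × S → X)
        (w : EuclideanSpace ℝ (Fin k) × S → EX) (q₀ : EuclideanSpace ℝ (Fin k) × S),
        ContMDiffAt (𝓘(ℝ, EuclideanSpace ℝ (Fin k)).prod 𝓘(ℝ, ES)) 𝓘(ℝ, ES) ∞ b q₀ →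
        ContMDiffAt (𝓘(ℝ, EuclideanSpace ℝ (Fin k)).prod 𝓘(ℝ, ES)) 𝓘(ℝ, EX).tangent ∞
          (fun q => (⟨a q, w q⟩ : TangentBundle 𝓘(ℝ, EX) X)) q₀ → (∀ q, a q = τ (b q)) →
        ContMDiffAt (𝓘(ℝ, EuclideanSpace ℝ (Fin k)).prod 𝓘(ℝ, ES)) 𝓘(ℝ, ES).tangent ∞
          (fun q => (⟨b q, Q (b q) (w q)⟩ : TangentBundle 𝓘(ℝ, ES) S)) q₀ := by
  choose r U W hU hW hx hUW hr hrτ using exists_local_retraction hτ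
  obtain ⟨ρ, hρ⟩ := SmoothPartitionOfUnity.exists_isSubordinate 𝓘(ℝ, ES) isClosed_univ
    W hW (fun x _ => mem_iUnion.2 ⟨x, hx x⟩)
  let Qi : S → S → EX →L[ℝ] ES := fun i x => mfderiv 𝓘(ℝ, EX) 𝓘(ℝ, ES) (r i) (τ x)
  have hQ : ∀ x (u : EX), (∑ i ∈ ρ.finsupport x, ρ i x • Qi i x) u =
      ∑ i ∈ ρ.finsupport x, ρ i x • Qi i x u := fun x u => by
    rw [sum_apply]
    rfl
  have hτd : ContMDiff 𝓘(ℝ, ES) 𝓘(ℝ, EX) ∞ τ := hτ.contMDiff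
  refine ⟨fun x => ∑ i ∈ ρ.finsupport x, ρ i x • Qi i x, fun x e => ?_, fun b a w q₀ hb hw ha => ?_⟩
  · refine (hQ x _).trans ?_
    have h1 : ∀ i ∈ ρ.finsupport x, ρ i x • Qi i x (mfderiv 𝓘(ℝ, ES) 𝓘(ℝ, EX) τ x e) =
        ρ i x • e := fun i hi => by
      have hxi : x ∈ W i := hρ i (subset_tsupport _ ((ρ.mem_finsupport x).1 hi))
      have h2 := mfderiv_comp_model x (IM := 𝓘(ℝ, ES)) (IN := 𝓘(ℝ, EX)) (IP := 𝓘(ℝ, ES))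
        (g := r i) (f := τ)
        (((hr i).contMDiffAt ((hU i).mem_nhds (hUW i hxi))).mdifferentiableAt (by simp))
        (hτd.mdifferentiableAt (by simp)) e
      have h3 : (fun x => r i (τ x)) =ᶠ[𝓝 x] id := by
        filter_upwards [(hW i).mem_nhds hxi] with x' hx' using hrτ i x' hx'
      have h4 := mfderiv_apply_congr (IM := 𝓘(ℝ, ES)) (IN := 𝓘(ℝ, ES)) h3 e
      rw [mfderiv_id] at h4
      exact congrArg (ρ i x • ·) (h2.symm.trans h4)
    rw [Finset.sum_congr rfl h1, ← Finset.sum_smul, ρ.sum_finsupport x (mem_univ x), one_smul]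
  · have h := ρ.contMDiffAt_sum_along (V := ES) (B := TangentSpace 𝓘(ℝ, ES)) hb
      (v := fun i q => Qi i (b q) (w q)) (q₀ := q₀) fun i hi => ?_
    · refine h.congr_of_eventuallyEq (Filter.Eventually.of_forall fun q => ?_)
      exact congrArg (TotalSpace.mk (b q)) (hQ (b q) (w q))
    · have h1 := (hr i).mfderiv_along (hU i) (b := a) (w := w)
        (by rw [ha]; exact hUW i (hρ i hi)) hw
      refine h1.congr_of_eventuallyEq ?_
      filter_upwards [hb.continuousAt.eventually_mem ((hW i).mem_nhds (hρ i hi))] with q hq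
      refine TotalSpace.ext ?_ (heq_of_eq ?_)
      · change b q = r i (a q)
        rw [ha, hrτ i _ hq]
      · change Qi i (b q) (w q) = _
        rw [ha]
        rfl

end TangentRetraction

section MomentumLift

open Diffeology

variable {S X Y EX EY F : Type*} {n : ℕ}
  [TopologicalSpace S] [ChartedSpace (EuclideanSpace ℝ (Fin n)) S]
  [IsManifold 𝓘(ℝ, EuclideanSpace ℝ (Fin n)) ∞ S] [T2Space S] [SigmaCompactSpace S]
  [NormedAddCommGroup EX] [NormedSpace ℝ EX]
  [TopologicalSpace X] [ChartedSpace EX X] [IsManifold 𝓘(ℝ, EX) ∞ X]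
  [NormedAddCommGroup EY] [NormedSpace ℝ EY] [FiniteDimensional ℝ EY]
  [TopologicalSpace Y] [ChartedSpace EY Y] [IsManifold 𝓘(ℝ, EY) ∞ Y] [T2Space Y]
  [SigmaCompactSpace Y]
  [NormedAddCommGroup F] [NormedSpace ℝ F] [FiniteDimensional ℝ F]
  {p : Y → X} (hp : Manifold.IsSubmersionOfComplement F 𝓘(ℝ, EY) 𝓘(ℝ, EX) ∞ p) {τ : S → X}

local notation "ℰ" => EuclideanSpace ℝ (Fin n)
local notation "𝓘Z" => ModelWithCorners.prod (modelWithCornersSelf ℝ EY)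
  (modelWithCornersSelf ℝ (ContinuousAlternatingMap ℝ EY ℝ (Fin (n + 1))))
local notation "𝓘M" => ModelWithCorners.prod
  (ModelWithCorners.prod (modelWithCornersSelf ℝ (EuclideanSpace ℝ (Fin n)))
    (modelWithCornersSelf ℝ EY))
  (modelWithCornersSelf ℝ (ContinuousLinearMap (RingHom.id ℝ) F
    (ContinuousAlternatingMap ℝ (EuclideanSpace ℝ (Fin n)) ℝ (Fin n))))

/-- The map `v ↦ Q^* (μ (P v))`, from a linear map `μ` from the vertical vectors to forms. -/
def pairingForm {VA VF : Type*} [NormedAddCommGroup VF] [NormedSpace ℝ VF]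
    [AddCommGroup VA] [Module ℝ VA] [TopologicalSpace VA]
    (P : EY →L[ℝ] VA) (Q : EY →L[ℝ] VF) (μ : VA →L[ℝ] (VF [⋀^Fin n]→L[ℝ] ℝ)) :
    EY →L[ℝ] (EY [⋀^Fin n]→L[ℝ] ℝ) :=
  (ContinuousAlternatingMap.compContinuousLinearMapCLM Q :
    (VF [⋀^Fin n]→L[ℝ] ℝ) →L[ℝ] (EY [⋀^Fin n]→L[ℝ] ℝ)).comp (μ.comp P)

/-- The wedge product of `P` and `μ ∘ Q`, expanded along its first factor. -/
theorem alternatizeUncurryFin_pairingForm {VA VF : Type*} [NormedAddCommGroup VF] [NormedSpace ℝ VF]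
    [AddCommGroup VA] [Module ℝ VA] [TopologicalSpace VA]
    (P : EY →L[ℝ] VA) (Q : EY →L[ℝ] VF) (μ : VA →L[ℝ] (VF [⋀^Fin n]→L[ℝ] ℝ))
    (u : Fin (n + 1) → EY) :
    ContinuousAlternatingMap.alternatizeUncurryFin (pairingForm P Q μ) u =
      ∑ i : Fin (n + 1), (-1) ^ (i : ℕ) * μ (P (u i)) (fun j => Q (u (i.succAbove j))) := by
  rw [ContinuousAlternatingMap.alternatizeUncurryFin_apply]
  refine Finset.sum_congr rfl fun i _ => ?_
  rw [zsmul_eq_mul]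
  push_cast
  rfl

/-- There is a smooth map which assigns, to a linear map `μ` from `V_yY` to `Λⁿ T*ₓS`, an
alternating map on `T_yY` with momentum `μ`: with the help of a connection and of a left inverse of
the tangent map of `τ`, it is the exterior product of `μ` with the vertical projection. -/
theorem exists_momentumLift (hτ : Manifold.IsImmersion 𝓘(ℝ, ℰ) 𝓘(ℝ, EX) ∞ τ) :
    ∃ l : ∀ m : MomentumBundle ℰ S hp n, FormAt EY (n + 1) m.1.2,
      (∀ {k : ℕ} (c : EuclideanSpace ℝ (Fin k) × S → MomentumBundle ℰ S hp n),
        ContMDiff (𝓘(ℝ, EuclideanSpace ℝ (Fin k)).prod 𝓘(ℝ, ℰ)) 𝓘M ∞ c →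
        (∀ q, p (c q).1.2 = τ (c q).1.1) →
        ContMDiff (𝓘(ℝ, EuclideanSpace ℝ (Fin k)).prod 𝓘(ℝ, ℰ)) 𝓘Z ∞
          (fun q => (⟨(c q).1.2, l (c q)⟩ : FormBundle EY Y (n + 1)))) ∧
      (∀ m, (⟨m.1.2, l m⟩ : FormBundle EY Y (n + 1)) ∈ multiphase EX p (n + 1)) ∧
      ∀ (m : MomentumBundle ℰ S hp n) (B : ℰ →L[ℝ] EY),
        (∀ e, (mfderiv 𝓘(ℝ, EY) 𝓘(ℝ, EX) p m.1.2 (B e) : EX) =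
          mfderiv 𝓘(ℝ, ℰ) 𝓘(ℝ, EX) τ m.1.1 e) →
        ∀ (v : VertAt hp m.1.2) (e : Fin n → ℰ),
          (l m (Matrix.vecCons (VertAt.incl hp m.1.2 v) fun j => B (e j)) : ℝ) =
            (show ℰ [⋀^Fin n]→L[ℝ] ℝ from m.2 v) e := by
  obtain ⟨P, hP, hPs⟩ := exists_verticalProjection hp 𝓘(ℝ, ℰ) S
  obtain ⟨Q, hQ, hQs⟩ := exists_tangentRetraction hτ
  let Tp : Y → EY →L[ℝ] EX := fun y => mfderiv 𝓘(ℝ, EY) 𝓘(ℝ, EX) p y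
  have hTp : ∀ y (v : VertAt hp y), Tp y (VertAt.incl hp y v) = 0 := VertAt.mfderiv_incl hp
  let μ : ∀ m : MomentumBundle ℰ S hp n, VertAt hp m.1.2 →L[ℝ] (ℰ [⋀^Fin n]→L[ℝ] ℝ) := fun m => m.2
  let l : ∀ m : MomentumBundle ℰ S hp n, EY [⋀^Fin (n + 1)]→L[ℝ] ℝ := fun m =>
    ContinuousAlternatingMap.alternatizeUncurryFin
      (pairingForm (P m.1.2) ((Q m.1.1).comp (Tp m.1.2)) (μ m))
  have hl : ∀ m (u : Fin (n + 1) → EY), l m u = ∑ i : Fin (n + 1), (-1) ^ (i : ℕ) *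
      μ m (P m.1.2 (u i)) (fun j => Q m.1.1 (Tp m.1.2 (u (i.succAbove j)))) := fun m u =>
    alternatizeUncurryFin_pairingForm _ _ _ u
  refine ⟨l, fun {k} c hc hpc => ?_, fun m u i j hij hi hj => ?_, fun m B hB v e => ?_⟩
  · intro q₀
    have hb : ContMDiff (𝓘(ℝ, EuclideanSpace ℝ (Fin k)).prod 𝓘(ℝ, ℰ)) 𝓘(ℝ, EY) ∞
        (fun q => (c q).1.2) := (contMDiff_momentum_config hp).comp hc
    have ha : ContMDiff (𝓘(ℝ, EuclideanSpace ℝ (Fin k)).prod 𝓘(ℝ, ℰ)) 𝓘(ℝ, ℰ) ∞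
        (fun q => (c q).1.1) :=
      contMDiff_fst.comp ((contMDiff_momentum_proj (ES := ℰ) (S := S) (k := n) hp).comp hc)
    refine contMDiffAt_form_of_apply (b := fun q => (c q).1.2) hb.contMDiffAt fun u hu => ?_
    have hub : ∀ i, ContMDiffAt (𝓘(ℝ, EuclideanSpace ℝ (Fin k)).prod 𝓘(ℝ, ℰ)) 𝓘(ℝ, EY).tangent ∞
        (fun q => (⟨(c q).1.2, u i (c q).1.2⟩ : TangentBundle 𝓘(ℝ, EY) Y)) q₀ := fun i =>
      (hu i).comp q₀ hb.contMDiffAt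
    have hpd : ContMDiff 𝓘(ℝ, EY) 𝓘(ℝ, EX) ∞ p := fun y => (hp y).contMDiffAt
    have hterm : ∀ i : Fin (n + 1), ContMDiffAt (𝓘(ℝ, EuclideanSpace ℝ (Fin k)).prod 𝓘(ℝ, ℰ))
        𝓘(ℝ, ℝ) ∞ (fun q => μ (c q) (P (c q).1.2 (u i (c q).1.2))
          (fun j => Q (c q).1.1 (Tp (c q).1.2 (u (i.succAbove j) (c q).1.2)))) q₀ := by
      intro i
      have h1 := ContMDiffAt.momentum_apply hp (a := fun q => (c q).1.1) (b := fun q => (c q).1.2)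
        (μ := fun q => (c q).2) hc.contMDiffAt
        (hPs (fun q => (c q).1.2) (fun q => u i (c q).1.2) q₀ (hub i))
      exact ContMDiffAt.form_apply (b := fun q => (c q).1.1)
        (A := fun q => (c q).2 (P (c q).1.2 (u i (c q).1.2)))
        (u := fun j q => Q (c q).1.1 (Tp (c q).1.2 (u (i.succAbove j) (c q).1.2))) h1
        fun j => hQs (fun q => (c q).1.1) (fun q => p (c q).1.2)
          (fun q => Tp (c q).1.2 (u (i.succAbove j) (c q).1.2)) q₀ ha.contMDiffAt
          (hpd.mfderiv_along (hub _)) hpc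
    have hsum : ContMDiffAt (𝓘(ℝ, EuclideanSpace ℝ (Fin k)).prod 𝓘(ℝ, ℰ)) 𝓘(ℝ, ℝ) ∞
        (fun q => ∑ i : Fin (n + 1), (-1) ^ (i : ℕ) * μ (c q) (P (c q).1.2 (u i (c q).1.2))
          (fun j => Q (c q).1.1 (Tp (c q).1.2 (u (i.succAbove j) (c q).1.2)))) q₀ :=
      ContMDiffAt.sum fun i _ => contMDiffAt_const.mul (hterm i)
    exact hsum.congr_of_eventuallyEq (Filter.Eventually.of_forall fun q =>
      hl (c q) fun i => u i (c q).1.2)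
  · refine (hl m u).trans (Finset.sum_eq_zero fun a _ => ?_)
    have hex : ∃ b, Tp m.1.2 (u (a.succAbove b)) = 0 := by
      by_cases hai : a = i
      · obtain ⟨b, hb⟩ := Fin.exists_succAbove_eq (x := j) (y := a) (by rw [hai]; exact hij.symm)
        exact ⟨b, by rw [hb]; exact hj⟩
      · obtain ⟨b, hb⟩ := Fin.exists_succAbove_eq (x := i) (y := a) (Ne.symm hai)
        exact ⟨b, by rw [hb]; exact hi⟩
    obtain ⟨b, hb⟩ := hex
    rw [(μ m (P m.1.2 (u a))).map_coord_zero b (by rw [hb, map_zero]), mul_zero]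
  · refine (hl m _).trans ((Finset.sum_eq_single 0 (fun a _ ha => ?_) (by simp)).trans ?_)
    · obtain ⟨b, hb⟩ := Fin.exists_succAbove_eq (x := 0) (y := a) (Ne.symm ha)
      rw [(μ m _).map_coord_zero b, mul_zero]
      rw [hb]
      exact (congrArg (Q m.1.1) (hTp m.1.2 v)).trans (map_zero _)
    · rw [Fin.val_zero, pow_zero, one_mul]
      refine (congrArg (fun w => μ m w _) (hP m.1.2 v)).trans ?_
      refine congrArg (μ m v) (funext fun j => ?_)
      exact (congrArg (Q m.1.1) (hB (e j))).trans (hQ m.1.1 (e j))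

end MomentumLift

section RightInverse

open Diffeology

variable {S X Y EX EY F : Type*} {n : ℕ}
  [TopologicalSpace S] [ChartedSpace (EuclideanSpace ℝ (Fin n)) S]
  [IsManifold 𝓘(ℝ, EuclideanSpace ℝ (Fin n)) ∞ S] [CompactSpace S] [T2Space S]
  [NormedAddCommGroup EX] [NormedSpace ℝ EX]
  [TopologicalSpace X] [ChartedSpace EX X] [IsManifold 𝓘(ℝ, EX) ∞ X]
  [NormedAddCommGroup EY] [NormedSpace ℝ EY] [FiniteDimensional ℝ EY]
  [TopologicalSpace Y] [ChartedSpace EY Y] [IsManifold 𝓘(ℝ, EY) ∞ Y] [T2Space Y]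
  [SigmaCompactSpace Y]
  [NormedAddCommGroup F] [NormedSpace ℝ F] [FiniteDimensional ℝ F]
  {p : Y → X} (hp : Manifold.IsSubmersionOfComplement F 𝓘(ℝ, EY) 𝓘(ℝ, EX) ∞ p) {τ : S → X}

local notation "ℰ" => EuclideanSpace ℝ (Fin n)
local notation "𝓘Z" => ModelWithCorners.prod (modelWithCornersSelf ℝ EY)
  (modelWithCornersSelf ℝ (ContinuousAlternatingMap ℝ EY ℝ (Fin (n + 1))))
local notation "𝓘M" => ModelWithCorners.prod
  (ModelWithCorners.prod (modelWithCornersSelf ℝ (EuclideanSpace ℝ (Fin n)))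
    (modelWithCornersSelf ℝ EY))
  (modelWithCornersSelf ℝ (ContinuousLinearMap (RingHom.id ℝ) F
    (ContinuousAlternatingMap ℝ (EuclideanSpace ℝ (Fin n)) ℝ (Fin n))))

/-- A smooth map from `L(VY, Λⁿ T*S)` to `Λⁿ⁺¹ T*Y` over `Y`, which is a right inverse of the
reduction of multimomenta to momenta. -/
def momentumLift (hτ : Manifold.IsImmersion 𝓘(ℝ, ℰ) 𝓘(ℝ, EX) ∞ τ) (m : MomentumBundle ℰ S hp n) :
    FormAt EY (n + 1) m.1.2 := (exists_momentumLift hp hτ).choose m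

theorem contMDiff_momentumLift (hτ : Manifold.IsImmersion 𝓘(ℝ, ℰ) 𝓘(ℝ, EX) ∞ τ)
    {k : ℕ}
    {c : EuclideanSpace ℝ (Fin k) × S → MomentumBundle ℰ S hp n}
    (hc : ContMDiff (𝓘(ℝ, EuclideanSpace ℝ (Fin k)).prod 𝓘(ℝ, ℰ)) 𝓘M ∞ c)
    (hpc : ∀ q, p (c q).1.2 = τ (c q).1.1) :
    ContMDiff (𝓘(ℝ, EuclideanSpace ℝ (Fin k)).prod 𝓘(ℝ, ℰ)) 𝓘Z ∞
      (fun q => (⟨(c q).1.2, momentumLift hp hτ (c q)⟩ : FormBundle EY Y (n + 1))) :=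
  (exists_momentumLift hp hτ).choose_spec.1 c hc hpc

theorem contMDiff_momentumLift_right (hτ : Manifold.IsImmersion 𝓘(ℝ, ℰ) 𝓘(ℝ, EX) ∞ τ)
    {c : S → MomentumBundle ℰ S hp n}
    (hc : ContMDiff 𝓘(ℝ, ℰ) 𝓘M ∞ c) (hpc : ∀ x, p (c x).1.2 = τ (c x).1.1) :
    ContMDiff 𝓘(ℝ, ℰ) 𝓘Z ∞
      (fun x => (⟨(c x).1.2, momentumLift hp hτ (c x)⟩ : FormBundle EY Y (n + 1))) :=
  (contMDiff_momentumLift hp hτ (k := 0) (c := fun q => c q.2) (hc.comp contMDiff_snd)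
    (fun q => hpc q.2)).comp
      ((contMDiff_const (c := (0 : EuclideanSpace ℝ (Fin 0)))).prodMk contMDiff_id)

theorem momentumLift_mem (hτ : Manifold.IsImmersion 𝓘(ℝ, ℰ) 𝓘(ℝ, EX) ∞ τ)
    (m : MomentumBundle ℰ S hp n) :
    (⟨m.1.2, momentumLift hp hτ m⟩ : FormBundle EY Y (n + 1)) ∈ multiphase EX p (n + 1) :=
  (exists_momentumLift hp hτ).choose_spec.2.1 m

/-- On one vertical vector and lifts `B e` of tangent vectors of `Σ`, only the first summand of the
wedge product is nonzero: the others involve the projection of the vertical vector to `TX`, which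
vanishes. -/
theorem momentumLift_apply (hτ : Manifold.IsImmersion 𝓘(ℝ, ℰ) 𝓘(ℝ, EX) ∞ τ)
    (m : MomentumBundle ℰ S hp n) (B : ℰ →L[ℝ] EY)
    (hB : ∀ e, (mfderiv 𝓘(ℝ, EY) 𝓘(ℝ, EX) p m.1.2 (B e) : EX) =
      mfderiv 𝓘(ℝ, ℰ) 𝓘(ℝ, EX) τ m.1.1 e) (v : VertAt hp m.1.2) (e : Fin n → ℰ) :
    (momentumLift hp hτ m (Matrix.vecCons (VertAt.incl hp m.1.2 v) fun j => B (e j)) : ℝ) =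
      (show ℰ [⋀^Fin n]→L[ℝ] ℝ from m.2 v) e :=
  (exists_momentumLift hp hτ).choose_spec.2.2 m B hB v e

theorem MomentumBundle.mk_eq {m : MomentumBundle ℰ S hp n} {x : S} (h : m.1.1 = x)
    {μ : MomentumAt ℰ hp n (x, m.1.2)}
    (hμ : ∀ (v : VertAt hp m.1.2) (e : Fin n → ℰ), (show ℰ [⋀^Fin n]→L[ℝ] ℝ from μ v) e =
      (show ℰ [⋀^Fin n]→L[ℝ] ℝ from m.2 v) e) :
    (⟨(x, m.1.2), μ⟩ : MomentumBundle ℰ S hp n) = m := by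
  obtain ⟨⟨a, b⟩, ν⟩ := m
  obtain rfl : a = x := h
  refine TotalSpace.ext rfl (heq_of_eq ?_)
  exact ContinuousLinearMap.ext fun v => ContinuousAlternatingMap.ext fun e => hμ v e

/-- The derivative of a section is a lift of the derivative of `τ`. -/
theorem mfderiv_proj_section
    (hp : Manifold.IsSubmersionOfComplement F 𝓘(ℝ, EY) 𝓘(ℝ, EX) ∞ p) {f : S → Y}
    (hf : ContMDiff 𝓘(ℝ, ℰ) 𝓘(ℝ, EY) ∞ f)
    (h : ∀ x, p (f x) = τ x) (x : S) (e : ℰ) :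
    (mfderiv 𝓘(ℝ, EY) 𝓘(ℝ, EX) p (f x) (mfderiv 𝓘(ℝ, ℰ) 𝓘(ℝ, EY) f x e) : EX) =
      mfderiv 𝓘(ℝ, ℰ) 𝓘(ℝ, EX) τ x e := by
  have h1 := mfderiv_comp_model x (IM := 𝓘(ℝ, ℰ)) (IN := 𝓘(ℝ, EY)) (IP := 𝓘(ℝ, EX)) (g := p)
    (f := f) (((hp (f x)).contMDiffAt).mdifferentiableAt (by simp))
    (hf.mdifferentiableAt (by simp)) e
  refine h1.symm.trans ?_
  exact mfderiv_apply_congr (Filter.Eventually.of_forall h) e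

theorem PhaseSpace.proj_config (s : PhaseSpace hp τ n) (x : S) : p (s x).1.2 = τ x :=
  congrArg Prod.snd (s.proj_eq x)

theorem PhaseSpace.proj_config' (s : PhaseSpace hp τ n) (x : S) :
    p (s x).1.2 = τ (s x).1.1 := by
  rw [PhaseSpace.base_eq hp s x, PhaseSpace.proj_config hp s x]

/-- The right inverse of the reduction map. -/
def reductionLift (hτ : Manifold.IsImmersion 𝓘(ℝ, ℰ) 𝓘(ℝ, EX) ∞ τ)
    (s : PhaseSpace hp τ n) : MultimomentumSpace hp τ n where
  toFun x := ⟨(s x).1.2, momentumLift hp hτ (s x)⟩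
  contMDiff := contMDiff_momentumLift_right hp hτ s.contMDiff (PhaseSpace.proj_config' hp s)
  proj_eq x := PhaseSpace.proj_config hp s x
  mem_carrier x := momentumLift_mem hp hτ (s x)

theorem isPlot_reductionLift (hτ : Manifold.IsImmersion 𝓘(ℝ, ℰ) 𝓘(ℝ, EX) ∞ τ)
    {k : ℕ} {c : EuclideanSpace ℝ (Fin k) → PhaseSpace hp τ n}
    (hc : IsPlot c) : IsPlot (fun t => reductionLift hp hτ (c t)) :=
  contMDiff_momentumLift hp hτ (c := fun q => c q.1 q.2) hc
    (fun q => PhaseSpace.proj_config' hp (c q.1) q.2)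

/-- The reduction map has a right inverse which maps smooth families to smooth families. -/
theorem reduction_reductionLift (hτ : Manifold.IsImmersion 𝓘(ℝ, ℰ) 𝓘(ℝ, EX) ∞ τ)
    (s : PhaseSpace hp τ n) :
    reduction hp τ (reductionLift hp hτ s) = s := by
  refine Sections.ext_apply fun x => ?_
  refine MomentumBundle.mk_eq hp (PhaseSpace.base_eq hp s x) fun v e => ?_
  have hφ : ContMDiff 𝓘(ℝ, ℰ) 𝓘(ℝ, EY) ∞ (fun x => (s x).1.2) :=
    (contMDiff_momentum_config hp).comp s.contMDiff
  refine momentumLift_apply hp hτ (s x)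
    (mfderiv 𝓘(ℝ, ℰ) 𝓘(ℝ, EY) (fun x => (s x).1.2) x) (fun e => ?_) v e
  refine (mfderiv_proj_section hp hφ (PhaseSpace.proj_config hp s) x e).trans ?_
  exact congrArg (fun x => (mfderiv 𝓘(ℝ, ℰ) 𝓘(ℝ, EX) τ x : ℰ →L[ℝ] EX) e)
    (PhaseSpace.base_eq hp s x).symm

theorem surjective_reduction (hτ : Manifold.IsImmersion 𝓘(ℝ, ℰ) 𝓘(ℝ, EX) ∞ τ) :
    Surjective (reduction hp τ (n := n)) := fun s =>
  ⟨reductionLift hp hτ s, reduction_reductionLift hp hτ s⟩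

end RightInverse

/-! ### Affine families of multimomentum fields -/

section Shift

open Diffeology

variable {S X Y EX EY F : Type*} {n : ℕ}
  [TopologicalSpace S] [ChartedSpace (EuclideanSpace ℝ (Fin n)) S]
  [IsManifold 𝓘(ℝ, EuclideanSpace ℝ (Fin n)) ∞ S]
  [NormedAddCommGroup EX] [NormedSpace ℝ EX]
  [TopologicalSpace X] [ChartedSpace EX X] [IsManifold 𝓘(ℝ, EX) ∞ X]
  [NormedAddCommGroup EY] [NormedSpace ℝ EY] [FiniteDimensional ℝ EY]
  [TopologicalSpace Y] [ChartedSpace EY Y] [IsManifold 𝓘(ℝ, EY) ∞ Y]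
  [NormedAddCommGroup F] [NormedSpace ℝ F] [FiniteDimensional ℝ F]
  {p : Y → X} (hp : Manifold.IsSubmersionOfComplement F 𝓘(ℝ, EY) 𝓘(ℝ, EX) ∞ p) {τ : S → X}

local notation "ℰ" => EuclideanSpace ℝ (Fin n)
local notation "𝓘Z" => ModelWithCorners.prod (modelWithCornersSelf ℝ EY)
  (modelWithCornersSelf ℝ (ContinuousAlternatingMap ℝ EY ℝ (Fin (n + 1))))

/-- Linear combinations of forms along a map are smooth. -/
theorem ContMDiffAt.form_add_smul {EM HM M EN N : Type*} {k : ℕ} [NormedAddCommGroup EM]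
    [NormedSpace ℝ EM] [TopologicalSpace HM] {IM : ModelWithCorners ℝ EM HM} [TopologicalSpace M]
    [ChartedSpace HM M] [NormedAddCommGroup EN] [NormedSpace ℝ EN] [FiniteDimensional ℝ EN]
    [TopologicalSpace N] [ChartedSpace EN N] [IsManifold 𝓘(ℝ, EN) ∞ N]
    {b : M → N} {A B : ∀ q, FormAt EN k (b q)} {g : M → ℝ} {q₀ : M}
    (hA : ContMDiffAt IM (𝓘(ℝ, EN).prod 𝓘(ℝ, EN [⋀^Fin k]→L[ℝ] ℝ)) ∞
      (fun q => (⟨b q, A q⟩ : FormBundle EN N k)) q₀)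
    (hB : ContMDiffAt IM (𝓘(ℝ, EN).prod 𝓘(ℝ, EN [⋀^Fin k]→L[ℝ] ℝ)) ∞
      (fun q => (⟨b q, B q⟩ : FormBundle EN N k)) q₀) (hg : ContMDiffAt IM 𝓘(ℝ, ℝ) ∞ g q₀) :
    ContMDiffAt IM (𝓘(ℝ, EN).prod 𝓘(ℝ, EN [⋀^Fin k]→L[ℝ] ℝ)) ∞
      (fun q => (⟨b q, A q + g q • B q⟩ : FormBundle EN N k)) q₀ := by
  have hb : ContMDiffAt IM 𝓘(ℝ, EN) ∞ b q₀ := (contMDiffAt_totalSpace.1 hA).1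
  refine contMDiffAt_form_of_apply hb fun u hu => ?_
  exact (hA.form_apply fun i => (hu i).comp q₀ hb).add
    (hg.mul (hB.form_apply fun i => (hu i).comp q₀ hb))

/-- The multimomentum field `σ + r B`, where `B` is a field along the configuration field of `σ`. -/
def MultimomentumSpace.shift
    (σ : MultimomentumSpace hp τ n) (B : ∀ x, FormAt EY (n + 1) (σ x).1)
    (hB : ContMDiff 𝓘(ℝ, ℰ) 𝓘Z ∞ (fun x => (⟨(σ x).1, B x⟩ : FormBundle EY Y (n + 1))))
    (hm : ∀ x, (⟨(σ x).1, B x⟩ : FormBundle EY Y (n + 1)) ∈ multiphase EX p (n + 1)) (r : ℝ) :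
    MultimomentumSpace hp τ n where
  toFun x := ⟨(σ x).1, (σ x).2 + r • B x⟩
  contMDiff x := ContMDiffAt.form_add_smul (b := fun x => (σ x).1) (A := fun x => (σ x).2)
    σ.contMDiff.contMDiffAt hB.contMDiffAt contMDiffAt_const
  proj_eq x := σ.proj_eq x
  mem_carrier x u i j hij hi hj := by
    have h1 := σ.mem_carrier x u i j hij hi hj
    have h2 := hm x u i j hij hi hj
    change (σ x).2 u + r * B x u = 0
    rw [h1, h2, mul_zero, add_zero]

theorem MultimomentumSpace.isPlot_shift
    (σ : MultimomentumSpace hp τ n) (B : ∀ x, FormAt EY (n + 1) (σ x).1)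
    (hB : ContMDiff 𝓘(ℝ, ℰ) 𝓘Z ∞ (fun x => (⟨(σ x).1, B x⟩ : FormBundle EY Y (n + 1))))
    (hm : ∀ x, (⟨(σ x).1, B x⟩ : FormBundle EY Y (n + 1)) ∈ multiphase EX p (n + 1)) :
    IsPlot (fun t : EuclideanSpace ℝ (Fin 1) => MultimomentumSpace.shift hp σ B hB hm (t 0)) := by
  intro q
  have h0 : ContMDiff (𝓘(ℝ, EuclideanSpace ℝ (Fin 1)).prod 𝓘(ℝ, ℰ)) 𝓘(ℝ, ℝ) ∞
      (fun q : EuclideanSpace ℝ (Fin 1) × S => q.1 0) :=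
    (EuclideanSpace.proj 0 : EuclideanSpace ℝ (Fin 1) →L[ℝ] ℝ).contMDiff.comp contMDiff_fst
  exact ContMDiffAt.form_add_smul (b := fun q : EuclideanSpace ℝ (Fin 1) × S => (σ q.2).1)
    (A := fun q => (σ q.2).2) (B := fun q => B q.2) (g := fun q => q.1 0)
    (σ.contMDiff.comp contMDiff_snd).contMDiffAt (hB.comp contMDiff_snd).contMDiffAt
    h0.contMDiffAt

theorem MultimomentumSpace.shift_zero
    (σ : MultimomentumSpace hp τ n) (B : ∀ x, FormAt EY (n + 1) (σ x).1)
    (hB : ContMDiff 𝓘(ℝ, ℰ) 𝓘Z ∞ (fun x => (⟨(σ x).1, B x⟩ : FormBundle EY Y (n + 1))))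
    (hm : ∀ x, (⟨(σ x).1, B x⟩ : FormBundle EY Y (n + 1)) ∈ multiphase EX p (n + 1)) :
    MultimomentumSpace.shift hp σ B hB hm 0 = σ := by
  refine Sections.ext_apply fun x => TotalSpace.ext rfl (heq_of_eq ?_)
  exact ContinuousAlternatingMap.ext fun u => by
    change (σ x).2 u + 0 * B x u = (σ x).2 u
    rw [zero_mul, add_zero]

theorem MultimomentumSpace.reduction_shift_apply
    (σ : MultimomentumSpace hp τ n) (B : ∀ x, FormAt EY (n + 1) (σ x).1)
    (hB : ContMDiff 𝓘(ℝ, ℰ) 𝓘Z ∞ (fun x => (⟨(σ x).1, B x⟩ : FormBundle EY Y (n + 1))))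
    (hm : ∀ x, (⟨(σ x).1, B x⟩ : FormBundle EY Y (n + 1)) ∈ multiphase EX p (n + 1))
    (r : ℝ) (x : S) (v : VertAt hp (σ x).1)
    (e : Fin n → ℰ) :
    PhaseSpace.momentum hp (reduction hp τ (MultimomentumSpace.shift hp σ B hB hm r)) x v e =
      PhaseSpace.momentum hp (reduction hp τ σ) x v e + r * B x (Matrix.vecCons
        (VertAt.incl hp (σ x).1 v)
        fun j => mfderiv 𝓘(ℝ, ℰ) 𝓘(ℝ, EY) (fun x' => (σ x').1) x (e j)) := rfl

end Shift

/-! ### Nondegeneracy -/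

section TangentVectors

open Diffeology

variable {ES EK HK EB HB S K B EK' HK' EB' HB' K' B' : Type*}
  [NormedAddCommGroup ES] [NormedSpace ℝ ES] [FiniteDimensional ℝ ES]
  [NormedAddCommGroup EK] [NormedSpace ℝ EK] [TopologicalSpace HK]
  [NormedAddCommGroup EB] [NormedSpace ℝ EB] [TopologicalSpace HB]
  {IK : ModelWithCorners ℝ EK HK} {IB : ModelWithCorners ℝ EB HB}
  [TopologicalSpace S] [ChartedSpace ES S] [IsManifold 𝓘(ℝ, ES) ∞ S] [CompactSpace S] [T2Space S]
  [TopologicalSpace K] [ChartedSpace HK K] [IsManifold IK ∞ K]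
  [TopologicalSpace B] [ChartedSpace HB B]
  {D : SectionData IK IB S K B}
  [NormedAddCommGroup EK'] [NormedSpace ℝ EK'] [TopologicalSpace HK']
  [NormedAddCommGroup EB'] [NormedSpace ℝ EB'] [TopologicalSpace HB']
  {IK' : ModelWithCorners ℝ EK' HK'} {IB' : ModelWithCorners ℝ EB' HB'}
  [TopologicalSpace K'] [ChartedSpace HK' K'] [IsManifold IK' ∞ K']
  [TopologicalSpace B'] [ChartedSpace HB' B']
  {D' : SectionData IK' IB' S K' B'}

/-- The product of a tangent vector to a space of sections with a smooth function on `S`. -/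
def SectionTangent.smulFun {s : Sections 𝓘(ℝ, ES) D} (V : SectionTangent s) {g : S → ℝ}
    (hg : ContMDiff 𝓘(ℝ, ES) 𝓘(ℝ, ℝ) ∞ g) : SectionTangent s where
  val x := g x • V.1 x
  property := by
    refine ⟨fun x₀ => ?_, fun x => ⟨?_, Submodule.smul_mem _ _ (V.2.2 x).2⟩⟩
    · have h1 := (contMDiffAt_totalSpace.1 (V.2.1 x₀)).2
      refine contMDiffAt_totalSpace.2 ⟨s.contMDiff x₀,
        ((hg x₀).smul h1).congr_of_eventuallyEq ?_⟩
      have hb : ∀ᶠ x in 𝓝 x₀, s x ∈ (trivializationAt EK (TangentSpace IK) (s x₀)).baseSet :=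
        (s.contMDiff.continuous.continuousAt).eventually_mem
          ((trivializationAt EK (TangentSpace IK) (s x₀)).open_baseSet.mem_nhds
            (FiberBundle.mem_baseSet_trivializationAt' (s x₀)))
      filter_upwards [hb] with x hx
      exact ((trivializationAt EK (TangentSpace IK) (s x₀)).linear ℝ hx).map_smul (g x) (V.1 x)
    · rw [map_smul, (V.2.2 x).1, smul_zero]

/-- The velocity of a deformation is a tangent vector in the space of sections. -/
theorem IsDeformation.exists_tangent {s : Sections 𝓘(ℝ, ES) D} {V : ∀ x, TangentSpace IK (s x)}
    {A : ℝ × S × K → K} (hA : IsDeformation s V A) :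
    ∃ W : SectionTangent s, ∀ x, (W.1 x : EK) = V x := by
  have h0 : ContMDiff (𝓘(ℝ, EuclideanSpace ℝ (Fin 1)).prod 𝓘(ℝ, ES)) 𝓘(ℝ, ℝ) ∞
      (fun q : EuclideanSpace ℝ (Fin 1) × S => q.1 0) :=
    (EuclideanSpace.proj 0 : EuclideanSpace ℝ (Fin 1) →L[ℝ] ℝ).contMDiff.comp contMDiff_fst
  have hF : ContMDiff (𝓘(ℝ, EuclideanSpace ℝ (Fin 1)).prod 𝓘(ℝ, ES)) IK ∞
      (fun q : EuclideanSpace ℝ (Fin 1) × S => A (q.1 0, q.2, s q.2)) :=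
    hA.contMDiff.comp (h0.prodMk (contMDiff_snd.prodMk (s.contMDiff.comp contMDiff_snd)))
  let c : EuclideanSpace ℝ (Fin 1) → Sections 𝓘(ℝ, ES) D := fun t =>
    { toFun := fun x => A (t 0, x, s x)
      contMDiff := hF.comp (contMDiff_const.prodMk contMDiff_id)
      proj_eq := fun x => (hA.proj _).trans (s.proj_eq x)
      mem_carrier := fun x => hA.mem_carrier _ (s.mem_carrier x) }
  have hc : IsPlot c := hF
  have hc0 : c 0 = s := Sections.ext_apply fun x => hA.zero x (s x)
  have hW : ∀ s', c 0 = s' → ∃ W : SectionTangent s', ∀ x, (W.1 x : EK) =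
      velocityFun c 0 (EuclideanSpace.single 0 1) x := by
    rintro _ rfl
    exact ⟨velocity c hc 0 (EuclideanSpace.single 0 1), fun _ => rfl⟩
  obtain ⟨W, hW⟩ := hW s hc0
  refine ⟨W, fun x => (hW x).trans ((velocityFun_eq_curve hc _ _ _).trans ?_)⟩
  have : (fun r : ℝ => (c (0 + r • EuclideanSpace.single 0 1)).toFun x) =
      fun r : ℝ => A (r, x, s x) := by
    funext r
    change A (_, x, s x) = _
    congr 2
    simp
  rw [← hA.mfderiv x, this]
  rfl

/-- Every horizontal direction of an adapted chart is the value at `x₀` of a tangent vector to the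
space of sections. -/
theorem AdaptedChart.exists_tangent {s : Sections 𝓘(ℝ, ES) D} {x₀ : S}
    (a : AdaptedChart D (s x₀)) {h : EK} (hH : h ∈ a.H) :
    ∃ W : SectionTangent s, (mfderiv IK 𝓘(ℝ, EK) a.Psi (s x₀) (W.1 x₀) : EK) = h := by
  have hδ : 0 < a.ε / (‖h‖ + 1) := div_pos a.ε_pos (by positivity)
  have hh : ∀ _ : S, a.ε / (‖h‖ + 1) * ‖h‖ < a.ε := by
    intro _
    rw [div_mul_eq_mul_div, div_lt_iff₀ (by positivity)]
    exact mul_lt_mul_of_pos_left (lt_add_one _) a.ε_pos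
  have hs : ContMDiff 𝓘(ℝ, ES) 𝓘(ℝ, EK) ∞ (fun _ : S => h) := contMDiff_const
  have hH' : ∀ _ : S, h ∈ a.H := fun _ => hH
  generalize a.ε / (‖h‖ + 1) = δ at hδ hh
  have h1 : a.f (s x₀) = 1 := a.f_eq_one.self_of_nhds
  have hA : IsDeformation s (fun x => (show EK from mfderiv 𝓘(ℝ, ℝ) IK
      (fun r : ℝ => a.push (fun _ => h) δ (r, x, s x)) 0 (1 : ℝ))) (a.push (fun _ => h) δ) :=
    { contMDiff := a.contMDiff_push hs hH' hδ hh
      zero := a.push_zero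
      proj := a.proj_push hH' hδ hh
      mem_carrier := a.push_mem_carrier hH' hδ hh
      mfderiv := fun x => rfl }
  obtain ⟨W, hW⟩ := hA.exists_tangent
  refine ⟨W, ?_⟩
  have h2 := a.mfderiv_push hs hH' hδ hh x₀ (a.mem_N_of_f h1)
  rw [h1, one_smul] at h2
  exact (congrArg (mfderiv IK 𝓘(ℝ, EK) a.Psi (s x₀) : EK → EK) (hW x₀)).trans h2

end TangentVectors

theorem fderiv_clm_alternating_apply {P F E : Type*} {k : ℕ} [NormedAddCommGroup P]
    [NormedSpace ℝ P] [NormedAddCommGroup F] [NormedSpace ℝ F] [FiniteDimensional ℝ F]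
    [NormedAddCommGroup E] [NormedSpace ℝ E] [FiniteDimensional ℝ E]
    {A : P → F →L[ℝ] (E [⋀^Fin k]→L[ℝ] ℝ)} {t : P} (hA : DifferentiableAt ℝ A t) (v : P) (f : F)
    (u : Fin k → E) : fderiv ℝ (fun t => A t f u) t v = fderiv ℝ A t v f u := by
  have h1 := hA.hasFDerivAt.clm_apply (hasFDerivAt_const f t)
  let ev : (E [⋀^Fin k]→L[ℝ] ℝ) →ₗ[ℝ] ℝ :=
    { toFun := fun A => A u
      map_add' := fun A B => rfl
      map_smul' := fun r A => rfl }
  refine (congrArg (fun L => L v)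
    ((LinearMap.toContinuousLinearMap ev).hasFDerivAt.comp t h1).fderiv).trans ?_
  change (A t 0 + fderiv ℝ A t v f) u = _
  rw [map_zero, zero_add]

theorem fderiv_add_coord_mul (a b : ℝ) :
    fderiv ℝ (fun t : EuclideanSpace ℝ (Fin 1) => a + t 0 * b) 0 (EuclideanSpace.single 0 1) =
      b := by
  have h : HasFDerivAt (fun t : EuclideanSpace ℝ (Fin 1) => a + t 0 * b)
      (b • (EuclideanSpace.proj 0 : EuclideanSpace ℝ (Fin 1) →L[ℝ] ℝ)) 0 :=
    (((EuclideanSpace.proj 0 : EuclideanSpace ℝ (Fin 1) →L[ℝ] ℝ).hasFDerivAt).mul_const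
      b).const_add a
  rw [h.fderiv]
  simp

section TestVectors

open Diffeology

variable {S X Y EX EY F : Type*} {n : ℕ}
  [TopologicalSpace S] [ChartedSpace (EuclideanSpace ℝ (Fin n)) S]
  [IsManifold 𝓘(ℝ, EuclideanSpace ℝ (Fin n)) ∞ S] [CompactSpace S] [T2Space S]
  [NormedAddCommGroup EX] [NormedSpace ℝ EX]
  [TopologicalSpace X] [ChartedSpace EX X] [IsManifold 𝓘(ℝ, EX) ∞ X]
  [NormedAddCommGroup EY] [NormedSpace ℝ EY] [FiniteDimensional ℝ EY]
  [TopologicalSpace Y] [ChartedSpace EY Y] [IsManifold 𝓘(ℝ, EY) ∞ Y] [T2Space Y]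
  [SigmaCompactSpace Y]
  [NormedAddCommGroup F] [NormedSpace ℝ F] [FiniteDimensional ℝ F]
  {p : Y → X} (hp : Manifold.IsSubmersionOfComplement F 𝓘(ℝ, EY) 𝓘(ℝ, EX) ∞ p) {τ : S → X}

local notation "ℰ" => EuclideanSpace ℝ (Fin n)
local notation "𝓘Z" => ModelWithCorners.prod (modelWithCornersSelf ℝ EY)
  (modelWithCornersSelf ℝ (ContinuousAlternatingMap ℝ EY ℝ (Fin (n + 1))))
local notation "𝓘M" => ModelWithCorners.prod
  (ModelWithCorners.prod (modelWithCornersSelf ℝ (EuclideanSpace ℝ (Fin n)))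
    (modelWithCornersSelf ℝ EY))
  (modelWithCornersSelf ℝ (ContinuousLinearMap (RingHom.id ℝ) F
    (ContinuousAlternatingMap ℝ (EuclideanSpace ℝ (Fin n)) ℝ (Fin n))))

theorem fibreVelocity_eq_vertCoord (s : PhaseSpace hp τ n) (V : SectionTangent s) (x : S) :
    fibreVelocity hp (s x) (V.1 x) =
      vertCoord hp (s x).1.2 (s x).1.2 (configVelocity hp τ s V x) :=
  mfderiv_fibreCoord hp (s x).1.2 (s x) (mem_adChart_source hp _) (V.1 x)

/-- The fibre part of `TR W` is the vertical coordinate of the velocity of the configuration,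
as the reduction map preserves configurations. -/
theorem fibreVelocity_tangentMap
    {TR : ∀ σ : MultimomentumSpace hp τ n, SectionTangent σ →ₗ[ℝ] SectionTangent (reduction hp τ σ)}
    (hTR : IsTangentMap (reduction hp τ) TR) (σ : MultimomentumSpace hp τ n)
    (W : SectionTangent σ) (x : S) :
    fibreVelocity hp (reduction hp τ σ x) ((TR σ W).1 x) =
      (adEquiv hp (σ x).1 (chartD hp (σ x).1 (σ x).1
        (multimomentumConfigVelocity hp τ σ W x))).2 :=
  (fibreVelocity_eq_vertCoord hp (reduction hp τ σ) (TR σ W) x).trans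
    (congrArg (fun e : EY => (adEquiv hp (σ x).1 (chartD hp (σ x).1 (σ x).1 e)).2)
      (incl_configVelocity_tangentMap hp hTR σ W x))

/-- The velocity of a reduced family is in the image of the tangent map. -/
theorem exists_tangentMap_eq_velocityFun
    {TR : ∀ σ : MultimomentumSpace hp τ n, SectionTangent σ →ₗ[ℝ] SectionTangent (reduction hp τ σ)}
    (hTR : IsTangentMap (reduction hp τ) TR) {k : ℕ}
    {c : EuclideanSpace ℝ (Fin k) → MultimomentumSpace hp τ n} (hc : IsPlot c)
    (t v : EuclideanSpace ℝ (Fin k)) {σ : MultimomentumSpace hp τ n} (hs : c t = σ) :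
    ∃ W : SectionTangent σ, ∀ x, ((TR σ W).1 x :
      (ℰ × EY) × (F →L[ℝ] (ℰ [⋀^Fin n]→L[ℝ] ℝ))) =
        velocityFun (fun t => reduction hp τ (c t)) t v x := by
  subst hs
  refine ⟨velocity c hc t v, fun x => ?_⟩
  rw [hTR c hc (isPlot_reduction hp τ hc) t v]
  rfl

/-- The image by the tangent map of the reduction map of the velocity of a family with constant
configuration field, whose momentum is affine. -/
theorem exists_tangent_of_affine
    {TR : ∀ σ : MultimomentumSpace hp τ n, SectionTangent σ →ₗ[ℝ] SectionTangent (reduction hp τ σ)}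
    (hTR : IsTangentMap (reduction hp τ) TR) {σ : MultimomentumSpace hp τ n}
    {c : EuclideanSpace ℝ (Fin 1) → MultimomentumSpace hp τ n} (hc : IsPlot c) (hc0 : c 0 = σ)
    (hbase : ∀ t x, (c t x).1 = (σ x).1) {a b : ∀ x, VertAt hp (σ x).1 → (Fin n → ℰ) → ℝ}
    (hmom : ∀ t x (v : VertAt hp (σ x).1) (u : Fin n → ℰ), momentumCoord hp (x, (σ x).1)
      (reduction hp τ (c t) x) (vertCoord hp (σ x).1 (σ x).1 v) u = a x v u + t 0 * b x v u) :
    ∃ W : SectionTangent σ, (∀ x, fibreVelocity hp (reduction hp τ σ x) ((TR σ W).1 x) = 0) ∧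
      ∀ x (v : VertAt hp (σ x).1) (u : Fin n → ℰ),
        momentumVelocity hp (reduction hp τ σ x) ((TR σ W).1 x)
          (vertCoord hp (σ x).1 (σ x).1 v) u = b x v u := by
  have hRc := isPlot_reduction hp τ hc
  obtain ⟨W, hW⟩ := exists_tangentMap_eq_velocityFun hp hTR hc 0
    (EuclideanSpace.single 0 1) hc0
  have hR0 : ∀ x, reduction hp τ (c 0) x = reduction hp τ σ x := fun x => by rw [hc0]
  refine ⟨W, fun x => ?_, fun x v u => ?_⟩
  · rw [hW x, ← hR0 x]
    refine (fderiv_fibreCoord hp hRc 0 (EuclideanSpace.single 0 1) x).symm.trans ?_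
    have h : (fun t' => fibreCoord hp (reduction hp τ (c 0) x).1.2 (reduction hp τ (c t') x).1.2) =
        fun _ => fibreCoord hp (σ x).1 (σ x).1 := by
      funext t'
      change fibreCoord hp (c 0 x).1 (c t' x).1 = _
      rw [hbase, hbase]
    rw [h, fderiv_fun_const]
    rfl
  · have h1 := fderiv_momentumCoord hp hRc 0 (EuclideanSpace.single 0 1) x
    rw [hW x, ← hR0 x]
    refine (congrArg (fun A : F →L[ℝ] (ℰ [⋀^Fin n]→L[ℝ] ℝ) =>
      A (vertCoord hp (σ x).1 (σ x).1 v) u) h1).symm.trans ?_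
    have hA : ContMDiffAt 𝓘(ℝ, EuclideanSpace ℝ (Fin 1)) 𝓘(ℝ, F →L[ℝ] (ℰ [⋀^Fin n]→L[ℝ] ℝ)) ∞
        (fun t' => momentumCoord hp (reduction hp τ (c 0) x).1 (reduction hp τ (c t') x)) 0 :=
      ContMDiffAt.comp 0 (I' := 𝓘M) (g := momentumCoord hp (reduction hp τ (c 0) x).1)
        (f := fun t' => reduction hp τ (c t') x)
        (contMDiffAt_momentumCoord hp _ (mem_momSource_self hp _))
        (contMDiff_phase_left hp hRc x).contMDiffAt
    refine (fderiv_clm_alternating_apply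
      ((contMDiffAt_iff_contDiffAt.1 hA).differentiableAt (by simp)) _
        (vertCoord hp (σ x).1 (σ x).1 v) u).symm.trans ?_
    have h3 : (fun t' => momentumCoord hp (reduction hp τ (c 0) x).1 (reduction hp τ (c t') x)
        (vertCoord hp (σ x).1 (σ x).1 v) u) = fun t' : EuclideanSpace ℝ (Fin 1) =>
          a x v u + t' 0 * b x v u := by
      funext t'
      rw [hR0 x]
      exact hmom t' x v u
    rw [h3]
    exact fderiv_add_coord_mul _ _

/-- The image by the tangent map of the reduction map of the tangent vector to the affine family
`σ + r B`. -/
theorem exists_tangent_shift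
    {TR : ∀ σ : MultimomentumSpace hp τ n, SectionTangent σ →ₗ[ℝ] SectionTangent (reduction hp τ σ)}
    (hTR : IsTangentMap (reduction hp τ) TR) (σ : MultimomentumSpace hp τ n)
    (B : ∀ x, FormAt EY (n + 1) (σ x).1)
    (hB : ContMDiff 𝓘(ℝ, ℰ) 𝓘Z ∞ (fun x => (⟨(σ x).1, B x⟩ : FormBundle EY Y (n + 1))))
    (hm : ∀ x, (⟨(σ x).1, B x⟩ : FormBundle EY Y (n + 1)) ∈ multiphase EX p (n + 1)) :
    ∃ W : SectionTangent σ, (∀ x, fibreVelocity hp (reduction hp τ σ x) ((TR σ W).1 x) = 0) ∧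
      ∀ x (v : VertAt hp (σ x).1) (u : Fin n → ℰ),
        momentumVelocity hp (reduction hp τ σ x) ((TR σ W).1 x)
          (vertCoord hp (σ x).1 (σ x).1 v) u = B x (Matrix.vecCons (VertAt.incl hp (σ x).1 v)
            fun j => mfderiv 𝓘(ℝ, ℰ) 𝓘(ℝ, EY) (fun x' => (σ x').1) x (u j)) :=
  exists_tangent_of_affine hp hTR (MultimomentumSpace.isPlot_shift hp σ B hB hm)
    (MultimomentumSpace.shift_zero hp σ B hB hm) (fun _ _ => rfl)
    (a := fun x v u => PhaseSpace.momentum hp (reduction hp τ σ) x v u)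
    (b := fun x v u => B x (Matrix.vecCons (VertAt.incl hp (σ x).1 v)
      fun j => mfderiv 𝓘(ℝ, ℰ) 𝓘(ℝ, EY) (fun x' => (σ x').1) x (u j)))
    fun t x v u => (congrArg (fun A : ℰ [⋀^Fin n]→L[ℝ] ℝ => A u)
      (momentum_eq_momentumCoord hp
        (reduction hp τ (MultimomentumSpace.shift hp σ B hB hm (t 0))) x (x, (σ x).1) rfl
        (mem_adChart_source hp (σ x).1) v)).symm.trans
      (MultimomentumSpace.reduction_shift_apply hp σ B hB hm (t 0) x v u)

/-- A smooth field `μ` of momenta along the configuration field of `σ` is the image by the tangent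
map of the reduction map of a tangent vector to the space of multimomentum fields, which is
tangent to the fibres over the configuration fields. -/
theorem exists_tangent_momentum (hτ : Manifold.IsImmersion 𝓘(ℝ, ℰ) 𝓘(ℝ, EX) ∞ τ)
    {TR : ∀ σ : MultimomentumSpace hp τ n, SectionTangent σ →ₗ[ℝ] SectionTangent (reduction hp τ σ)}
    (hTR : IsTangentMap (reduction hp τ) TR) (σ : MultimomentumSpace hp τ n)
    (μ : ∀ x, MomentumAt ℰ hp n (x, (σ x).1))
    (hμ : ContMDiff 𝓘(ℝ, ℰ) 𝓘M ∞
      (fun x => (⟨(x, (σ x).1), μ x⟩ : MomentumBundle ℰ S hp n))) :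
    ∃ W : SectionTangent σ, (∀ x, fibreVelocity hp (reduction hp τ σ x) ((TR σ W).1 x) = 0) ∧
      ∀ x (v : VertAt hp (σ x).1), momentumVelocity hp (reduction hp τ σ x) ((TR σ W).1 x)
        (vertCoord hp (σ x).1 (σ x).1 v) = (show ℰ [⋀^Fin n]→L[ℝ] ℝ from μ x v) := by
  have hφ : ContMDiff 𝓘(ℝ, ℰ) 𝓘(ℝ, EY) ∞ (fun x => (σ x).1) :=
    (contMDiff_proj (n := ∞) (FormAt EY (n + 1) : Y → Type _)).comp σ.contMDiff
  obtain ⟨W, h1, h2⟩ := exists_tangent_shift hp hTR σ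
    (fun x => momentumLift hp hτ ⟨(x, (σ x).1), μ x⟩)
    (contMDiff_momentumLift_right hp hτ hμ fun x => σ.proj_eq x)
    (fun x => momentumLift_mem hp hτ ⟨(x, (σ x).1), μ x⟩)
  refine ⟨W, h1, fun x v => ContinuousAlternatingMap.ext fun u => (h2 x v u).trans ?_⟩
  exact momentumLift_apply hp hτ ⟨(x, (σ x).1), μ x⟩
    (mfderiv 𝓘(ℝ, ℰ) 𝓘(ℝ, EY) (fun x' => (σ x').1) x)
    (fun e => mfderiv_proj_section hp hφ σ.proj_eq x e) v u

end TestVectors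

section Nondegenerate

open Diffeology

variable {S X Y EX EY F : Type*} {n : ℕ}
  [TopologicalSpace S] [ChartedSpace (EuclideanSpace ℝ (Fin n)) S]
  [IsManifold 𝓘(ℝ, EuclideanSpace ℝ (Fin n)) ∞ S] [CompactSpace S] [T2Space S]
  [NormedAddCommGroup EX] [NormedSpace ℝ EX]
  [TopologicalSpace X] [ChartedSpace EX X] [IsManifold 𝓘(ℝ, EX) ∞ X]
  [NormedAddCommGroup EY] [NormedSpace ℝ EY] [FiniteDimensional ℝ EY]
  [TopologicalSpace Y] [ChartedSpace EY Y] [IsManifold 𝓘(ℝ, EY) ∞ Y] [T2Space Y]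
  [SigmaCompactSpace Y]
  [NormedAddCommGroup F] [NormedSpace ℝ F] [FiniteDimensional ℝ F]
  {p : Y → X} (hp : Manifold.IsSubmersionOfComplement F 𝓘(ℝ, EY) 𝓘(ℝ, EX) ∞ p) {τ : S → X}

local notation "ℰ" => EuclideanSpace ℝ (Fin n)
local notation "𝓘Z" => ModelWithCorners.prod (modelWithCornersSelf ℝ EY)
  (modelWithCornersSelf ℝ (ContinuousAlternatingMap ℝ EY ℝ (Fin (n + 1))))
local notation "𝓘M" => ModelWithCorners.prod
  (ModelWithCorners.prod (modelWithCornersSelf ℝ (EuclideanSpace ℝ (Fin n)))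
    (modelWithCornersSelf ℝ EY))
  (modelWithCornersSelf ℝ (ContinuousLinearMap (RingHom.id ℝ) F
    (ContinuousAlternatingMap ℝ (EuclideanSpace ℝ (Fin n)) ℝ (Fin n))))

/-- Linear functionals on a vertical tangent space extend to smooth fields of functionals. -/
theorem exists_vertical_covector {φ : S → Y} (hφ : ContMDiff 𝓘(ℝ, ℰ) 𝓘(ℝ, EY) ∞ φ) (x₀ : S)
    (l : F →L[ℝ] ℝ) : ∃ sc : ∀ x, VertAt hp (φ x) →L[ℝ] ℝ,
      (∀ v, sc x₀ v = l (vertCoord hp (φ x₀) (φ x₀) v)) ∧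
      ∀ (v : ∀ x, VertAt hp (φ x)) (x : S), ContMDiffAt 𝓘(ℝ, ℰ) (𝓘(ℝ, EY).prod 𝓘(ℝ, F)) ∞
        (fun x => (⟨φ x, v x⟩ : TotalSpace F (VertAt hp))) x →
          ContMDiffAt 𝓘(ℝ, ℰ) 𝓘(ℝ, ℝ) ∞ (fun x => sc x (v x)) x := by
  have hU : φ ⁻¹' (adChart hp (φ x₀)).source ∈ 𝓝 x₀ := hφ.continuous.continuousAt.preimage_mem_nhds
    ((adChart hp (φ x₀)).open_source.mem_nhds (mem_adChart_source hp _))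
  obtain ⟨χ, hχ, -, hsupp, h1⟩ := exists_bump_tsupport_subset (E := ℰ) hU
  refine ⟨fun x => χ x • l.comp (vertCoord hp (φ x₀) (φ x)), fun v => ?_, fun v x hv => ?_⟩
  · change χ x₀ * l (vertCoord hp (φ x₀) (φ x₀) v) = _
    rw [h1.self_of_nhds, one_mul]
  · by_cases hx : x ∈ tsupport χ
    · have h2 := ((contMDiffAt_tangent_iff_chartD hp (φ x₀) (hsupp hx)).1
        ((contMDiffAt_vert_iff hp).1 hv)).2
      have h3 : ContMDiff 𝓘(ℝ, EY) 𝓘(ℝ, ℝ) ∞ (l.comp ((ContinuousLinearMap.snd ℝ EX F).comp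
        (adEquiv hp (φ x₀) : EY →L[ℝ] EX × F))) := ContinuousLinearMap.contMDiff _
      exact hχ.contMDiffAt.mul (h3.contMDiffAt.comp x h2)
    · refine (contMDiffAt_const (c := (0 : ℝ))).congr_of_eventuallyEq ?_
      filter_upwards [(isClosed_tsupport χ).isOpen_compl.mem_nhds hx] with x' hx'
      change χ x' * _ = 0
      rw [image_eq_zero_of_notMem_tsupport hx', zero_mul]

theorem contMDiff_configVelocity (s : PhaseSpace hp τ n) (V : SectionTangent s) :
    ContMDiff 𝓘(ℝ, ℰ) (𝓘(ℝ, EY).prod 𝓘(ℝ, F)) ∞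
      (fun x => (⟨(s x).1.2, configVelocity hp τ s V x⟩ : TotalSpace F (VertAt hp))) := fun x =>
  (contMDiffAt_vert_iff hp (b := fun x => (s x).1.2)
    (v := fun x => configVelocity hp τ s V x)).2
      ((contMDiff_momentum_config hp (n := n) (S := S)).mfderiv_along (V.2.1 x))

/-- A smooth field of momenta whose value on a given vertical vector field is a nonnegative
multiple of the orientation form. -/
theorem exists_momentum_apply_eq {φ : S → Y} (hφ : ContMDiff 𝓘(ℝ, ℰ) 𝓘(ℝ, EY) ∞ φ)
    (o : OrientationForm n S) {V : ∀ x, VertAt hp (φ x)}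
    (hV : ContMDiff 𝓘(ℝ, ℰ) (𝓘(ℝ, EY).prod 𝓘(ℝ, F)) ∞
      (fun x => (⟨φ x, V x⟩ : TotalSpace F (VertAt hp)))) (x₀ : S) (l : F →L[ℝ] ℝ) :
    ∃ (g : S → ℝ) (μ : ∀ x, MomentumAt ℰ hp n (x, φ x)),
      ContMDiff 𝓘(ℝ, ℰ) 𝓘M ∞ (fun x => (⟨(x, φ x), μ x⟩ : MomentumBundle ℰ S hp n)) ∧
      (∀ x (u : Fin n → ℰ), (show ℰ [⋀^Fin n]→L[ℝ] ℝ from μ x (V x)) u =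
        g x * g x * (o.toFun x u : ℝ)) ∧ g x₀ = l (vertCoord hp (φ x₀) (φ x₀) (V x₀)) := by
  obtain ⟨sc, hsc₀, hsc⟩ := exists_vertical_covector hp hφ x₀ l
  refine ⟨fun x => sc x (V x), fun x => (show VertAt hp (φ x) →L[ℝ] FormAt ℰ n x from
      (sc x).smulRight (sc x (V x) • o.toFun x)), fun x => ?_, fun x u => ?_, hsc₀ _⟩
  · refine contMDiffAt_momentum_of_apply hp (a := fun x : S => x) (b := φ)
      contMDiffAt_id hφ.contMDiffAt fun v hv => ?_
    refine contMDiffAt_form_of_apply (b := fun x : S => x)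
      (A := fun x => (sc x (v (φ x)) • sc x (V x) • o.toFun x)) contMDiffAt_id fun u hu => ?_
    have h1 := hsc (fun x => v (φ x)) x (hv.comp x hφ.contMDiffAt)
    have h2 := hsc V x hV.contMDiffAt
    have h3 := ContMDiffAt.form_apply (b := fun x : S => x) (A := o.toFun) (u := u)
      o.contMDiff.contMDiffAt hu
    exact h1.mul (h2.mul h3)
  · exact (mul_assoc (sc x (V x)) (sc x (V x)) (o.toFun x u : ℝ)).symm

/-- Against a vector without fibre part, the pointwise symplectic form pairs the momentum part of
this vector with the fibre part of the other. -/
theorem symplecticIntegrand_of_right (s : PhaseSpace hp τ n) (V W : SectionTangent s) (x : S)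
    (hW : fibreVelocity hp (s x) (W.1 x) = 0) :
    (symplecticIntegrand hp s V W x : ℰ [⋀^Fin n]→L[ℝ] ℝ) =
      momentumVelocity hp (s x) (W.1 x) (fibreVelocity hp (s x) (V.1 x)) := by
  change momentumVelocity hp (s x) (W.1 x) (fibreVelocity hp (s x) (V.1 x)) -
    momentumVelocity hp (s x) (V.1 x) (fibreVelocity hp (s x) (W.1 x)) = _
  rw [hW, map_zero, sub_zero]

theorem symplecticIntegrand_of_left (s : PhaseSpace hp τ n) (V W : SectionTangent s) (x : S)
    (hV : fibreVelocity hp (s x) (V.1 x) = 0) :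
    (symplecticIntegrand hp s V W x : ℰ [⋀^Fin n]→L[ℝ] ℝ) =
      -momentumVelocity hp (s x) (V.1 x) (fibreVelocity hp (s x) (W.1 x)) := by
  change momentumVelocity hp (s x) (W.1 x) (fibreVelocity hp (s x) (V.1 x)) -
    momentumVelocity hp (s x) (V.1 x) (fibreVelocity hp (s x) (W.1 x)) = _
  rw [hV, map_zero, zero_sub]

/-- A tangent vector which is orthogonal to the image of the tangent map of the reduction map has no
configuration part: test with momenta. -/
theorem fibreVelocity_eq_zero (hτ : Manifold.IsImmersion 𝓘(ℝ, ℰ) 𝓘(ℝ, EX) ∞ τ)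
    (o : OrientationForm n S)
    {TR : ∀ σ : MultimomentumSpace hp τ n, SectionTangent σ →ₗ[ℝ] SectionTangent (reduction hp τ σ)}
    (hTR : IsTangentMap (reduction hp τ) TR) (σ : MultimomentumSpace hp τ n)
    (U : SectionTangent (reduction hp τ σ))
    (hU : ∀ W, phaseTwoForm hp τ o (reduction hp τ σ) ![U, TR σ W] = 0) (x₀ : S) :
    fibreVelocity hp (reduction hp τ σ x₀) (U.1 x₀) = 0 := by
  have hfv := fibreVelocity_eq_vertCoord hp (reduction hp τ σ) U
  by_contra hne
  obtain ⟨l, hl⟩ := SeparatingDual.exists_ne_zero (R := ℝ) hne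
  have hφ : ContMDiff 𝓘(ℝ, ℰ) 𝓘(ℝ, EY) ∞ (fun x => (σ x).1) :=
    (contMDiff_proj (n := ∞) (FormAt EY (n + 1) : Y → Type _)).comp σ.contMDiff
  obtain ⟨g, μ, hμ, hg, hg₀⟩ := exists_momentum_apply_eq hp hφ o
    (contMDiff_configVelocity hp (reduction hp τ σ) U) x₀ l
  obtain ⟨W, hW1, hW2⟩ := exists_tangent_momentum hp hτ hTR σ μ hμ
  have hint : ∀ x, symplecticIntegrand hp (reduction hp τ σ) U (TR σ W) x =
      (g x * g x) • o.toFun x := by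
    intro x
    refine ContinuousAlternatingMap.ext fun u => ?_
    refine (congrArg (fun A : ℰ [⋀^Fin n]→L[ℝ] ℝ => A u)
      (symplecticIntegrand_of_right hp (reduction hp τ σ) U (TR σ W) x (hW1 x))).trans ?_
    refine (congrArg (fun f : F => momentumVelocity hp (reduction hp τ σ x) ((TR σ W).1 x) f u)
      (hfv x)).trans ?_
    refine (congrArg (fun A : ℰ [⋀^Fin n]→L[ℝ] ℝ => A u)
      (hW2 x (configVelocity hp τ (reduction hp τ σ) U x))).trans ?_
    exact hg x u
  have hg₀' : g x₀ ≠ 0 := by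
    rw [hg₀]
    rw [hfv x₀] at hl
    exact hl
  have hpos := integralForm_pos o (g := fun x => g x * g x) (x₀ := x₀)
    (fun x => mul_self_nonneg _) (mul_self_ne_zero.2 hg₀') hint
    (contMDiff_symplecticIntegrand hp (reduction hp τ σ) U (TR σ W))
  exact hpos.ne' (hU W)

end Nondegenerate

theorem alternating_zero_left {M : Type*} [AddCommGroup M] [Module ℝ M] (A : M [⋀^Fin 2]→ₗ[ℝ] ℝ)
    (W : M) : A ![0, W] = 0 := A.map_coord_zero 0 rfl

section Ratio

variable {n : ℕ} {S : Type*} [TopologicalSpace S] [ChartedSpace (EuclideanSpace ℝ (Fin n)) S]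
  [IsManifold 𝓘(ℝ, EuclideanSpace ℝ (Fin n)) ∞ S]

local notation "ℰ" => EuclideanSpace ℝ (Fin n)

/-- The space of alternating maps of maximal degree is one-dimensional. -/
theorem alternating_eq_smul (A B : ℰ [⋀^Fin n]→L[ℝ] ℝ) (hA : A ≠ 0) :
    A (fun i => EuclideanSpace.single i (1 : ℝ)) ≠ 0 ∧
    B = (B (fun i => EuclideanSpace.single i (1 : ℝ)) /
      A (fun i => EuclideanSpace.single i (1 : ℝ))) • A := by
  let b := (EuclideanSpace.basisFun (Fin n) ℝ).toBasis
  have hb : (b : Fin n → ℰ) = fun i => EuclideanSpace.single i (1 : ℝ) := by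
    funext i
    simp [b]
  have h : ∀ C : ℰ [⋀^Fin n]→L[ℝ] ℝ, ∀ u, C u =
      C (fun i => EuclideanSpace.single i (1 : ℝ)) * b.det u := by
    intro C u
    have := congrArg (fun D : ℰ [⋀^Fin n]→ₗ[ℝ] ℝ => D u)
      (AlternatingMap.eq_smul_basis_det b C.toAlternatingMap)
    rw [hb] at this
    exact this
  have h0 : A (fun i => EuclideanSpace.single i (1 : ℝ)) ≠ 0 := by
    intro h0
    apply hA
    ext u
    rw [h, h0, zero_mul]
    rfl
  refine ⟨h0, ?_⟩
  ext u
  change B u = _ / _ * A u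
  rw [h B u, h A u]
  field_simp

/-- A form of maximal degree is a smooth multiple of the orientation form. -/
theorem OrientationForm.exists_eq_smul (o : OrientationForm n S) {D : ∀ x : S, FormAt ℰ n x}
    (hD : ContMDiff 𝓘(ℝ, ℰ) (𝓘(ℝ, ℰ).prod 𝓘(ℝ, ℰ [⋀^Fin n]→L[ℝ] ℝ)) ∞
      (fun x => (⟨x, D x⟩ : FormBundle ℰ S n))) :
    ∃ g : S → ℝ, ContMDiff 𝓘(ℝ, ℰ) 𝓘(ℝ, ℝ) ∞ g ∧ ∀ x, D x = g x • o.toFun x := by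
  have hex : ∀ x, ∃ r : ℝ, D x = r • o.toFun x := fun x =>
    ⟨_, (alternating_eq_smul (n := n) (o.toFun x) (D x) (o.ne_zero x)).2⟩
  choose g hg using hex
  refine ⟨g, fun x₀ => ?_, hg⟩
  let u : Fin n → ∀ x : S, TangentSpace 𝓘(ℝ, ℰ) x := fun i x =>
    (trivializationAt ℰ (TangentSpace 𝓘(ℝ, ℰ)) x₀).symmL ℝ x (EuclideanSpace.single i (1 : ℝ))
  have hu : ∀ i, ContMDiffAt 𝓘(ℝ, ℰ) 𝓘(ℝ, ℰ).tangent ∞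
      (fun x => (⟨x, u i x⟩ : TangentBundle 𝓘(ℝ, ℰ) S)) x₀ := fun i =>
    contMDiffAt_trivialization_symmL x₀ _
  have h1 := ContMDiffAt.form_apply (b := fun x : S => x) (A := D) (u := u) hD.contMDiffAt hu
  have h2 := ContMDiffAt.form_apply (b := fun x : S => x) (A := o.toFun) (u := u)
    o.contMDiff.contMDiffAt hu
  have h3 : (o.toFun x₀ fun i => u i x₀ : ℝ) ≠ 0 := by
    have h4 := (alternating_eq_smul (n := n) (o.toFun x₀) (D x₀) (o.ne_zero x₀)).1
    have h5 : (fun i => u i x₀) = fun i => EuclideanSpace.single i (1 : ℝ) :=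
      funext fun i => trivializationAt_tangent_symmL_self rfl _
    rw [h5]
    exact h4
  refine (h1.div₀ h2 h3).congr_of_eventuallyEq ?_
  filter_upwards [h2.continuousAt.eventually_ne h3] with x hx
  refine (eq_div_iff hx).2 ?_
  exact congrArg (fun A : FormAt ℰ n x => (A fun i => u i x : ℝ)) (hg x).symm

end Ratio

section Nondegenerate

open Diffeology

variable {S X Y EX EY F : Type*} {n : ℕ}
  [TopologicalSpace S] [ChartedSpace (EuclideanSpace ℝ (Fin n)) S]
  [IsManifold 𝓘(ℝ, EuclideanSpace ℝ (Fin n)) ∞ S] [CompactSpace S] [T2Space S]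
  [NormedAddCommGroup EX] [NormedSpace ℝ EX]
  [TopologicalSpace X] [ChartedSpace EX X] [IsManifold 𝓘(ℝ, EX) ∞ X]
  [NormedAddCommGroup EY] [NormedSpace ℝ EY] [FiniteDimensional ℝ EY]
  [TopologicalSpace Y] [ChartedSpace EY Y] [IsManifold 𝓘(ℝ, EY) ∞ Y] [T2Space Y]
  [SigmaCompactSpace Y]
  [NormedAddCommGroup F] [NormedSpace ℝ F] [FiniteDimensional ℝ F]
  {p : Y → X} (hp : Manifold.IsSubmersionOfComplement F 𝓘(ℝ, EY) 𝓘(ℝ, EX) ∞ p) {τ : S → X}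

local notation "ℰ" => EuclideanSpace ℝ (Fin n)
local notation "𝓘Z" => ModelWithCorners.prod (modelWithCornersSelf ℝ EY)
  (modelWithCornersSelf ℝ (ContinuousAlternatingMap ℝ EY ℝ (Fin (n + 1))))
local notation "𝓘M" => ModelWithCorners.prod
  (ModelWithCorners.prod (modelWithCornersSelf ℝ (EuclideanSpace ℝ (Fin n)))
    (modelWithCornersSelf ℝ EY))
  (modelWithCornersSelf ℝ (ContinuousLinearMap (RingHom.id ℝ) F
    (ContinuousAlternatingMap ℝ (EuclideanSpace ℝ (Fin n)) ℝ (Fin n))))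

/-- Images of `TR` attain every fibre direction at a given point. -/
theorem exists_fibreVelocity_eq
    {TR : ∀ σ : MultimomentumSpace hp τ n, SectionTangent σ →ₗ[ℝ] SectionTangent (reduction hp τ σ)}
    (hTR : IsTangentMap (reduction hp τ) TR) (σ : MultimomentumSpace hp τ n) (x₀ : S) (f : F) :
    ∃ W : SectionTangent σ, fibreVelocity hp (reduction hp τ σ x₀) ((TR σ W).1 x₀) = f := by
  obtain ⟨a, ha, haH⟩ := exists_adaptedChart_multimomentum hp τ n (σ x₀)
  have hH : (((adEquiv hp (σ x₀).1).symm (0, f), 0) :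
      EY × (EY [⋀^Fin (n + 1)]→L[ℝ] ℝ)) ∈ a.H := by
    rw [haH]
    refine ⟨?_, zero_mem _⟩
    change (adEquiv hp (σ x₀).1 ((adEquiv hp (σ x₀).1).symm (0, f))).1 = 0
    rw [ContinuousLinearEquiv.apply_symm_apply]
  obtain ⟨W, hW⟩ := a.exists_tangent hH
  refine ⟨W, (fibreVelocity_tangentMap hp hTR σ W x₀).trans ?_⟩
  rw [ha] at hW
  have h1 := mfderiv_formPsi_fst hp (σ x₀).1 (σ x₀) (mem_adChart_source hp _) (W.1 x₀)
  have h2 := h1.symm.trans (congrArg Prod.fst hW)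
  refine (congrArg (fun e : EY => (adEquiv hp (σ x₀).1 e).2) h2).trans ?_
  change (adEquiv hp (σ x₀).1 ((adEquiv hp (σ x₀).1).symm (0, f))).2 = f
  rw [ContinuousLinearEquiv.apply_symm_apply]

theorem fibreVelocity_smulFun
    {TR : ∀ σ : MultimomentumSpace hp τ n, SectionTangent σ →ₗ[ℝ] SectionTangent (reduction hp τ σ)}
    (hTR : IsTangentMap (reduction hp τ) TR) (σ : MultimomentumSpace hp τ n)
    (W : SectionTangent σ) {g : S → ℝ} (hg : ContMDiff 𝓘(ℝ, ℰ) 𝓘(ℝ, ℝ) ∞ g) (x : S) :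
    fibreVelocity hp (reduction hp τ σ x) ((TR σ (SectionTangent.smulFun W hg)).1 x) =
      g x • fibreVelocity hp (reduction hp τ σ x) ((TR σ W).1 x) := by
  refine (fibreVelocity_tangentMap hp hTR σ _ x).trans ?_
  refine Eq.trans ?_ (congrArg (fun f : F => g x • f) (fibreVelocity_tangentMap hp hTR σ W x)).symm
  have h : (multimomentumConfigVelocity hp τ σ (SectionTangent.smulFun W hg) x : EY) =
      g x • (show EY from multimomentumConfigVelocity hp τ σ W x) :=
    map_smul (mfderiv 𝓘Z 𝓘(ℝ, EY) (TotalSpace.proj : FormBundle EY Y (n + 1) → Y) (σ x)) (g x)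
      (W.1 x)
  let L : EY →L[ℝ] F := ((ContinuousLinearMap.snd ℝ EX F).comp
    (adEquiv hp (σ x).1 : EY →L[ℝ] EX × F)).comp (chartD hp (σ x).1 (σ x).1)
  exact (congrArg L h).trans (map_smul L _ _)

/-- A tangent vector without configuration part which is orthogonal to the image of the tangent map
of the reduction map has no momentum part. -/
theorem momentumVelocity_eq_zero (o : OrientationForm n S)
    {TR : ∀ σ : MultimomentumSpace hp τ n, SectionTangent σ →ₗ[ℝ] SectionTangent (reduction hp τ σ)}
    (hTR : IsTangentMap (reduction hp τ) TR) (σ : MultimomentumSpace hp τ n)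
    (U : SectionTangent (reduction hp τ σ))
    (hU : ∀ W, phaseTwoForm hp τ o (reduction hp τ σ) ![U, TR σ W] = 0)
    (hf : ∀ x, fibreVelocity hp (reduction hp τ σ x) (U.1 x) = 0) (x₀ : S) :
    momentumVelocity hp (reduction hp τ σ x₀) (U.1 x₀) = 0 := by
  refine ContinuousLinearMap.ext fun f => ?_
  obtain ⟨W, hW⟩ := exists_fibreVelocity_eq hp hTR σ x₀ f
  obtain ⟨g, hg, hgD⟩ := o.exists_eq_smul
    (contMDiff_symplecticIntegrand hp (reduction hp τ σ) U (TR σ W))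
  have hD : ∀ x, (symplecticIntegrand hp (reduction hp τ σ) U (TR σ W) x : ℰ [⋀^Fin n]→L[ℝ] ℝ) =
      -momentumVelocity hp (reduction hp τ σ x) (U.1 x)
        (fibreVelocity hp (reduction hp τ σ x) ((TR σ W).1 x)) := fun x =>
    symplecticIntegrand_of_left hp (reduction hp τ σ) U (TR σ W) x (hf x)
  have hint : ∀ x, symplecticIntegrand hp (reduction hp τ σ) U
      (TR σ (SectionTangent.smulFun W hg)) x = (g x * g x) • o.toFun x := by
    intro x
    refine (symplecticIntegrand_of_left hp (reduction hp τ σ) U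
      (TR σ (SectionTangent.smulFun W hg)) x (hf x)).trans ?_
    have e : ∀ (L : F →L[ℝ] (ℰ [⋀^Fin n]→L[ℝ] ℝ)) (r : ℝ) (f : F), -L (r • f) = r • -L f :=
      fun L r f => by rw [map_smul, smul_neg]
    refine (congrArg (fun f : F => -momentumVelocity hp (reduction hp τ σ x) (U.1 x) f)
      (fibreVelocity_smulFun hp hTR σ W hg x)).trans ?_
    refine (e _ _ _).trans ?_
    refine (congrArg (fun A : ℰ [⋀^Fin n]→L[ℝ] ℝ => g x • A) ((hD x).symm.trans (hgD x))).trans ?_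
    exact smul_smul (g x) (g x) (show ℰ [⋀^Fin n]→L[ℝ] ℝ from o.toFun x)
  by_contra hne
  have hg₀ : g x₀ ≠ 0 := by
    intro h0
    apply hne
    have h1 := (hD x₀).symm.trans (hgD x₀)
    rw [hW, h0, zero_smul] at h1
    exact neg_eq_zero.1 h1
  have hpos := integralForm_pos o (g := fun x => g x * g x) (x₀ := x₀)
    (fun x => mul_self_nonneg _) (mul_self_ne_zero.2 hg₀) hint
    (contMDiff_symplecticIntegrand hp (reduction hp τ σ) U (TR σ (SectionTangent.smulFun W hg)))
  exact hpos.ne' (hU _)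

/-- A tangent vector of the phase space is determined by its fibre and momentum parts. -/
theorem PhaseSpace.tangent_eq_zero (s : PhaseSpace hp τ n) (U : SectionTangent s) (x : S)
    (hf : fibreVelocity hp (s x) (U.1 x) = 0) (hm : momentumVelocity hp (s x) (U.1 x) = 0) :
    U.1 x = 0 := by
  obtain ⟨a, ha, haH, haN⟩ := exists_adaptedChart_momentum hp τ (s x)
  have hN : s x ∈ a.N := by
    rw [haN]
    exact mem_momSource_self hp (s x)
  have hinj := a.mfderiv_Psi_injective hN
  have hmem := a.mfderiv_mem _ hN (s.mem_carrier x) _ (U.2.2 x).1 (U.2.2 x).2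
  rw [ha] at hinj hmem
  rw [haH] at hmem
  have h1 := mfderiv_momPsi_fst_snd hp (s x).1 (mem_momSource_self hp (s x)) (U.1 x)
  have h2 := mfderiv_snd_apply (mdifferentiableAt_momPsi hp (s x).1 (mem_momSource_self hp (s x)))
    (U.1 x)
  have h3 := mfderiv_fibreCoord hp (s x).1.2 (s x) (mem_adChart_source hp _) (U.1 x)
  have hz : (mfderiv 𝓘M 𝓘(ℝ, (ℰ × EY) × (F →L[ℝ] (ℰ [⋀^Fin n]→L[ℝ] ℝ)))
      (momPsi hp (s x).1) (s x) 0 : (ℰ × EY) × (F →L[ℝ] (ℰ [⋀^Fin n]→L[ℝ] ℝ))) = 0 :=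
    ContinuousLinearMap.map_zero _
  refine hinj (Eq.trans ?_ hz.symm)
  refine Prod.ext (Prod.ext hmem.1 ?_) (h2.trans hm)
  refine (adEquiv hp (s x).1.2).injective
    (Eq.trans (Prod.ext hmem.2 ?_) (map_zero (adEquiv hp (s x).1.2)).symm)
  exact (congrArg (fun e : EY => (adEquiv hp (s x).1.2 e).2) h1).trans (h3.symm.trans hf)

/-- The canonical two-form of the phase space is nondegenerate on the image of the tangent map of
the reduction map. -/
theorem eq_zero_of_phaseTwoForm_tangentMap (hτ : Manifold.IsImmersion 𝓘(ℝ, ℰ) 𝓘(ℝ, EX) ∞ τ)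
    (o : OrientationForm n S)
    {TR : ∀ σ : MultimomentumSpace hp τ n, SectionTangent σ →ₗ[ℝ] SectionTangent (reduction hp τ σ)}
    (hTR : IsTangentMap (reduction hp τ) TR) (σ : MultimomentumSpace hp τ n)
    (U : SectionTangent (reduction hp τ σ))
    (hU : ∀ W, phaseTwoForm hp τ o (reduction hp τ σ) ![U, TR σ W] = 0) : U = 0 := by
  have hf := fibreVelocity_eq_zero hp hτ o hTR σ U hU
  exact Subtype.ext (funext fun x => PhaseSpace.tangent_eq_zero hp (reduction hp τ σ) U x (hf x)
    (momentumVelocity_eq_zero hp o hTR σ U hU hf x))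

/-- Weak nondegeneracy: every element of the phase space is a reduction, and testing against
the image of the tangent map suffices. -/
theorem ker_phaseTwoForm (hτ : Manifold.IsImmersion 𝓘(ℝ, ℰ) 𝓘(ℝ, EX) ∞ τ)
    (o : OrientationForm n S) (s : PhaseSpace hp τ n) : (phaseTwoForm hp τ o).ker s = ⊥ := by
  obtain ⟨σ, rfl⟩ := surjective_reduction hp hτ s
  obtain ⟨TR, hTR, -⟩ := existsUnique_isTangentMap_reduction (τ := τ) (n := n) hp
  refine (Submodule.eq_bot_iff _).2 fun U hU => ?_
  exact eq_zero_of_phaseTwoForm_tangentMap hp hτ o hTR σ U fun W => TwoForm.mem_ker.1 hU (TR σ W)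

/-- A vector `TR V` orthogonal to the image of `TR` is zero, so the kernel of the tangent map is
that of the pulled-back form. -/
theorem ker_tangentMap (hτ : Manifold.IsImmersion 𝓘(ℝ, ℰ) 𝓘(ℝ, EX) ∞ τ)
    (o : OrientationForm n S)
    {TR : ∀ σ : MultimomentumSpace hp τ n, SectionTangent σ →ₗ[ℝ] SectionTangent (reduction hp τ σ)}
    (hTR : IsTangentMap (reduction hp τ) TR) (σ : MultimomentumSpace hp τ n) :
    LinearMap.ker (TR σ) = ((phaseTwoForm hp τ o).pullback TR).ker σ := by
  ext V
  rw [TwoForm.mem_ker, LinearMap.mem_ker]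
  simp_rw [TwoForm.pullback_apply]
  refine ⟨fun h W => ?_, fun h => eq_zero_of_phaseTwoForm_tangentMap hp hτ o hTR σ _ h⟩
  exact (congrArg (fun U => phaseTwoForm hp τ o (reduction hp τ σ) ![U, TR σ W]) h).trans
    (alternating_zero_left (phaseTwoForm hp τ o (reduction hp τ σ)) (TR σ W))

end Nondegenerate

/-! ### The leaves of the characteristic distribution -/

/-- A differentiable map with vanishing derivative on a normed space is constant. -/
theorem eq_of_mfderiv_eq_zero {E EM HM M : Type*} [NormedAddCommGroup E] [NormedSpace ℝ E]
    [NormedAddCommGroup EM] [NormedSpace ℝ EM] [TopologicalSpace HM] {IM : ModelWithCorners ℝ EM HM}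
    [TopologicalSpace M] [ChartedSpace HM M] [IsManifold IM ∞ M] {f : E → M}
    (hf : MDifferentiable 𝓘(ℝ, E) IM f) (h : ∀ t v, (mfderiv 𝓘(ℝ, E) IM f t v : EM) = 0)
    (a b : E) : f a = f b := by
  suffices hl : IsLocallyConstant f from hl.apply_eq_of_preconnectedSpace a b
  refine (IsLocallyConstant.iff_eventually_eq f).2 fun t₀ => ?_
  have hU : IsOpen (f ⁻¹' (chartAt HM (f t₀)).source) :=
    (chartAt HM (f t₀)).open_source.preimage hf.continuous
  obtain ⟨r, hr, hball⟩ := Metric.isOpen_iff.1 hU t₀ (mem_chart_source HM (f t₀))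
  have hd : ∀ t ∈ Metric.ball t₀ r, MDifferentiableAt 𝓘(ℝ, E) 𝓘(ℝ, EM)
      (extChartAt IM (f t₀) ∘ f) t := fun t ht =>
    (mdifferentiableAt_extChartAt (hball ht)).comp t (hf t)
  have hz : ∀ t ∈ Metric.ball t₀ r, fderiv ℝ (extChartAt IM (f t₀) ∘ f) t = 0 := by
    intro t ht
    rw [← mfderiv_eq_fderiv, mfderiv_comp t (mdifferentiableAt_extChartAt (hball ht)) (hf t)]
    refine ContinuousLinearMap.ext fun v => ?_
    exact (congrArg (mfderiv IM 𝓘(ℝ, EM) (extChartAt IM (f t₀)) (f t)) (h t v)).trans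
      (ContinuousLinearMap.map_zero _)
  filter_upwards [Metric.ball_mem_nhds t₀ hr] with t ht
  refine (extChartAt IM (f t₀)).injOn ?_ ?_ ?_
  · rw [extChartAt_source]; exact hball ht
  · rw [extChartAt_source]; exact mem_chart_source HM (f t₀)
  · exact Metric.isOpen_ball.is_const_of_fderiv_eq_zero (𝕜 := ℝ)
      (convex_ball t₀ r).isPreconnected
      (fun t ht => (mdifferentiableAt_iff_differentiableAt.1 (hd t ht)).differentiableWithinAt) hz
      ht (Metric.mem_ball_self hr)

section Leaves

open Diffeology

variable {S X Y EX EY F : Type*} {n : ℕ}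
  [TopologicalSpace S] [ChartedSpace (EuclideanSpace ℝ (Fin n)) S]
  [IsManifold 𝓘(ℝ, EuclideanSpace ℝ (Fin n)) ∞ S] [CompactSpace S] [T2Space S]
  [NormedAddCommGroup EX] [NormedSpace ℝ EX]
  [TopologicalSpace X] [ChartedSpace EX X] [IsManifold 𝓘(ℝ, EX) ∞ X]
  [NormedAddCommGroup EY] [NormedSpace ℝ EY] [FiniteDimensional ℝ EY]
  [TopologicalSpace Y] [ChartedSpace EY Y] [IsManifold 𝓘(ℝ, EY) ∞ Y] [T2Space Y]
  [SigmaCompactSpace Y]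
  [NormedAddCommGroup F] [NormedSpace ℝ F] [FiniteDimensional ℝ F]
  {p : Y → X} (hp : Manifold.IsSubmersionOfComplement F 𝓘(ℝ, EY) 𝓘(ℝ, EX) ∞ p) {τ : S → X}

local notation "ℰ" => EuclideanSpace ℝ (Fin n)
local notation "𝓘Z" => ModelWithCorners.prod (modelWithCornersSelf ℝ EY)
  (modelWithCornersSelf ℝ (ContinuousAlternatingMap ℝ EY ℝ (Fin (n + 1))))

/-- Along a family with constant momentum, the velocity is in the kernel of the tangent map of the
reduction map. -/
theorem tangentMap_velocity_eq_zero
    {TR : ∀ σ : MultimomentumSpace hp τ n, SectionTangent σ →ₗ[ℝ] SectionTangent (reduction hp τ σ)}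
    (hTR : IsTangentMap (reduction hp τ) TR) {k : ℕ}
    {c : EuclideanSpace ℝ (Fin k) → MultimomentumSpace hp τ n} (hc : IsPlot c)
    (hR : ∀ t t', reduction hp τ (c t) = reduction hp τ (c t')) (t v : EuclideanSpace ℝ (Fin k)) :
    TR (c t) (velocity c hc t v) = 0 := by
  rw [hTR c hc (isPlot_reduction hp τ hc) t v]
  refine Subtype.ext (funext fun x => ?_)
  have h : (fun t' => reduction hp τ (c t') x) = fun _ => reduction hp τ (c t) x :=
    funext fun t' => by rw [hR t' t]
  change mfderiv _ _ (fun t' => reduction hp τ (c t') x) t v = 0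
  rw [h, mfderiv_const]
  rfl

/-- The momentum is constant along a family whose velocities are in the kernel of the tangent map of
the reduction map. -/
theorem reduction_eq_of_tangentMap_velocity
    {TR : ∀ σ : MultimomentumSpace hp τ n, SectionTangent σ →ₗ[ℝ] SectionTangent (reduction hp τ σ)}
    (hTR : IsTangentMap (reduction hp τ) TR) {k : ℕ}
    {c : EuclideanSpace ℝ (Fin k) → MultimomentumSpace hp τ n} (hc : IsPlot c)
    (h : ∀ t v, TR (c t) (velocity c hc t v) = 0) (t t' : EuclideanSpace ℝ (Fin k)) :
    reduction hp τ (c t) = reduction hp τ (c t') := by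
  refine Sections.ext_apply fun x => ?_
  refine eq_of_mfderiv_eq_zero (f := fun t => reduction hp τ (c t) x)
    ((contMDiff_phase_left hp (isPlot_reduction hp τ hc) x).mdifferentiable (by simp))
    (fun t v => ?_) t t'
  have h1 := (hTR c hc (isPlot_reduction hp τ hc) t v).symm.trans (h t v)
  exact congrFun (congrArg Subtype.val h1) x

/-- Fields with the same reduction cover the same configuration. -/
theorem reduction_base (σ σ' : MultimomentumSpace hp τ n)
    (h : reduction hp τ σ = reduction hp τ σ') (x : S) : (σ' x).1 = (σ x).1 :=
  (congrArg (fun s : PhaseSpace hp τ n => (s x).1.2) h).symm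

theorem mem_multiphase_cast {k : ℕ} {y y' : Y} (h : y = y') (A : FormAt EY k y)
    (hA : (⟨y, A⟩ : FormBundle EY Y k) ∈ multiphase EX p k) :
    (⟨y', FormAt.cast h A⟩ : FormBundle EY Y k) ∈ multiphase EX p k := by
  subst h
  exact hA

/-- Two multimomentum fields with the same momentum differ by a field along their common
configuration field, in the kernel of the reduction map. -/
theorem exists_shift_of_reduction_eq (σ σ' : MultimomentumSpace hp τ n)
    (h : reduction hp τ σ = reduction hp τ σ') :
    ∃ (B : ∀ x, FormAt EY (n + 1) (σ x).1)
      (hB : ContMDiff 𝓘(ℝ, ℰ) 𝓘Z ∞ (fun x => (⟨(σ x).1, B x⟩ : FormBundle EY Y (n + 1))))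
      (hm : ∀ x, (⟨(σ x).1, B x⟩ : FormBundle EY Y (n + 1)) ∈ multiphase EX p (n + 1)),
      MultimomentumSpace.shift hp σ B hB hm 1 = σ' ∧
      ∀ x (v : VertAt hp (σ x).1) (e : Fin n → ℰ), B x (Matrix.vecCons
        (VertAt.incl hp (σ x).1 v)
        fun j => mfderiv 𝓘(ℝ, ℰ) 𝓘(ℝ, EY) (fun x' => (σ x').1) x (e j)) = 0 := by
  have hb := reduction_base hp σ σ' h
  let A : ∀ x, FormAt EY (n + 1) (σ x).1 := fun x => FormAt.cast (hb x) (σ' x).2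
  have hA0 : ∀ x, (⟨(σ x).1, A x⟩ : FormBundle EY Y (n + 1)) = σ' x := fun x =>
    FormAt.mk_cast (hb x) (σ' x).2
  have hA : ContMDiff 𝓘(ℝ, ℰ) 𝓘Z ∞ (fun x => (⟨(σ x).1, A x⟩ : FormBundle EY Y (n + 1))) :=
    σ'.contMDiff.congr hA0
  have hAm : ∀ x, (⟨(σ x).1, A x⟩ : FormBundle EY Y (n + 1)) ∈ multiphase EX p (n + 1) :=
    fun x => mem_multiphase_cast (hb x) (σ' x).2 (σ'.mem_carrier x)
  let B : ∀ x, FormAt EY (n + 1) (σ x).1 := fun x => A x + (-1 : ℝ) • (σ x).2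
  have hB : ContMDiff 𝓘(ℝ, ℰ) 𝓘Z ∞ (fun x => (⟨(σ x).1, B x⟩ : FormBundle EY Y (n + 1))) :=
    fun x => ContMDiffAt.form_add_smul (b := fun x => (σ x).1) (A := A) (B := fun x => (σ x).2)
      (g := fun _ => (-1 : ℝ)) hA.contMDiffAt σ.contMDiff.contMDiffAt contMDiffAt_const
  have hm : ∀ x, (⟨(σ x).1, B x⟩ : FormBundle EY Y (n + 1)) ∈ multiphase EX p (n + 1) := by
    intro x u i j hij hi hj
    have h1 := hAm x u i j hij hi hj
    have h2 := σ.mem_carrier x u i j hij hi hj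
    change A x u + (-1) * (σ x).2 u = 0
    rw [h1, h2, mul_zero, add_zero]
  have hshift : MultimomentumSpace.shift hp σ B hB hm 1 = σ' := by
    refine Sections.ext_apply fun x => Eq.trans ?_ (hA0 x)
    refine TotalSpace.ext rfl (heq_of_eq ?_)
    refine ContinuousAlternatingMap.ext fun u => ?_
    change (σ x).2 u + 1 * (A x u + (-1) * (σ x).2 u) = A x u
    ring
  refine ⟨B, hB, hm, hshift, fun x v e => ?_⟩
  have h1 := MultimomentumSpace.reduction_shift_apply hp σ B hB hm 1 x v e
  have h2 : reduction hp τ (MultimomentumSpace.shift hp σ B hB hm 1) = reduction hp τ σ := by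
    rw [hshift, h]
  have h3 : PhaseSpace.momentum hp (reduction hp τ (MultimomentumSpace.shift hp σ B hB hm 1)) x v =
      PhaseSpace.momentum hp (reduction hp τ σ) x v :=
    congrArg (fun μ : MomentumAt ℰ hp n (x, (σ x).1) => (show ℰ [⋀^Fin n]→L[ℝ] ℝ from μ v))
      (TotalSpace.mk_inj.1 (congrArg (fun s : PhaseSpace hp τ n => s x) h2))
  have h4 := h1.symm.trans (congrArg (fun D : ℰ [⋀^Fin n]→L[ℝ] ℝ => D e) h3)
  rw [one_mul, add_eq_left] at h4
  exact h4

/-- A family `σ + r B` has constant momentum if `B` is in the kernel of the reduction map. -/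
theorem reduction_shift_eq (σ : MultimomentumSpace hp τ n) (B : ∀ x, FormAt EY (n + 1) (σ x).1)
    (hB : ContMDiff 𝓘(ℝ, ℰ) 𝓘Z ∞ (fun x => (⟨(σ x).1, B x⟩ : FormBundle EY Y (n + 1))))
    (hm : ∀ x, (⟨(σ x).1, B x⟩ : FormBundle EY Y (n + 1)) ∈ multiphase EX p (n + 1))
    (h0 : ∀ x (v : VertAt hp (σ x).1) (e : Fin n → ℰ), B x (Matrix.vecCons
        (VertAt.incl hp (σ x).1 v)
        fun j => mfderiv 𝓘(ℝ, ℰ) 𝓘(ℝ, EY) (fun x' => (σ x').1) x (e j)) = 0) (r : ℝ) :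
    reduction hp τ (MultimomentumSpace.shift hp σ B hB hm r) = reduction hp τ σ := by
  refine Sections.ext_apply fun x => TotalSpace.mk_inj.2 ?_
  refine ContinuousLinearMap.ext fun v => ContinuousAlternatingMap.ext fun e => ?_
  refine (MultimomentumSpace.reduction_shift_apply hp σ B hB hm r x v e).trans ?_
  rw [h0 x v e, mul_zero, add_zero]
  rfl

/-- If the form `B` does not contribute to the momentum, the segment from `σ` to `σ + B` is a
curve with constant reduction, so its velocities are in the kernel of the tangent map. -/
theorem exists_curve_of_shift
    {TR : ∀ σ : MultimomentumSpace hp τ n, SectionTangent σ →ₗ[ℝ] SectionTangent (reduction hp τ σ)}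
    (hTR : IsTangentMap (reduction hp τ) TR)
    (σ : MultimomentumSpace hp τ n) (B : ∀ x, FormAt EY (n + 1) (σ x).1)
    (hB : ContMDiff 𝓘(ℝ, ℰ) 𝓘Z ∞ (fun x => (⟨(σ x).1, B x⟩ : FormBundle EY Y (n + 1))))
    (hm : ∀ x, (⟨(σ x).1, B x⟩ : FormBundle EY Y (n + 1)) ∈ multiphase EX p (n + 1))
    (h0 : ∀ x (v : VertAt hp (σ x).1) (e : Fin n → ℰ), B x (Matrix.vecCons
        (VertAt.incl hp (σ x).1 v)
        fun j => mfderiv 𝓘(ℝ, ℰ) 𝓘(ℝ, EY) (fun x' => (σ x').1) x (e j)) = 0) :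
    ∃ (c : EuclideanSpace ℝ (Fin 1) → MultimomentumSpace hp τ n) (hc : IsPlot c), c 0 = σ ∧
      c (EuclideanSpace.single 0 1) = MultimomentumSpace.shift hp σ B hB hm 1 ∧
      ∀ t v, TR (c t) (velocity c hc t v) = 0 := by
  refine ⟨_, MultimomentumSpace.isPlot_shift hp σ B hB hm,
    MultimomentumSpace.shift_zero hp σ B hB hm, ?_,
    tangentMap_velocity_eq_zero hp hTR _ fun t t' => ?_⟩
  · rw [show (EuclideanSpace.single 0 1 : EuclideanSpace ℝ (Fin 1)) 0 = 1 by simp]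
  · rw [reduction_shift_eq hp σ B hB hm h0, reduction_shift_eq hp σ B hB hm h0]

/-- The leaves of the characteristic distribution are the fibres of the reduction map. -/
theorem leafSetoid_iff_reduction_eq
    {TR : ∀ σ : MultimomentumSpace hp τ n, SectionTangent σ →ₗ[ℝ] SectionTangent (reduction hp τ σ)}
    (hTR : IsTangentMap (reduction hp τ) TR) {Om : TwoForm 𝓘(ℝ, ℰ) (multimomentumData hp τ n)}
    (hker : ∀ σ, LinearMap.ker (TR σ) = Om.ker σ) (σ σ' : MultimomentumSpace hp τ n) :
    leafSetoid Om σ σ' ↔ reduction hp τ σ = reduction hp τ σ' := by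
  refine ⟨fun h => ?_, fun h => ?_⟩
  · replace h : Relation.EqvGen _ σ σ' := h
    induction h with
    | rel a b hab =>
      obtain ⟨c, hc, rfl, rfl, hv⟩ := hab
      refine reduction_eq_of_tangentMap_velocity hp hTR hc (fun t v => ?_) _ _
      have := hv t v
      rw [← hker] at this
      exact this
    | refl a => rfl
    | symm a b _ ih => exact ih.symm
    | trans a b c _ _ ih₁ ih₂ => exact ih₁.trans ih₂
  · obtain ⟨B, hB, hm, hs, h0⟩ := exists_shift_of_reduction_eq hp σ σ' h
    obtain ⟨c, hc, hc0, hc1, hv⟩ := exists_curve_of_shift hp hTR σ B hB hm h0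
    refine Relation.EqvGen.rel _ _ ⟨c, hc, hc0, hc1.trans hs, fun t v => ?_⟩
    rw [← hker]
    exact hv t v

/-- Over a fixed configuration the reduction map is linear, so that equality of reductions means
that the difference reduces to zero. -/
theorem differByKernel_iff_reduction_eq (σ σ' : MultimomentumSpace hp τ n) :
    DifferByKernel hp τ (reduction hp τ) σ σ' ↔ reduction hp τ σ = reduction hp τ σ' := by
  refine ⟨fun ⟨κ, hκ, h⟩ => ?_, fun h => ?_⟩
  · have hb : ∀ x, (κ x).1 = (σ x).1 := by
      intro x
      obtain ⟨y, a, b, ha, hb, -⟩ := h x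
      rw [ha, hb]
    let B : ∀ x, FormAt EY (n + 1) (σ x).1 := fun x => FormAt.cast (hb x) (κ x).2
    have hB0 : ∀ x, (⟨(σ x).1, B x⟩ : FormBundle EY Y (n + 1)) = κ x := fun x =>
      FormAt.mk_cast (hb x) (κ x).2
    have hB : ContMDiff 𝓘(ℝ, ℰ) 𝓘Z ∞ (fun x => (⟨(σ x).1, B x⟩ : FormBundle EY Y (n + 1))) :=
      κ.contMDiff.congr hB0
    have hm : ∀ x, (⟨(σ x).1, B x⟩ : FormBundle EY Y (n + 1)) ∈ multiphase EX p (n + 1) :=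
      fun x => mem_multiphase_cast (hb x) (κ x).2 (κ.mem_carrier x)
    let κ' : MultimomentumSpace hp τ n :=
      { toFun := fun x => ⟨(σ x).1, B x⟩
        contMDiff := hB
        proj_eq := σ.proj_eq
        mem_carrier := hm }
    have hκ' : κ' = κ := Sections.ext_apply hB0
    have h0 : ∀ x (v : VertAt hp (σ x).1) (e : Fin n → ℰ), B x (Matrix.vecCons
        (VertAt.incl hp (σ x).1 v)
        fun j => mfderiv 𝓘(ℝ, ℰ) 𝓘(ℝ, EY) (fun x' => (σ x').1) x (e j)) = 0 := by
      intro x v e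
      have h1 : (reduction hp τ κ' x).2 = 0 := by
        rw [hκ']
        exact hκ x
      exact congrArg (fun μ : MomentumAt ℰ hp n (x, (σ x).1) =>
        (show ℰ [⋀^Fin n]→L[ℝ] ℝ from μ v) e) h1
    have hs : MultimomentumSpace.shift hp σ B hB hm 1 = σ' := by
      refine Sections.ext_apply fun x => ?_
      obtain ⟨y, a, b, ha, hb, hab⟩ := h x
      rw [hab]
      have h1 : ∀ (z : FormBundle EY Y (n + 1)) (D : FormAt EY (n + 1) z.1), z = ⟨y, a⟩ →
          (⟨z.1, D⟩ : FormBundle EY Y (n + 1)) = ⟨y, b⟩ →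
            (⟨z.1, z.2 + (1 : ℝ) • D⟩ : FormBundle EY Y (n + 1)) = ⟨y, a + b⟩ := by
        rintro _ D rfl hD
        rw [TotalSpace.mk_inj.1 hD, one_smul]
      exact h1 (σ x) (B x) ha ((hB0 x).trans hb)
    rw [← hs, reduction_shift_eq hp σ B hB hm h0]
  · obtain ⟨B, hB, hm, hs, h0⟩ := exists_shift_of_reduction_eq hp σ σ' h
    refine ⟨{ toFun := fun x => ⟨(σ x).1, B x⟩
              contMDiff := hB
              proj_eq := σ.proj_eq
              mem_carrier := hm }, fun x => ?_, fun x => ⟨(σ x).1, (σ x).2, B x, rfl, rfl, ?_⟩⟩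
    · refine ContinuousLinearMap.ext fun v => ContinuousAlternatingMap.ext fun e => ?_
      exact h0 x v e
    · rw [← hs]
      refine TotalSpace.mk_inj.2 ?_
      exact congrArg (fun D => (σ x).2 + D) (one_smul ℝ (B x))

end Leaves

/-! ### The quotient by the characteristic distribution -/

/-- An alternating bilinear form on a finite-dimensional space is continuous. -/
def AlternatingMap.toContinuousOfFinrank {E : Type*} [NormedAddCommGroup E] [NormedSpace ℝ E]
    [FiniteDimensional ℝ E] (A : E [⋀^Fin 2]→ₗ[ℝ] ℝ) : E [⋀^Fin 2]→L[ℝ] ℝ :=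
  { A with
    cont := by
      let f : E →ₗ[ℝ] E →ₗ[ℝ] ℝ := LinearMap.mk₂ ℝ (fun x y => A ![x, y])
        (fun x x' y => congrArg (fun B : E [⋀^Fin 1]→ₗ[ℝ] ℝ => B ![y]) (A.curryLeft.map_add x x'))
        (fun r x y => congrArg (fun B : E [⋀^Fin 1]→ₗ[ℝ] ℝ => B ![y]) (A.curryLeft.map_smul r x))
        (fun x y y' => congrArg (fun B : E [⋀^Fin 0]→ₗ[ℝ] ℝ => B ![])
          ((A.curryLeft x).curryLeft.map_add y y'))
        (fun r x y => congrArg (fun B : E [⋀^Fin 0]→ₗ[ℝ] ℝ => B ![])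
          ((A.curryLeft x).curryLeft.map_smul r y))
      have h : ∀ u : Fin 2 → E, A u = f.toContinuousBilinearMap (u 0) (u 1) := by
        intro u
        refine congrArg A (funext fun i => ?_)
        fin_cases i <;> rfl
      exact Continuous.congr (by fun_prop) fun u => (h u).symm }

section Quotient

open Diffeology

variable {ES EK HK EB HB S K B EK' HK' EB' HB' K' B' : Type*}
  [NormedAddCommGroup ES] [NormedSpace ℝ ES] [FiniteDimensional ℝ ES]
  [NormedAddCommGroup EK] [NormedSpace ℝ EK] [TopologicalSpace HK]
  [NormedAddCommGroup EB] [NormedSpace ℝ EB] [TopologicalSpace HB]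
  {IK : ModelWithCorners ℝ EK HK} {IB : ModelWithCorners ℝ EB HB}
  [TopologicalSpace S] [ChartedSpace ES S] [IsManifold 𝓘(ℝ, ES) ∞ S] [CompactSpace S] [T2Space S]
  [TopologicalSpace K] [ChartedSpace HK K] [IsManifold IK ∞ K]
  [TopologicalSpace B] [ChartedSpace HB B]
  {D : SectionData IK IB S K B}
  [NormedAddCommGroup EK'] [NormedSpace ℝ EK'] [TopologicalSpace HK']
  [NormedAddCommGroup EB'] [NormedSpace ℝ EB'] [TopologicalSpace HB']
  {IK' : ModelWithCorners ℝ EK' HK'} {IB' : ModelWithCorners ℝ EB' HB'}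
  [TopologicalSpace K'] [ChartedSpace HK' K'] [IsManifold IK' ∞ K']
  [TopologicalSpace B'] [ChartedSpace HB' B']
  {D' : SectionData IK' IB' S K' B'}

/-- The velocity of a family as a linear map. -/
def velocityLinear {k : ℕ} (c : EuclideanSpace ℝ (Fin k) → Sections 𝓘(ℝ, ES) D) (hc : IsPlot c)
    (t : EuclideanSpace ℝ (Fin k)) : EuclideanSpace ℝ (Fin k) →ₗ[ℝ] SectionTangent (c t) where
  toFun := velocity c hc t
  map_add' _ _ := Subtype.ext (funext fun _ => map_add _ _ _)
  map_smul' _ _ := Subtype.ext (funext fun _ => map_smul _ _ _)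

theorem velocity_reparam {k m : ℕ} (c : EuclideanSpace ℝ (Fin k) → Sections 𝓘(ℝ, ES) D)
    (hc : IsPlot c) {f : EuclideanSpace ℝ (Fin m) → EuclideanSpace ℝ (Fin k)}
    (hf : ContDiff ℝ ∞ f) (hcf : IsPlot (c ∘ f)) (t v : EuclideanSpace ℝ (Fin m)) :
    velocity (c ∘ f) hcf t v = velocity c hc (f t) (fderiv ℝ f t v) := by
  refine Subtype.ext (funext fun x => ?_)
  refine (mfderiv_comp_model t (IM := 𝓘(ℝ, EuclideanSpace ℝ (Fin m)))
    (IN := 𝓘(ℝ, EuclideanSpace ℝ (Fin k))) (IP := IK) (g := fun t' => c t' x) (f := f)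
    ((velocityFun_contMDiff_left hc x).mdifferentiableAt (by simp))
    (hf.contMDiff.mdifferentiableAt (by simp)) v).trans ?_
  rw [mfderiv_eq_fderiv]
  rfl

/-- The pull-back of a smooth two-form on a space of sections by a smooth map from a diffeological
space. -/
def DiffeologicalTwoForm.ofPullback {Q : Type*} [DiffeologicalSpace Q]
    (f : Q → Sections 𝓘(ℝ, ES) D) (hf : DSmooth f) (β : TwoForm 𝓘(ℝ, ES) D)
    (hβ : ∀ {k : ℕ} (c : EuclideanSpace ℝ (Fin k) → Sections 𝓘(ℝ, ES) D) (hc : IsPlot c)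
      (v w : EuclideanSpace ℝ (Fin k)),
      ContDiff ℝ ∞ (fun t => β (c t) ![velocity c hc t v, velocity c hc t w])) :
    DiffeologicalTwoForm Q where
  toFun c hc t := ((β (f (c t))).compLinearMap
    (velocityLinear (f ∘ c) (hf _ _ hc) t)).toContinuousOfFinrank
  contDiff {k} c hc := by
    refine contMDiff_iff_contDiff.1 fun t => contMDiffAt_alternating_of_apply fun u => ?_
    have h := hβ (f ∘ c) (hf _ _ hc) (u 0) (u 1)
    refine h.contMDiff.contMDiffAt.congr_of_eventuallyEq (Filter.Eventually.of_forall fun t => ?_)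
    refine congrArg (β (f (c t))) (funext fun i => ?_)
    fin_cases i <;> rfl
  comp {k m} c hc g hg t := by
    refine ContinuousAlternatingMap.ext fun u => ?_
    refine congrArg (β (f (c (g t)))) (funext fun i => ?_)
    exact velocity_reparam (f ∘ c) (hf _ _ hc) hg (hf _ _ (isPlot_reparam hc hg)) t (u i)

theorem DiffeologicalTwoForm.ofPullback_apply {Q : Type*} [DiffeologicalSpace Q]
    (f : Q → Sections 𝓘(ℝ, ES) D) (hf : DSmooth f) (β : TwoForm 𝓘(ℝ, ES) D)
    (hβ : ∀ {k : ℕ} (c : EuclideanSpace ℝ (Fin k) → Sections 𝓘(ℝ, ES) D) (hc : IsPlot c)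
      (v w : EuclideanSpace ℝ (Fin k)),
      ContDiff ℝ ∞ (fun t => β (c t) ![velocity c hc t v, velocity c hc t w])) {k : ℕ}
    (c : EuclideanSpace ℝ (Fin k) → Q) (hc : IsPlot c) (t v w : EuclideanSpace ℝ (Fin k)) :
    (DiffeologicalTwoForm.ofPullback f hf β hβ).toFun c hc t ![v, w] =
      β (f (c t)) ![velocity (f ∘ c) (hf _ _ hc) t v, velocity (f ∘ c) (hf _ _ hc) t w] := by
  refine congrArg (β (f (c t))) (funext fun i => ?_)
  fin_cases i <;> rfl

theorem DiffeologicalTwoForm.ext_apply {Q : Type*} [DiffeologicalSpace Q]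
    {γ γ' : DiffeologicalTwoForm Q}
    (h : ∀ {k : ℕ} (c : EuclideanSpace ℝ (Fin k) → Q) (hc : IsPlot c)
      (t v w : EuclideanSpace ℝ (Fin k)), γ.toFun c hc t ![v, w] = γ'.toFun c hc t ![v, w]) :
    γ = γ' := by
  have hf : @γ.toFun = @γ'.toFun := by
    funext k c hc t
    refine ContinuousAlternatingMap.ext fun u => ?_
    have hu : u = ![u 0, u 1] := by
      funext i
      fin_cases i <;> rfl
    rw [hu]
    exact h c hc t (u 0) (u 1)
  cases γ
  cases γ'
  congr

/-- Families of leaves lift locally, so a map on the space of leaves is smooth as soon as it is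
smooth before passing to the quotient. -/
theorem LeafSpace.dsmooth_of_comp_mk {Q : Type*} [DiffeologicalSpace Q] {β : TwoForm 𝓘(ℝ, ES) D}
    {f : LeafSpace β → Q} (h : DSmooth (f ∘ LeafSpace.mk β)) : DSmooth f := by
  let d : DiffeologicalSpace (LeafSpace β) :=
    { plots := fun k => {c | IsPlot (f ∘ c)}
      constant_plots := fun x => DiffeologicalSpace.constant_plots (f x)
      plot_reparam := fun hc hg => DiffeologicalSpace.plot_reparam (X := Q) hc hg
      locality := fun hc => DiffeologicalSpace.locality (X := Q) hc }
  have hd : ∀ P ∈ {P : (k : ℕ) × (EuclideanSpace ℝ (Fin k) → LeafSpace β) |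
      ∃ c : EuclideanSpace ℝ (Fin P.1) → Sections 𝓘(ℝ, ES) D,
        IsPlot c ∧ P.2 = LeafSpace.mk β ∘ c}, P ∈ d.toPlots := by
    rintro ⟨k, q⟩ ⟨c, hc, hq⟩
    have hfq : f ∘ q = (f ∘ LeafSpace.mk β) ∘ c := congrArg (fun q => f ∘ q) hq
    change IsPlot (f ∘ q)
    rw [hfq]
    exact h k c hc
  intro k c hc
  exact hc d hd

theorem LeafSpace.dsmooth_mk (β : TwoForm 𝓘(ℝ, ES) D) : DSmooth (LeafSpace.mk β) :=
  fun _ c hc => DiffeologicalSpace.isPlot_generatedFrom_of_mem ⟨c, hc, rfl⟩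

/-- Transport of the values of a two-form along an equality of families; the tangent spaces at
the two families are different types. -/
theorem velocity_pair_congr {k : ℕ} (β : TwoForm 𝓘(ℝ, ES) D)
    {c c' : EuclideanSpace ℝ (Fin k) → Sections 𝓘(ℝ, ES) D} (h : c = c') (hc : IsPlot c)
    (hc' : IsPlot c') (t v w : EuclideanSpace ℝ (Fin k)) :
    β (c t) ![velocity c hc t v, velocity c hc t w] =
      β (c' t) ![velocity c' hc' t v, velocity c' hc' t w] := by
  subst h
  rfl

/-- The quotient by the characteristic distribution of the pull-back of a two-form by a smooth map
with a smooth right inverse, whose fibres are the leaves. -/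
theorem exists_leafSpace_equiv {R : Sections 𝓘(ℝ, ES) D → Sections 𝓘(ℝ, ES) D'} (hR : DSmooth R)
    {L : Sections 𝓘(ℝ, ES) D' → Sections 𝓘(ℝ, ES) D} (hL : DSmooth L) (hRL : ∀ s, R (L s) = s)
    {TR : ∀ s, SectionTangent s →ₗ[ℝ] SectionTangent (R s)} (hTR : IsTangentMap R TR)
    {β : TwoForm 𝓘(ℝ, ES) D'} (hβ : IsWeaklySymplectic β)
    (hleaf : ∀ s s', leafSetoid (β.pullback TR) s s' ↔ R s = R s') :
    ∃ Rbar : LeafSpace (β.pullback TR) ≃ Sections 𝓘(ℝ, ES) D',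
      (∀ s, Rbar (LeafSpace.mk (β.pullback TR) s) = R s) ∧
      DSmooth Rbar ∧ DSmooth Rbar.symm ∧
      (∃! γ : DiffeologicalTwoForm (LeafSpace (β.pullback TR)),
        γ.PullbackEq (LeafSpace.mk (β.pullback TR)) (β.pullback TR)) ∧
      ∀ γ : DiffeologicalTwoForm (LeafSpace (β.pullback TR)),
        γ.PullbackEq (LeafSpace.mk (β.pullback TR)) (β.pullback TR) → γ.EqPullback Rbar β := by
  let Rbar : LeafSpace (β.pullback TR) ≃ Sections 𝓘(ℝ, ES) D' :=
    { toFun := Quotient.lift R fun s s' h => (hleaf s s').1 h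
      invFun := fun s => LeafSpace.mk _ (L s)
      left_inv := by
        rintro ⟨s⟩
        exact Quotient.sound ((hleaf _ _).2 (hRL (R s)))
      right_inv := hRL }
  have hmk : ∀ s, Rbar (LeafSpace.mk (β.pullback TR) s) = R s := fun s => rfl
  have hRbar : DSmooth Rbar := LeafSpace.dsmooth_of_comp_mk hR
  have hsymm : DSmooth Rbar.symm := fun k c hc => LeafSpace.dsmooth_mk _ k _ (hL k c hc)
  -- Every family of leaves lifts to the family `L ∘ Rbar ∘ c` of sections.
  have hEq : ∀ γ : DiffeologicalTwoForm (LeafSpace (β.pullback TR)),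
      γ.PullbackEq (LeafSpace.mk (β.pullback TR)) (β.pullback TR) → γ.EqPullback Rbar β := by
    intro γ hγ k c hc hfc t v w
    have hLc : IsPlot (L ∘ Rbar ∘ c) := hL k _ hfc
    have hc' : LeafSpace.mk (β.pullback TR) ∘ L ∘ Rbar ∘ c = c :=
      funext fun t => Rbar.symm_apply_apply (c t)
    have h1 := hγ (L ∘ Rbar ∘ c) hLc (hc'.symm ▸ hc) t v w
    rw [TwoForm.pullback_apply, hTR _ hLc (hR _ _ hLc), hTR _ hLc (hR _ _ hLc)] at h1
    have h2 : ∀ (c' : EuclideanSpace ℝ (Fin k) → LeafSpace (β.pullback TR)) (hc' : IsPlot c'),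
        c' = c → γ.toFun c' hc' t ![v, w] = γ.toFun c hc t ![v, w] := by
      rintro _ _ rfl
      rfl
    rw [h2 _ _ hc'] at h1
    exact (velocity_pair_congr β (c := Rbar ∘ c) (c' := fun t => R (L (Rbar (c t))))
      (funext fun t => (hRL _).symm) hfc (hR _ _ hLc) t v w).trans h1.symm
  refine ⟨Rbar, hmk, hRbar, hsymm,
    ⟨DiffeologicalTwoForm.ofPullback Rbar hRbar β hβ.contDiff, ?_, fun γ hγ => ?_⟩, hEq⟩
  · intro k c hc hqc t v w
    rw [TwoForm.pullback_apply, hTR _ hc (hR _ _ hc), hTR _ hc (hR _ _ hc)]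
    exact DiffeologicalTwoForm.ofPullback_apply Rbar hRbar β hβ.contDiff _ hqc t v w
  · refine DiffeologicalTwoForm.ext_apply fun c hc t v w => ?_
    exact (hEq γ hγ c hc (hRbar _ _ hc) t v w).symm.trans
      (DiffeologicalTwoForm.ofPullback_apply Rbar hRbar β hβ.contDiff c hc t v w).symm

/-- Minus an exterior derivative is smooth and closed, hence weakly symplectic when its kernel
vanishes. -/
theorem IsExtDeriv.isWeaklySymplectic {α : TangentFunction 𝓘(ℝ, ES) D} {β : TwoForm 𝓘(ℝ, ES) D}
    (h : IsExtDeriv α (-β)) (hker : ∀ s, β.ker s = ⊥) : IsWeaklySymplectic β where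
  contDiff c hc v w := by
    have h1 := (h.contDiff c hc v w).neg
    have h2 : (fun t => -((-β) (c t) ![velocity c hc t v, velocity c hc t w])) =
        fun t => β (c t) ![velocity c hc t v, velocity c hc t w] := funext fun t => neg_neg _
    exact h2 ▸ h1
  closed c hc t u v w := by
    have h1 := h.closed c hc t u v w
    have h2 : ∀ u v w, fderiv ℝ (fun t' => (-β) (c t') ![velocity c hc t' v, velocity c hc t' w])
        t u = -fderiv ℝ (fun t' => β (c t') ![velocity c hc t' v, velocity c hc t' w]) t u :=
      fun u v w =>
      congrArg (fun L : EuclideanSpace ℝ (Fin _) →L[ℝ] ℝ => L u) (fderiv_fun_neg (𝕜 := ℝ)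
        (f := fun t' => β (c t') ![velocity c hc t' v, velocity c hc t' w]) (x := t))
    rw [h2, h2, h2] at h1
    linarith
  ker_eq_bot := hker

end Quotient

/-! ### Symplectic reduction -/

/-- The properties of the reduction map and of the canonical two-forms. The maps and forms are
variables with prescribed values, so that the statement applies to any maps and forms with the
characteristic properties of these values. -/
theorem symplectic_reduction
    {n : ℕ} {S X Y EX EY F : Type*}
    [TopologicalSpace S] [ChartedSpace (EuclideanSpace ℝ (Fin n)) S]
    [IsManifold 𝓘(ℝ, EuclideanSpace ℝ (Fin n)) ∞ S] [T2Space S] [CompactSpace S]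
    [NormedAddCommGroup EX] [NormedSpace ℝ EX]
    [TopologicalSpace X] [ChartedSpace EX X] [IsManifold 𝓘(ℝ, EX) ∞ X]
    [NormedAddCommGroup EY] [NormedSpace ℝ EY] [FiniteDimensional ℝ EY]
    [TopologicalSpace Y] [ChartedSpace EY Y] [IsManifold 𝓘(ℝ, EY) ∞ Y]
    [T2Space Y] [SigmaCompactSpace Y]
    [NormedAddCommGroup F] [NormedSpace ℝ F] [FiniteDimensional ℝ F]
    {p : Y → X} (hp : Manifold.IsSubmersionOfComplement F 𝓘(ℝ, EY) 𝓘(ℝ, EX) ∞ p)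
    {τ : S → X}
    (hτ : Manifold.IsImmersion 𝓘(ℝ, EuclideanSpace ℝ (Fin n)) 𝓘(ℝ, EX) ∞ τ)
    (o : OrientationForm n S)
    {TR : ∀ σ : MultimomentumSpace hp τ n, SectionTangent σ →ₗ[ℝ] SectionTangent (reduction hp τ σ)}
    (hTR : IsTangentMap (reduction hp τ) TR)
    (R : MultimomentumSpace hp τ n → PhaseSpace hp τ n) (hR : R = reduction hp τ)
    (om : TwoForm 𝓘(ℝ, EuclideanSpace ℝ (Fin n)) (momentumData hp τ n))
    (hom : om = phaseTwoForm hp τ o)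
    (Om : TwoForm 𝓘(ℝ, EuclideanSpace ℝ (Fin n)) (multimomentumData hp τ n))
    (hOm : Om = (phaseTwoForm hp τ o).pullback TR) :
    IsWeaklySymplectic om ∧ Diffeology.DSmooth R ∧
      (∃! TR : ∀ σ, SectionTangent σ →ₗ[ℝ] SectionTangent (R σ), IsTangentMap R TR) ∧
      (∀ TR : ∀ σ, SectionTangent σ →ₗ[ℝ] SectionTangent (R σ), IsTangentMap R TR →
        (∀ σ V W, om (R σ) ![TR σ V, TR σ W] = Om σ ![V, W]) ∧
        (∀ σ, LinearMap.ker (TR σ) = Om.ker σ)) ∧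
      (∀ σ σ', leafSetoid Om σ σ' ↔ DifferByKernel hp τ R σ σ') ∧
      ∃ Rbar : LeafSpace Om ≃ PhaseSpace hp τ n,
        (∀ σ, Rbar (LeafSpace.mk Om σ) = R σ) ∧
        Diffeology.DSmooth Rbar ∧ Diffeology.DSmooth Rbar.symm ∧
        (∃! γ : DiffeologicalTwoForm (LeafSpace Om), γ.PullbackEq (LeafSpace.mk Om) Om) ∧
        ∀ γ : DiffeologicalTwoForm (LeafSpace Om), γ.PullbackEq (LeafSpace.mk Om) Om →
          γ.EqPullback Rbar om := by
  subst hR hom hOm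
  have hleaf := leafSetoid_iff_reduction_eq hp hTR (ker_tangentMap hp hτ o hTR)
  have hsymp : IsWeaklySymplectic (phaseTwoForm hp τ o) :=
    (isExtDeriv_phaseOneForm (τ := τ) hp o).isWeaklySymplectic (ker_phaseTwoForm hp hτ o)
  have hTRe := existsUnique_isTangentMap_reduction (τ := τ) (n := n) hp
  refine ⟨hsymp, dsmooth_reduction hp τ, hTRe, fun TR' hTR' => ?_, fun σ σ' =>
    (hleaf σ σ').trans (differByKernel_iff_reduction_eq hp σ σ').symm, ?_⟩
  · have h := hTRe.unique hTR' hTR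
    subst h
    exact ⟨fun σ V W => (TwoForm.pullback_apply _ _ σ V W).symm, ker_tangentMap hp hτ o hTR'⟩
  · exact exists_leafSpace_equiv (L := reductionLift hp hτ) (dsmooth_reduction hp τ)
      (fun _ _ hc => isPlot_reductionLift hp hτ hc) (reduction_reductionLift hp hτ) hTR hsymp hleaf

end

theorem corollary5p3
    {n : ℕ} {S X Y EX EY F : Type*}
    [TopologicalSpace S] [ChartedSpace (EuclideanSpace ℝ (Fin n)) S]
    [IsManifold 𝓘(ℝ, EuclideanSpace ℝ (Fin n)) ∞ S] [T2Space S] [CompactSpace S]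
    [NormedAddCommGroup EX] [NormedSpace ℝ EX] [FiniteDimensional ℝ EX]
    (hEX : Module.finrank ℝ EX = n + 1)
    [TopologicalSpace X] [ChartedSpace EX X] [IsManifold 𝓘(ℝ, EX) ∞ X]
    [T2Space X] [SigmaCompactSpace X]
    [NormedAddCommGroup EY] [NormedSpace ℝ EY] [FiniteDimensional ℝ EY]
    [TopologicalSpace Y] [ChartedSpace EY Y] [IsManifold 𝓘(ℝ, EY) ∞ Y]
    [T2Space Y] [SigmaCompactSpace Y]
    [NormedAddCommGroup F] [NormedSpace ℝ F] [FiniteDimensional ℝ F]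
    {p : Y → X} (hp : Manifold.IsSubmersionOfComplement F 𝓘(ℝ, EY) 𝓘(ℝ, EX) ∞ p)
    {τ : S → X}
    (hτ : Manifold.IsSmoothEmbedding 𝓘(ℝ, EuclideanSpace ℝ (Fin n)) 𝓘(ℝ, EX) ∞ τ)
    (o : OrientationForm n S) :
    (∃! R : MultimomentumSpace hp τ n → PhaseSpace hp τ n, IsReductionMap hp τ R) ∧
    (∃! om : TwoForm 𝓘(ℝ, EuclideanSpace ℝ (Fin n)) (momentumData hp τ n),
      IsExtDeriv (phaseOneForm hp τ o) (-om)) ∧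
    (∃! Om : TwoForm 𝓘(ℝ, EuclideanSpace ℝ (Fin n)) (multimomentumData hp τ n),
      IsExtDeriv (multimomentumOneForm hp τ o) (-Om)) ∧
    ∀ (R : MultimomentumSpace hp τ n → PhaseSpace hp τ n)
      (om : TwoForm 𝓘(ℝ, EuclideanSpace ℝ (Fin n)) (momentumData hp τ n))
      (Om : TwoForm 𝓘(ℝ, EuclideanSpace ℝ (Fin n)) (multimomentumData hp τ n)),
      IsReductionMap hp τ R → IsExtDeriv (phaseOneForm hp τ o) (-om) →
      IsExtDeriv (multimomentumOneForm hp τ o) (-Om) →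
      IsWeaklySymplectic om ∧ Diffeology.DSmooth R ∧
      (∃! TR : ∀ σ, SectionTangent σ →ₗ[ℝ] SectionTangent (R σ), IsTangentMap R TR) ∧
      (∀ TR : ∀ σ, SectionTangent σ →ₗ[ℝ] SectionTangent (R σ), IsTangentMap R TR →
        (∀ σ V W, om (R σ) ![TR σ V, TR σ W] = Om σ ![V, W]) ∧
        (∀ σ, LinearMap.ker (TR σ) = Om.ker σ)) ∧
      (∀ σ σ', leafSetoid Om σ σ' ↔ DifferByKernel hp τ R σ σ') ∧
      ∃ Rbar : LeafSpace Om ≃ PhaseSpace hp τ n,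
        (∀ σ, Rbar (LeafSpace.mk Om σ) = R σ) ∧
        Diffeology.DSmooth Rbar ∧ Diffeology.DSmooth Rbar.symm ∧
        (∃! γ : DiffeologicalTwoForm (LeafSpace Om), γ.PullbackEq (LeafSpace.mk Om) Om) ∧
        ∀ γ : DiffeologicalTwoForm (LeafSpace Om), γ.PullbackEq (LeafSpace.mk Om) Om →
          γ.EqPullback Rbar om := by
  have hTRe := existsUnique_isTangentMap_reduction (τ := τ) (n := n) hp
  refine hTRe.exists.elim fun TR hTR => ?_
  have hphase := isExtDeriv_phaseOneForm (τ := τ) hp o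
  have hmulti := isExtDeriv_multimomentumOneForm hp o hTR
  have hom : ∀ om, IsExtDeriv (phaseOneForm hp τ o) (-om) → om = phaseTwoForm hp τ o :=
    fun om h => neg_injective
      (h.unique (fun m _ => nonempty_adaptedChart_momentum hp m) hphase)
  have hOm : ∀ Om, IsExtDeriv (multimomentumOneForm hp τ o) (-Om) →
      Om = (phaseTwoForm hp τ o).pullback TR := fun Om h => neg_injective
    (h.unique (fun z _ => nonempty_adaptedChart_multimomentum hp τ n z) hmulti)
  exact ⟨⟨reduction hp τ, isReductionMap_reduction hp τ, fun R hR => hR.eq_reduction hp τ⟩,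
    ⟨_, hphase, hom⟩, ⟨_, hmulti, hOm⟩, fun R om Om hR h h' =>
      symplectic_reduction hp hτ.isImmersion o hTR R (hR.eq_reduction hp τ) om (hom om h)
        Om (hOm Om h')⟩
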